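/- Let $n\ge 2$, $Q=\mathbb R^n_+\times\mathbb S^{n-1}$ with $\mathbb R^n_+=\{x\in\mathbb R^n: x^n>0\}$, and $\Gamma_\pm=\{(x,\theta): x^n=0,\ \mp\theta^n>0\}$. Let $\sigma_0,\lambda_0,M>0$, let $\sigma\in C^1(\mathbb R^n_+)$ satisfy $\sigma_0\le\sigma\le M$ and $|\nabla\sigma|\le M$, and let $\lambda$ be measurable with $\lambda_0\le\lambda\le M$ on $\mathbb R^n_+$. For $\varepsilon>0$ consider $$-\varepsilon^2\sigma(x)\Delta_\theta u+\theta\cdot\nabla_xu+\lambda(x)u=f\ \text{ in } Q,\qquad u=g\ \text{ on }\Gamma_-,\tag{FP}$$ where $\Delta_\theta$ is the Laplace–Beltrami operator of $\mathbb S^{n-1}$, $f\in L^2(Q)$ and $g\in L^2(\Gamma_-;|\theta^n|\,dx'd\theta)$. Let $\mathcal H=\{u\in L^2(Q):\nabla_\theta u\in L^2(Q)\}$, $\|u\|_{\mathcal H}^2=\|u\|_{L^2}^2+\varepsilon^2\|\nabla_\theta u\|_{L^2}^2$. A weak solution of (FP) is a function $u\in\mathcal H$ with $\theta\cdot\nabla_xu\in\mathcal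 H'$ such that $$\int_Q\big(\varepsilon^2\sigma\nabla_\theta u\cdot\nabla_\theta\varphi-u\,\theta\cdot\nabla_x\varphi+\lambda u\varphi\big)\,dx\,d\theta=\int_Qf\varphi\,dx\,d\theta+\int_{\Gamma_-}g\varphi\,|\theta^n|\,dx'\,d\theta$$ for all compactly supported $\varphi\in C^\infty(\overline Q)$ with $\varphi=0$ on $\Gamma_+$. Let $D_x^{2/3}=(I-\Delta_x)^{1/3}$ be the Fourier multiplier with symbol $(1+|k|^2)^{1/3}$ on $\mathbb R^n$; $D^{2/3}_xu$ denotes the restriction to $Q$ of the distribution obtained by applying it to the extension of $u$ by zero to $\mathbb R^n\times\mathbb S^{n-1}$. $L^2_{loc}(Q)$ is the space of functions that are square integrable on every compact subset of $Q$. **Theorem.** (i) If $u$ is a weak solution of (FP), then $$\Delta_\theta u,\quad \theta\cdot\nabla_xu,\quad D_x^{2/3}u\ \in L^2_{loc}(Q)$$ in the sense of distributions, and $u$ is a strong solution: $-\varepsilon^2\sigma\Delta_\theta u+\theta\cdot\nabla_xu+\lambda u=f$ a.e. in $Q$. (ii) For every compact $\mathcal K$ and open $\mathcal O$ with $\mathcal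 K\subset\mathcal O\subset Q$ and every $\varepsilon_0>0$ there is a constant $C>0$, depending only on $n,\sigma_0,\lambda_0,M,\mathcal K,\mathcal O,\varepsilon_0$, such that for all $\sigma,\lambda$ as above, all $\varepsilon\in(0,\varepsilon_0]$, all $f,g$ as above and every weak solution $u$ of (FP), $$\varepsilon^2\|\Delta_\theta u\|_{L^2(\mathcal K)}+\varepsilon^{2/3}\|D_x^{2/3}u\|_{L^2(\mathcal K)}+\|\theta\cdot\nabla_xu\|_{L^2(\mathcal K)}\le C\big(\|f\|_{L^2(\mathcal O)}+\varepsilon^2\|\nabla_\theta u\|_{L^2(Q)}+\|u\|_{L^2(Q)}\big).$$ -/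

import Mathlib

open MeasureTheory Set
open scoped FourierTransform ContDiff RealInnerProductSpace

noncomputable section

namespace FokkerPlanck

/-- `ℝⁿ` with `n = d + 1`; the distinguished (normal) coordinate `xⁿ` is the last one. -/
abbrev E (d : ℕ) : Type := EuclideanSpace ℝ (Fin (d + 1))

/-- The unit sphere `𝕊ⁿ⁻¹ ⊂ ℝⁿ`. -/
abbrev S (d : ℕ) : Type := Metric.sphere (0 : E d) 1

/-- The open half-space `ℝⁿ₊ = {xⁿ > 0}`. -/
def halfSpace (d : ℕ) : Set (E d) := {x | 0 < x (Fin.last d)}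

/-- The phase space `Q = ℝⁿ₊ × 𝕊ⁿ⁻¹`. -/
def Q (d : ℕ) : Set (E d × S d) := {p | p.1 ∈ halfSpace d}

/-- The measure `dx dθ` on `ℝⁿ × 𝕊ⁿ⁻¹` (Lebesgue measure times surface measure). -/
def dxdθ (d : ℕ) : Measure (E d × S d) :=
  (volume : Measure (E d)).prod (volume : Measure (E d)).toSphere

/-- The boundary point `(x', 0)` of the half-space. -/
def bdryPoint (d : ℕ) (x' : EuclideanSpace ℝ (Fin d)) : E d :=
  WithLp.toLp 2 (Fin.snoc (α := fun _ => ℝ) (fun i => x' i) 0)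

/-- The measure `|θ · ν| dS(x) dθ` on `Γ₋`, where `ν = -eₙ`. The boundary hyperplane is
parametrized by `x' ∈ ℝⁿ⁻¹`, and `Γ₋` is the part of the boundary where `θ · ν = -θⁿ < 0`. -/
def inflowMeasure (d : ℕ) : Measure (EuclideanSpace ℝ (Fin d) × S d) :=
  (((volume : Measure (EuclideanSpace ℝ (Fin d))).prod
      (volume : Measure (E d)).toSphere).restrict
    {p | 0 < (p.2 : E d) (Fin.last d)}).withDensity
      (fun p => ENNReal.ofReal |(p.2 : E d) (Fin.last d)|)

/-! ### Test functions

A smooth function on (an open part of) `ℝⁿ × 𝕊ⁿ⁻¹` is represented as the restriction of a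
smooth function `Φ` of `(x, y) ∈ ℝⁿ × ℝⁿ` to `|y| = 1`. Every smooth compactly supported function
on `ℝⁿ × 𝕊ⁿ⁻¹` is of this form, with `Φ` compactly supported. All the operators below depend only
on the restriction of `Φ` to `|y| = 1`. -/

/-- `C_c^∞(Q)` (with values in `F`). -/
structure IsTest (d : ℕ) {F : Type*} [NormedAddCommGroup F] [NormedSpace ℝ F]
    (Φ : E d × E d → F) : Prop where
  smooth : ContDiff ℝ ∞ Φ
  compact : HasCompactSupport Φ
  support : tsupport Φ ⊆ {p | p.1 ∈ halfSpace d}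

/-- Compactly supported functions in `C^∞(Q̄)` that vanish on
`Γ₊ = {xⁿ = 0, θ · ν > 0} = {xⁿ = 0, θⁿ < 0}`. -/
structure IsBdryTest (d : ℕ) (Φ : E d × E d → ℝ) : Prop where
  smooth : ContDiff ℝ ∞ Φ
  compact : HasCompactSupport Φ
  vanish : ∀ (x : E d) (θ : S d), x (Fin.last d) = 0 → (θ : E d) (Fin.last d) < 0 →
    Φ (x, (θ : E d)) = 0

/-- The angular gradient `∇_θ φ`: the gradient at `θ` of the extension of `φ(x, ·)` from the sphere
that is homogeneous of degree `0`. It is tangent to the sphere. -/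
def angGrad (d : ℕ) (Φ : E d × E d → ℝ) (x θ : E d) : E d :=
  gradient (fun y : E d => Φ (x, ‖y‖⁻¹ • y)) θ

/-- The Laplace-Beltrami operator `Δ_θ φ` of the unit sphere: the Euclidean Laplacian at `θ` of the
extension of `φ(x, ·)` that is homogeneous of degree `0`. -/
def angLaplacian (d : ℕ) (Φ : E d × E d → ℝ) (x θ : E d) : ℝ :=
  Laplacian.laplacian (fun y : E d => Φ (x, ‖y‖⁻¹ • y)) θ

/-- The divergence on the sphere of a tangent field `Ψ(x, ·)`. -/
def angDiv (d : ℕ) (Ψ : E d × E d → E d) (x θ : E d) : ℝ :=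
  LinearMap.trace ℝ (E d)
    (fderiv ℝ (fun y : E d => Ψ (x, ‖y‖⁻¹ • y)) θ : E d →L[ℝ] E d).toLinearMap

/-- The transport operator `θ · ∇_x φ`. -/
def transport (d : ℕ) (Φ : E d × E d → ℝ) (x θ : E d) : ℝ :=
  fderiv ℝ (fun z : E d => Φ (z, θ)) x θ

/-- `D^s ψ = (I - Δ)^{s/2} ψ` on `ℝⁿ`, as the Fourier multiplier with symbol `(1 + |k|²)^{s/2}`.
Mathlib's Fourier transform has the kernel `exp (-2πi ξ · x)`, so that `k = 2πξ`. The operator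
is real (the symbol is even), hence the real part. -/
def besselD (d : ℕ) (s : ℝ) (ψ : E d → ℝ) (x : E d) : ℝ :=
  (𝓕⁻ (fun ξ : E d => (((1 + (2 * Real.pi * ‖ξ‖) ^ 2) ^ (s / 2) : ℝ) : ℂ) *
    𝓕 (fun z : E d => (ψ z : ℂ)) ξ) x).re

/-! ### Weak derivatives -/

/-- `L²_loc(Q)`: square integrable on the compact subsets of `Q`. -/
def L2loc (d : ℕ) (w : E d × S d → ℝ) : Prop :=
  ∀ K : Set (E d × S d), IsCompact K → K ⊆ Q d → MemLp w 2 ((dxdθ d).restrict K)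

/-- `G = ∇_θ u` weakly in `Q`, with `G ∈ L²(Q)`: `G` is tangential, and one may integrate by parts
against smooth tangent fields with compact support in `Q`. -/
structure HasWeakAngGrad (d : ℕ) (u : E d × S d → ℝ) (G : E d × S d → E d) : Prop where
  memLp : MemLp G 2 ((dxdθ d).restrict (Q d))
  tangent : ∀ᵐ p ∂(dxdθ d).restrict (Q d), ⟪G p, (p.2 : E d)⟫ = 0
  parts : ∀ Ψ : E d × E d → E d, IsTest d Ψ →
    (∀ (x : E d) (θ : S d), ⟪Ψ (x, (θ : E d)), (θ : E d)⟫ = 0) →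
    ∫ p in Q d, ⟪G p, Ψ (p.1, (p.2 : E d))⟫ ∂dxdθ d =
      -∫ p in Q d, u p * angDiv d Ψ p.1 p.2 ∂dxdθ d

/-- `k = Δ_θ u` weakly in `Q`, with `k ∈ L²_loc(Q)`. -/
structure HasWeakAngLaplacian (d : ℕ) (u k : E d × S d → ℝ) : Prop where
  loc : L2loc d k
  parts : ∀ Φ : E d × E d → ℝ, IsTest d Φ →
    ∫ p in Q d, k p * Φ (p.1, (p.2 : E d)) ∂dxdθ d =
      ∫ p in Q d, u p * angLaplacian d Φ p.1 p.2 ∂dxdθ d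

/-- `h = θ · ∇_x u` weakly in `Q`, with `h ∈ L²_loc(Q)`. -/
structure HasWeakTransport (d : ℕ) (u h : E d × S d → ℝ) : Prop where
  loc : L2loc d h
  parts : ∀ Φ : E d × E d → ℝ, IsTest d Φ →
    ∫ p in Q d, h p * Φ (p.1, (p.2 : E d)) ∂dxdθ d =
      -∫ p in Q d, u p * transport d Φ p.1 p.2 ∂dxdθ d

/-- `w = D_x^s u` as a distribution in `Q`, with `w ∈ L²_loc(Q)`. The operator `D_x^s` is nonlocal;
`u ∈ L²(Q)` is extended by zero to `ℝⁿ × 𝕊ⁿ⁻¹`, and `D_x^s` is transposed onto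
the test function, on which it is given by the Fourier integral in `x`. -/
structure HasWeakBesselD (d : ℕ) (s : ℝ) (u w : E d × S d → ℝ) : Prop where
  loc : L2loc d w
  parts : ∀ Φ : E d × E d → ℝ, IsTest d Φ →
    ∫ p in Q d, w p * Φ (p.1, (p.2 : E d)) ∂dxdθ d =
      ∫ p in Q d, u p * besselD d s (fun z => Φ (z, (p.2 : E d))) p.1 ∂dxdθ d

/-! ### The equation -/

/-- The coefficients: `σ` is `C¹` and `λ` is measurable on the half-space, with
`σ₀ ≤ σ`, `‖σ‖_{C¹} ≤ M` and `λ₀ ≤ λ ≤ M`. -/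
structure Coefficients (d : ℕ) (σ₀ lam₀ M : ℝ) (σ lam : E d → ℝ) : Prop where
  σ_C1 : ContDiffOn ℝ 1 σ (halfSpace d)
  σ_lower : ∀ x ∈ halfSpace d, σ₀ ≤ σ x
  σ_upper : ∀ x ∈ halfSpace d, σ x ≤ M
  σ_deriv : ∀ x ∈ halfSpace d, ‖fderiv ℝ σ x‖ ≤ M
  lam_meas : AEMeasurable lam (volume.restrict (halfSpace d))
  lam_lower : ∀ x ∈ halfSpace d, lam₀ ≤ lam x
  lam_upper : ∀ x ∈ halfSpace d, lam x ≤ M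

/-- `‖φ‖_H = (‖φ‖² + ε² ‖∇_θ φ‖²)^{1/2}` for a test function `φ`. -/
def normH (d : ℕ) (ε : ℝ) (Φ : E d × E d → ℝ) : ℝ :=
  Real.sqrt (∫ p in Q d, Φ (p.1, (p.2 : E d)) ^ 2 ∂dxdθ d +
    ε ^ 2 * ∫ p in Q d, ‖angGrad d Φ p.1 p.2‖ ^ 2 ∂dxdθ d)

/-- `u`, with weak angular gradient `G = ∇_θ u`, is a weak solution of
`-ε² σ Δ_θ u + θ · ∇_x u + λ u = f` in `Q`, `u = g` on `Γ₋`. The first three fields say that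
`u` belongs to the space `Y` of all `u ∈ L²(Q)` with `∇_θ u ∈ L²(Q)` and `θ · ∇_x u ∈ H'`. -/
structure IsWeakSolution (d : ℕ) (ε : ℝ) (σ lam : E d → ℝ) (f : E d × S d → ℝ)
    (g : EuclideanSpace ℝ (Fin d) × S d → ℝ)
    (u : E d × S d → ℝ) (G : E d × S d → E d) : Prop where
  memLp : MemLp u 2 ((dxdθ d).restrict (Q d))
  grad : HasWeakAngGrad d u G
  transport_dual : ∃ B : ℝ, ∀ Φ : E d × E d → ℝ, IsTest d Φ →
    |∫ p in Q d, u p * transport d Φ p.1 p.2 ∂dxdθ d| ≤ B * normH d ε Φ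
  eqn : ∀ Φ : E d × E d → ℝ, IsBdryTest d Φ →
    ∫ p in Q d, (ε ^ 2 * σ p.1 * ⟪G p, angGrad d Φ p.1 p.2⟫
        - u p * transport d Φ p.1 p.2 + lam p.1 * u p * Φ (p.1, (p.2 : E d))) ∂dxdθ d =
      ∫ p in Q d, f p * Φ (p.1, (p.2 : E d)) ∂dxdθ d +
      ∫ q, g q * Φ (bdryPoint d q.1, (q.2 : E d)) ∂inflowMeasure d

end FokkerPlanck

end

noncomputable section

namespace FokkerPlanck

/-! The gain of `2/3` of a derivative comes from the Kolmogorov operator `-κ Δ_y + y · ∇ₓ` on flat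
space. A Fourier transform in `x` turns it into `X = -κ Δφ + 2πi (y · k) φ`, one operator in `y` for
each frequency `k`. Pairing with `φ` gives the energy bound `κ ‖∇φ‖² ≤ ‖X‖ ‖φ‖`, since the transport
term is skew. Pairing with `Δφ` leaves, apart from `κ ‖Δφ‖²`, a commutator of size `|k| ‖φ‖ ‖∇φ‖`.
The uncertainty principle `|k| ‖φ‖² ≤ 2 ‖(y · k) φ‖ ‖∇φ‖` turns regularity in `y` into decay in `k`.
These inequalities close on each other: `κ ‖Δφ‖ ≤ 4 ‖X‖` and `κ |k|² ‖φ‖³ ≤ 3 ‖X‖³`, with no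
dependence on `κ` or `k` in the constants (`HasSecond.frozen_estimate`). Plancherel in `x` gives
`CcSmooth.lintegral_lapY_le` and `CcSmooth.lintegral_sym_le`; with `κ` of size `ε²` the second bound
carries exactly the weight `ε^(2/3)`.

The equation on the sphere becomes such an equation for the extension `ũ(x, y) = u(x, y / |y|)`.
Multiplied by `|y|` it reads `-ε² σ |y|³ Δ_y ũ + y · ∇ₓ ũ = |y| (f - λ u)`. Because `∇_y ũ` is
tangential, the factor `|y|³` may stand inside or outside the divergence, so the weak form survives
(`SphereSolution.lift_gradient`, `SphereSolution.lift_equation`). A cutoff to a small ball gives a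
solution on the whole space with coefficient `b` close to a constant `b₀`
(`SphereSolution.flatSolution`).

Such a solution is mollified. The commutators of the mollifier with the Lipschitz coefficient `b`
and with the linear field `y` are bounded in `L²` uniformly in the scale, because the differences
`b(z) - b(t)` and `y - y'` cancel the derivative on the kernel. For the smooth mollified function,
the error of freezing `b` at `b₀` is absorbed by the estimate for the frozen operator
(`FlatSolution.l2_bounds`). Letting the scale tend to zero, in a form dual to test functions, gives
`exists_flat_estimate`.

To return to the sphere, a test function is extended homogeneously and multiplied by a radial
cutoff; the integrals then factor into an integral over `Q` and a radial constant. The operator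
`D_x^{2/3}` is nonlocal, but the symbol is Lipschitz, so its commutator with the cutoff in `x` is
bounded on `L²` (`exists_lintegral_cutoff_bes_le`). This proves `exists_local_estimate`, and a
partition of unity gives `exists_compact_estimate`. Only the `L²` norm of the test function appears
on the right, so no derivative of the partition enters.

The three distributions are thus locally bounded in the `L²` norm of the test function. The Riesz
theorem represents them by functions in `L²_loc` with the same bounds
(`SphereFunctional.exists_l2loc`, `SphereFunctional.mul_eLpNorm_le`). The pointwise equation follows
by integration by parts on the sphere; since `σ` depends on `x` alone, it can be inserted after
integrating over `θ` for almost every `x` (`SphereSolution.strong_form`). -/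

/-! ### The `L²` norm -/

/-- The `L²` norm as a real number. -/
def l2 {α F : Type*} [MeasurableSpace α] [NormedAddCommGroup F] (f : α → F) (μ : Measure α) : ℝ :=
  Real.sqrt (∫ x, ‖f x‖ ^ 2 ∂μ)

section L2
variable {α F : Type*} [MeasurableSpace α] {μ : Measure α} [NormedAddCommGroup F]

lemma l2_nonneg (f : α → F) : 0 ≤ l2 f μ := Real.sqrt_nonneg _

lemma l2_sq (f : α → F) : l2 f μ ^ 2 = ∫ x, ‖f x‖ ^ 2 ∂μ :=
  Real.sq_sqrt (integral_nonneg fun _ => by positivity)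

lemma l2_eq_toReal {f : α → F} (hf : AEStronglyMeasurable f μ) :
    l2 f μ = (eLpNorm f 2 μ).toReal := by
  rw [l2, eLpNorm_eq_lintegral_rpow_enorm_toReal (by norm_num) (by norm_num),
    ← ENNReal.toReal_rpow, ENNReal.toReal_ofNat, ← Real.sqrt_eq_rpow]
  congr 1
  have := integral_norm_eq_lintegral_enorm (μ := μ) (f := fun x => ‖f x‖ ^ 2) (hf.norm.pow 2)
  simp only [norm_pow, norm_norm, enorm_pow, enorm_norm] at this
  rw [this]
  norm_cast

lemma l2_add_le {f g : α → F} (hf : MemLp f 2 μ) (hg : MemLp g 2 μ) :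
    l2 (f + g) μ ≤ l2 f μ + l2 g μ := by
  rw [l2_eq_toReal hf.1, l2_eq_toReal hg.1, l2_eq_toReal (hf.add hg).1,
    ← ENNReal.toReal_add hf.2.ne hg.2.ne]
  exact ENNReal.toReal_mono (ENNReal.add_ne_top.2 ⟨hf.2.ne, hg.2.ne⟩)
    (eLpNorm_add_le hf.1 hg.1 (by norm_num))

lemma l2_const_mul [NormedSpace ℝ F] (c : ℝ) (f : α → F) :
    l2 (fun x => c • f x) μ = |c| * l2 f μ := by
  simp only [l2, norm_smul, mul_pow, integral_const_mul]
  rw [Real.sqrt_mul (by positivity), Real.sqrt_sq (by positivity), Real.norm_eq_abs]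

lemma abs_integral_inner_le {F : Type*} [NormedAddCommGroup F] [InnerProductSpace ℝ F] {f g : α → F}
    (hf : MemLp f 2 μ) (hg : MemLp g 2 μ) :
    |∫ x, ⟪f x, g x⟫ ∂μ| ≤ l2 f μ * l2 g μ := by
  have h := abs_real_inner_le_norm (hf.toLp f) (hg.toLp g)
  rw [L2.inner_def, Lp.norm_toLp, Lp.norm_toLp, ← l2_eq_toReal hf.1, ← l2_eq_toReal hg.1] at h
  refine le_trans (le_of_eq ?_) h
  congr 1
  refine integral_congr_ae ?_
  filter_upwards [hf.coeFn_toLp, hg.coeFn_toLp] with x h1 h2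
  rw [h1, h2]

end L2

/-! ### The frozen operator at a fixed frequency -/

/-- The standard basis vector. -/
abbrev bas (d : ℕ) (j : Fin (d + 1)) : E d := EuclideanSpace.single j 1

/-- The letters stand for `p = ‖φ‖`, `q = ‖∇φ‖`, `a = ‖Δφ‖`, `x = ‖X‖`, `τ = ‖(y · k) φ‖`, `K = |k|`
and `t = π`. The hypotheses `h1` to `h4` are the energy bound, the pairing with `Δφ`, the
uncertainty principle and the triangle inequality for the transport term. They are homogeneous and
contain no lower-order term, whence constants independent of `κ` and `K`. -/
lemma frozen_scalar {p q a x τ K κ t : ℝ} (hp : 0 ≤ p) (hq : 0 ≤ q) (hx : 0 ≤ x)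
    (hτ : 0 ≤ τ) (hK : 0 ≤ K) (hκ : 0 < κ) (ht : 3 ≤ t)
    (h1 : κ * q ^ 2 ≤ x * p) (h2 : κ * a ^ 2 ≤ x * a + 2 * t * (K * p * q))
    (h3 : K * p ^ 2 ≤ 2 * τ * q) (h4 : 2 * t * τ ≤ x + κ * a) :
    κ * a ≤ 4 * x ∧ κ * K ^ 2 * p ^ 3 ≤ 3 * x ^ 3 := by
  -- Multiply `h3` by `κ q`, insert `h1` and cancel one factor `p`. This controls the commutator
  -- term in `h2`.
  have h5 : κ * (K * p * q) ≤ 2 * τ * x := by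
    rcases hp.eq_or_lt with rfl | hp'
    · simp; positivity
    · have : p * (κ * (K * p * q)) ≤ p * (2 * τ * x) := by
        calc p * (κ * (K * p * q)) = κ * q * (K * p ^ 2) := by ring
          _ ≤ κ * q * (2 * τ * q) := by gcongr
          _ = 2 * τ * (κ * q ^ 2) := by ring
          _ ≤ 2 * τ * (x * p) := by gcongr
          _ = _ := by ring
      exact le_of_mul_le_mul_left this hp'
  -- With `A = κ a`, the bound `h4` leads to `A² ≤ 3 x A + 2 x²`, whose positive root is below `4
  -- x`.
  have h6 : κ * a ≤ 4 * x := by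
    have : (κ * a) ^ 2 ≤ x * (κ * a) + 2 * (x + κ * a) * x := by
      have e1 : κ * (κ * a ^ 2) ≤ κ * (x * a + 2 * t * (K * p * q)) := by gcongr
      have e2 : 2 * t * (κ * (K * p * q)) ≤ 2 * t * (2 * τ * x) := by gcongr
      have e3 : 2 * t * τ * (2 * x) ≤ (x + κ * a) * (2 * x) := by gcongr
      nlinarith
    by_contra! h
    nlinarith
  refine ⟨h6, ?_⟩
  -- The same cancellation with `h3` squared. Afterwards `6 τ ≤ 2 t τ ≤ 5 x` gives `4 τ² x ≤ (25 /
  -- 9) x³`.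
  have h7 : κ * K ^ 2 * p ^ 3 ≤ 4 * τ ^ 2 * x := by
    rcases hp.eq_or_lt with rfl | hp'
    · simp; positivity
    · have : p * (κ * K ^ 2 * p ^ 3) ≤ p * (4 * τ ^ 2 * x) := by
        calc p * (κ * K ^ 2 * p ^ 3) = κ * (K * p ^ 2) ^ 2 := by ring
          _ ≤ κ * (2 * τ * q) ^ 2 := by gcongr
          _ = 4 * τ ^ 2 * (κ * q ^ 2) := by ring
          _ ≤ 4 * τ ^ 2 * (x * p) := by gcongr
          _ = _ := by ring
      exact le_of_mul_le_mul_left this hp'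
  have h8 : 6 * τ ≤ 5 * x := by nlinarith
  have h9 : (6 * τ) ^ 2 ≤ (5 * x) ^ 2 := by gcongr
  have h10 : (6 * τ) ^ 2 * x ≤ (5 * x) ^ 2 * x := by gcongr
  have h11 : 0 ≤ x ^ 3 := by positivity
  nlinarith

section Frozen
variable {d : ℕ} {k : E d} {κ : ℝ} {φ : E d → ℂ} {φ1 φ2 : Fin (d + 1) → E d → ℂ}

/-- `φ1 j = ∂_j φ` and `φ2 j = ∂_j ∂_j φ`, all continuous with compact support. -/
structure HasSecond (d : ℕ) (φ : E d → ℂ) (φ1 φ2 : Fin (d + 1) → E d → ℂ) : Prop where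
  c0 : Continuous φ
  c1 : ∀ j, Continuous (φ1 j)
  c2 : ∀ j, Continuous (φ2 j)
  s0 : HasCompactSupport φ
  s1 : ∀ j, HasCompactSupport (φ1 j)
  s2 : ∀ j, HasCompactSupport (φ2 j)
  d1 : ∀ j y, HasLineDerivAt ℝ φ (φ1 j y) y (bas d j)
  d2 : ∀ j y, HasLineDerivAt ℝ (φ1 j) (φ2 j y) y (bas d j)

lemma integral_inner_parts {f g f' g' : E d → ℂ} (v : E d)
    (hf : Continuous f) (hg : Continuous g) (hf' : Continuous f') (hg' : Continuous g')
    (sf : HasCompactSupport f) (sg : HasCompactSupport g)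
    (df : ∀ y, HasLineDerivAt ℝ f (f' y) y v) (dg : ∀ y, HasLineDerivAt ℝ g (g' y) y v) :
    ∫ y, ⟪f y, g' y⟫ = -∫ y, ⟪f' y, g y⟫ := by
  refine integral_bilinear_hasLineDerivAt_right_eq_neg_left_of_integrable
    (B := innerSL ℝ) (μ := (volume : Measure (E d))) (f := f) (g := g) (f' := f') (g' := g')
    ?_ ?_ ?_ (fun y _ => df y) (fun y _ => dg y)
  · refine Continuous.integrable_of_hasCompactSupport (hf'.inner hg)
      (sg.mono fun y hy => ?_)
    rw [Function.mem_support] at hy ⊢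
    contrapose! hy
    simp [hy]
  · refine Continuous.integrable_of_hasCompactSupport (hf.inner hg')
      (sf.mono fun y hy => ?_)
    rw [Function.mem_support] at hy ⊢
    contrapose! hy
    simp [hy]
  · refine Continuous.integrable_of_hasCompactSupport (hf.inner hg)
      (sf.mono fun y hy => ?_)
    rw [Function.mem_support] at hy ⊢
    contrapose! hy
    simp [hy]

lemma hasLineDerivAt_inner_smul (h : HasSecond d φ φ1 φ2) (j : Fin (d + 1)) (y : E d) (c : ℂ) :
    HasLineDerivAt ℝ (fun y => ⟪y, k⟫ • (c * φ y))
      (k j • (c * φ y) + ⟪y, k⟫ • (c * φ1 j y)) y (bas d j) := by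
  have h1 := h.d1 j y
  unfold HasLineDerivAt at h1 ⊢
  have h2 : HasDerivAt (fun t : ℝ => ⟪y + t • bas d j, k⟫) (k j) 0 := by
    have : (fun t : ℝ => ⟪y + t • bas d j, k⟫) = fun t : ℝ => ⟪y, k⟫ + t * k j := by
      funext t
      rw [inner_add_left, inner_smul_left, EuclideanSpace.inner_single_left]; simp
    rw [this]
    simpa using ((hasDerivAt_id (0 : ℝ)).mul_const (k j)).const_add ⟪y, k⟫
  have := h2.smul (h1.const_mul c)
  simp only [zero_smul, add_zero] at this
  rw [add_comm (⟪y, k⟫ • (c * φ1 j y))] at this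
  exact this

lemma sum_abs_mul_le (k : E d) (r : Fin (d + 1) → ℝ) :
    ∑ j, |k j| * r j ≤ ‖k‖ * Real.sqrt (∑ j, r j ^ 2) := by
  have := Finset.sum_mul_sq_le_sq_mul_sq Finset.univ (fun j => |k j|) r
  rw [EuclideanSpace.norm_eq, ← Real.sqrt_mul (by positivity)]
  refine Real.le_sqrt_of_sq_le ?_
  simpa using this

lemma HasCompactSupport.integrable_inner {f g : E d → ℂ} (hf : Continuous f) (hg : Continuous g)
    (sg : HasCompactSupport g) : Integrable (fun y => ⟪f y, g y⟫) volume :=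
  (hf.inner hg).integrable_of_hasCompactSupport (sg.mono fun y hy => by
    rw [Function.mem_support] at hy ⊢; contrapose! hy; simp [hy])

lemma hasCompactSupport_sum {ι α F : Type*} [TopologicalSpace α] [AddCommGroup F] (S : Finset ι)
    {f : ι → α → F} (h : ∀ i ∈ S, HasCompactSupport (f i)) :
    HasCompactSupport fun y => ∑ i ∈ S, f i y := by
  classical
  induction S using Finset.induction_on with
  | empty => simp only [Finset.sum_empty]; exact HasCompactSupport.zero
  | insert a S ha ih =>
    simp only [Finset.sum_insert ha]
    exact (h a (by simp)).add (ih fun i hi => h i (by simp [hi]))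

namespace HasSecond

/-- The `L²` norm of the gradient. -/
def grad (_ : HasSecond d φ φ1 φ2) : ℝ := Real.sqrt (∑ j, l2 (φ1 j) volume ^ 2)

lemma grad_nonneg (h : HasSecond d φ φ1 φ2) : 0 ≤ h.grad := Real.sqrt_nonneg _

lemma grad_sq (h : HasSecond d φ φ1 φ2) : h.grad ^ 2 = ∑ j, l2 (φ1 j) volume ^ 2 :=
  Real.sq_sqrt (by positivity)

lemma memLp (h : HasSecond d φ φ1 φ2) : MemLp φ 2 volume := h.c0.memLp_of_hasCompactSupport h.s0

lemma continuous_lap (h : HasSecond d φ φ1 φ2) : Continuous fun y => ∑ j, φ2 j y :=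
  continuous_finsetSum _ fun j _ => h.c2 j

lemma hasCompactSupport_lap (h : HasSecond d φ φ1 φ2) : HasCompactSupport fun y => ∑ j, φ2 j y :=
  hasCompactSupport_sum _ fun j _ => h.s2 j

lemma integral_inner_lap (h : HasSecond d φ φ1 φ2) :
    ∫ y, ⟪∑ j, φ2 j y, φ y⟫ = -h.grad ^ 2 := by
  simp only [sum_inner]
  rw [integral_finsetSum _ fun j _ => HasCompactSupport.integrable_inner (h.c2 j) h.c0 h.s0,
    h.grad_sq, ← Finset.sum_neg_distrib]
  refine Finset.sum_congr rfl fun j _ => ?_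
  simp only [real_inner_comm (φ _)]
  rw [integral_inner_parts (bas d j) h.c0 (h.c1 j) (h.c1 j) (h.c2 j) h.s0 (h.s1 j) (h.d1 j)
    (h.d2 j), l2_sq]
  simp

lemma abs_sum_le (h : HasSecond d φ φ1 φ2) (k : E d) {f : E d → ℂ} (hf : MemLp f 2 volume) :
    |∑ j, k j * ∫ y, ⟪f y, φ1 j y⟫| ≤ ‖k‖ * l2 f volume * h.grad := by
  calc |∑ j, k j * ∫ y, ⟪f y, φ1 j y⟫| ≤ ∑ j, |k j| * (l2 f volume * l2 (φ1 j) volume) := by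
        refine (Finset.abs_sum_le_sum_abs _ _).trans (Finset.sum_le_sum fun j _ => ?_)
        rw [abs_mul]
        gcongr
        exact abs_integral_inner_le hf ((h.c1 j).memLp_of_hasCompactSupport (h.s1 j))
    _ = l2 f volume * ∑ j, |k j| * l2 (φ1 j) volume := by
        rw [Finset.mul_sum]; exact Finset.sum_congr rfl fun j _ => by ring
    _ ≤ l2 f volume * (‖k‖ * h.grad) := by
        gcongr
        · exact l2_nonneg _
        · exact sum_abs_mul_le k _
    _ = _ := by ring

lemma continuous_weight (h : HasSecond d φ φ1 φ2) (k : E d) (c : ℂ) :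
    Continuous fun y => ⟪y, k⟫ • (c * φ y) := by
  have := h.c0
  fun_prop

lemma hasCompactSupport_weight (h : HasSecond d φ φ1 φ2) (k : E d) (c : ℂ) :
    HasCompactSupport fun y => ⟪y, k⟫ • (c * φ y) :=
  (h.s0.mul_left (f := fun _ => c)).smul_left (f := fun y => ⟪y, k⟫)

lemma memLp_weight (h : HasSecond d φ φ1 φ2) (k : E d) (c : ℂ) :
    MemLp (fun y => ⟪y, k⟫ • (c * φ y)) 2 volume :=
  (h.continuous_weight k c).memLp_of_hasCompactSupport (h.hasCompactSupport_weight k c)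

/-- The derivative falls either on the weight, where it gives the constant `k j`, or on `φ`. The
choice `c = 1` serves the uncertainty principle, `c = i` the pairing with the Laplacian. -/
lemma integral_weight_inner (h : HasSecond d φ φ1 φ2) (k : E d) (c : ℂ) (j : Fin (d + 1))
    {g g' : E d → ℂ} (cg : Continuous g) (cg' : Continuous g') (sg : HasCompactSupport g)
    (dg : ∀ y, HasLineDerivAt ℝ g (g' y) y (bas d j)) :
    ∫ y, ⟪⟪y, k⟫ • (c * φ y), g' y⟫ =
      -(k j * (∫ y, ⟪c * φ y, g y⟫) + ∫ y, ⟪y, k⟫ * ⟪c * φ1 j y, g y⟫) := by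
  have hc1 : Continuous fun y => k j • (c * φ y) + ⟪y, k⟫ • (c * φ1 j y) := by
    have := h.c0
    have := h.c1 j
    fun_prop
  rw [integral_inner_parts (bas d j) (h.continuous_weight k c) cg hc1 cg'
    (h.hasCompactSupport_weight k c) sg
    (fun y => hasLineDerivAt_inner_smul h j y c) dg, ← integral_const_mul, ← integral_add]
  · congr 1
    refine integral_congr_ae (Filter.Eventually.of_forall fun y => ?_)
    simp only [inner_add_left, inner_smul_left, RCLike.conj_to_real]
  · exact (HasCompactSupport.integrable_inner (continuous_const.mul h.c0) cg sg).const_mul _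
  · have := HasCompactSupport.integrable_inner
      (f := fun y => ⟪y, k⟫ • (c * φ1 j y)) (by have := h.c1 j; fun_prop) cg sg
    simpa only [inner_smul_left, RCLike.conj_to_real] using this

/-- Multiplication by `i` is skew for the real inner product of `ℂ`. This removes the transport term
from the energy identity and every weighted term from the pairing with the Laplacian. -/
lemma inner_I_mul (z : ℂ) : ⟪Complex.I * z, z⟫ = 0 := by simp [Complex.inner]; ring

/-- After one integration by parts the terms that still carry the unbounded weight are pairings of
`i ∂_j φ` with `∂_j φ` and vanish. Only the derivative of the weight survives, which costs a factor
`|k|` and one gradient. -/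
lemma integral_weight_inner_lap (h : HasSecond d φ φ1 φ2) (k : E d) :
    |∫ y, ⟪⟪y, k⟫ • (Complex.I * φ y), ∑ j, φ2 j y⟫| ≤ ‖k‖ * l2 φ volume * h.grad := by
  simp only [inner_sum]
  rw [integral_finsetSum _ fun j _ => HasCompactSupport.integrable_inner
    (h.continuous_weight k Complex.I) (h.c2 j) (h.s2 j)]
  simp only [fun j => h.integral_weight_inner k Complex.I j (h.c1 j) (h.c2 j) (h.s1 j) (h.d2 j),
    inner_I_mul, mul_zero, integral_zero, add_zero, Finset.sum_neg_distrib, abs_neg]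
  have := h.abs_sum_le k (f := fun y => Complex.I * φ y) (h.memLp.const_mul _)
  rwa [show l2 (fun y => Complex.I * φ y) volume = l2 φ volume by simp [l2]] at this

/-- The uncertainty principle in the direction `k`. -/
lemma uncertainty (h : HasSecond d φ φ1 φ2) (k : E d) :
    ‖k‖ * l2 φ volume ^ 2 ≤ 2 * l2 (fun y => ⟪y, k⟫ • φ y) volume * h.grad := by
  have hw := h.memLp_weight k 1
  -- Integration by parts reproduces the same sum with the opposite sign, so twice the sum equals
  -- `-|k|² ‖φ‖²`.
  have e : ∑ j, k j * ∫ y, ⟪⟪y, k⟫ • (1 * φ y), φ1 j y⟫ = -(‖k‖ ^ 2 * l2 φ volume ^ 2) -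
      ∑ j, k j * ∫ y, ⟪⟪y, k⟫ • (1 * φ y), φ1 j y⟫ := by
    rw [EuclideanSpace.real_norm_sq_eq, Finset.sum_mul, ← Finset.sum_neg_distrib,
      ← Finset.sum_sub_distrib]
    refine Finset.sum_congr rfl fun j _ => ?_
    have h1 := h.integral_weight_inner k 1 j h.c0 (h.c1 j) h.s0 (h.d1 j)
    have h2 : ∫ y, ⟪y, k⟫ * ⟪1 * φ1 j y, φ y⟫ = ∫ y, ⟪⟪y, k⟫ • (1 * φ y), φ1 j y⟫ :=
      integral_congr_ae (Filter.Eventually.of_forall fun y => by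
        simp only [inner_smul_left, RCLike.conj_to_real, real_inner_comm, one_mul])
    have h3 : ∫ y, ⟪1 * φ y, φ y⟫ = l2 φ volume ^ 2 := by simp [l2_sq]
    rw [h2, h3] at h1
    linear_combination k j * h1
  have e2 := neg_le_of_abs_le (h.abs_sum_le k hw)
  simp only [one_mul] at e e2
  rcases (norm_nonneg k).eq_or_lt with h0 | h0
  · rw [← h0, zero_mul]
    exact mul_nonneg (mul_nonneg two_pos.le (l2_nonneg _)) (Real.sqrt_nonneg _)
  · refine le_of_mul_le_mul_left ?_ h0
    linarith

/-- `κ`-uniform bounds for `-κ Δφ + 2πi (y · k) φ`. -/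
lemma frozen_estimate (h : HasSecond d φ φ1 φ2) (hκ : 0 < κ) {X : E d → ℂ}
    (hX : ∀ y, X y = -(κ • ∑ j, φ2 j y) + (2 * Real.pi) • (⟪y, k⟫ • (Complex.I * φ y))) :
    κ * l2 (fun y => ∑ j, φ2 j y) volume ≤ 4 * l2 X volume ∧
      κ * ‖k‖ ^ 2 * l2 φ volume ^ 3 ≤ 3 * l2 X volume ^ 3 := by
  have cL := h.continuous_lap
  have sL := h.hasCompactSupport_lap
  have cW := h.continuous_weight k Complex.I
  have sW := h.hasCompactSupport_weight k Complex.I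
  have cX : Continuous X := by
    rw [funext hX]; fun_prop
  have sX : HasCompactSupport X := by
    rw [funext hX]
    exact (HasCompactSupport.smul_left (f := fun _ => κ) sL).neg.add
      (HasCompactSupport.smul_left (f := fun _ => 2 * Real.pi) sW)
  have mL : MemLp (fun y => ∑ j, φ2 j y) 2 volume := cL.memLp_of_hasCompactSupport sL
  have mX : MemLp X 2 volume := cX.memLp_of_hasCompactSupport sX
  refine frozen_scalar (l2_nonneg _) (h.grad_nonneg) (l2_nonneg _)
    (l2_nonneg fun y => ⟪y, k⟫ • φ y) (norm_nonneg _) hκ Real.pi_gt_three.le ?_ ?_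
    (h.uncertainty k) ?_
  · have e : ∫ y, ⟪X y, φ y⟫ = κ * h.grad ^ 2 := by
      have : ∀ y, ⟪X y, φ y⟫ = -κ * ⟪∑ j, φ2 j y, φ y⟫ := by
        intro y
        rw [hX, inner_add_left, inner_neg_left, inner_smul_left, inner_smul_left, inner_smul_left,
          inner_I_mul]
        simp
      simp_rw [this]
      rw [integral_const_mul, h.integral_inner_lap]; ring
    rw [← e]
    exact (le_abs_self _).trans (abs_integral_inner_le mX h.memLp)
  · have e : ∫ y, ⟪X y, ∑ j, φ2 j y⟫ = -κ * l2 (fun y => ∑ j, φ2 j y) volume ^ 2 +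
        2 * Real.pi * ∫ y, ⟪⟪y, k⟫ • (Complex.I * φ y), ∑ j, φ2 j y⟫ := by
      have : ∀ y, ⟪X y, ∑ j, φ2 j y⟫ = -κ * ‖∑ j, φ2 j y‖ ^ 2 +
          2 * Real.pi * ⟪⟪y, k⟫ • (Complex.I * φ y), ∑ j, φ2 j y⟫ := by
        intro y
        rw [hX, inner_add_left, inner_neg_left, inner_smul_left _ _ κ,
          inner_smul_left _ _ (2 * Real.pi), real_inner_self_eq_norm_sq]
        simp
      simp_rw [this]
      rw [integral_add, integral_const_mul, integral_const_mul, l2_sq]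
      · simpa only [real_inner_self_eq_norm_sq] using
          (HasCompactSupport.integrable_inner cL cL sL).const_mul (-κ)
      · exact (HasCompactSupport.integrable_inner cW cL sL).const_mul _
    have e1 := neg_le_of_abs_le (abs_integral_inner_le mX mL)
    have e2 := le_of_abs_le (h.integral_weight_inner_lap k)
    rw [e] at e1
    have := mul_le_mul_of_nonneg_left e2 (by positivity : 0 ≤ 2 * Real.pi)
    linarith
  -- Solve the definition of `X` for the transport term, `2π (y · k) i φ = X + κ Δφ`, and use the
  -- triangle inequality.
  · have e1 := l2_const_mul (μ := (volume : Measure (E d))) (2 * Real.pi)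
      (fun y => ⟪y, k⟫ • (Complex.I * φ y))
    have e2 := l2_const_mul (μ := (volume : Measure (E d))) κ (fun y => ∑ j, φ2 j y)
    rw [abs_of_pos hκ] at e2
    rw [abs_of_pos (by positivity)] at e1
    have e3 : l2 (fun y => ⟪y, k⟫ • (Complex.I * φ y)) volume =
      l2 (fun y => ⟪y, k⟫ • φ y) volume := by simp [l2]
    rw [← e2, ← e3, ← e1]
    refine le_trans (le_of_eq ?_) (l2_add_le mX (mL.const_smul κ))
    congr 1
    funext y
    simp only [Pi.add_apply, hX]
    abel

end HasSecond

end Frozen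

/-! ### Smooth functions with compact support -/

/-- Real smooth functions with compact support. -/
structure CcSmooth {V : Type*} [NormedAddCommGroup V] [NormedSpace ℝ V] (f : V → ℝ) : Prop where
  smooth : ContDiff ℝ ∞ f
  compact : HasCompactSupport f

namespace CcSmooth
variable {V : Type*} [NormedAddCommGroup V] [NormedSpace ℝ V] {f g : V → ℝ}

lemma continuous (hf : CcSmooth f) : Continuous f := hf.smooth.continuous

lemma differentiable (hf : CcSmooth f) : Differentiable ℝ f := hf.smooth.differentiable (by simp)

lemma fderiv_apply (hf : CcSmooth f) (v : V) : CcSmooth fun x => fderiv ℝ f x v where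
  smooth := (hf.smooth.fderiv_right (m := ∞) (by simp)).clm_apply contDiff_const
  compact := hf.compact.fderiv_apply ℝ v

lemma add (hf : CcSmooth f) (hg : CcSmooth g) : CcSmooth fun x => f x + g x :=
  ⟨hf.smooth.add hg.smooth, hf.compact.add hg.compact⟩

lemma smooth_mul (hf : ContDiff ℝ ∞ f) (hg : CcSmooth g) : CcSmooth fun x => f x * g x :=
  ⟨hf.mul hg.smooth, hg.compact.mul_left⟩

lemma mul_smooth (hf : CcSmooth f) (hg : ContDiff ℝ ∞ g) : CcSmooth fun x => f x * g x :=
  ⟨hf.smooth.mul hg, hf.compact.mul_right⟩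

lemma const_mul (c : ℝ) (hf : CcSmooth f) : CcSmooth fun x => c * f x :=
  smooth_mul contDiff_const hf

lemma sum {ι : Type*} (S : Finset ι) {f : ι → V → ℝ} (h : ∀ i, CcSmooth (f i)) :
    CcSmooth fun x => ∑ i ∈ S, f i x :=
  ⟨ContDiff.sum fun i _ => (h i).smooth, hasCompactSupport_sum S fun i _ => (h i).compact⟩

lemma exists_bound (hf : CcSmooth f) : ∃ C, 0 ≤ C ∧ ∀ x, |f x| ≤ C := by
  obtain ⟨C, hC⟩ := hf.continuous.bounded_above_of_compact_support hf.compact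
  exact ⟨C, (abs_nonneg _).trans (hC 0), hC⟩

end CcSmooth

/-! ### Fourier transform in `x` and the Kolmogorov operator on `ℝⁿ × ℝⁿ`. -/

section PartialFourier
variable {d : ℕ} {W : E d × E d → ℝ}

/-- Derivative in the first variable. -/
def dX (v : E d) (W : E d × E d → ℝ) (z : E d × E d) : ℝ := fderiv ℝ W z (v, 0)

/-- Derivative in the second variable. -/
def dY (v : E d) (W : E d × E d → ℝ) (z : E d × E d) : ℝ := fderiv ℝ W z (0, v)

/-- Laplacian in the second variable. -/
def lapY (W : E d × E d → ℝ) (z : E d × E d) : ℝ := ∑ j, dY (bas d j) (dY (bas d j) W) z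

/-- `y · ∇ₓ`. -/
def trans (W : E d × E d → ℝ) (z : E d × E d) : ℝ := ∑ j, z.2 j * dX (bas d j) W z

lemma CcSmooth.dX (hW : CcSmooth W) (v : E d) : CcSmooth (dX v W) := hW.fderiv_apply _

lemma CcSmooth.dY (hW : CcSmooth W) (v : E d) : CcSmooth (dY v W) := hW.fderiv_apply _

lemma CcSmooth.lapY (hW : CcSmooth W) : CcSmooth (lapY W) :=
  CcSmooth.sum _ fun _ => (hW.dY _).dY _

lemma CcSmooth.trans (hW : CcSmooth W) : CcSmooth (trans W) :=
  CcSmooth.sum _ fun j => CcSmooth.smooth_mul (by fun_prop) (hW.dX _)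

lemma CcSmooth.slice (hW : CcSmooth W) (y : E d) : CcSmooth fun x => W (x, y) where
  smooth := hW.smooth.comp (by fun_prop)
  compact := by
    have hK := hW.compact.isCompact.image continuous_fst
    refine HasCompactSupport.intro hK fun x hx => ?_
    by_contra h
    exact hx ⟨(x, y), subset_tsupport _ h, rfl⟩

/-- A slicewise complex-valued function, as a Schwartz function. -/
def CcSmooth.toSchwartz {V : Type*} [NormedAddCommGroup V] [NormedSpace ℝ V] {f : V → ℝ}
    (hf : CcSmooth f) : SchwartzMap V ℂ :=
  HasCompactSupport.toSchwartzMap (f := fun x => (f x : ℂ))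
    (hf.compact.comp_left (g := fun t : ℝ => (t : ℂ)) rfl)
    (Complex.ofRealCLM.contDiff.comp hf.smooth)

@[simp] lemma CcSmooth.toSchwartz_apply {V : Type*} [NormedAddCommGroup V] [NormedSpace ℝ V]
    {f : V → ℝ} (hf : CcSmooth f) (x : V) : hf.toSchwartz x = (f x : ℂ) := rfl

/-- Fourier transform in the first variable. -/
def pF (W : E d × E d → ℝ) (k y : E d) : ℂ := 𝓕 (fun x => (W (x, y) : ℂ)) k

lemma pF_eq (k y : E d) : pF W k y = ∫ x, Real.fourierChar (-⟪x, k⟫) • (W (x, y) : ℂ) :=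
  Real.fourier_eq _ _

/-- The projection of the support to the first factor is compact, so one bound serves all slices at
once. It is the dominating function for continuity and for differentiation under the Fourier
integral. -/
lemma CcSmooth.exists_dominating (hW : CcSmooth W) :
    ∃ b : E d → ℝ, Integrable b volume ∧ ∀ x y, |W (x, y)| ≤ b x := by
  obtain ⟨C, hC0, hC⟩ := hW.exists_bound
  have hK := hW.compact.isCompact.image continuous_fst
  refine ⟨indicator (Prod.fst '' tsupport W) fun _ => C, ?_, fun x y => ?_⟩
  · exact (integrable_indicator_iff hK.measurableSet).2 (integrableOn_const hK.measure_ne_top)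
  · by_cases hx : x ∈ Prod.fst '' tsupport W
    · rw [indicator_of_mem hx]; exact hC _
    · rw [indicator_of_notMem hx]
      have : W (x, y) = 0 := by
        by_contra h
        exact hx ⟨(x, y), subset_tsupport _ h, rfl⟩
      simp [this]

lemma CcSmooth.continuous_pF (hW : CcSmooth W) : Continuous fun q : E d × E d => pF W q.1 q.2 := by
  obtain ⟨b, hb, hWb⟩ := hW.exists_dominating
  simp only [pF_eq]
  have hc := hW.continuous
  refine continuous_of_dominated (bound := b) (fun q => ?_) (fun q => ?_) hb ?_
  · refine Continuous.aestronglyMeasurable ?_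
    simp only [Circle.smul_def]
    fun_prop
  · refine Filter.Eventually.of_forall fun x => ?_
    rw [Circle.norm_smul, Complex.norm_real]
    exact hWb x q.2
  · refine Filter.Eventually.of_forall fun x => ?_
    simp only [Circle.smul_def]
    fun_prop

lemma CcSmooth.hasCompactSupport_pF (hW : CcSmooth W) (k : E d) :
    HasCompactSupport fun y => pF W k y := by
  have hK := hW.compact.isCompact.image continuous_snd
  refine HasCompactSupport.intro hK fun y hy => ?_
  have : ∀ x, W (x, y) = 0 := fun x => by
    by_contra h
    exact hy ⟨(x, y), subset_tsupport _ h, rfl⟩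
  simp [pF_eq, this]

lemma CcSmooth.hasDerivAt_line (hW : CcSmooth W) (x y v : E d) (t : ℝ) :
    HasDerivAt (fun t : ℝ => W (x, y + t • v)) (FokkerPlanck.dY v W (x, y + t • v)) t := by
  have h1 : HasDerivAt (fun t : ℝ => (x, y + t • v)) ((0 : E d), v) t := by
    refine HasDerivAt.prodMk (hasDerivAt_const _ _) ?_
    simpa using ((hasDerivAt_id t).smul_const v).const_add y
  exact (hW.differentiable _).hasFDerivAt.comp_hasDerivAt t h1

lemma CcSmooth.hasLineDerivAt_pF (hW : CcSmooth W) (k y v : E d) :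
    HasLineDerivAt ℝ (pF W k) (pF (FokkerPlanck.dY v W) k y) y v := by
  obtain ⟨b, hb, hWb⟩ := (hW.dY v).exists_dominating
  have hc := hW.continuous
  have hc' := (hW.dY v).continuous
  unfold HasLineDerivAt
  simp only [pF_eq]
  have hint := (hW.slice y).toSchwartz.integrable (μ := volume)
  have := (hasDerivAt_integral_of_dominated_loc_of_deriv_le (μ := (volume : Measure (E d)))
    (F := fun (t : ℝ) x => Real.fourierChar (-⟪x, k⟫) • (W (x, y + t • v) : ℂ))
    (F' := fun (t : ℝ) x => Real.fourierChar (-⟪x, k⟫) • (FokkerPlanck.dY v W (x, y + t • v) : ℂ))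
    (bound := b) (x₀ := 0) (s := univ) Filter.univ_mem ?_ ?_ ?_ ?_ hb ?_).2
  · simpa using this
  · refine Filter.Eventually.of_forall fun t => Continuous.aestronglyMeasurable ?_
    simp only [Circle.smul_def]
    fun_prop
  · simp only [zero_smul, add_zero]
    exact (Real.fourierIntegral_convergent_iff k).2 hint
  · refine Continuous.aestronglyMeasurable ?_
    simp only [Circle.smul_def]
    fun_prop
  · refine Filter.Eventually.of_forall fun x t _ => ?_
    rw [Circle.norm_smul, Complex.norm_real]
    exact hWb x _
  · refine Filter.Eventually.of_forall fun x t _ => ?_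
    exact ((hW.hasDerivAt_line x y v t).ofReal_comp).const_smul _

lemma CcSmooth.continuous_pF_right (hW : CcSmooth W) (k : E d) : Continuous (pF W k) := by
  have h : Continuous fun y : E d => (k, y) := by fun_prop
  have := Continuous.comp hW.continuous_pF h
  simpa only [Function.comp_def] using this

lemma CcSmooth.hasSecond_pF (hW : CcSmooth W) (k : E d) :
    HasSecond d (pF W k) (fun j => pF (FokkerPlanck.dY (bas d j) W) k)
      (fun j => pF (FokkerPlanck.dY (bas d j) (FokkerPlanck.dY (bas d j) W)) k) := by
  have h1 := fun j => hW.dY (bas d j)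
  have h2 := fun j => (h1 j).dY (bas d j)
  exact ⟨hW.continuous_pF_right k, fun j => (h1 j).continuous_pF_right k,
    fun j => (h2 j).continuous_pF_right k, hW.hasCompactSupport_pF k,
    fun j => (h1 j).hasCompactSupport_pF k, fun j => (h2 j).hasCompactSupport_pF k,
    fun j y => hW.hasLineDerivAt_pF k y _, fun j y => (h1 j).hasLineDerivAt_pF k y _⟩

open scoped LineDeriv in
lemma CcSmooth.pF_dX (hW : CcSmooth W) (v k y : E d) :
    pF (FokkerPlanck.dX v W) k y = (2 * Real.pi * ⟪v, k⟫ : ℝ) • (Complex.I * pF W k y) := by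
  have hs := hW.slice y
  have h := congrArg (fun g : SchwartzMap (E d) ℂ => g k)
    (SchwartzMap.fourier_lineDerivOp_eq hs.toSchwartz v)
  simp only [SchwartzMap.fourier_coe] at h
  have e1 : (fun x => (FokkerPlanck.dX v W (x, y) : ℂ)) =
      (∂_{v} hs.toSchwartz : SchwartzMap (E d) ℂ) := by
    funext x
    rw [SchwartzMap.lineDerivOp_apply_eq_fderiv]
    have h1 : HasFDerivAt (fun x : E d => (x, y)) (ContinuousLinearMap.inl ℝ (E d) (E d)) x :=
      hasFDerivAt_prodMk_left x y
    have h2 := Complex.ofRealCLM.hasFDerivAt.comp x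
      ((hW.differentiable (x, y)).hasFDerivAt.comp x h1)
    have h3 : fderiv ℝ (hs.toSchwartz : E d → ℂ) x = _ := h2.fderiv
    rw [h3]
    simp [FokkerPlanck.dX]
  unfold pF
  rw [e1, h, smul_apply, SchwartzMap.smulLeftCLM_apply_apply (by fun_prop),
    SchwartzMap.fourier_coe, real_inner_comm]
  simp only [Complex.real_smul, smul_eq_mul, Complex.ofReal_mul]
  push_cast
  change _ = _ * (Complex.I * 𝓕 (hs.toSchwartz : E d → ℂ) k)
  ring

lemma CcSmooth.integrable_slice (hW : CcSmooth W) (k y : E d) :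
    Integrable (fun x => Real.fourierChar (-⟪x, k⟫) • (W (x, y) : ℂ)) volume :=
  (Real.fourierIntegral_convergent_iff k).2 ((hW.slice y).toSchwartz.integrable (μ := volume))

lemma pF_sum {ι : Type*} (S : Finset ι) {W : ι → E d × E d → ℝ} (h : ∀ i, CcSmooth (W i))
    (k y : E d) : pF (fun z => ∑ i ∈ S, W i z) k y = ∑ i ∈ S, pF (W i) k y := by
  simp only [pF_eq]
  rw [← integral_finsetSum _ fun i _ => (h i).integrable_slice k y]
  simp [Finset.smul_sum]

lemma pF_smul (W : E d × E d → ℝ) (c : E d → ℝ) (k y : E d) :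
    pF (fun z => c z.2 * W z) k y = c y • pF W k y := by
  simp only [pF_eq]
  rw [← integral_smul]
  congr 1
  funext x
  rw [smul_comm]
  simp

lemma pF_add {W₁ W₂ : E d × E d → ℝ} (h₁ : CcSmooth W₁) (h₂ : CcSmooth W₂) (k y : E d) :
    pF (fun z => W₁ z + W₂ z) k y = pF W₁ k y + pF W₂ k y := by
  simp only [pF_eq]
  rw [← integral_add (h₁.integrable_slice k y) (h₂.integrable_slice k y)]
  simp

/-- The Kolmogorov operator with constant coefficient `κ`. -/
def kolm (κ : ℝ) (W : E d × E d → ℝ) (z : E d × E d) : ℝ := -κ * lapY W z + trans W z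

lemma CcSmooth.kolm (hW : CcSmooth W) (κ : ℝ) : CcSmooth (kolm κ W) :=
  (hW.lapY.const_mul _).add hW.trans

lemma CcSmooth.pF_lapY (hW : CcSmooth W) (k y : E d) : pF (FokkerPlanck.lapY W) k y =
    ∑ j, pF (FokkerPlanck.dY (bas d j) (FokkerPlanck.dY (bas d j) W)) k y :=
  pF_sum _ (fun _ => (hW.dY _).dY _) k y

/-- The variable `y` is a constant for the transform in `x`, so `y · ∇ₓ` becomes multiplication by
`2πi (y · k)`. The frequencies decouple and the frozen estimate applies to each of them. -/
lemma CcSmooth.pF_kolm (hW : CcSmooth W) (κ : ℝ) (k y : E d) :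
    pF (FokkerPlanck.kolm κ W) k y =
      -(κ • ∑ j, pF (FokkerPlanck.dY (bas d j) (FokkerPlanck.dY (bas d j) W)) k y) +
        (2 * Real.pi) • (⟪y, k⟫ • (Complex.I * pF W k y)) := by
  unfold FokkerPlanck.kolm
  rw [pF_add (hW.lapY.const_mul _) hW.trans, pF_smul _ (fun _ => -κ), hW.pF_lapY, neg_smul]
  congr 1
  unfold FokkerPlanck.trans
  rw [pF_sum _ fun j => CcSmooth.smooth_mul (f := fun z : E d × E d => z.2 j) (by fun_prop)
    (hW.dX _)]
  simp only [fun j => pF_smul (FokkerPlanck.dX (bas d j) W) (fun y => y j) k y, hW.pF_dX]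
  simp only [smul_smul, ← Finset.sum_smul]
  congr 1
  rw [PiLp.inner_apply, Finset.mul_sum]
  refine Finset.sum_congr rfl fun j _ => ?_
  rw [EuclideanSpace.inner_single_left]
  simp
  ring

lemma lintegral_enorm_sq {α F : Type*} [MeasurableSpace α] {μ : Measure α} [NormedAddCommGroup F]
    {f : α → F} (hf : MemLp f 2 μ) : ∫⁻ x, ‖f x‖ₑ ^ 2 ∂μ = ENNReal.ofReal (l2 f μ ^ 2) := by
  rw [l2_sq, ofReal_integral_eq_lintegral_ofReal (hf.integrable_norm_pow (by norm_num))
    (Filter.Eventually.of_forall fun x => by positivity)]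
  simp [ENNReal.ofReal_pow]

/-- Plancherel in the first variable. -/
lemma CcSmooth.lintegral_pF (hW : CcSmooth W) (y : E d) :
    ∫⁻ k, ‖pF W k y‖ₑ ^ 2 = ∫⁻ x, ‖W (x, y)‖ₑ ^ 2 := by
  have h := (hW.slice y).toSchwartz.integral_norm_sq_fourier
  have e := lintegral_enorm_sq (SchwartzMap.memLp (𝓕 (hW.slice y).toSchwartz) 2 volume)
  rw [l2_sq, h, ← l2_sq, ← lintegral_enorm_sq (SchwartzMap.memLp _ 2 volume)] at e
  rw [SchwartzMap.fourier_coe] at e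
  refine Eq.trans e (lintegral_congr fun x => ?_)
  rw [toSchwartz_apply]
  simp [← ofReal_norm]

lemma CcSmooth.lintegral_lintegral_pF (hW : CcSmooth W) :
    ∫⁻ k, ∫⁻ y, ‖pF W k y‖ₑ ^ 2 = ∫⁻ z, ‖W z‖ₑ ^ 2 := by
  have h1 : Measurable fun q : E d × E d => ‖pF W q.1 q.2‖ₑ ^ 2 :=
    (hW.continuous_pF.enorm.measurable.pow_const 2)
  have h2 : Measurable fun z : E d × E d => ‖W z‖ₑ ^ 2 := (hW.continuous.enorm.measurable.pow_const 2)
  rw [lintegral_lintegral_swap h1.aemeasurable, Measure.volume_eq_prod,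
    lintegral_prod_symm _ h2.aemeasurable]
  exact lintegral_congr fun y => hW.lintegral_pF y

lemma CcSmooth.memLp_pF (hW : CcSmooth W) (k : E d) : MemLp (pF W k) 2 volume :=
  (hW.continuous_pF_right k).memLp_of_hasCompactSupport (hW.hasCompactSupport_pF k)

/-- The frozen bound for `κ Δφ` is squared, integrated over `k` and read through Plancherel; `16 =
4²`. -/
lemma CcSmooth.lintegral_lapY_le (hW : CcSmooth W) {κ : ℝ} (hκ : 0 < κ) :
    ENNReal.ofReal (κ ^ 2) * ∫⁻ z, ‖FokkerPlanck.lapY W z‖ₑ ^ 2 ≤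
      16 * ∫⁻ z, ‖FokkerPlanck.kolm κ W z‖ₑ ^ 2 := by
  rw [← hW.lapY.lintegral_lintegral_pF, ← (hW.kolm κ).lintegral_lintegral_pF,
    ← lintegral_const_mul' _ _ ENNReal.ofReal_ne_top, ← lintegral_const_mul' _ _ (by norm_num)]
  refine lintegral_mono fun k => ?_
  have h := ((hW.hasSecond_pF k).frozen_estimate hκ (hW.pF_kolm κ k)).1
  rw [lintegral_enorm_sq (hW.lapY.memLp_pF k), lintegral_enorm_sq ((hW.kolm κ).memLp_pF k),
    ← ENNReal.ofReal_mul (by positivity), show (16 : ENNReal) = ENNReal.ofReal 16 by norm_num,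
    ← ENNReal.ofReal_mul (by norm_num), funext (hW.pF_lapY k)]
  refine ENNReal.ofReal_le_ofReal ?_
  rw [← mul_pow, show (16 : ℝ) = 4 ^ 2 by norm_num, ← mul_pow]
  exact pow_le_pow_left₀ (mul_nonneg hκ.le (l2_nonneg _)) h 2

/-- The symbol of `D_x^{2/3}`. -/
def sym (k : E d) : ℝ := (1 + (2 * Real.pi * ‖k‖) ^ 2) ^ ((2 / 3 : ℝ) / 2)

lemma sym_pos (k : E d) : 0 < sym k := by unfold sym; positivity

/-- Subadditivity of `t ↦ t^(2/3)` separates the low frequencies. The constant is `8^(4/3) = 16`,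
from `2π ≤ 8`. -/
lemma sym_sq_le (k : E d) : sym k ^ 2 ≤ 1 + 16 * ‖k‖ ^ (4 / 3 : ℝ) := by
  have h0 : 0 ≤ ‖k‖ := norm_nonneg k
  have e1 : sym k ^ 2 = (1 + (2 * Real.pi * ‖k‖) ^ 2) ^ (2 / 3 : ℝ) := by
    unfold sym
    rw [← Real.rpow_natCast, ← Real.rpow_mul (by positivity)]
    norm_num
  have e2 : (1 + (2 * Real.pi * ‖k‖) ^ 2) ^ (2 / 3 : ℝ) ≤
      1 ^ (2 / 3 : ℝ) + ((2 * Real.pi * ‖k‖) ^ 2) ^ (2 / 3 : ℝ) :=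
    Real.rpow_add_le_add_rpow (by norm_num) (by positivity) (by norm_num) (by norm_num)
  have e3 : ((2 * Real.pi * ‖k‖) ^ 2) ^ (2 / 3 : ℝ) ≤ ((8 * ‖k‖) ^ 2) ^ (2 / 3 : ℝ) := by
    have := Real.pi_lt_four
    gcongr
    linarith
  have e4 : ((8 * ‖k‖) ^ 2) ^ (2 / 3 : ℝ) = 16 * ‖k‖ ^ (4 / 3 : ℝ) := by
    rw [← Real.rpow_natCast, ← Real.rpow_mul (by positivity),
      Real.mul_rpow (by norm_num) h0, show (8 : ℝ) = 2 ^ (3 : ℝ) by norm_num,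
      ← Real.rpow_mul (by norm_num)]
    norm_num
  rw [Real.one_rpow] at e2
  linarith

/-- The power `2/3` of the cubic bound is quadratic in the two norms, hence can be integrated over
`k`. The constant uses `3^(2/3) ≤ 3`. -/
lemma rpow_le_of_cube_le {κ K p x : ℝ} (hκ : 0 < κ) (hK : 0 ≤ K) (hp : 0 ≤ p) (hx : 0 ≤ x)
    (h : κ * K ^ 2 * p ^ 3 ≤ 3 * x ^ 3) :
    K ^ (4 / 3 : ℝ) * p ^ 2 ≤ 3 * κ ^ (-(2 / 3) : ℝ) * x ^ 2 := by
  have h1 := Real.rpow_le_rpow (by positivity) h (by norm_num : (0 : ℝ) ≤ 2 / 3)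
  have p3 : ∀ t : ℝ, 0 ≤ t → (t ^ 3) ^ (2 / 3 : ℝ) = t ^ 2 := fun t ht => by
    rw [← Real.rpow_natCast, ← Real.rpow_mul ht, ← Real.rpow_natCast]; norm_num
  have p2 : (K ^ 2) ^ (2 / 3 : ℝ) = K ^ (4 / 3 : ℝ) := by
    rw [← Real.rpow_natCast, ← Real.rpow_mul hK]; norm_num
  rw [Real.mul_rpow (by positivity) (by positivity), Real.mul_rpow hκ.le (by positivity),
    Real.mul_rpow (by norm_num) (by positivity), p3 p hp, p3 x hx, p2] at h1
  have h2 : (3 : ℝ) ^ (2 / 3 : ℝ) ≤ 3 := by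
    simpa using Real.rpow_le_rpow_of_exponent_le (by norm_num : (1 : ℝ) ≤ 3)
      (by norm_num : (2 / 3 : ℝ) ≤ 1)
  calc K ^ (4 / 3 : ℝ) * p ^ 2 = κ ^ (-(2 / 3) : ℝ) * (κ ^ (2 / 3 : ℝ) * K ^ (4 / 3 : ℝ) * p ^ 2) := by
        rw [← mul_assoc, ← mul_assoc, ← Real.rpow_add hκ]; norm_num
    _ ≤ κ ^ (-(2 / 3) : ℝ) * (3 * x ^ 2) := by
        exact mul_le_mul_of_nonneg_left (h1.trans (by gcongr)) (by positivity)
    _ = _ := by ring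

/-- In the bound `1 + 16 |k|^(4/3)` for the squared symbol, the first term costs the norm of `W` and
the second is paid for by the frozen estimate; `48 = 16 · 3`. -/
lemma CcSmooth.lintegral_sym_le (hW : CcSmooth W) {κ : ℝ} (hκ : 0 < κ) :
    ∫⁻ k, ∫⁻ y, ‖sym k * pF W k y‖ₑ ^ 2 ≤ (∫⁻ z, ‖W z‖ₑ ^ 2) +
      ENNReal.ofReal (48 * κ ^ (-(2 / 3) : ℝ)) * ∫⁻ z, ‖FokkerPlanck.kolm κ W z‖ₑ ^ 2 := by
  have hm : Measurable fun k => ∫⁻ y, ‖pF W k y‖ₑ ^ 2 :=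
    (hW.continuous_pF.enorm.measurable.pow_const 2).lintegral_prod_right'
  rw [← hW.lintegral_lintegral_pF, ← (hW.kolm κ).lintegral_lintegral_pF,
    ← lintegral_const_mul' _ _ ENNReal.ofReal_ne_top, ← lintegral_add_left hm]
  refine lintegral_mono fun k => ?_
  have h := rpow_le_of_cube_le hκ (norm_nonneg k) (l2_nonneg _) (l2_nonneg _)
    ((hW.hasSecond_pF k).frozen_estimate hκ (hW.pF_kolm κ k)).2
  have h1 := sym_sq_le k
  have e : ∀ y, ‖sym k * pF W k y‖ₑ ^ 2 = ENNReal.ofReal (sym k ^ 2) * ‖pF W k y‖ₑ ^ 2 := by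
    intro y
    rw [enorm_mul, mul_pow, ENNReal.ofReal_pow (sym_pos k).le, ← ofReal_norm (sym k : ℂ),
      Complex.norm_real, Real.norm_of_nonneg (sym_pos k).le]
  simp only [e]
  rw [lintegral_const_mul' _ _ ENNReal.ofReal_ne_top]
  rw [lintegral_enorm_sq (hW.memLp_pF k), lintegral_enorm_sq ((hW.kolm κ).memLp_pF k),
    ← ENNReal.ofReal_mul (by positivity), ← ENNReal.ofReal_mul (by positivity),
    ← ENNReal.ofReal_add (by positivity) (by positivity)]
  refine ENNReal.ofReal_le_ofReal ?_
  have h2 := mul_le_mul_of_nonneg_right h1 (sq_nonneg (l2 (pF W k) volume))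
  nlinarith

end PartialFourier

/-! ### Young's inequality -/

section Young

/-- Cauchy–Schwarz with respect to the density `a`, that is, for the factors `√a` and `√a b`. -/
lemma lintegral_mul_sq_le {α : Type*} [MeasurableSpace α] {μ : Measure α} {a b : α → ENNReal}
    (ha : Measurable a) (hb : Measurable b) :
    (∫⁻ t, a t * b t ∂μ) ^ 2 ≤ (∫⁻ t, a t ∂μ) * ∫⁻ t, a t * b t ^ 2 ∂μ := by
  have h := ENNReal.lintegral_mul_le_Lp_mul_Lq μ Real.HolderConjugate.two_two
    (f := fun t => a t ^ (1 / 2 : ℝ)) (g := fun t => a t ^ (1 / 2 : ℝ) * b t)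
    (ha.pow_const _).aemeasurable ((ha.pow_const _).mul hb).aemeasurable
  have e0 : ∀ t : ENNReal, t ^ (1 / 2 : ℝ) * t ^ (1 / 2 : ℝ) = t := fun t => by
    rw [← ENNReal.rpow_add_of_nonneg _ _ (by norm_num) (by norm_num)]; norm_num
  have e2 : ∀ t : ENNReal, (t ^ (1 / 2 : ℝ)) ^ (2 : ℝ) = t := fun t => by
    rw [← ENNReal.rpow_mul]; norm_num
  simp only [Pi.mul_apply, ← mul_assoc, e0, e2,
    ENNReal.mul_rpow_of_nonneg _ _ (by norm_num : (0 : ℝ) ≤ 2)] at h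
  calc (∫⁻ t, a t * b t ∂μ) ^ 2 ≤ _ := pow_le_pow_left₀ zero_le h 2
    _ = _ := by
      rw [mul_pow, ← ENNReal.rpow_natCast, ← ENNReal.rpow_natCast, ← ENNReal.rpow_mul,
        ← ENNReal.rpow_mul]
      norm_num

/-- Cauchy–Schwarz in the density `a`, then Tonelli and translation invariance. It bounds both the
commutator of `D_x^{2/3}` on the frequency side and the averages over small balls that come from
mollification. -/
lemma lintegral_young {G : Type*} [AddGroup G] [MeasurableSpace G] [MeasurableAdd₂ G]
    [MeasurableNeg G] [MeasurableSub₂ G] {μ : Measure G} [SFinite μ] [μ.IsAddRightInvariant]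
    {a b : G → ENNReal} (ha : Measurable a) (hb : Measurable b) :
    ∫⁻ x, (∫⁻ t, a t * b (x - t) ∂μ) ^ 2 ∂μ ≤ (∫⁻ t, a t ∂μ) ^ 2 * ∫⁻ x, b x ^ 2 ∂μ := by
  calc ∫⁻ x, (∫⁻ t, a t * b (x - t) ∂μ) ^ 2 ∂μ
      ≤ ∫⁻ x, (∫⁻ t, a t ∂μ) * ∫⁻ t, a t * b (x - t) ^ 2 ∂μ ∂μ :=
        lintegral_mono fun x => lintegral_mul_sq_le ha (hb.comp (measurable_const.sub measurable_id))
    _ = (∫⁻ t, a t ∂μ) * ∫⁻ x, ∫⁻ t, a t * b (x - t) ^ 2 ∂μ ∂μ := by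
        rw [lintegral_const_mul]
        exact (Measurable.lintegral_prod_right' (f := fun q : G × G => a q.2 * b (q.1 - q.2) ^ 2)
          ((ha.comp measurable_snd).mul ((hb.comp measurable_sub).pow_const 2)))
    _ = (∫⁻ t, a t ∂μ) * ∫⁻ t, ∫⁻ x, a t * b (x - t) ^ 2 ∂μ ∂μ := by
        rw [lintegral_lintegral_swap]
        exact ((ha.comp measurable_snd).mul ((hb.comp measurable_sub).pow_const 2)).aemeasurable
    _ = _ := by
        have : ∀ t, ∫⁻ x, a t * b (x - t) ^ 2 ∂μ = a t * ∫⁻ x, b x ^ 2 ∂μ := fun t => by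
          have hm : Measurable fun x => b (x - t) ^ 2 :=
            (hb.comp (measurable_id.sub_const t)).pow_const 2
          rw [lintegral_const_mul _ hm, lintegral_sub_right_eq_self (fun x => b x ^ 2) t]
        simp only [this]
        rw [lintegral_mul_const _ ha, sq, mul_assoc]

end Young

lemma integrable_inner_of_memLp {𝕜 α F : Type*} [RCLike 𝕜] [MeasurableSpace α] {μ : Measure α}
    [NormedAddCommGroup F] [InnerProductSpace 𝕜 F] {f g : α → F} (hf : MemLp f 2 μ)
    (hg : MemLp g 2 μ) : Integrable (fun x => inner 𝕜 (f x) (g x)) μ := by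
  refine (L2.integrable_inner (𝕜 := 𝕜) (hf.toLp f) (hg.toLp g)).congr ?_
  filter_upwards [hf.coeFn_toLp, hg.coeFn_toLp] with x h1 h2
  rw [h1, h2]

/-! ### The fractional derivative -/

section Bessel
variable {d : ℕ} {W : E d × E d → ℝ} {ψ : E d → ℝ}

/-- With `A = sym k`, `r = 2π |k|` and `B`, `s` for `l`, one has `A³ = 1 + r²`, so `(A - B)(A² + A B
+ B²) = (r - s)(r + s)`. Since `r ≤ A²` and `s ≤ B²`, the symbol is `1`-Lipschitz as a function of
`r`. This makes the commutator with a cutoff an operator of order zero. -/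
lemma sym_sub_le (k l : E d) : |sym k - sym l| ≤ 2 * Real.pi * ‖k - l‖ := by
  have key : ∀ r s A B : ℝ, 0 ≤ s → s ≤ r → 1 ≤ A → 1 ≤ B → A ^ 3 = 1 + r ^ 2 → B ^ 3 = 1 + s ^ 2 →
      |A - B| ≤ r - s := by
    intro r s A B hs hsr hA hB h1 h2
    have h3 : ∀ t D : ℝ, 0 ≤ t → 1 ≤ D → D ^ 3 = 1 + t ^ 2 → t ≤ D ^ 2 := by
      intro t D ht hD h
      refine le_of_pow_le_pow_left₀ (n := 3) (by norm_num) (by positivity) ?_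
      calc t ^ 3 ≤ (1 + t ^ 2) ^ 2 := by nlinarith [sq_nonneg (t ^ 2 - t), sq_nonneg (t - 1), sq_nonneg t]
        _ = (D ^ 2) ^ 3 := by rw [← h]; ring
    have hr := h3 r A (hs.trans hsr) hA h1
    have hs' := h3 s B hs hB h2
    have hBA : B ≤ A := by
      refine le_of_pow_le_pow_left₀ (n := 3) (by norm_num) (by positivity) ?_
      rw [h1, h2]; gcongr
    rw [abs_of_nonneg (by linarith)]
    by_contra! h
    have e : (A - B) * (A ^ 2 + A * B + B ^ 2) = (r - s) * (r + s) := by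
      linear_combination h1 - h2
    have : (r - s) * (r + s) < (A - B) * (A ^ 2 + A * B + B ^ 2) := by
      calc (r - s) * (r + s) ≤ (r - s) * (A ^ 2 + A * B + B ^ 2) := by
            gcongr
            nlinarith
        _ < _ := by
            gcongr
    linarith
  have h1 : ∀ k : E d, 1 ≤ sym k := fun k => Real.one_le_rpow (by nlinarith [sq_nonneg (2 * Real.pi * ‖k‖)]) (by norm_num)
  have h3 : ∀ k : E d, sym k ^ 3 = 1 + (2 * Real.pi * ‖k‖) ^ 2 := fun k => by
    unfold sym
    rw [← Real.rpow_natCast, ← Real.rpow_mul (by positivity)]; norm_num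
  have hpi := Real.pi_pos
  wlog h : ‖l‖ ≤ ‖k‖ generalizing k l
  · rw [abs_sub_comm, norm_sub_rev]; exact this l k (le_of_not_ge h)
  refine (key (2 * Real.pi * ‖k‖) (2 * Real.pi * ‖l‖) _ _ (by positivity) (by gcongr) (h1 k) (h1 l)
    (h3 k) (h3 l)).trans ?_
  rw [← mul_sub]
  gcongr
  exact norm_sub_norm_le k l

lemma hasTemperateGrowth_sym : (fun k : E d => ((sym k : ℝ) : ℂ)).HasTemperateGrowth := by
  have h1 := (Function.hasTemperateGrowth_one_add_norm_sq_rpow (H := E d) ((2 / 3 : ℝ) / 2)).comp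
    (g := fun x : E d => (1 + ‖x‖ ^ 2) ^ ((2 / 3 : ℝ) / 2)) (f := fun k : E d => (2 * Real.pi) • k)
    (by fun_prop)
  have h2 := Function.HasTemperateGrowth.comp (Function.Complex.hasTemperateGrowth_ofReal) h1
  convert! h2 using 1
  funext k
  simp [sym, norm_smul, abs_of_pos Real.pi_pos]

/-- `sym · 𝓕 ψ` as a Schwartz function. -/
def symF (f : SchwartzMap (E d) ℂ) : SchwartzMap (E d) ℂ :=
  SchwartzMap.smulLeftCLM ℂ (fun k : E d => ((sym k : ℝ) : ℂ)) (𝓕 f)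

lemma symF_apply (f : SchwartzMap (E d) ℂ) (k : E d) : symF f k = sym k * 𝓕 (f : E d → ℂ) k := by
  rw [symF, SchwartzMap.smulLeftCLM_apply_apply hasTemperateGrowth_sym, SchwartzMap.fourier_coe,
    smul_eq_mul]

lemma besselD_eq (hψ : CcSmooth ψ) (x : E d) :
    besselD d (2 / 3) ψ x = ((𝓕⁻ (symF hψ.toSchwartz) : SchwartzMap (E d) ℂ) x).re := by
  rw [SchwartzMap.fourierInv_coe]
  unfold besselD
  have : (fun ξ : E d => (((1 + (2 * Real.pi * ‖ξ‖) ^ 2) ^ ((2 / 3 : ℝ) / 2) : ℝ) : ℂ) *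
      𝓕 (fun z : E d => (ψ z : ℂ)) ξ) = symF hψ.toSchwartz := by
    funext k
    rw [symF_apply]
    rfl
  rw [this]

/-- `I - Δ` in the first variable. -/
def oneSubLapX (W : E d × E d → ℝ) (z : E d × E d) : ℝ :=
  W z + -1 * ∑ j, dX (bas d j) (dX (bas d j) W) z

lemma CcSmooth.oneSubLapX (hW : CcSmooth W) : CcSmooth (oneSubLapX W) :=
  hW.add ((CcSmooth.sum _ fun _ => (hW.dX _).dX _).const_mul _)

lemma CcSmooth.pF_oneSubLapX (hW : CcSmooth W) (k y : E d) :
    pF (FokkerPlanck.oneSubLapX W) k y = ((1 + (2 * Real.pi * ‖k‖) ^ 2 : ℝ) : ℂ) * pF W k y := by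
  unfold FokkerPlanck.oneSubLapX
  have h := CcSmooth.sum Finset.univ fun j => (hW.dX (bas d j)).dX (bas d j)
  rw [pF_add hW (h.const_mul _), pF_smul (fun z => ∑ j, FokkerPlanck.dX (bas d j)
    (FokkerPlanck.dX (bas d j) W) z) (fun _ => -1), pF_sum _ fun j => (hW.dX _).dX _]
  simp only [(hW.dX _).pF_dX, hW.pF_dX]
  have e : ‖k‖ ^ 2 = ∑ j, ⟪bas d j, k⟫ ^ 2 := by
    rw [EuclideanSpace.real_norm_sq_eq]
    refine Finset.sum_congr rfl fun j _ => ?_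
    rw [EuclideanSpace.inner_single_left]; simp
  have e2 : ∀ j : Fin (d + 1), (2 * Real.pi * ⟪bas d j, k⟫ : ℝ) • (Complex.I *
      ((2 * Real.pi * ⟪bas d j, k⟫ : ℝ) • (Complex.I * pF W k y))) =
      ((-(2 * Real.pi) ^ 2 * ⟪bas d j, k⟫ ^ 2 : ℝ) : ℂ) * pF W k y := by
    intro j
    simp only [Complex.real_smul]
    push_cast
    linear_combination (4 * (Real.pi : ℂ) ^ 2 * (⟪bas d j, k⟫ : ℂ) ^ 2 * pF W k y) * Complex.I_sq
  simp only [e2]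
  rw [← Finset.sum_mul, ← Complex.ofReal_sum, ← Finset.mul_sum, ← e, Complex.real_smul]
  push_cast
  ring

/-- Each use of `I - Δₓ` multiplies the transform by `1 + (2π |k|)²`, which dominates `1 + |k|²`,
and does not leave the smooth functions with compact support. The bound is uniform in `y`, which
Schwartz decay of the separate slices would not state. -/
lemma CcSmooth.exists_pF_decay (hW : CcSmooth W) (N : ℕ) :
    ∃ C, 0 ≤ C ∧ ∀ k y, (1 + ‖k‖ ^ 2) ^ N * ‖pF W k y‖ ≤ C := by
  induction N generalizing W with
  | zero =>
    obtain ⟨b, hb, hWb⟩ := hW.exists_dominating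
    refine ⟨∫ x, b x, integral_nonneg fun x => (abs_nonneg _).trans (hWb x 0), fun k y => ?_⟩
    rw [pow_zero, one_mul, pF_eq]
    refine norm_integral_le_of_norm_le hb (Filter.Eventually.of_forall fun x => ?_)
    rw [Circle.norm_smul, Complex.norm_real]
    exact hWb x y
  | succ N ih =>
    obtain ⟨C, hC0, hC⟩ := ih hW.oneSubLapX
    refine ⟨C, hC0, fun k y => le_trans ?_ (hC k y)⟩
    rw [hW.pF_oneSubLapX, norm_mul, Complex.norm_real, Real.norm_of_nonneg (by positivity), pow_succ,
      mul_assoc]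
    have : 1 ≤ 2 * Real.pi := by linarith [Real.pi_gt_three]
    have : ‖k‖ ≤ 2 * Real.pi * ‖k‖ := le_mul_of_one_le_left (norm_nonneg _) this
    gcongr

lemma CcSmooth.exists_sym_dominating (hW : CcSmooth W) :
    ∃ b : E d → ℝ, Integrable b volume ∧ Integrable (fun k => b k ^ 2) volume ∧
      ∀ k y, ‖sym k * pF W k y‖ ≤ b k := by
  -- One factor `I - Δₓ` absorbs the symbol. The other `d + 2` make the bound integrable on
  -- `ℝ^(d+1)`, as `2 (d + 2) > d + 1`.
  obtain ⟨C, hC0, hC⟩ := (hW.oneSubLapX).exists_pF_decay (d + 2)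
  have hfin : (Module.finrank ℝ (E d) : ℝ) < 2 * (d + 2) := by
    rw [finrank_euclideanSpace_fin]; push_cast; linarith
  have hint := integrable_rpow_neg_one_add_norm_sq (μ := (volume : Measure (E d))) hfin
  have e : ∀ k : E d, (1 + ‖k‖ ^ 2) ^ (-(2 * ((d : ℝ) + 2)) / 2) = ((1 + ‖k‖ ^ 2) ^ (d + 2))⁻¹ := by
    intro k
    rw [← Real.rpow_natCast (1 + ‖k‖ ^ 2), ← Real.rpow_neg (by positivity)]
    congr 1; push_cast; ring
  simp only [e] at hint
  have hle1 : ∀ k : E d, ((1 + ‖k‖ ^ 2) ^ (d + 2))⁻¹ ≤ 1 := fun k =>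
    inv_le_one_of_one_le₀ (one_le_pow₀ (by nlinarith [sq_nonneg ‖k‖]))
  refine ⟨fun k => C * ((1 + ‖k‖ ^ 2) ^ (d + 2))⁻¹, hint.const_mul C, ?_, fun k y => ?_⟩
  · simp only [mul_pow]
    refine (hint.mono' ?_ (Filter.Eventually.of_forall fun k => ?_)).const_mul _
    · have := hint.aestronglyMeasurable; exact this.pow 2
    · have h0 : 0 ≤ ((1 + ‖k‖ ^ 2) ^ (d + 2))⁻¹ := by positivity
      rw [Real.norm_of_nonneg (by positivity)]
      nlinarith [hle1 k]
  · have h1 := hC k y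
    rw [hW.pF_oneSubLapX, norm_mul, Complex.norm_real, Real.norm_of_nonneg (by positivity)] at h1
    rw [norm_mul, Complex.norm_real, Real.norm_of_nonneg (sym_pos k).le]
    change _ ≤ C * ((1 + ‖k‖ ^ 2) ^ (d + 2))⁻¹
    rw [← div_eq_mul_inv, le_div_iff₀ (by positivity), mul_comm]
    have h2 : sym k ≤ 1 + (2 * Real.pi * ‖k‖) ^ 2 := by
      refine (Real.rpow_le_rpow_of_exponent_le (by nlinarith [sq_nonneg (2 * Real.pi * ‖k‖)])
        (by norm_num : (2 / 3 : ℝ) / 2 ≤ 1)).trans (by rw [Real.rpow_one])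
    refine le_trans ?_ h1
    gcongr

/-- `D_x^{2/3} W`. -/
def bes (W : E d × E d → ℝ) (z : E d × E d) : ℝ := besselD d (2 / 3) (fun x => W (x, z.2)) z.1

lemma bes_eq_integral (z : E d × E d) :
    bes W z = (∫ k, Real.fourierChar ⟪k, z.1⟫ • (sym k * pF W k z.2)).re := by
  unfold bes besselD
  rw [Real.fourierInv_eq]
  rfl

lemma continuous_sym : Continuous (sym : E d → ℝ) := by
  unfold sym
  refine Continuous.rpow_const (by fun_prop) fun k => Or.inl ?_
  positivity

lemma CcSmooth.continuous_bes (hW : CcSmooth W) : Continuous (bes W) := by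
  obtain ⟨b, hb, -, hWb⟩ := hW.exists_sym_dominating
  rw [funext (bes_eq_integral (W := W))]
  refine Complex.continuous_re.comp ?_
  have hs := continuous_sym (d := d)
  refine continuous_of_dominated (bound := b) (fun z => ?_) (fun z => ?_) hb ?_
  · refine Continuous.aestronglyMeasurable ?_
    simp only [Circle.smul_def]
    have := hW.continuous_pF_right
    have : Continuous fun k => pF W k z.2 := by
      have h : Continuous fun k : E d => (k, z.2) := by fun_prop
      simpa only [Function.comp_def] using Continuous.comp hW.continuous_pF h
    fun_prop
  · exact Filter.Eventually.of_forall fun k => by rw [Circle.norm_smul]; exact hWb k z.2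
  · refine Filter.Eventually.of_forall fun k => ?_
    simp only [Circle.smul_def]
    have : Continuous fun z : E d × E d => pF W k z.2 := (hW.continuous_pF_right k).comp continuous_snd
    fun_prop

lemma CcSmooth.exists_bound_bes (hW : CcSmooth W) : ∃ C, ∀ z, |bes W z| ≤ C := by
  obtain ⟨b, hb, -, hWb⟩ := hW.exists_sym_dominating
  refine ⟨∫ k, b k, fun z => ?_⟩
  rw [bes_eq_integral]
  refine (Complex.abs_re_le_norm _).trans
    (norm_integral_le_of_norm_le hb (Filter.Eventually.of_forall fun k => ?_))
  rw [Circle.norm_smul]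
  exact hWb k z.2

lemma norm_fourierInv_sq (f : SchwartzMap (E d) ℂ) :
    ∫⁻ x, ‖(𝓕⁻ f : SchwartzMap (E d) ℂ) x‖ₑ ^ 2 = ∫⁻ k, ‖f k‖ₑ ^ 2 := by
  have h := (𝓕⁻ f : SchwartzMap (E d) ℂ).integral_norm_sq_fourier
  simp only [FourierTransform.fourier_fourierInv_eq] at h
  rw [lintegral_enorm_sq (SchwartzMap.memLp _ 2 volume),
    lintegral_enorm_sq (SchwartzMap.memLp _ 2 volume), l2_sq, l2_sq, h]

lemma enorm_bes_le (hW : CcSmooth W) (x y : E d) :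
    ‖bes W (x, y)‖ₑ ≤ ‖(𝓕⁻ (symF (hW.slice y).toSchwartz) : SchwartzMap (E d) ℂ) x‖ₑ := by
  unfold bes
  rw [besselD_eq (hW.slice y), ← ofReal_norm, ← ofReal_norm]
  exact ENNReal.ofReal_le_ofReal (Complex.abs_re_le_norm _)

lemma CcSmooth.symF_slice (hW : CcSmooth W) (k y : E d) :
    symF (hW.slice y).toSchwartz k = sym k * pF W k y := by
  rw [symF_apply]; rfl

/-- Parseval's identity on slices. -/
lemma integral_mul_bes_slice {V : E d × E d → ℝ} (hV : CcSmooth V) (hW : CcSmooth W) (y : E d) :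
    ∫ x, V (x, y) * bes W (x, y) = ∫ k, ⟪sym k * pF V k y, pF W k y⟫ := by
  have h := SchwartzMap.integral_inner_fourier_fourier (hV.slice y).toSchwartz
    (𝓕⁻ (symF (hW.slice y).toSchwartz))
  simp only [FourierTransform.fourier_fourierInv_eq] at h
  have h2 := congrArg Complex.re h
  have i1 := integrable_inner_of_memLp (𝕜 := ℂ) (SchwartzMap.memLp (𝓕 (hV.slice y).toSchwartz) 2 volume)
    (SchwartzMap.memLp (symF (hW.slice y).toSchwartz) 2 volume)
  have i2 := integrable_inner_of_memLp (𝕜 := ℂ) (SchwartzMap.memLp ((hV.slice y).toSchwartz) 2 volume)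
    (SchwartzMap.memLp (𝓕⁻ (symF (hW.slice y).toSchwartz)) 2 volume)
  rw [← RCLike.re_eq_complex_re, ← integral_re i1, ← integral_re i2] at h2
  refine Eq.trans ?_ (h2.symm.trans ?_)
  · refine integral_congr_ae (Filter.Eventually.of_forall fun x => ?_)
    simp only [CcSmooth.toSchwartz_apply]
    unfold bes
    rw [besselD_eq (hW.slice y)]
    simp
    ring
  · refine integral_congr_ae (Filter.Eventually.of_forall fun k => ?_)
    simp only [hW.symF_slice, SchwartzMap.fourier_coe]
    change RCLike.re (inner ℂ (pF V k y) _) = _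
    simp [Complex.inner]
    ring

lemma memLp_two_of_lintegral {α F : Type*} [MeasurableSpace α] {μ : Measure α}
    [NormedAddCommGroup F] {f : α → F} (hf : AEStronglyMeasurable f μ)
    (h : ∫⁻ x, ‖f x‖ₑ ^ 2 ∂μ ≠ ⊤) : MemLp f 2 μ := by
  refine ⟨hf, (eLpNorm_lt_top_iff_lintegral_rpow_enorm_lt_top (by norm_num) (by norm_num)).2 ?_⟩
  simpa using h.lt_top

lemma l2_le_of_lintegral {α F : Type*} [MeasurableSpace α] {μ : Measure α}
    [NormedAddCommGroup F] {f : α → F} {A : ℝ} (hA : 0 ≤ A) (hf : AEStronglyMeasurable f μ)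
    (h : ∫⁻ x, ‖f x‖ₑ ^ 2 ∂μ ≤ ENNReal.ofReal (A ^ 2)) : l2 f μ ≤ A := by
  have hm := memLp_two_of_lintegral hf (h.trans_lt ENNReal.ofReal_lt_top).ne
  rw [lintegral_enorm_sq hm, ENNReal.ofReal_le_ofReal_iff (by positivity)] at h
  exact le_of_pow_le_pow_left₀ (n := 2) (by norm_num) hA h

lemma CcSmooth.memLp {V : Type*} [NormedAddCommGroup V] [NormedSpace ℝ V] [MeasurableSpace V]
    [BorelSpace V] {f : V → ℝ} (hf : CcSmooth f) (μ : Measure V) [IsFiniteMeasureOnCompacts μ] :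
    MemLp f 2 μ := hf.continuous.memLp_of_hasCompactSupport hf.compact

/-- Parseval moves the multiplier from `W` to `V`, on which the frequency-side bound is known. Only
the `L²` norm of `W` is then needed. -/
lemma abs_integral_mul_bes_le {V : E d × E d → ℝ} (hV : CcSmooth V) (hW : CcSmooth W) {A : ℝ}
    (hA : 0 ≤ A) (h : ∫⁻ k, ∫⁻ y, ‖sym k * pF V k y‖ₑ ^ 2 ≤ ENNReal.ofReal (A ^ 2)) :
    |∫ z, V z * bes W z| ≤ A * l2 W volume := by
  have c1 : Continuous fun q : E d × E d => sym q.1 * pF V q.1 q.2 :=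
    (Complex.continuous_ofReal.comp (continuous_sym.comp continuous_fst)).mul hV.continuous_pF
  have m1 : Measurable fun q : E d × E d => ‖sym q.1 * pF V q.1 q.2‖ₑ ^ 2 :=
    c1.enorm.measurable.pow_const 2
  have m2 : Measurable fun q : E d × E d => ‖pF W q.1 q.2‖ₑ ^ 2 :=
    hW.continuous_pF.enorm.measurable.pow_const 2
  have e1 := lintegral_prod (μ := (volume : Measure (E d))) (ν := (volume : Measure (E d)))
    _ m1.aemeasurable
  have e2 := lintegral_prod (μ := (volume : Measure (E d))) (ν := (volume : Measure (E d)))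
    _ m2.aemeasurable
  rw [hW.lintegral_lintegral_pF, lintegral_enorm_sq (hW.memLp volume)] at e2
  rw [← Measure.volume_eq_prod] at e1 e2
  have l1 : MemLp (fun q : E d × E d => sym q.1 * pF V q.1 q.2) 2 volume :=
    memLp_two_of_lintegral c1.aestronglyMeasurable
      (by rw [e1]; exact (h.trans_lt ENNReal.ofReal_lt_top).ne)
  have l2' : MemLp (fun q : E d × E d => pF W q.1 q.2) 2 volume :=
    memLp_two_of_lintegral hW.continuous_pF.aestronglyMeasurable
      (by rw [e2]; exact ENNReal.ofReal_ne_top)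
  have n1 := l2_le_of_lintegral hA c1.aestronglyMeasurable (e1.trans_le h)
  have n2 := l2_le_of_lintegral (l2_nonneg _) hW.continuous_pF.aestronglyMeasurable e2.le
  have hint : Integrable (fun z => V z * bes W z) volume :=
    (hV.continuous.mul hW.continuous_bes).integrable_of_hasCompactSupport hV.compact.mul_right
  have e3 : ∫ z, V z * bes W z = ∫ q : E d × E d, ⟪sym q.1 * pF V q.1 q.2, pF W q.1 q.2⟫ := by
    have hi2 := integrable_inner_of_memLp (𝕜 := ℝ) l1 l2'
    rw [Measure.volume_eq_prod] at hint hi2 ⊢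
    rw [integral_prod_symm _ hint, integral_prod_symm _ hi2]
    exact integral_congr_ae (Filter.Eventually.of_forall fun y => integral_mul_bes_slice hV hW y)
  rw [e3]
  refine (abs_integral_inner_le l1 l2').trans (mul_le_mul n1 n2 (l2_nonneg _) hA)

/-- The commutator of `D_x^{2/3}` with a cutoff is bounded on `L²`, here applied off the set where
the cutoff is equal to one. -/
lemma exists_lintegral_cutoff_bes_le {χ : E d → ℝ} (hχ : CcSmooth χ) :
    ∃ C : ENNReal, C ≠ ⊤ ∧ ∀ W : E d × E d → ℝ, CcSmooth W → ∀ y, (∀ x, W (x, y) ≠ 0 → χ x = 1) →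
      ∫⁻ x, ‖(1 - χ x) * bes W (x, y)‖ₑ ^ 2 ≤ C * ∫⁻ x, ‖W (x, y)‖ₑ ^ 2 := by
  set a : SchwartzMap (E d) ℂ := 𝓕 hχ.toSchwartz with ha
  set α : E d → ENNReal := fun k => ENNReal.ofReal (2 * Real.pi * (‖k‖ * ‖a k‖)) with hα
  have hαint : Integrable (fun k => 2 * Real.pi * (‖k‖ * ‖a k‖)) volume := by
    have := (a.integrable_pow_mul volume 1).const_mul (2 * Real.pi)
    simpa using this
  have hαm : Measurable α := by
    have := a.continuous
    refine (Continuous.measurable ?_).ennreal_ofReal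
    fun_prop
  refine ⟨(∫⁻ k, α k) ^ 2, ENNReal.pow_ne_top ?_, fun W hW y hy => ?_⟩
  · rw [← ofReal_integral_eq_lintegral_ofReal hαint
      (Filter.Eventually.of_forall fun k => by positivity)]
    exact ENNReal.ofReal_ne_top
  set b : SchwartzMap (E d) ℂ := 𝓕 (hW.slice y).toSchwartz with hb
  set s : SchwartzMap (E d) ℂ := symF (hW.slice y).toSchwartz with hs
  set B := ContinuousLinearMap.mul ℂ ℂ with hB
  have inv_conv : ∀ f g : SchwartzMap (E d) ℂ, ∀ x,
      (𝓕⁻ (SchwartzMap.convolution B f g) : SchwartzMap (E d) ℂ) x =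
        (𝓕⁻ f : SchwartzMap (E d) ℂ) x * (𝓕⁻ g : SchwartzMap (E d) ℂ) x := by
    intro f g x
    have h := congrArg (fun u : SchwartzMap (E d) ℂ => u (-x))
      (SchwartzMap.fourier_convolution B f g)
    simp only [SchwartzMap.pairing_apply_apply, SchwartzMap.fourier_coe] at h
    simp only [SchwartzMap.fourierInv_coe, Real.fourierInv_eq_fourier_neg]
    exact h
  -- This is `χ W = W` on the frequency side.
  have hab : SchwartzMap.convolution B a b = b := by
    have : (𝓕⁻ (SchwartzMap.convolution B a b) : SchwartzMap (E d) ℂ) =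
        𝓕⁻ b := by
      ext x
      rw [inv_conv, ha, hb, FourierTransform.fourierInv_fourier_eq,
        FourierTransform.fourierInv_fourier_eq, CcSmooth.toSchwartz_apply,
        CcSmooth.toSchwartz_apply]
      by_cases h0 : W (x, y) = 0
      · simp [h0]
      · simp [hy x h0]
    have h2 := congrArg (fun u : SchwartzMap (E d) ℂ => (𝓕 u : SchwartzMap (E d) ℂ)) this
    simpa only [FourierTransform.fourier_fourierInv_eq] using h2
  -- Writing `D` for the multiplier, `(1 - χ) D W = D W - χ D W`, and since `W = χ W` this is the
  -- commutator of `D` with `χ` applied to `W`.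
  have key : ∀ x, ‖(1 - χ x) * bes W (x, y)‖ₑ ≤
      ‖(𝓕⁻ (s - SchwartzMap.convolution B a s) : SchwartzMap (E d) ℂ) x‖ₑ := by
    intro x
    have e : (𝓕⁻ (s - SchwartzMap.convolution B a s) : SchwartzMap (E d) ℂ) x =
        ((1 - χ x : ℝ) : ℂ) * (𝓕⁻ s : SchwartzMap (E d) ℂ) x := by
      rw [show (𝓕⁻ (s - SchwartzMap.convolution B a s) : SchwartzMap (E d) ℂ) =
        𝓕⁻ s - 𝓕⁻ (SchwartzMap.convolution B a s) from
        map_sub (FourierTransform.fourierInvCLM ℂ (SchwartzMap (E d) ℂ)) _ _, sub_apply, inv_conv, ha,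
        FourierTransform.fourierInv_fourier_eq, CcSmooth.toSchwartz_apply]
      push_cast
      ring
    rw [e, enorm_mul, enorm_mul]
    refine mul_le_mul' (le_of_eq ?_) (enorm_bes_le hW x y)
    rw [← ofReal_norm, ← ofReal_norm, Complex.norm_real]
  -- In the convolution kernel the symbol appears only as the difference `sym k - sym (k - t)`. Its
  -- Lipschitz bound puts the growth on the transform of `χ`, where `|t|` is harmless.
  have hR : ∀ k, ‖(s - SchwartzMap.convolution B a s) k‖ₑ ≤ ∫⁻ t, α t * ‖b (k - t)‖ₑ := by
    intro k
    have i1 : ∀ g : SchwartzMap (E d) ℂ, Integrable (fun t => a t * g (k - t)) volume := by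
      intro g
      refine a.integrable.mul_bdd (c := SchwartzMap.seminorm ℝ 0 0 g) ?_
        (Filter.Eventually.of_forall fun t => SchwartzMap.norm_le_seminorm ℝ g _)
      exact (g.continuous.comp (by fun_prop)).aestronglyMeasurable
    have e : (s - SchwartzMap.convolution B a s) k =
        ∫ t, ((sym k - sym (k - t) : ℝ) : ℂ) * (a t * b (k - t)) := by
      have e1 : s k = sym k * ∫ t, a t * b (k - t) := by
        rw [hs, symF_apply, ← SchwartzMap.fourier_coe, ← hb]
        conv_lhs => rw [← hab, SchwartzMap.convolution_apply]
        rfl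
      have e2 : SchwartzMap.convolution B a s k = ∫ t, a t * s (k - t) := by
        rw [SchwartzMap.convolution_apply]; rfl
      rw [sub_apply, e1, e2, ← integral_const_mul, ← integral_sub ((i1 b).const_mul _) (i1 s)]
      refine integral_congr_ae (Filter.Eventually.of_forall fun t => ?_)
      simp only [hs, symF_apply]
      rw [← SchwartzMap.fourier_coe, ← hb]
      push_cast
      ring
    rw [e]
    refine (enorm_integral_le_lintegral_enorm _).trans (lintegral_mono fun t => ?_)
    rw [enorm_mul, enorm_mul, ← mul_assoc]
    refine mul_le_mul' ?_ le_rfl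
    rw [hα, ← ofReal_norm, ← ofReal_norm, ← ENNReal.ofReal_mul (norm_nonneg _), Complex.norm_real]
    refine ENNReal.ofReal_le_ofReal ?_
    rw [← mul_assoc]
    gcongr
    simpa using sym_sub_le k (k - t)
  calc ∫⁻ x, ‖(1 - χ x) * bes W (x, y)‖ₑ ^ 2
      ≤ ∫⁻ x, ‖(𝓕⁻ (s - SchwartzMap.convolution B a s) : SchwartzMap (E d) ℂ) x‖ₑ ^ 2 :=
        lintegral_mono fun x => pow_le_pow_left₀ zero_le (key x) 2
    _ = ∫⁻ k, ‖(s - SchwartzMap.convolution B a s) k‖ₑ ^ 2 := norm_fourierInv_sq _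
    _ ≤ ∫⁻ k, (∫⁻ t, α t * ‖b (k - t)‖ₑ) ^ 2 :=
        lintegral_mono fun k => pow_le_pow_left₀ zero_le (hR k) 2
    _ ≤ (∫⁻ k, α k) ^ 2 * ∫⁻ k, ‖b k‖ₑ ^ 2 := lintegral_young hαm b.continuous.enorm.measurable
    _ = _ := by
      congr 1
      rw [← hW.lintegral_pF y, hb, SchwartzMap.fourier_coe]
      rfl

end Bessel

/-! ### Mollification -/

section Mollifier
variable {d : ℕ}

instance instIsAddHaarMeasureProd : (volume : Measure (E d × E d)).IsAddHaarMeasure :=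
  inferInstanceAs ((volume : Measure (E d)).prod (volume : Measure (E d))).IsAddHaarMeasure

/-- A mollifier at scale `δ`, with constant `C` in the bounds for its first derivatives. -/
structure IsMollifier (d : ℕ) (C δ : ℝ) (η : E d × E d → ℝ) : Prop where
  cc : CcSmooth η
  nonneg : ∀ z, 0 ≤ η z
  integral : ∫ z, η z = 1
  supp : ∀ z, δ ≤ ‖z‖ → η z = 0
  suppX : ∀ j z, δ < ‖z‖ → dX (bas d j) η z = 0
  suppY : ∀ j z, δ < ‖z‖ → dY (bas d j) η z = 0
  bound : ∀ z, |η z| ≤ C * (δ ^ Module.finrank ℝ (E d × E d))⁻¹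
  boundX : ∀ j z, δ * |dX (bas d j) η z| ≤ C * (δ ^ Module.finrank ℝ (E d × E d))⁻¹
  boundY : ∀ j z, δ * |dY (bas d j) η z| ≤ C * (δ ^ Module.finrank ℝ (E d × E d))⁻¹

/-- Rescaling one fixed bump costs a factor `δ⁻¹` for each derivative. One constant that dominates
the sup norms of the bump and of its first derivatives therefore serves all scales. -/
lemma exists_isMollifier (d : ℕ) :
    ∃ C, 0 ≤ C ∧ ∀ δ, 0 < δ → ∃ η, IsMollifier d C δ η := by
  set φ : ContDiffBump (0 : E d × E d) := ⟨1 / 2, 1, by norm_num, by norm_num⟩ with hφ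
  set η₀ := φ.normed volume with hη₀
  have c₀ : CcSmooth η₀ := ⟨φ.contDiff_normed, φ.hasCompactSupport_normed⟩
  obtain ⟨C₀, hC₀, h₀⟩ := c₀.exists_bound
  choose CX hCX hX using fun j => (c₀.dX (bas d j)).exists_bound
  choose CY hCY hY using fun j => (c₀.dY (bas d j)).exists_bound
  have hsX := Finset.sum_nonneg (s := Finset.univ) fun j _ => hCX j
  have hsY := Finset.sum_nonneg (s := Finset.univ) fun j _ => hCY j
  refine ⟨C₀ + ∑ j, CX j + ∑ j, CY j, by positivity, fun δ hδ => ?_⟩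
  have hleX : ∀ j, CX j ≤ C₀ + ∑ j, CX j + ∑ j, CY j := fun j => by
    have := Finset.single_le_sum (fun i _ => hCX i) (Finset.mem_univ j)
    linarith
  have hleY : ∀ j, CY j ≤ C₀ + ∑ j, CX j + ∑ j, CY j := fun j => by
    have := Finset.single_le_sum (fun i _ => hCY i) (Finset.mem_univ j)
    linarith
  set D := (δ ^ Module.finrank ℝ (E d × E d))⁻¹ with hD
  have hD0 : 0 < D := by positivity
  have hcc : CcSmooth fun z : E d × E d => D * η₀ (δ⁻¹ • z) := by
    refine CcSmooth.const_mul D ⟨c₀.smooth.comp (by fun_prop), ?_⟩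
    exact c₀.compact.comp_smul (inv_ne_zero hδ.ne')
  have hsupp : ∀ z : E d × E d, δ ≤ ‖z‖ → η₀ (δ⁻¹ • z) = 0 := fun z hz => by
    have : δ⁻¹ • z ∉ Function.support η₀ := by
      rw [hη₀, φ.support_normed_eq]
      simp only [Metric.mem_ball, dist_zero_right, norm_smul, norm_inv, Real.norm_of_nonneg hδ.le,
        not_lt, hφ]
      rw [← div_eq_inv_mul, le_div_iff₀ hδ]
      linarith
    simpa using this
  have hfd : ∀ z v : E d × E d, fderiv ℝ (fun z : E d × E d => D * η₀ (δ⁻¹ • z)) z v =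
      D * (δ⁻¹ * fderiv ℝ η₀ (δ⁻¹ • z) v) := by
    intro z v
    have h1 : HasFDerivAt (fun z : E d × E d => δ⁻¹ • z)
        (δ⁻¹ • ContinuousLinearMap.id ℝ (E d × E d)) z := (hasFDerivAt_id z).const_smul δ⁻¹
    have h2 := ((c₀.differentiable (δ⁻¹ • z)).hasFDerivAt.comp z h1).const_mul D
    have h3 : fderiv ℝ (fun z : E d × E d => D * η₀ (δ⁻¹ • z)) z = _ := h2.fderiv
    rw [h3]
    simp
  have hz0 : ∀ z v : E d × E d, δ < ‖z‖ →
      fderiv ℝ (fun z : E d × E d => D * η₀ (δ⁻¹ • z)) z v = 0 := by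
    intro z v hz
    have : (fun z : E d × E d => D * η₀ (δ⁻¹ • z)) =ᶠ[nhds z] fun _ => 0 := by
      filter_upwards [(isOpen_lt continuous_const continuous_norm).mem_nhds hz] with w hw
      rw [hsupp w (le_of_lt hw), mul_zero]
    rw [this.fderiv_eq]
    simp
  refine ⟨fun z => D * η₀ (δ⁻¹ • z), hcc, fun z => mul_nonneg hD0.le (φ.nonneg_normed _), ?_,
    fun z hz => by rw [hsupp z hz, mul_zero], fun j z hz => hz0 z _ hz, fun j z hz => hz0 z _ hz,
    fun z => ?_, fun j z => ?_, fun j z => ?_⟩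
  · rw [integral_const_mul, Measure.integral_comp_smul, hη₀, φ.integral_normed, smul_eq_mul, mul_one,
      inv_pow, inv_inv, abs_of_pos (by positivity), hD]
    exact inv_mul_cancel₀ (by positivity)
  · rw [abs_mul, abs_of_pos hD0, mul_comm]
    gcongr
    linarith [h₀ (δ⁻¹ • z)]
  · rw [dX, hfd, abs_mul, abs_mul, abs_of_pos hD0, abs_of_pos (inv_pos.2 hδ)]
    calc δ * (D * (δ⁻¹ * |fderiv ℝ η₀ (δ⁻¹ • z) (bas d j, 0)|))
        = |fderiv ℝ η₀ (δ⁻¹ • z) (bas d j, 0)| * D := by field_simp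
      _ ≤ _ := by gcongr; exact (hX j _).trans (hleX j)
  · rw [dY, hfd, abs_mul, abs_mul, abs_of_pos hD0, abs_of_pos (inv_pos.2 hδ)]
    calc δ * (D * (δ⁻¹ * |fderiv ℝ η₀ (δ⁻¹ • z) (0, bas d j)|))
        = |fderiv ℝ η₀ (δ⁻¹ • z) (0, bas d j)| * D := by field_simp
      _ ≤ _ := by gcongr; exact (hY j _).trans (hleY j)

/-- The normalized indicator of the ball of radius `δ`. -/
def ballKernel (d : ℕ) (δ : ℝ) (z : E d × E d) : ENNReal :=
  indicator (Metric.closedBall 0 δ)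
    (fun _ => ENNReal.ofReal (δ ^ Module.finrank ℝ (E d × E d))⁻¹) z

lemma measurable_ballKernel (δ : ℝ) : Measurable (ballKernel d δ) :=
  measurable_const.indicator measurableSet_closedBall

lemma lintegral_ballKernel {δ : ℝ} (hδ : 0 < δ) :
    ∫⁻ z, ballKernel d δ z = volume (Metric.closedBall (0 : E d × E d) 1) := by
  unfold ballKernel
  rw [lintegral_indicator_const measurableSet_closedBall,
    Measure.addHaar_closedBall' _ _ hδ.le, ← mul_assoc, ← ENNReal.ofReal_mul (by positivity),
    inv_mul_cancel₀ (by positivity)]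
  simp

/-- `V ⋆ η`. -/
def moll (η V : E d × E d → ℝ) (z : E d × E d) : ℝ := ∫ t, V t * η (z - t)

variable {V η : E d × E d → ℝ} {C δ : ℝ}

lemma moll_eq : moll η V = convolution V η (ContinuousLinearMap.mul ℝ ℝ) volume := rfl

lemma moll_cc (hη : CcSmooth η) (hV : LocallyIntegrable V volume) (cV : HasCompactSupport V) :
    CcSmooth (moll η V) := by
  rw [moll_eq]
  exact ⟨hη.compact.contDiff_convolution_right _ hV hη.smooth,
    HasCompactSupport.convolution _ cV hη.compact⟩

lemma fderiv_moll (hη : CcSmooth η) (hV : LocallyIntegrable V volume) (z v : E d × E d) :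
    fderiv ℝ (moll η V) z v = moll (fun z => fderiv ℝ η z v) V z := by
  rw [moll_eq, (hη.compact.hasFDerivAt_convolution_right (ContinuousLinearMap.mul ℝ ℝ) hV
    (hη.smooth.of_le (by simp)) z).fderiv,
    convolution_precompR_apply _ hV (hη.compact.fderiv ℝ)
    ((hη.smooth.fderiv_right (m := 0) (by simp)).continuous)]
  rfl

lemma dX_moll (hη : CcSmooth η) (hV : LocallyIntegrable V volume) (v : E d) :
    dX v (moll η V) = moll (dX v η) V := funext fun z => fderiv_moll hη hV z _

lemma dY_moll (hη : CcSmooth η) (hV : LocallyIntegrable V volume) (v : E d) :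
    dY v (moll η V) = moll (dY v η) V := funext fun z => fderiv_moll hη hV z _

lemma integrable_mul_smooth (hη : CcSmooth η) (hV : LocallyIntegrable V volume) (z : E d × E d) :
    Integrable (fun t => V t * η (z - t)) volume := by
  have h := hη.compact.convolutionExists_right (ContinuousLinearMap.mul ℝ ℝ) hV hη.continuous z
  exact h

lemma lapY_moll (hη : CcSmooth η) (hV : LocallyIntegrable V volume) :
    lapY (moll η V) = moll (lapY η) V := by
  funext z
  unfold lapY
  simp only [dY_moll hη hV, fun j => dY_moll (hη.dY (bas d j)) hV]
  unfold moll
  simp only [Finset.mul_sum]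
  rw [integral_finsetSum]
  exact fun j _ => integrable_mul_smooth ((hη.dY _).dY _) hV z

lemma trans_moll (hη : CcSmooth η) (hV : LocallyIntegrable V volume) (z : E d × E d) :
    trans (moll η V) z = ∫ t, V t * ∑ j, z.2 j * dX (bas d j) η (z - t) := by
  unfold trans
  simp only [dX_moll hη hV]
  unfold moll
  simp only [Finset.mul_sum]
  rw [integral_finsetSum]
  · refine Finset.sum_congr rfl fun j _ => ?_
    rw [← integral_const_mul]
    exact integral_congr_ae (Filter.Eventually.of_forall fun t => by ring)
  · intro j _
    refine ((integrable_mul_smooth (hη.dX (bas d j)) hV z).const_mul (z.2 j)).congr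
      (Filter.Eventually.of_forall fun t => by ring)

lemma fderiv_sub_left (hη : CcSmooth η) (z t v : E d × E d) :
    fderiv ℝ (fun t => η (z - t)) t v = -fderiv ℝ η (z - t) v := by
  have h1 : HasFDerivAt (fun t : E d × E d => z - t) (-ContinuousLinearMap.id ℝ (E d × E d)) t :=
    (hasFDerivAt_id t).const_sub z
  have h2 := (hη.differentiable (z - t)).hasFDerivAt.comp t h1
  have h3 : fderiv ℝ (fun t => η (z - t)) t = _ := h2.fderiv
  rw [h3]
  simp

lemma CcSmooth.sub_left (hη : CcSmooth η) (z : E d × E d) : CcSmooth fun t => η (z - t) := by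
  refine ⟨hη.smooth.comp (by fun_prop), ?_⟩
  exact hη.compact.comp_homeomorph (Homeomorph.subLeft z)

lemma dX_sub_left (hη : CcSmooth η) (v : E d) (z : E d × E d) :
    dX v (fun t => η (z - t)) = fun t => -dX v η (z - t) :=
  funext fun t => fderiv_sub_left hη z t _

lemma dY_sub_left (hη : CcSmooth η) (v : E d) (z : E d × E d) :
    dY v (fun t => η (z - t)) = fun t => -dY v η (z - t) :=
  funext fun t => fderiv_sub_left hη z t _

lemma dY_neg (v : E d) (W : E d × E d → ℝ) : dY v (fun t => -W t) = fun t => -dY v W t := by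
  funext t
  unfold dY
  rw [fderiv_fun_neg]
  rfl

lemma lapY_sub_left (hη : CcSmooth η) (z t : E d × E d) :
    lapY (fun t => η (z - t)) t = lapY η (z - t) := by
  unfold lapY
  refine Finset.sum_congr rfl fun j _ => ?_
  rw [dY_sub_left hη, dY_neg, dY_sub_left (hη.dY _)]
  simp

/-- `V ⋆ η` converges to `V` against bounded continuous functions. -/
lemma abs_integral_moll_sub_le {z₀ : E d × E d} {R τ B : ℝ} (hV : Integrable V volume)
    (sV : ∀ z, z ∉ Metric.closedBall z₀ R → V z = 0) {g : E d × E d → ℝ} (hg : Continuous g)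
    (hB : ∀ z, |g z| ≤ B) (hτ : 0 < τ) :
    ∃ δ₀ > 0, ∀ C δ η, δ < δ₀ → IsMollifier d C δ η →
      |(∫ z, moll η V z * g z) - ∫ z, V z * g z| ≤ τ * ∫ z, |V z| := by
  -- Uniform continuity of `g` is needed on the support of `V` enlarged by the mollification scale,
  -- which is kept below `1`.
  have hK : IsCompact (Metric.closedBall z₀ (R + 1)) := isCompact_closedBall _ _
  have hu := hK.uniformContinuousOn_of_continuous hg.continuousOn
  rw [Metric.uniformContinuousOn_iff_le] at hu
  obtain ⟨δ₁, hδ₁, hu⟩ := hu τ hτ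
  refine ⟨min δ₁ 1, by positivity, fun C δ η hlt hη => ?_⟩
  have iη := hη.cc.continuous.integrable_of_hasCompactSupport hη.cc.compact (μ := volume)
  have hint1 : Integrable (fun q : (E d × E d) × (E d × E d) => V q.2 * η (q.1 - q.2))
      (volume.prod volume) :=
    hV.convolution_integrand (ContinuousLinearMap.mul ℝ ℝ) iη
  have hint2 : Integrable (fun q : (E d × E d) × (E d × E d) => V q.2 * η (q.1 - q.2) * g q.1)
      (volume.prod volume) :=
    hint1.mul_bdd (c := B) (hg.comp continuous_fst).aestronglyMeasurable
      (Filter.Eventually.of_forall fun q => hB q.1)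
  have e1 : ∫ z, moll η V z * g z = ∫ t, V t * ∫ z, η (z - t) * g z := by
    unfold moll
    simp only [← integral_mul_const]
    rw [integral_integral_swap hint2]
    refine integral_congr_ae (Filter.Eventually.of_forall fun t => ?_)
    simp only [← integral_const_mul, mul_assoc]
  have iηg : ∀ t, Integrable (fun z => η (z - t) * g z) volume := fun t =>
    (iη.comp_sub_right t).mul_bdd (c := B) hg.aestronglyMeasurable (Filter.Eventually.of_forall hB)
  have e2 : ∀ t, |V t * (∫ z, η (z - t) * g z) - V t * g t| ≤ τ * |V t| := by
    intro t
    by_cases ht : t ∈ Metric.closedBall z₀ R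
    · have h1 : ∫ z, η (z - t) = 1 := by rw [integral_sub_right_eq_self η t, hη.integral]
      have h2 : (∫ z, η (z - t) * g z) - g t = ∫ z, η (z - t) * (g z - g t) := by
        simp only [mul_sub]
        rw [integral_sub (iηg t) ((iη.comp_sub_right t).mul_const _), integral_mul_const, h1, one_mul]
      rw [← mul_sub, h2, abs_mul, mul_comm]
      refine mul_le_mul_of_nonneg_right ?_ (abs_nonneg _)
      have h3 : ‖∫ z, η (z - t) * (g z - g t)‖ ≤ ∫ z, η (z - t) * τ := by
        refine norm_integral_le_of_norm_le ((iη.comp_sub_right t).mul_const τ)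
          (Filter.Eventually.of_forall fun z => ?_)
        rw [norm_mul, Real.norm_of_nonneg (hη.nonneg _)]
        by_cases hz : δ ≤ ‖z - t‖
        · simp [hη.supp _ hz]
        · push Not at hz
          refine mul_le_mul_of_nonneg_left ?_ (hη.nonneg _)
          rw [← dist_eq_norm]
          rw [← dist_eq_norm] at hz
          rw [Metric.mem_closedBall] at ht
          refine hu z ?_ t ?_ (hz.le.trans (hlt.le.trans (min_le_left _ _)))
          · rw [Metric.mem_closedBall]
            have := hlt.le.trans (min_le_right _ _)
            linarith [dist_triangle z t z₀]
          · rw [Metric.mem_closedBall]; linarith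
      rwa [integral_mul_const, h1, one_mul] at h3
    · simp [sV t ht]
  have i3 : Integrable (fun t => V t * ∫ z, η (z - t) * g z) volume := by
    have := hint2.integral_prod_right
    refine this.congr (Filter.Eventually.of_forall fun t => ?_)
    simp only [← integral_const_mul, mul_assoc]
  have i4 : Integrable (fun t => V t * g t) volume :=
    hV.mul_bdd (c := B) hg.aestronglyMeasurable (Filter.Eventually.of_forall hB)
  rw [e1, ← integral_sub i3 i4, ← integral_const_mul]
  exact norm_integral_le_of_norm_le (hV.abs.const_mul τ)
    (Filter.Eventually.of_forall fun t => (Real.norm_eq_abs _).trans_le (e2 t))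

end Mollifier

/-! ### The local estimate in flat space -/

section Flat
variable {d : ℕ}

/-- A weak solution `V` of `-ε² b Δ_y V + y · ∇ₓ V = F` on `ℝⁿ × ℝⁿ`, supported in a small ball. The
field `H` is the part of `∇_y V` that does not come from a cutoff function. -/
structure FlatSolution (d : ℕ) (ε b₀ β L : ℝ) (z₀ : E d × E d) (R R' : ℝ)
    (b V F J h : E d × E d → ℝ) (H : Fin (d + 1) → E d × E d → ℝ) : Prop where
  lt : R < R'
  b_le : ∀ z ∈ Metric.closedBall z₀ R', |b z| ≤ β
  b_osc : ∀ z ∈ Metric.closedBall z₀ R', 8 * |b z - b₀| ≤ b₀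
  b_lip : ∀ z ∈ Metric.closedBall z₀ R', ∀ t ∈ Metric.closedBall z₀ R', |b z - b t| ≤ L * ‖z - t‖
  memV : MemLp V 2 volume
  memF : MemLp F 2 volume
  memJ : MemLp J 2 volume
  memH : ∀ j, MemLp (H j) 2 volume
  membH : ∀ j, MemLp (fun z => b z * H j z) 2 volume
  meas : Measurable h
  memh : MemLp h 2 volume
  suppV : ∀ z, z ∉ Metric.closedBall z₀ R → V z = 0
  suppH : ∀ j z, z ∉ Metric.closedBall z₀ R → H j z = 0
  leV : ∀ᵐ z, |V z| ≤ h z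
  leF : ∀ᵐ z, |F z| ≤ h z
  leJ : ∀ᵐ z, ε ^ 2 * |J z| ≤ h z
  leH : ∀ j, ∀ᵐ z, ε ^ 2 * |H j z| ≤ h z
  gradient : ∀ N, CcSmooth N →
    ∫ z, V z * lapY N z = -(∫ z, ∑ j, H j z * dY (bas d j) N z) + ∫ z, J z * N z
  equation : ∀ N, CcSmooth N →
    ε ^ 2 * (∫ z, ∑ j, b z * H j z * dY (bas d j) N z) - ∫ z, V z * trans N z = ∫ z, F z * N z

lemma _root_.MeasureTheory.MemLp.locallyIntegrable_two {V : E d × E d → ℝ} (h : MemLp V 2 volume) :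
    LocallyIntegrable V volume := h.locallyIntegrable (by norm_num)

/-- Young's inequality with the normalized ball kernel. The mass of the kernel is the volume of the
unit ball and does not depend on `δ`, so the bound is uniform in the scale. -/
lemma lintegral_ball_average_le {f h : E d × E d → ℝ} {c δ : ℝ} (hc : 0 ≤ c) (hδ : 0 < δ)
    (hm : Measurable h) (hh : MemLp h 2 volume)
    (hf : ∀ z, ‖f z‖ₑ ≤ ∫⁻ t, ENNReal.ofReal c * ‖h t‖ₑ * ballKernel d δ (z - t)) :
    ∫⁻ z, ‖f z‖ₑ ^ 2 ≤ ENNReal.ofReal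
      ((c * (volume (Metric.closedBall (0 : E d × E d) 1)).toReal * l2 h volume) ^ 2) := by
  have e : ∀ z, ∫⁻ t, ENNReal.ofReal c * ‖h t‖ₑ * ballKernel d δ (z - t) =
      ∫⁻ t, ballKernel d δ t * (ENNReal.ofReal c * ‖h (z - t)‖ₑ) := by
    intro z
    have : (volume : Measure (E d × E d)).IsNegInvariant :=
      Measure.IsAddHaarMeasure.isNegInvariant_of_regular _
    rw [← lintegral_sub_left_eq_self
      (fun t => ENNReal.ofReal c * ‖h t‖ₑ * ballKernel d δ (z - t)) z]
    refine lintegral_congr fun t => ?_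
    rw [sub_sub_cancel, mul_comm]
  calc ∫⁻ z, ‖f z‖ₑ ^ 2
      ≤ ∫⁻ z, (∫⁻ t, ballKernel d δ t * (ENNReal.ofReal c * ‖h (z - t)‖ₑ)) ^ 2 :=
        lintegral_mono fun z => pow_le_pow_left₀ zero_le ((hf z).trans_eq (e z)) 2
    _ ≤ (∫⁻ z, ballKernel d δ z) ^ 2 * ∫⁻ z, (ENNReal.ofReal c * ‖h z‖ₑ) ^ 2 :=
        lintegral_young (b := fun z => ENNReal.ofReal c * ‖h z‖ₑ) (measurable_ballKernel δ)
          (hm.enorm.const_mul _)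
    _ = _ := by
        have hv : volume (Metric.closedBall (0 : E d × E d) 1) ≠ ⊤ := measure_closedBall_lt_top.ne
        simp only [mul_pow]
        rw [lintegral_const_mul _ (hm.enorm.pow_const 2), lintegral_enorm_sq hh,
          lintegral_ballKernel hδ, ENNReal.ofReal_mul (by positivity),
          ENNReal.ofReal_mul (by positivity), ENNReal.ofReal_pow hc,
          ENNReal.ofReal_pow ENNReal.toReal_nonneg, ENNReal.ofReal_toReal hv]
        ring

namespace FlatSolution
variable {ε b₀ β L R R' : ℝ} {z₀ : E d × E d} {b V F J h : E d × E d → ℝ}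
  {H : Fin (d + 1) → E d × E d → ℝ} {C δ : ℝ} {η : E d × E d → ℝ}

/-- The mollified function is computed by testing both identities for `V` with `η(z - ·)`. The
coefficients at `z` and at `t` differ, and the two last sums record this difference: they are
Friedrichs commutators, in which all derivatives fall on the kernel and none on the solution. -/
lemma b_mul_lap_add_trans (S : FlatSolution d ε b₀ β L z₀ R R' b V F J h H) (hη : CcSmooth η)
    (z : E d × E d) :
    -(ε ^ 2 * b z) * lapY (moll η V) z + trans (moll η V) z =
      ∫ t, (F t * η (z - t) - ε ^ 2 * b z * (J t * η (z - t)) -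
        ∑ j, ε ^ 2 * (b z - b t) * (H j t * dY (bas d j) η (z - t)) +
        ∑ j, (z.2 j - t.2 j) * (V t * dX (bas d j) η (z - t))) := by
  have lV := S.memV.locallyIntegrable_two
  have iF := integrable_mul_smooth hη S.memF.locallyIntegrable_two z
  have iJ := integrable_mul_smooth hη S.memJ.locallyIntegrable_two z
  have iH := fun j => integrable_mul_smooth (hη.dY (bas d j)) (S.memH j).locallyIntegrable_two z
  have ibH := fun j => integrable_mul_smooth (hη.dY (bas d j)) (S.membH j).locallyIntegrable_two z
  have iV := fun j => integrable_mul_smooth (hη.dX (bas d j)) lV z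
  have iVt : ∀ j, Integrable (fun t => t.2 j * (V t * dX (bas d j) η (z - t))) volume := by
    intro j
    have hc : CcSmooth fun t : E d × E d => (z.2 j - t.2 j) * dX (bas d j) η t :=
      CcSmooth.smooth_mul (by fun_prop) (hη.dX _)
    refine (integrable_mul_smooth hc lV z).congr (Filter.Eventually.of_forall fun t => ?_)
    simp only [Prod.snd_sub, PiLp.sub_apply]
    ring
  have g := S.gradient _ (hη.sub_left z)
  have q := S.equation _ (hη.sub_left z)
  simp only [lapY_sub_left hη, dY_sub_left hη] at g
  simp only [trans, dX_sub_left hη, dY_sub_left hη] at q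
  have e1 : ∫ t, ∑ j, H j t * -dY (bas d j) η (z - t) = -∑ j, ∫ t, H j t * dY (bas d j) η (z - t) := by
    simp only [mul_neg, Finset.sum_neg_distrib, integral_neg]
    rw [integral_finsetSum _ fun j _ => iH j]
  have e2 : ∫ t, ∑ j, b t * H j t * -dY (bas d j) η (z - t) =
      -∑ j, ∫ t, b t * H j t * dY (bas d j) η (z - t) := by
    simp only [mul_neg, Finset.sum_neg_distrib, integral_neg]
    rw [integral_finsetSum _ fun j _ => ibH j]
  have e3 : ∫ t, V t * ∑ j, t.2 j * -dX (bas d j) η (z - t) =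
      -∑ j, ∫ t, t.2 j * (V t * dX (bas d j) η (z - t)) := by
    rw [← integral_finsetSum _ fun j _ => iVt j, ← integral_neg]
    refine integral_congr_ae (Filter.Eventually.of_forall fun t => ?_)
    simp only [mul_neg, Finset.sum_neg_distrib, Finset.mul_sum]
    exact congrArg _ (Finset.sum_congr rfl fun j _ => by ring)
  have e4 : ∫ t, V t * ∑ j, z.2 j * dX (bas d j) η (z - t) =
      ∑ j, z.2 j * ∫ t, V t * dX (bas d j) η (z - t) := by
    simp only [← integral_const_mul]
    rw [← integral_finsetSum _ fun j _ => (iV j).const_mul (z.2 j)]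
    refine integral_congr_ae (Filter.Eventually.of_forall fun t => ?_)
    simp only [Finset.mul_sum]
    exact Finset.sum_congr rfl fun j _ => by ring
  have iA : ∀ j, Integrable (fun t => ε ^ 2 * (b z - b t) * (H j t * dY (bas d j) η (z - t)))
      volume := fun j => (((iH j).const_mul (ε ^ 2 * b z)).sub ((ibH j).const_mul (ε ^ 2))).congr
    (Filter.Eventually.of_forall fun t => by simp only [Pi.sub_apply]; ring)
  have eA : ∀ j, ∫ t, ε ^ 2 * (b z - b t) * (H j t * dY (bas d j) η (z - t)) =
      ε ^ 2 * b z * (∫ t, H j t * dY (bas d j) η (z - t)) -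
        ε ^ 2 * ∫ t, b t * H j t * dY (bas d j) η (z - t) := fun j => by
    rw [← integral_const_mul, ← integral_const_mul,
      ← integral_sub ((iH j).const_mul _) ((ibH j).const_mul _)]
    exact integral_congr_ae (Filter.Eventually.of_forall fun t => by ring)
  have iB : ∀ j, Integrable (fun t => (z.2 j - t.2 j) * (V t * dX (bas d j) η (z - t))) volume :=
    fun j => (((iV j).const_mul (z.2 j)).sub (iVt j)).congr
    (Filter.Eventually.of_forall fun t => by simp only [Pi.sub_apply]; ring)
  have eB : ∀ j, ∫ t, (z.2 j - t.2 j) * (V t * dX (bas d j) η (z - t)) =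
      z.2 j * (∫ t, V t * dX (bas d j) η (z - t)) - ∫ t, t.2 j * (V t * dX (bas d j) η (z - t)) :=
    fun j => by
    rw [← integral_const_mul, ← integral_sub ((iV j).const_mul _) (iVt j)]
    exact integral_congr_ae (Filter.Eventually.of_forall fun t => by ring)
  rw [e1] at g
  rw [e2, e3] at q
  have i1 : Integrable (fun t => F t * η (z - t) - ε ^ 2 * b z * (J t * η (z - t))) volume :=
    iF.sub (iJ.const_mul _)
  have i2 : Integrable (fun t => F t * η (z - t) - ε ^ 2 * b z * (J t * η (z - t)) -
      ∑ j, ε ^ 2 * (b z - b t) * (H j t * dY (bas d j) η (z - t))) volume :=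
    i1.sub (integrable_finsetSum _ fun j _ => iA j)
  have m : lapY (moll η V) z = ∫ t, V t * lapY η (z - t) := by rw [lapY_moll hη lV]; rfl
  rw [m, g, trans_moll hη lV, e4,
    integral_add i2 (integrable_finsetSum _ fun j _ => iB j),
    integral_sub i1 (integrable_finsetSum _ fun j _ => iA j),
    integral_sub iF (iJ.const_mul _), integral_const_mul,
    integral_finsetSum _ fun j _ => iA j, integral_finsetSum _ fun j _ => iB j]
  simp only [eA, eB, Finset.sum_sub_distrib, ← Finset.mul_sum]
  linear_combination q

/-- On the support of the kernel the differences of `b` and of `y` are `O(δ)` and compensate the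
`δ⁻¹` in the derivatives of `η`. All terms are then averages of `h`; the powers of `ε` are already
contained in the bounds by `h`, so the constant is free of `ε` and `δ`. -/
lemma enorm_b_mul_lap_add_trans_le (S : FlatSolution d ε b₀ β L z₀ R R' b V F J h H)
    (hL : 0 ≤ L) (hC : 0 ≤ C) (hδ : 0 < δ) (hη : IsMollifier d C δ η) {z : E d × E d}
    (hz : z ∈ Metric.closedBall z₀ R') :
    ‖-(ε ^ 2 * b z) * lapY (moll η V) z + trans (moll η V) z‖ₑ ≤
      ∫⁻ t, ENNReal.ofReal ((1 + β + (d + 1) * L + (d + 1)) * C) * ‖h t‖ₑ * ballKernel d δ (z - t) := by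
  have hβ : 0 ≤ β := (abs_nonneg _).trans (S.b_le z hz)
  rw [S.b_mul_lap_add_trans hη.cc]
  refine (enorm_integral_le_lintegral_enorm _).trans (lintegral_mono_ae ?_)
  have leH := ae_all_iff.2 S.leH
  filter_upwards [S.leV, S.leF, S.leJ, leH] with t hV hF hJ hH
  have h0 : 0 ≤ h t := (abs_nonneg _).trans hV
  set D := (δ ^ Module.finrank ℝ (E d × E d))⁻¹ with hD
  have hD0 : 0 ≤ D := by positivity
  by_cases hzt : ‖z - t‖ ≤ δ
  · have hk : ballKernel d δ (z - t) = ENNReal.ofReal D :=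
      indicator_of_mem (by simpa using hzt) _
    rw [hk, ← ofReal_norm, ← ofReal_norm, ← ENNReal.ofReal_mul (by positivity),
      ← ENNReal.ofReal_mul (by positivity)]
    refine ENNReal.ofReal_le_ofReal ?_
    rw [Real.norm_of_nonneg h0, Real.norm_eq_abs]
    have hw := hη.bound (z - t)
    have hX := fun j => hη.boundX j (z - t)
    have hY := fun j => hη.boundY j (z - t)
    rw [← hD] at hw
    simp only [← hD] at hX hY
    have b1 : |F t * η (z - t)| ≤ h t * (C * D) := by
      rw [abs_mul]; gcongr
    have b2 : |ε ^ 2 * b z * (J t * η (z - t))| ≤ β * (h t * (C * D)) := by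
      calc |ε ^ 2 * b z * (J t * η (z - t))| = |b z| * ((ε ^ 2 * |J t|) * |η (z - t)|) := by
            rw [abs_mul, abs_mul, abs_mul, abs_of_nonneg (sq_nonneg ε)]; ring
        _ ≤ _ := by
            gcongr
            exact S.b_le z hz
    have b3 : ∀ j, |ε ^ 2 * (b z - b t) * (H j t * dY (bas d j) η (z - t))| ≤
        L * (h t * (C * D)) := by
      intro j
      -- The Lipschitz bound for `b` is available only in the large ball; elsewhere `H` vanishes.
      by_cases ht : t ∈ Metric.closedBall z₀ R
      · have hlip := S.b_lip z hz t (Metric.closedBall_subset_closedBall S.lt.le ht)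
        calc |ε ^ 2 * (b z - b t) * (H j t * dY (bas d j) η (z - t))|
            = |b z - b t| * ((ε ^ 2 * |H j t|) * |dY (bas d j) η (z - t)|) := by
              rw [abs_mul, abs_mul, abs_mul, abs_of_nonneg (sq_nonneg ε)]; ring
          _ ≤ (L * δ) * (h t * |dY (bas d j) η (z - t)|) := by
              gcongr
              · exact hlip.trans (by gcongr)
              · exact hH j
          _ = L * (h t * (δ * |dY (bas d j) η (z - t)|)) := by ring
          _ ≤ _ := mul_le_mul_of_nonneg_left (mul_le_mul_of_nonneg_left (hY j) h0) hL
      · rw [S.suppH j t ht]; simp; positivity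
    have b4 : ∀ j, |(z.2 j - t.2 j) * (V t * dX (bas d j) η (z - t))| ≤ h t * (C * D) := by
      intro j
      have : |z.2 j - t.2 j| ≤ δ := by
        have h1 : ‖(z - t).2 j‖ ≤ ‖(z - t).2‖ := PiLp.norm_apply_le _ j
        have h2 := norm_snd_le (z - t)
        simpa using h1.trans (h2.trans hzt)
      calc |(z.2 j - t.2 j) * (V t * dX (bas d j) η (z - t))|
          = |z.2 j - t.2 j| * (|V t| * |dX (bas d j) η (z - t)|) := by rw [abs_mul, abs_mul]
        _ ≤ δ * (h t * |dX (bas d j) η (z - t)|) := by gcongr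
        _ = h t * (δ * |dX (bas d j) η (z - t)|) := by ring
        _ ≤ _ := mul_le_mul_of_nonneg_left (hX j) h0
    have b3' := (Finset.abs_sum_le_sum_abs _ _).trans
      (Finset.sum_le_sum fun j (_ : j ∈ Finset.univ) => b3 j)
    have b4' := (Finset.abs_sum_le_sum_abs _ _).trans
      (Finset.sum_le_sum fun j (_ : j ∈ Finset.univ) => b4 j)
    simp only [Finset.sum_const, Finset.card_univ, Fintype.card_fin, nsmul_eq_mul] at b3' b4'
    push_cast at b3' b4'
    refine (abs_add_le _ _).trans ?_
    refine (add_le_add ((abs_sub _ _).trans (add_le_add ((abs_sub _ _).trans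
      (add_le_add b1 b2)) b3')) b4').trans (le_of_eq ?_)
    ring
  · push Not at hzt
    simp [hη.supp _ hzt.le, hη.suppX _ _ hzt, hη.suppY _ _ hzt]

lemma moll_cc (S : FlatSolution d ε b₀ β L z₀ R R' b V F J h H) (hη : IsMollifier d C δ η) :
    CcSmooth (moll η V) :=
  FokkerPlanck.moll_cc hη.cc S.memV.locallyIntegrable_two
    (HasCompactSupport.intro (isCompact_closedBall z₀ R) S.suppV)

lemma enorm_moll_le (S : FlatSolution d ε b₀ β L z₀ R R' b V F J h H)
    (hC : 0 ≤ C) (hη : IsMollifier d C δ η) (z : E d × E d) :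
    ‖moll η V z‖ₑ ≤ ∫⁻ t, ENNReal.ofReal C * ‖h t‖ₑ * ballKernel d δ (z - t) := by
  refine (enorm_integral_le_lintegral_enorm _).trans (lintegral_mono_ae ?_)
  filter_upwards [S.leV] with t hV
  have h0 : 0 ≤ h t := (abs_nonneg _).trans hV
  by_cases hzt : ‖z - t‖ ≤ δ
  · have hk : ballKernel d δ (z - t) =
        ENNReal.ofReal (δ ^ Module.finrank ℝ (E d × E d))⁻¹ :=
      indicator_of_mem (by simpa using hzt) _
    rw [hk, ← ofReal_norm, ← ofReal_norm, ← ENNReal.ofReal_mul (by positivity),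
      ← ENNReal.ofReal_mul (by positivity)]
    refine ENNReal.ofReal_le_ofReal ?_
    rw [Real.norm_of_nonneg h0, norm_mul, mul_comm C, mul_assoc]
    exact mul_le_mul hV (hη.bound _) (abs_nonneg _) h0
  · push Not at hzt
    simp [hη.supp _ hzt.le]

lemma moll_eq_zero (S : FlatSolution d ε b₀ β L z₀ R R' b V F J h H) (hη : IsMollifier d C δ η)
    (hlt : δ < R' - R) {z : E d × E d} (hz : z ∉ Metric.closedBall z₀ R') :
    lapY (moll η V) z = 0 ∧ trans (moll η V) z = 0 := by
  have h0 : ∀ w, w ∉ Metric.closedBall z₀ (R + δ) → moll η V w = 0 := by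
    intro w hw
    unfold moll
    rw [integral_eq_zero_of_ae]
    refine Filter.Eventually.of_forall fun t => ?_
    by_cases ht : t ∈ Metric.closedBall z₀ R
    · simp only [Pi.zero_apply]
      rw [hη.supp, mul_zero]
      rw [Metric.mem_closedBall] at hw ht
      rw [← dist_eq_norm]
      linarith [dist_triangle w t z₀]
    · simp [S.suppV t ht]
  have hts : tsupport (moll η V) ⊆ Metric.closedBall z₀ (R + δ) :=
    closure_minimal (fun w hw => by by_contra h; exact hw (h0 w h)) Metric.isClosed_closedBall
  have hd : ∀ (f : E d × E d → ℝ) v, tsupport f ⊆ Metric.closedBall z₀ (R + δ) →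
      tsupport (fun z => fderiv ℝ f z v) ⊆ Metric.closedBall z₀ (R + δ) :=
    fun f v hf => (tsupport_fderiv_apply_subset ℝ v).trans hf
  have hz' : z ∉ Metric.closedBall z₀ (R + δ) := fun h =>
    hz (Metric.closedBall_subset_closedBall (by linarith) h)
  constructor
  · exact Finset.sum_eq_zero fun j _ => image_eq_zero_of_notMem_tsupport
      (fun h => hz' (hd _ _ (hd _ _ hts) h))
  · refine Finset.sum_eq_zero fun j _ => ?_
    have : dX (bas d j) (moll η V) z = 0 :=
      image_eq_zero_of_notMem_tsupport (fun h => hz' (hd _ _ hts h))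
    rw [this, mul_zero]

/-- The constant in the estimates for the mollified solution. -/
def cst (d : ℕ) (β L C : ℝ) : ℝ := (1 + β + (d + 1) * L + (d + 1)) * C *
  (volume (Metric.closedBall (0 : E d × E d) 1)).toReal

/-- Replacing `b` by `b₀` costs at most `κ / 8` times the Laplacian, while the frozen estimate
bounds `κ` times the Laplacian by `4` times the Kolmogorov operator. So half of the squared norm of
the latter is absorbed on the left. The absorption is legitimate since the mollified function is
smooth with compact support and all norms are finite. -/
lemma l2_bounds (S : FlatSolution d ε b₀ β L z₀ R R' b V F J h H) (hε : 0 < ε) (hb₀ : 0 < b₀)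
    (hβ : 0 ≤ β) (hL : 0 ≤ L) (hC : 0 ≤ C) (hδ : 0 < δ) (hlt : δ < R' - R)
    (hη : IsMollifier d C δ η) :
    l2 (moll η V) volume ≤ cst d β L C * l2 h volume ∧
    l2 (kolm (ε ^ 2 * b₀) (moll η V)) volume ≤ 2 * cst d β L C * l2 h volume ∧
    ε ^ 2 * b₀ * l2 (lapY (moll η V)) volume ≤ 8 * cst d β L C * l2 h volume := by
  have cc := S.moll_cc hη
  set κ := ε ^ 2 * b₀ with hκ
  have hκ0 : 0 < κ := by positivity
  set v := (volume (Metric.closedBall (0 : E d × E d) 1)).toReal with hv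
  have hv0 : 0 ≤ v := ENNReal.toReal_nonneg
  have hh0 : 0 ≤ l2 h volume := l2_nonneg _
  have hc0 : 0 ≤ cst d β L C := by unfold cst; positivity
  have hCc : C * v ≤ cst d β L C := by
    unfold cst
    have : C * v ≤ (1 + β + (d + 1) * L + (d + 1)) * (C * v) := by
      refine le_mul_of_one_le_left (by positivity) ?_
      have : 0 ≤ ((d : ℝ) + 1) * L := by positivity
      have : 0 ≤ (d : ℝ) := by positivity
      linarith
    linarith
  have h1 : l2 (moll η V) volume ≤ cst d β L C * l2 h volume := by
    refine (l2_le_of_lintegral (by positivity) cc.continuous.aestronglyMeasurable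
      (lintegral_ball_average_le hC hδ S.meas S.memh (S.enorm_moll_le hC hη))).trans ?_
    gcongr
  set A : E d × E d → ENNReal := fun z => ∫⁻ t, ENNReal.ofReal ((1 + β + (d + 1) * L + (d + 1)) * C) *
    ‖h t‖ₑ * ballKernel d δ (z - t) with hA
  -- Nothing is known about `b` outside the large ball, but there the mollified function vanishes
  -- because `δ < R' - R`.
  set a : E d × E d → ℝ := fun z => indicator (Metric.closedBall z₀ R')
    (fun z => -(ε ^ 2 * b z) * lapY (moll η V) z + trans (moll η V) z) z with ha
  have hA2 : ∫⁻ z, ‖a z‖ₑ ^ 2 ≤ ENNReal.ofReal ((cst d β L C * l2 h volume) ^ 2) := by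
    refine lintegral_ball_average_le (by positivity) hδ S.meas S.memh fun z => ?_
    by_cases hz : z ∈ Metric.closedBall z₀ R'
    · simp only [ha, indicator_of_mem hz]
      exact S.enorm_b_mul_lap_add_trans_le hL hC hδ hη hz
    · simp [ha, indicator_of_notMem hz]
  have hpt : ∀ z, ‖kolm κ (moll η V) z‖ₑ ^ 2 ≤
      ENNReal.ofReal 2 * ‖a z‖ₑ ^ 2 + ENNReal.ofReal (κ ^ 2 / 32) * ‖lapY (moll η V) z‖ₑ ^ 2 := by
    intro z
    have key : |kolm κ (moll η V) z| ≤ |a z| + κ / 8 * |lapY (moll η V) z| := by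
      by_cases hz : z ∈ Metric.closedBall z₀ R'
      · simp only [ha, indicator_of_mem hz]
        have e : kolm κ (moll η V) z = (-(ε ^ 2 * b z) * lapY (moll η V) z + trans (moll η V) z) +
            ε ^ 2 * (b z - b₀) * lapY (moll η V) z := by
          rw [kolm, hκ]; ring
        rw [e]
        refine (abs_add_le _ _).trans (add_le_add le_rfl ?_)
        rw [abs_mul, abs_mul, abs_of_nonneg (sq_nonneg ε)]
        gcongr
        have := S.b_osc z hz
        rw [hκ, mul_div_assoc]
        gcongr
        linarith
      · have h0 := S.moll_eq_zero hη hlt hz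
        rw [kolm, h0.1, h0.2]
        simp
    have key2 : (kolm κ (moll η V) z) ^ 2 ≤ 2 * (a z) ^ 2 + κ ^ 2 / 32 * (lapY (moll η V) z) ^ 2 := by
      rw [← sq_abs (kolm κ (moll η V) z), ← sq_abs (a z), ← sq_abs (lapY (moll η V) z)]
      have := pow_le_pow_left₀ (abs_nonneg _) key 2
      nlinarith [sq_nonneg (|a z| - κ / 8 * |lapY (moll η V) z|)]
    have e : ∀ r : ℝ, ‖r‖ₑ ^ 2 = ENNReal.ofReal (r ^ 2) := fun r => by
      rw [← ofReal_norm, ← ENNReal.ofReal_pow (norm_nonneg _), Real.norm_eq_abs, sq_abs]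
    rw [e, e, e,
      ← ENNReal.ofReal_mul (by norm_num), ← ENNReal.ofReal_mul (by positivity),
      ← ENNReal.ofReal_add (by positivity) (by positivity)]
    exact ENNReal.ofReal_le_ofReal key2
  have mlap : Measurable fun z => ‖lapY (moll η V) z‖ₑ ^ 2 :=
    cc.lapY.continuous.enorm.measurable.pow_const 2
  have hI : ∫⁻ z, ‖kolm κ (moll η V) z‖ₑ ^ 2 ≤ ENNReal.ofReal 2 * (∫⁻ z, ‖a z‖ₑ ^ 2) +
      ENNReal.ofReal (κ ^ 2 / 32) * ∫⁻ z, ‖lapY (moll η V) z‖ₑ ^ 2 := by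
    refine (lintegral_mono hpt).trans (le_of_eq ?_)
    rw [lintegral_add_right _ (mlap.const_mul _), lintegral_const_mul' _ _ ENNReal.ofReal_ne_top,
      lintegral_const_mul' _ _ ENNReal.ofReal_ne_top]
  have hlap := cc.lintegral_lapY_le hκ0
  rw [lintegral_enorm_sq (cc.lapY.memLp volume), lintegral_enorm_sq ((cc.kolm κ).memLp volume),
    show (16 : ENNReal) = ENNReal.ofReal 16 by norm_num, ← ENNReal.ofReal_mul (by positivity),
    ← ENNReal.ofReal_mul (by positivity), ENNReal.ofReal_le_ofReal_iff (by positivity)] at hlap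
  have hI2 := hI.trans (add_le_add (mul_le_mul' le_rfl hA2) le_rfl)
  rw [lintegral_enorm_sq (cc.lapY.memLp volume), lintegral_enorm_sq ((cc.kolm κ).memLp volume),
    ← ENNReal.ofReal_mul (by positivity),
    ← ENNReal.ofReal_mul (by positivity), ← ENNReal.ofReal_add (by positivity) (by positivity),
    ENNReal.ofReal_le_ofReal_iff (by positivity)] at hI2
  -- With `A` the bound for `a`, the two inequalities combine to `‖kolm‖² ≤ 2 A² + ‖kolm‖² / 2`.
  have hK : l2 (kolm κ (moll η V)) volume ≤ 2 * cst d β L C * l2 h volume := by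
    refine le_of_pow_le_pow_left₀ (n := 2) (by norm_num) (by positivity) ?_
    nlinarith
  refine ⟨h1, hK, ?_⟩
  refine le_of_pow_le_pow_left₀ (n := 2) (by norm_num) (by positivity) ?_
  have := pow_le_pow_left₀ (l2_nonneg _) hK 2
  nlinarith

end FlatSolution

end Flat

/-! ### The flat estimate, tested against smooth functions -/

section FlatEstimate
variable {d : ℕ}

lemma CcSmooth.integrable {W : E d × E d → ℝ} (hW : CcSmooth W) : Integrable W volume :=
  hW.continuous.integrable_of_hasCompactSupport hW.compact

lemma CcSmooth.integral_mul_fderiv {W Ψ : E d × E d → ℝ} (hW : CcSmooth W) (hΨ : ContDiff ℝ ∞ Ψ)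
    (v : E d × E d) : ∫ z, W z * fderiv ℝ Ψ z v = -∫ z, fderiv ℝ W z v * Ψ z :=
  integral_mul_fderiv_eq_neg_fderiv_mul_of_integrable
    ((hW.fderiv_apply v).mul_smooth hΨ).integrable
    (hW.mul_smooth (hΨ.fderiv_right (m := ∞) (by simp) |>.clm_apply contDiff_const)).integrable
    (hW.mul_smooth hΨ).integrable
    (fun _ _ => hW.differentiable _) (fun _ _ => hΨ.differentiable (by simp) _)

lemma CcSmooth.integral_mul_lapY {W Ψ : E d × E d → ℝ} (hW : CcSmooth W) (hΨ : CcSmooth Ψ) :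
    ∫ z, W z * FokkerPlanck.lapY Ψ z = ∫ z, FokkerPlanck.lapY W z * Ψ z := by
  unfold FokkerPlanck.lapY
  simp only [Finset.mul_sum, Finset.sum_mul]
  rw [integral_finsetSum _ fun j _ => (hW.mul_smooth ((hΨ.dY _).dY _).smooth).integrable,
    integral_finsetSum _ fun j _ => (((hW.dY _).dY _).mul_smooth hΨ.smooth).integrable]
  refine Finset.sum_congr rfl fun j _ => ?_
  have e1 := hW.integral_mul_fderiv (hΨ.dY (bas d j)).smooth (0, bas d j)
  have e2 := (hW.dY (bas d j)).integral_mul_fderiv hΨ.smooth (0, bas d j)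
  change ∫ z, W z * fderiv ℝ (FokkerPlanck.dY (bas d j) Ψ) z (0, bas d j) = _
  rw [e1]
  change -∫ z, FokkerPlanck.dY (bas d j) W z * fderiv ℝ Ψ z (0, bas d j) = _
  rw [e2, neg_neg]
  rfl

/-- The coefficient `y` does not depend on `x`, so the transport operator is exactly skew. -/
lemma CcSmooth.integral_mul_trans {W Ψ : E d × E d → ℝ} (hW : CcSmooth W) (hΨ : CcSmooth Ψ) :
    ∫ z, W z * FokkerPlanck.trans Ψ z = -∫ z, FokkerPlanck.trans W z * Ψ z := by
  have hy : ∀ j, CcSmooth fun z : E d × E d => z.2 j * W z := fun j =>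
    CcSmooth.smooth_mul (by fun_prop) hW
  unfold FokkerPlanck.trans
  simp only [Finset.mul_sum, Finset.sum_mul]
  have hi : ∀ j, Integrable (fun z => W z * (z.2 j * FokkerPlanck.dX (bas d j) Ψ z)) volume :=
    fun j => ((hy j).mul_smooth (hΨ.dX (bas d j)).smooth).integrable.congr
      (Filter.Eventually.of_forall fun z => by ring)
  have hi' : ∀ j, Integrable (fun z => z.2 j * FokkerPlanck.dX (bas d j) W z * Ψ z) volume :=
    fun j => ((CcSmooth.smooth_mul (f := fun z : E d × E d => z.2 j) (by fun_prop)
      (hW.dX (bas d j))).mul_smooth hΨ.smooth).integrable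
  rw [integral_finsetSum _ fun j _ => hi j, integral_finsetSum _ fun j _ => hi' j,
    ← Finset.sum_neg_distrib]
  refine Finset.sum_congr rfl fun j _ => ?_
  have e := (hy j).integral_mul_fderiv hΨ.smooth (bas d j, 0)
  have ed : ∀ z, fderiv ℝ (fun z : E d × E d => z.2 j * W z) z (bas d j, 0) =
      z.2 j * FokkerPlanck.dX (bas d j) W z := by
    intro z
    have h1 : HasFDerivAt (fun z : E d × E d => z.2 j)
      ((EuclideanSpace.proj j : E d →L[ℝ] ℝ).comp (ContinuousLinearMap.snd ℝ (E d) (E d))) z :=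
      ((EuclideanSpace.proj j : E d →L[ℝ] ℝ).comp
        (ContinuousLinearMap.snd ℝ (E d) (E d))).hasFDerivAt
    have h2 : HasFDerivAt (fun z : E d × E d => z.2 j * W z) _ z :=
      h1.mul (hW.differentiable z).hasFDerivAt
    rw [h2.fderiv]
    simp [FokkerPlanck.dX]
  simp only [ed] at e
  rw [← e]
  exact integral_congr_ae (Filter.Eventually.of_forall fun z => by simp only [FokkerPlanck.dX]; ring)

lemma abs_integral_mul_le {W Ψ : E d × E d → ℝ} (hW : MemLp W 2 volume) (hΨ : MemLp Ψ 2 volume) :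
    |∫ z, W z * Ψ z| ≤ l2 W volume * l2 Ψ volume := by
  have := abs_integral_inner_le hΨ hW
  simpa [mul_comm] using this

namespace FlatSolution
variable {ε b₀ β L R R' : ℝ} {z₀ : E d × E d} {b V F J h : E d × E d → ℝ}
  {H : Fin (d + 1) → E d × E d → ℝ} {C : ℝ}

/-- A bound for the pairing of every mollified function with `g` passes to the limit. This is how
estimates for smooth functions reach the rough `V` without giving meaning to its derivatives. -/
lemma abs_integral_mul_le_of_moll (S : FlatSolution d ε b₀ β L z₀ R R' b V F J h H)
    {g : E d × E d → ℝ} (hg : Continuous g) {B A : ℝ} (hB : ∀ z, |g z| ≤ B)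
    (hC : ∀ δ > 0, ∃ η, IsMollifier d C δ η)
    (hA : ∀ δ η, 0 < δ → δ < R' - R → IsMollifier d C δ η → |∫ z, moll η V z * g z| ≤ A) :
    |∫ z, V z * g z| ≤ A := by
  have hVi : Integrable V volume := by
    have : Fact (volume (Metric.closedBall z₀ R) < ⊤) := ⟨measure_closedBall_lt_top⟩
    have : IntegrableOn V (Metric.closedBall z₀ R) volume :=
      (S.memV.restrict _).integrable (by norm_num)
    exact this.integrable_of_forall_notMem_eq_zero S.suppV
  have h0 : 0 ≤ ∫ z, |V z| := integral_nonneg fun z => abs_nonneg _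
  refine le_of_forall_pos_le_add fun τ hτ => ?_
  -- The denominator `1 + ‖V‖₁` makes the error at most `τ` and avoids a case distinction for `V =
  -- 0`.
  obtain ⟨δ₀, hδ₀, h⟩ := abs_integral_moll_sub_le hVi S.suppV hg hB
    (τ := τ / (1 + ∫ z, |V z|)) (by positivity)
  have hlt := sub_pos.2 S.lt
  obtain ⟨η, hη⟩ := hC (min δ₀ (R' - R) / 2) (by positivity)
  have hm : 0 < min δ₀ (R' - R) := by positivity
  have h1 := h C _ η (by linarith [min_le_left δ₀ (R' - R)]) hη
  have h2 := hA _ η (by positivity) (by linarith [min_le_right δ₀ (R' - R)]) hη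
  have h3 : τ / (1 + ∫ z, |V z|) * ∫ z, |V z| ≤ τ := by
    rw [div_mul_eq_mul_div, div_le_iff₀ (by positivity)]
    nlinarith
  have h4 := abs_sub_abs_le_abs_sub (∫ z, V z * g z) (∫ z, moll η V z * g z)
  rw [abs_sub_comm] at h4
  linarith

lemma _root_.FokkerPlanck.lintegral_le_of_l2_le {f : E d × E d → ℝ} {A : ℝ} (hf : CcSmooth f) (h : l2 f volume ≤ A) :
    ∫⁻ z, ‖f z‖ₑ ^ 2 ≤ ENNReal.ofReal (A ^ 2) := by
  rw [lintegral_enorm_sq (hf.memLp volume)]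
  exact ENNReal.ofReal_le_ofReal (pow_le_pow_left₀ (l2_nonneg _) h 2)

end FlatSolution

/-- The subelliptic estimate for solutions with small support in flat space. -/
theorem exists_flat_estimate (d : ℕ) {β₀ β L ε₀ : ℝ} (hβ₀ : 0 < β₀) (hβ : 0 ≤ β) (hL : 0 ≤ L) :
    ∃ C : ℝ, 0 ≤ C ∧ ∀ (ε b₀ : ℝ) (z₀ : E d × E d) (R R' : ℝ) (b V F J h : E d × E d → ℝ)
      (H : Fin (d + 1) → E d × E d → ℝ), 0 < ε → ε ≤ ε₀ → β₀ ≤ b₀ → b₀ ≤ β →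
      FlatSolution d ε b₀ β L z₀ R R' b V F J h H → ∀ Ψ, CcSmooth Ψ →
      ε ^ 2 * |∫ z, V z * lapY Ψ z| ≤ C * l2 h volume * l2 Ψ volume ∧
      |∫ z, V z * trans Ψ z| ≤ C * l2 h volume * l2 Ψ volume ∧
      ε ^ (2 / 3 : ℝ) * |∫ z, V z * bes Ψ z| ≤ C * l2 h volume * l2 Ψ volume := by
  obtain ⟨C, hC, hm⟩ := exists_isMollifier d
  set c := FlatSolution.cst d β L C with hc
  -- Here `192 = 48 · 2²`, with `48` from the frequency bound and `2` from the bound for the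
  -- Kolmogorov operator. Since `κ = ε² b₀`, multiplication by `ε^(4/3)` cancels `ε` in `κ^(-2/3)`,
  -- and only `ε₀` and `β₀` remain.
  set s := Real.sqrt (ε₀ ^ (4 / 3 : ℝ) + 192 * β₀ ^ (-(2 / 3) : ℝ)) with hs
  have hc0 : 0 ≤ c := by rw [hc]; unfold FlatSolution.cst; positivity
  -- One entry for each estimate. The middle one is `2 c + 8 c`, because `y · ∇ₓ` is the Kolmogorov
  -- operator plus `κ Δ_y`.
  refine ⟨max (max (8 * c / β₀) (10 * c)) (c * s),
    le_max_of_le_left (le_max_of_le_right (by positivity)), ?_⟩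
  intro ε b₀ z₀ R R' b V F J h H hε hεε hb hbβ S Ψ hΨ
  have hb₀ : 0 < b₀ := hβ₀.trans_le hb
  have hl := l2_nonneg (μ := (volume : Measure (E d × E d))) h
  have hp := l2_nonneg (μ := (volume : Measure (E d × E d))) Ψ
  have mono : ∀ {a x : ℝ}, a ≤ max (max (8 * c / β₀) (10 * c)) (c * s) →
      x ≤ a * l2 h volume * l2 Ψ volume →
      x ≤ max (max (8 * c / β₀) (10 * c)) (c * s) * l2 h volume * l2 Ψ volume := fun ha hx =>
    hx.trans (by gcongr)
  have hκ : 0 < ε ^ 2 * b₀ := by positivity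
  have bd := fun δ η h1 h2 (h3 : IsMollifier d C δ η) =>
    S.l2_bounds hε hb₀ hβ hL hC h1 h2 h3
  rw [← hc] at bd
  refine ⟨mono (le_max_of_le_left (le_max_left _ _)) ?_,
    mono (le_max_of_le_left (le_max_right _ _)) ?_, mono (le_max_right _ _) ?_⟩
  · obtain ⟨B, -, hB⟩ := hΨ.lapY.exists_bound
    have key := S.abs_integral_mul_le_of_moll hΨ.lapY.continuous hB hm
      (A := 8 * c / (ε ^ 2 * b₀) * l2 h volume * l2 Ψ volume) fun δ η h1 h2 hη => by
        have cc := S.moll_cc hη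
        rw [cc.integral_mul_lapY hΨ]
        refine (abs_integral_mul_le (cc.lapY.memLp volume) (hΨ.memLp volume)).trans ?_
        gcongr
        rw [div_mul_eq_mul_div, le_div_iff₀ hκ, mul_comm]
        exact (bd δ η h1 h2 hη).2.2
    calc ε ^ 2 * |∫ z, V z * lapY Ψ z| ≤
        ε ^ 2 * (8 * c / (ε ^ 2 * b₀) * l2 h volume * l2 Ψ volume) := by gcongr
      _ = 8 * c / b₀ * l2 h volume * l2 Ψ volume := by field_simp
      _ ≤ _ := by gcongr
  · obtain ⟨B, -, hB⟩ := hΨ.trans.exists_bound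
    refine S.abs_integral_mul_le_of_moll hΨ.trans.continuous hB hm fun δ η h1 h2 hη => ?_
    have cc := S.moll_cc hη
    rw [cc.integral_mul_trans hΨ, abs_neg]
    refine (abs_integral_mul_le (cc.trans.memLp volume) (hΨ.memLp volume)).trans ?_
    gcongr
    have e : trans (moll η V) = fun z => kolm (ε ^ 2 * b₀) (moll η V) z +
        (ε ^ 2 * b₀) * lapY (moll η V) z := by
      funext z; rw [kolm]; ring
    rw [e]
    refine (l2_add_le ((cc.kolm _).memLp volume) ((cc.lapY.const_mul _).memLp volume)).trans ?_
    have e2 := l2_const_mul (μ := (volume : Measure (E d × E d))) (ε ^ 2 * b₀) (lapY (moll η V))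
    simp only [smul_eq_mul] at e2
    rw [e2, abs_of_pos hκ]
    have := bd δ η h1 h2 hη
    linarith [this.2.1, this.2.2]
  · obtain ⟨B, hB⟩ := hΨ.exists_bound_bes
    set X := 1 + 192 * (ε ^ 2 * b₀) ^ (-(2 / 3) : ℝ) with hX
    have key := S.abs_integral_mul_le_of_moll hΨ.continuous_bes hB hm
      (A := c * l2 h volume * Real.sqrt X * l2 Ψ volume) fun δ η h1 h2 hη => by
        have cc := S.moll_cc hη
        refine abs_integral_mul_bes_le cc hΨ (by positivity)
          ((cc.lintegral_sym_le hκ).trans ?_)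
        have b1 := bd δ η h1 h2 hη
        refine (add_le_add (lintegral_le_of_l2_le cc b1.1)
          (mul_le_mul' le_rfl (lintegral_le_of_l2_le (cc.kolm _) b1.2.1))).trans ?_
        rw [← ENNReal.ofReal_mul (by positivity), ← ENNReal.ofReal_add (by positivity) (by positivity)]
        refine ENNReal.ofReal_le_ofReal (le_of_eq ?_)
        rw [mul_pow (c * l2 h volume), Real.sq_sqrt (by positivity), hX]
        ring
    have hs' : ε ^ (2 / 3 : ℝ) * Real.sqrt X ≤ s := by
      have e1 : (ε ^ (2 / 3 : ℝ)) ^ 2 = ε ^ (4 / 3 : ℝ) := by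
        rw [← Real.rpow_natCast, ← Real.rpow_mul hε.le]; norm_num
      have e2 : (ε ^ 2 * b₀) ^ (-(2 / 3) : ℝ) = ε ^ (-(4 / 3) : ℝ) * b₀ ^ (-(2 / 3) : ℝ) := by
        rw [Real.mul_rpow (by positivity) hb₀.le, ← Real.rpow_natCast, ← Real.rpow_mul hε.le]
        norm_num
      have e3 : ε ^ (4 / 3 : ℝ) * ε ^ (-(4 / 3) : ℝ) = 1 := by
        rw [← Real.rpow_add hε]; norm_num
      refine Real.le_sqrt_of_sq_le ?_
      rw [mul_pow, e1, Real.sq_sqrt (by positivity), hX, e2]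
      calc ε ^ (4 / 3 : ℝ) * (1 + 192 * (ε ^ (-(4 / 3) : ℝ) * b₀ ^ (-(2 / 3) : ℝ)))
          = ε ^ (4 / 3 : ℝ) + 192 * b₀ ^ (-(2 / 3) : ℝ) := by
            linear_combination (192 * b₀ ^ (-(2 / 3) : ℝ)) * e3
        _ ≤ _ := by
            have : b₀ ^ (-(2 / 3) : ℝ) ≤ β₀ ^ (-(2 / 3) : ℝ) :=
              Real.rpow_le_rpow_of_nonpos hβ₀ hb (by norm_num)
            gcongr
    calc ε ^ (2 / 3 : ℝ) * |∫ z, V z * bes Ψ z|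
        ≤ ε ^ (2 / 3 : ℝ) * (c * l2 h volume * Real.sqrt X * l2 Ψ volume) := by gcongr
      _ = c * (ε ^ (2 / 3 : ℝ) * Real.sqrt X) * l2 h volume * l2 Ψ volume := by ring
      _ ≤ _ := by gcongr

end FlatEstimate

/-! ### Polar coordinates -/

section Polar
variable {d : ℕ}

instance : IsFiniteMeasure ((volume : Measure (E d)).toSphere : Measure (S d)) := inferInstance

instance : SigmaFinite (dxdθ d) := by
  unfold dxdθ
  exact Measure.prod.instSigmaFinite

open Classical in
/-- The direction `y / |y|`. -/
def dir (y : E d) : S d :=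
  ⟨if y = 0 then bas d 0 else ‖y‖⁻¹ • y, by
    split_ifs with h
    · simp [bas]
    · simp [norm_smul, h]⟩

lemma dir_coe {y : E d} (hy : y ≠ 0) : (dir y : E d) = ‖y‖⁻¹ • y := if_neg hy

lemma measurable_dir : Measurable (dir : E d → S d) := by
  refine Measurable.subtype_mk ?_
  classical
  exact Measurable.ite (measurableSet_singleton 0) measurable_const (by fun_prop)

lemma dir_smul {r : ℝ} (hr : 0 < r) (θ : S d) : dir (r • (θ : E d)) = θ := by
  have h1 : ‖(θ : E d)‖ = 1 := by simp
  have h0 : (θ : E d) ≠ 0 := by rw [← norm_ne_zero_iff, h1]; norm_num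
  refine Subtype.ext ?_
  rw [dir_coe (smul_ne_zero hr.ne' h0), norm_smul, h1, Real.norm_of_nonneg hr.le, smul_smul]
  simp [hr.ne']

/-- The projection of `(x, y)` to `ℝⁿ × 𝕊ⁿ⁻¹`. -/
def lift (z : E d × E d) : E d × S d := (z.1, dir z.2)

lemma measurable_lift : Measurable (lift : E d × E d → E d × S d) :=
  measurable_fst.prodMk (measurable_dir.comp measurable_snd)

/-- The measure `r^d dr` on the half-line. -/
abbrev rad (d : ℕ) : Measure (Ioi (0 : ℝ)) := Measure.volumeIoiPow d

/-- Polar coordinates in the second variable. -/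
def pol (q : (E d × S d) × Ioi (0 : ℝ)) : E d × E d := (q.1.1, (q.2 : ℝ) • (q.1.2 : E d))

lemma lift_pol (q : (E d × S d) × Ioi (0 : ℝ)) : lift (pol q) = q.1 :=
  Prod.ext rfl (dir_smul q.2.2 _)

lemma norm_pol (q : (E d × S d) × Ioi (0 : ℝ)) : ‖(pol q).2‖ = q.2 := by
  have h1 : ‖(q.1.2 : E d)‖ = 1 := by simp
  rw [pol, norm_smul, h1, mul_one, Real.norm_of_nonneg q.2.2.le]

/-- Polar coordinates in `ℝ^(d+1)`, with radial density `r^d`. The origin is a null set, so the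
passage from its complement to the whole space is free. -/
lemma measurePreserving_smul :
    MeasurePreserving (fun q : S d × Ioi (0 : ℝ) => (q.2 : ℝ) • (q.1 : E d))
      ((volume : Measure (E d)).toSphere.prod (rad d)) volume := by
  have h := (volume : Measure (E d)).measurePreserving_homeomorphUnitSphereProd
  have hd : Module.finrank ℝ (E d) - 1 = d := by simp
  rw [hd] at h
  have h1 := (h.symm (homeomorphUnitSphereProd (E d)).toMeasurableEquiv)
  have h2 : MeasurePreserving (Subtype.val : ({0}ᶜ : Set (E d)) → E d)
      ((volume : Measure (E d)).comap (↑)) volume := by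
    have := measurePreserving_subtype_coe (μa := (volume : Measure (E d)))
      (s := ({0}ᶜ : Set (E d))) (measurableSet_singleton _).compl
    rwa [restrict_compl_singleton] at this
  exact h2.comp h1

lemma measurePreserving_pol : MeasurePreserving (pol (d := d)) ((dxdθ d).prod (rad d)) volume := by
  have h1 := (MeasurePreserving.id (volume : Measure (E d))).prod (measurePreserving_smul (d := d))
  have h2 : MeasurePreserving (MeasurableEquiv.prodAssoc (α := E d) (β := S d) (γ := Ioi (0:ℝ)))
      ((dxdθ d).prod (rad d))
      ((volume : Measure (E d)).prod ((volume : Measure (E d)).toSphere.prod (rad d))) :=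
    measurePreserving_prodAssoc _ _ _
  exact h1.comp h2

lemma lintegral_polar_mul {H : E d × E d → ENNReal} (hH : Measurable H) {k : Ioi (0 : ℝ) → ENNReal}
    {W : E d × S d → ENNReal} (hk : Measurable k) (h : ∀ q, H (pol q) = W q.1 * k q.2)
    (hW : Measurable W) :
    ∫⁻ z, H z = (∫⁻ p, W p ∂dxdθ d) * ∫⁻ r, k r ∂rad d := by
  rw [← measurePreserving_pol.lintegral_comp hH, ← lintegral_prod_mul hW.aemeasurable hk.aemeasurable]
  exact lintegral_congr h

/-- In polar coordinates the lift is the projection that forgets the radius. Null sets therefore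
pull back to null sets, and functions defined almost everywhere on the sphere can be lifted. -/
lemma quasiMeasurePreserving_lift :
    Measure.QuasiMeasurePreserving (lift : E d × E d → E d × S d) volume (dxdθ d) := by
  refine ⟨measurable_lift, ?_⟩
  rw [← measurePreserving_pol.map_eq, Measure.map_map measurable_lift measurePreserving_pol.measurable]
  have : lift ∘ pol = (Prod.fst : (E d × S d) × Ioi (0 : ℝ) → E d × S d) := funext lift_pol
  rw [this]
  exact Measure.quasiMeasurePreserving_fst.absolutelyContinuous

lemma integral_polar {H : E d × E d → ℝ} (hH : Integrable H volume) :
    ∫ z, H z = ∫ r, ∫ p, H (pol (p, r)) ∂dxdθ d ∂rad d := by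
  have h1 : Integrable (H ∘ pol) ((dxdθ d).prod (rad d)) :=
    measurePreserving_pol.integrable_comp_of_integrable hH
  rw [← measurePreserving_pol.map_eq, integral_map measurePreserving_pol.aemeasurable
    (by rw [measurePreserving_pol.map_eq]; exact hH.1)]
  exact integral_prod_symm _ h1

lemma integral_polar' {H : E d × E d → ℝ} (hH : Integrable H volume) :
    ∫ z, H z = ∫ p, ∫ r, H (pol (p, r)) ∂rad d ∂dxdθ d := by
  have h1 : Integrable (H ∘ pol) ((dxdθ d).prod (rad d)) :=
    measurePreserving_pol.integrable_comp_of_integrable hH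
  rw [← measurePreserving_pol.map_eq, integral_map measurePreserving_pol.aemeasurable
    (by rw [measurePreserving_pol.map_eq]; exact hH.1)]
  exact integral_prod _ h1

/-- If `H` is a product in polar coordinates, so is its integral. -/
lemma integral_polar_mul_ae {H : E d × E d → ℝ} (hH : AEStronglyMeasurable H volume)
    {k : Ioi (0 : ℝ) → ℝ} {W : E d × S d → ℝ}
    (h : ∀ᵐ q ∂(dxdθ d).prod (rad d), H (pol q) = W q.1 * k q.2) :
    ∫ z, H z = (∫ p, W p ∂dxdθ d) * ∫ r, k r ∂rad d := by
  rw [← measurePreserving_pol.map_eq, integral_map measurePreserving_pol.aemeasurable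
    (by rw [measurePreserving_pol.map_eq]; exact hH), ← integral_prod_mul]
  exact integral_congr_ae h

lemma integral_polar_mul {H : E d × E d → ℝ} (hH : AEStronglyMeasurable H volume) {k : Ioi (0 : ℝ) → ℝ}
    {W : E d × S d → ℝ} (h : ∀ q, H (pol q) = W q.1 * k q.2) :
    ∫ z, H z = (∫ p, W p ∂dxdθ d) * ∫ r, k r ∂rad d :=
  integral_polar_mul_ae hH (Filter.Eventually.of_forall h)

lemma rad_apply_le (a : ℝ) (ha : 0 < a) : rad d {r | (r : ℝ) ≤ a} ≠ ⊤ := by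
  have : rad d (Iio ⟨a + 1, by simp; linarith⟩) ≠ ⊤ := by
    rw [Measure.volumeIoiPow_apply_Iio]; exact ENNReal.ofReal_ne_top
  refine ne_top_of_le_ne_top this (measure_mono fun r hr => ?_)
  have hr : (r : ℝ) ≤ a := hr
  refine mem_Iio.2 (Subtype.coe_lt_coe.1 ?_)
  exact lt_of_le_of_lt hr (lt_add_one a)

lemma integral_rad (f : ℝ → ℝ) : ∫ r, f (r : ℝ) ∂rad d = ∫ r in Ioi (0 : ℝ), r ^ d * f r := by
  simp only [rad, Measure.volumeIoiPow, ENNReal.ofReal]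
  rw [integral_withDensity_eq_integral_smul
    (measurable_subtype_coe.pow_const _).real_toNNReal,
    integral_subtype_comap measurableSet_Ioi fun a ↦ Real.toNNReal (a ^ d) • f a,
    setIntegral_congr_fun measurableSet_Ioi fun x hx ↦ ?_]
  rw [NNReal.smul_def, Real.coe_toNNReal _ (pow_nonneg hx.out.le _), smul_eq_mul]

/-- Integration by parts on the half-line with weight `r^d`. -/
lemma integral_rad_deriv {φ : ℝ → ℝ} (hφ : ContDiff ℝ 1 φ) (hc : HasCompactSupport φ)
    (h0 : φ 0 = 0) :
    ∫ r, (deriv φ (r : ℝ) + d * (r : ℝ)⁻¹ * φ r) ∂rad d = 0 := by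
  rw [integral_rad (fun r => deriv φ r + d * r⁻¹ * φ r)]
  have e : ∫ r in Ioi (0 : ℝ), r ^ d * (deriv φ r + d * r⁻¹ * φ r) =
      ∫ r in Ioi (0 : ℝ), deriv (fun r => r ^ d * φ r) r := by
    refine setIntegral_congr_fun measurableSet_Ioi fun r hr => ?_
    have hr : (0 : ℝ) < r := hr
    have h1 : HasDerivAt (fun r : ℝ => r ^ d * φ r) (d * r ^ (d - 1) * φ r + r ^ d * deriv φ r) r :=
      (hasDerivAt_pow d r).mul (hφ.differentiable (by simp) r).hasDerivAt
    rw [h1.deriv]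
    clear hφ hc h0 h1
    rcases d with _ | d
    · simp
    · simp only [Nat.add_sub_cancel]
      field_simp
      push_cast
      ring
  have hc2 : ContDiff ℝ 1 fun r : ℝ => r ^ d * φ r := (contDiff_id.pow d).mul hφ
  have hc3 : HasCompactSupport fun r : ℝ => r ^ d * φ r := hc.mul_left
  rw [e, HasCompactSupport.integral_Ioi_deriv_eq hc2 hc3, h0]
  simp

end Polar

/-! ### Calculus on the sphere -/

section SphereCalculus
variable {d : ℕ}

lemma norm_sphere (θ : S d) : ‖(θ : E d)‖ = 1 := by simp

lemma inner_sphere (θ : S d) : ⟪(θ : E d), (θ : E d)⟫ = (1 : ℝ) := by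
  rw [real_inner_self_eq_norm_sq, norm_sphere]; norm_num

lemma inner_bas (w : E d) (j : Fin (d + 1)) : ⟪w, bas d j⟫ = w j := by
  simp [bas, EuclideanSpace.inner_single_right]

lemma sum_bas (v : E d) : v = ∑ j, v j • bas d j := by
  have := (EuclideanSpace.basisFun (Fin (d + 1)) ℝ).sum_repr v
  simpa [bas] using this.symm

/-- The orthogonal projection to the tangent space of the sphere at `θ`. -/
def tanProj (θ : E d) : E d →L[ℝ] E d :=
  ContinuousLinearMap.id ℝ (E d) - (innerSL ℝ θ).smulRight θ

lemma tanProj_apply (θ v : E d) : tanProj θ v = v - ⟪θ, v⟫ • θ := rfl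

lemma hasFDerivAt_normalize (θ : S d) :
    HasFDerivAt (fun y : E d => ‖y‖⁻¹ • y) (tanProj (θ : E d)) (θ : E d) := by
  have h0 : (θ : E d) ≠ 0 := by rw [← norm_ne_zero_iff, norm_sphere]; norm_num
  have h1 : HasFDerivAt (fun y : E d => ‖y‖) (innerSL ℝ (θ : E d)) (θ : E d) := by
    have h2 := (hasStrictFDerivAt_norm_sq (θ : E d)).hasFDerivAt
    have h3 := h2.sqrt (by simp)
    have e : (fun y : E d => Real.sqrt (‖y‖ ^ 2)) = fun y => ‖y‖ := by
      funext y; exact Real.sqrt_sq (norm_nonneg y)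
    rw [e] at h3
    refine h3.congr_fderiv ?_
    ext v
    simp
  have h2 := (hasDerivAt_inv (x := ‖(θ : E d)‖) (by simp)).comp_hasFDerivAt (θ : E d) h1
  have h3 := h2.smul (hasFDerivAt_id (𝕜 := ℝ) (θ : E d))
  refine h3.congr_fderiv ?_
  ext1 v
  simp [tanProj_apply, sub_eq_add_neg]

lemma fderiv_comp_normalize {F : Type*} [NormedAddCommGroup F] [NormedSpace ℝ F] {φ : E d → F}
    {θ : S d} (hφ : DifferentiableAt ℝ φ θ) :
    fderiv ℝ (fun y : E d => φ (‖y‖⁻¹ • y)) θ = (fderiv ℝ φ θ).comp (tanProj (θ : E d)) := by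
  have e : ‖(θ : E d)‖⁻¹ • (θ : E d) = θ := by simp
  have h : HasFDerivAt φ (fderiv ℝ φ θ) (‖(θ : E d)‖⁻¹ • (θ : E d)) := by
    rw [e]; exact hφ.hasFDerivAt
  exact (HasFDerivAt.comp (f := fun y : E d => ‖y‖⁻¹ • y) (θ : E d) h
    (hasFDerivAt_normalize θ)).fderiv

lemma hasFDerivAt_slice {F : Type*} [NormedAddCommGroup F] [NormedSpace ℝ F]
    {Φ : E d × E d → F} (hΦ : Differentiable ℝ Φ) (x y : E d) :
    HasFDerivAt (fun y => Φ (x, y))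
      ((fderiv ℝ Φ (x, y)).comp (ContinuousLinearMap.inr ℝ (E d) (E d))) y :=
  (hΦ (x, y)).hasFDerivAt.comp y (hasFDerivAt_prodMk_right x y)

variable {Φ : E d × E d → ℝ}

lemma dY_eq_sum (v : E d) (z : E d × E d) : dY v Φ z = ∑ j, v j * dY (bas d j) Φ z := by
  unfold dY
  have : ((0 : E d), v) = ∑ j, v j • ((0 : E d), bas d j) := by
    refine Prod.ext ?_ ?_
    · simp [Prod.fst_sum]
    · simp only [Prod.snd_sum, Prod.smul_snd]; exact sum_bas v
  rw [this, map_sum]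
  simp only [map_smul, smul_eq_mul]

lemma dX_eq_sum (v : E d) (z : E d × E d) : dX v Φ z = ∑ j, v j * dX (bas d j) Φ z := by
  unfold dX
  have : (v, (0 : E d)) = ∑ j, v j • (bas d j, (0 : E d)) := by
    refine Prod.ext ?_ ?_
    · simp only [Prod.fst_sum, Prod.smul_fst]; exact sum_bas v
    · simp [Prod.snd_sum]
  rw [this, map_sum]
  simp only [map_smul, smul_eq_mul]

lemma transport_eq (hΦ : Differentiable ℝ Φ) (x θ : E d) : transport d Φ x θ = trans Φ (x, θ) := by
  have h : HasFDerivAt (fun z => Φ (z, θ))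
      ((fderiv ℝ Φ (x, θ)).comp (ContinuousLinearMap.inl ℝ (E d) (E d))) x :=
    (hΦ (x, θ)).hasFDerivAt.comp x (hasFDerivAt_prodMk_left x θ)
  rw [transport, h.fderiv, trans, ← dX_eq_sum]
  rfl

/-- Differentiating the homogeneous extension projects a direction to the tangent space, and a
tangent vector is its own projection. So against tangential fields the angular gradient may be
replaced by the flat one. -/
lemma inner_angGrad (hΦ : Differentiable ℝ Φ) (x : E d) (θ : S d) {w : E d}
    (hw : ⟪w, (θ : E d)⟫ = (0 : ℝ)) :
    ⟪w, angGrad d Φ x θ⟫ = ∑ j, w j * dY (bas d j) Φ (x, θ) := by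
  have h := hasFDerivAt_slice hΦ x (θ : E d)
  rw [angGrad, real_inner_comm, gradient, InnerProductSpace.toDual_symm_apply,
    fderiv_comp_normalize (φ := fun y => Φ (x, y)) h.differentiableAt, h.fderiv, ← dY_eq_sum]
  simp only [ContinuousLinearMap.comp_apply, tanProj_apply]
  rw [real_inner_comm, hw]
  simp [dY]

lemma dY_scale (hΦ : Differentiable ℝ Φ) (r : ℝ) (v x y : E d) :
    dY v (fun z => Φ (z.1, r • z.2)) (x, y) = r * dY v Φ (x, r • y) := by
  have h1 : HasFDerivAt (fun z : E d × E d => (z.1, r • z.2))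
      ((ContinuousLinearMap.fst ℝ (E d) (E d)).prod (r • ContinuousLinearMap.snd ℝ (E d) (E d)))
      (x, y) := ((ContinuousLinearMap.fst ℝ (E d) (E d)).prod
        (r • ContinuousLinearMap.snd ℝ (E d) (E d))).hasFDerivAt
  have h2 := (hΦ (x, r • y)).hasFDerivAt.comp (f := fun z : E d × E d => (z.1, r • z.2)) (x, y) h1
  have h3 : HasFDerivAt (fun z : E d × E d => Φ (z.1, r • z.2)) _ (x, y) := h2
  rw [dY, h3.fderiv, dY, ← smul_eq_mul, ← map_smul]
  simp

lemma dX_scale (hΦ : Differentiable ℝ Φ) (r : ℝ) (v x y : E d) :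
    dX v (fun z => Φ (z.1, r • z.2)) (x, y) = dX v Φ (x, r • y) := by
  have h1 : HasFDerivAt (fun z : E d × E d => (z.1, r • z.2))
      ((ContinuousLinearMap.fst ℝ (E d) (E d)).prod (r • ContinuousLinearMap.snd ℝ (E d) (E d)))
      (x, y) := ((ContinuousLinearMap.fst ℝ (E d) (E d)).prod
        (r • ContinuousLinearMap.snd ℝ (E d) (E d))).hasFDerivAt
  have h2 := (hΦ (x, r • y)).hasFDerivAt.comp (f := fun z : E d × E d => (z.1, r • z.2)) (x, y) h1
  have h3 : HasFDerivAt (fun z : E d × E d => Φ (z.1, r • z.2)) _ (x, y) := h2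
  rw [dX, h3.fderiv, dX]
  simp

lemma trace_tanProj (θ : S d) :
    LinearMap.trace ℝ (E d) (tanProj (θ : E d)).toLinearMap = d := by
  have e : (tanProj (θ : E d)).toLinearMap =
      LinearMap.id - (innerSL ℝ (θ : E d)).toLinearMap.smulRight (θ : E d) := rfl
  rw [e, map_sub, LinearMap.trace_id, LinearMap.trace_smulRight]
  simp

/-- The divergence on the sphere of the tangential part of a constant field times a function. -/
lemma angDiv_smul (hΦ : Differentiable ℝ Φ) (j : Fin (d + 1)) (x : E d) (θ : S d) :
    angDiv d (fun z => Φ z • (bas d j - z.2 j • z.2)) x θ =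
      dY (bas d j) Φ (x, θ) - (θ : E d) j * dY (θ : E d) Φ (x, θ) -
        d * (θ : E d) j * Φ (x, θ) := by
  have h := hasFDerivAt_slice hΦ x (θ : E d)
  have hj : HasFDerivAt (fun y : E d => y j) (EuclideanSpace.proj j : E d →L[ℝ] ℝ) (θ : E d) :=
    (EuclideanSpace.proj j : E d →L[ℝ] ℝ).hasFDerivAt
  have h1 := h.smul ((hj.smul (hasFDerivAt_id (𝕜 := ℝ) (θ : E d))).const_sub (bas d j))
  have h2 : HasFDerivAt (fun y : E d => Φ (x, y) • (bas d j - y j • y)) _ (θ : E d) := h1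
  rw [angDiv, fderiv_comp_normalize (φ := fun y => Φ (x, y) • (bas d j - y j • y))
    h2.differentiableAt, h2.fderiv]
  set P := (tanProj (θ : E d)).toLinearMap with hP
  have hPθ : tanProj (θ : E d) (θ : E d) = 0 := by rw [tanProj_apply, inner_sphere]; simp
  calc _ = LinearMap.trace ℝ (E d) (-(Φ (x, θ) * (θ : E d) j) • P -
        Φ (x, θ) • ((EuclideanSpace.proj j : E d →L[ℝ] ℝ).toLinearMap.comp P).smulRight (θ : E d) +
      (((fderiv ℝ Φ (x, θ)).comp (ContinuousLinearMap.inr ℝ (E d) (E d))).toLinearMap.comp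
        P).smulRight (bas d j - (θ : E d) j • (θ : E d))) := by
        congr 1
        ext1 v
        simp [hP, smul_smul, smul_add, sub_eq_add_neg]
        abel
    _ = _ := by
        rw [map_add, map_sub, map_smul, map_smul, LinearMap.trace_smulRight,
          LinearMap.trace_smulRight, hP, trace_tanProj]
        simp only [LinearMap.comp_apply, ContinuousLinearMap.coe_coe, map_sub, map_smul, hPθ,
          tanProj_apply, ContinuousLinearMap.comp_apply, inner_bas, sub_zero, map_zero,
          smul_eq_mul, mul_zero, ContinuousLinearMap.inr_apply, dY]
        ring

end SphereCalculus

/-! ### Lifting a solution from the sphere to flat space -/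

section Lift
variable {d : ℕ}

lemma isOpen_halfSpace : IsOpen (halfSpace d) :=
  isOpen_lt continuous_const (by fun_prop)

lemma isOpen_Q : IsOpen (Q d) := isOpen_halfSpace.preimage continuous_fst

/-- The data of a weak solution, extended by zero to `ℝⁿ × 𝕊ⁿ⁻¹`. Here `l = λ u`. -/
structure SphereSolution (d : ℕ) (ε : ℝ) (σ : E d → ℝ) (u l f : E d × S d → ℝ)
    (G : E d × S d → E d) : Prop where
  memu : MemLp u 2 (dxdθ d)
  meml : MemLp l 2 (dxdθ d)
  memf : MemLp f 2 (dxdθ d)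
  memG : MemLp G 2 (dxdθ d)
  continuous_σ : Continuous σ
  tangent : ∀ᵐ p ∂dxdθ d, ⟪G p, (p.2 : E d)⟫ = (0 : ℝ)
  parts : ∀ Ψ : E d × E d → E d, IsTest d Ψ →
    (∀ (x : E d) (θ : S d), ⟪Ψ (x, (θ : E d)), (θ : E d)⟫ = (0 : ℝ)) →
    ∫ p, ⟪G p, Ψ (p.1, (p.2 : E d))⟫ ∂dxdθ d = -∫ p, u p * angDiv d Ψ p.1 p.2 ∂dxdθ d
  eqn : ∀ Φ : E d × E d → ℝ, IsTest d Φ →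
    ∫ p, (ε ^ 2 * σ p.1 * ⟪G p, angGrad d Φ p.1 p.2⟫ - u p * transport d Φ p.1 p.2 +
      l p * Φ (p.1, (p.2 : E d))) ∂dxdθ d = ∫ p, f p * Φ (p.1, (p.2 : E d)) ∂dxdθ d

/-- A lifted function is constant along rays, hence square integrable only over bounded ranges of
`|y|`. The radial integral then factors out. -/
lemma lintegral_lift {F : Type*} [NormedAddCommGroup F] {w : E d × S d → F}
    (hw : AEStronglyMeasurable w (dxdθ d)) (R : ℝ) :
    ∫⁻ z, ‖({z : E d × E d | ‖z.2‖ ≤ R}.indicator fun z => w (lift z)) z‖ₑ ^ 2 =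
      (∫⁻ p, ‖w p‖ₑ ^ 2 ∂dxdθ d) * rad d {r | (r : ℝ) ≤ R} := by
  have hR : MeasurableSet {z : E d × E d | ‖z.2‖ ≤ R} :=
    measurableSet_le (by fun_prop) measurable_const
  set w' : E d × S d → F := hw.mk w with hw'
  have hae : ∀ᵐ p ∂dxdθ d, w p = w' p := hw.ae_eq_mk
  have hwm : Measurable fun p => ‖w' p‖ₑ ^ 2 := hw.stronglyMeasurable_mk.enorm.pow_const 2
  have hS : MeasurableSet {r : Ioi (0 : ℝ) | (r : ℝ) ≤ R} :=
    measurableSet_le measurable_subtype_coe measurable_const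
  have e1 : ∫⁻ z, ‖({z : E d × E d | ‖z.2‖ ≤ R}.indicator fun z => w (lift z)) z‖ₑ ^ 2 =
      ∫⁻ z, ({z : E d × E d | ‖z.2‖ ≤ R}.indicator fun z => ‖w' (lift z)‖ₑ ^ 2) z := by
    refine lintegral_congr_ae ?_
    filter_upwards [quasiMeasurePreserving_lift.ae hae] with z hz
    by_cases h : z ∈ {z : E d × E d | ‖z.2‖ ≤ R}
    · rw [indicator_of_mem h, indicator_of_mem h, hz]
    · rw [indicator_of_notMem h, indicator_of_notMem h]; simp
  have e2 := lintegral_polar_mul (d := d) (H := {z : E d × E d | ‖z.2‖ ≤ R}.indicator fun z =>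
      ‖w' (lift z)‖ₑ ^ 2) ((hwm.comp measurable_lift).indicator hR)
    (k := {r : Ioi (0 : ℝ) | (r : ℝ) ≤ R}.indicator fun _ => 1) (W := fun p => ‖w' p‖ₑ ^ 2)
    (measurable_const.indicator hS) (fun q => by
      by_cases h : (q.2 : ℝ) ≤ R
      · have h1 : pol q ∈ {z : E d × E d | ‖z.2‖ ≤ R} := by simpa [norm_pol] using h
        have h2 : q.2 ∈ {r : Ioi (0 : ℝ) | (r : ℝ) ≤ R} := h
        rw [indicator_of_mem h1, indicator_of_mem h2, lift_pol, mul_one]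
      · have h1 : pol q ∉ {z : E d × E d | ‖z.2‖ ≤ R} := by simpa [norm_pol] using h
        have h2 : q.2 ∉ {r : Ioi (0 : ℝ) | (r : ℝ) ≤ R} := h
        rw [indicator_of_notMem h1, indicator_of_notMem h2, mul_zero]) hwm
  rw [e1, e2, lintegral_indicator_const hS, one_mul]
  congr 1
  refine lintegral_congr_ae ?_
  filter_upwards [hae] with p hp
  rw [hp]

lemma rad_le_ne_top (R : ℝ) : rad d {r | (r : ℝ) ≤ R} ≠ ⊤ :=
  ne_top_of_le_ne_top (rad_apply_le (d := d) (max R 1) (by positivity)) (measure_mono fun r hr =>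
    (show (r : ℝ) ≤ R from hr).trans (le_max_left _ _))

lemma memLp_lift {F : Type*} [NormedAddCommGroup F] {w : E d × S d → F}
    (hw : MemLp w 2 (dxdθ d)) (R : ℝ) :
    MemLp ({z : E d × E d | ‖z.2‖ ≤ R}.indicator fun z => w (lift z)) 2 volume := by
  have hm : AEStronglyMeasurable (fun z => w (lift z)) volume :=
    hw.1.comp_quasiMeasurePreserving quasiMeasurePreserving_lift
  refine memLp_two_of_lintegral
    (hm.indicator (measurableSet_le (by fun_prop) measurable_const)) ?_
  rw [lintegral_lift hw.1, lintegral_enorm_sq hw]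
  exact ENNReal.mul_ne_top ENNReal.ofReal_ne_top (rad_le_ne_top R)

lemma l2_lift_le {F : Type*} [NormedAddCommGroup F] {w : E d × S d → F}
    (hw : MemLp w 2 (dxdθ d)) (R : ℝ) :
    l2 ({z : E d × E d | ‖z.2‖ ≤ R}.indicator fun z => w (lift z)) volume ≤
      Real.sqrt (rad d {r | (r : ℝ) ≤ R}).toReal * l2 w (dxdθ d) := by
  refine l2_le_of_lintegral (mul_nonneg (Real.sqrt_nonneg _) (l2_nonneg _)) (memLp_lift hw R).1 ?_
  rw [lintegral_lift hw.1, lintegral_enorm_sq hw, mul_pow, Real.sq_sqrt ENNReal.toReal_nonneg,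
    ENNReal.ofReal_mul ENNReal.toReal_nonneg, ENNReal.ofReal_toReal (rad_le_ne_top R), mul_comm]

lemma integrable_lift_mul {w : E d × S d → ℝ} (hw : MemLp w 2 (dxdθ d)) {g : E d × E d → ℝ} {B : ℝ}
    {z₀ : E d × E d} {R : ℝ} (hg : AEStronglyMeasurable g volume) (hB : ∀ z, |g z| ≤ B)
    (hs : ∀ z, z ∉ Metric.closedBall z₀ R → g z = 0) :
    Integrable (fun z => w (lift z) * g z) volume := by
  have m1 := memLp_lift hw (‖z₀.2‖ + R)
  have m2 : MemLp g 2 volume := by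
    have : MemLp ((Metric.closedBall z₀ R).indicator fun _ : E d × E d => B) 2 volume :=
      memLp_indicator_const 2 measurableSet_closedBall B (Or.inr measure_closedBall_lt_top.ne)
    refine this.mono hg (Filter.Eventually.of_forall fun z => ?_)
    by_cases h : z ∈ Metric.closedBall z₀ R
    · rw [indicator_of_mem h]
      exact (hB z).trans (le_abs_self B)
    · rw [hs z h]; simp
  refine (m1.integrable_mul m2).congr (Filter.Eventually.of_forall fun z => ?_)
  by_cases h : z ∈ Metric.closedBall z₀ R
  · have : z ∈ {z : E d × E d | ‖z.2‖ ≤ ‖z₀.2‖ + R} := by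
      have h1 : dist z.2 z₀.2 ≤ R := (le_max_right _ _).trans (Metric.mem_closedBall.1 h)
      rw [dist_eq_norm] at h1
      have := norm_le_norm_add_norm_sub' z.2 z₀.2
      simp only [mem_ofPred_eq]
      linarith
    simp [indicator_of_mem this]
  · simp [hs z h]

/-- The part of `ℝⁿ₊ × ℝⁿ` where `1/2 < |y| < 2`. -/
def Ann (d : ℕ) : Set (E d × E d) := {z | z.1 ∈ halfSpace d ∧ 1 / 2 < ‖z.2‖ ∧ ‖z.2‖ < 2}

lemma CcSmooth.integrable_lift_mul {N : E d × E d → ℝ} (hN : CcSmooth N) {w : E d × S d → ℝ}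
    (hw : MemLp w 2 (dxdθ d)) {k : E d × E d → ℝ} (hk : Measurable k) {B : ℝ}
    (hB : ∀ z, N z ≠ 0 → |k z| ≤ B) : Integrable (fun z => w (lift z) * (k z * N z)) volume := by
  obtain ⟨C, hC, hN'⟩ := hN.exists_bound
  obtain ⟨R, hR⟩ := hN.compact.isBounded.subset_closedBall 0
  refine FokkerPlanck.integrable_lift_mul hw (z₀ := 0) (R := R) (B := max B 0 * C)
    (hk.aestronglyMeasurable.mul hN.continuous.aestronglyMeasurable)
    (fun z => ?_) fun z hz => ?_
  · rw [abs_mul]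
    by_cases h : N z = 0
    · rw [h, abs_zero, mul_zero]; positivity
    · exact mul_le_mul ((hB z h).trans (le_max_left _ _)) (hN' z) (abs_nonneg _) (by positivity)
  · rw [image_eq_zero_of_notMem_tsupport fun h => hz (hR h), mul_zero]

lemma CcSmooth.scale {N : E d × E d → ℝ} (hN : CcSmooth N) {r : ℝ} (hr : r ≠ 0) :
    CcSmooth fun z : E d × E d => N (z.1, r • z.2) where
  smooth := hN.smooth.comp (by fun_prop)
  compact := hN.compact.comp_homeomorph
    ((Homeomorph.refl (E d)).prodCongr (Homeomorph.smulOfNeZero r hr))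

lemma isTest_scale {N : E d × E d → ℝ} (hN : CcSmooth N)
    (hs : tsupport N ⊆ {p | p.1 ∈ halfSpace d}) {r : ℝ} (hr : r ≠ 0) : IsTest d fun z : E d × E d => N (z.1, r • z.2) where
  smooth := (hN.scale hr).smooth
  compact := (hN.scale hr).compact
  support := by
    have h := tsupport_comp_subset_preimage N (f := fun z : E d × E d => (z.1, r • z.2))
      (by fun_prop)
    exact fun z hz => hs (a := (z.1, r • z.2)) (h hz)

namespace SphereSolution
variable {ε : ℝ} {σ : E d → ℝ} {u l f : E d × S d → ℝ} {G : E d × S d → E d}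
  {N : E d × E d → ℝ}

lemma memG_apply (sol : SphereSolution d ε σ u l f G) (j : Fin (d + 1)) :
    MemLp (fun p => G p j) 2 (dxdθ d) := by
  have h := (EuclideanSpace.proj j : E d →L[ℝ] ℝ).comp_memLp' sol.memG
  exact h

/-- The weak gradient of `ũ` in `y` is `G / |y|`. The field `N e_j` is split at each radius into a
tangential and a radial part: the first is an admissible test field on the sphere, the second
contributes nothing because `ũ` does not depend on `|y|`. -/
lemma lift_gradient (sol : SphereSolution d ε σ u l f G) (hN : CcSmooth N) (hs : tsupport N ⊆ Ann d)
    (j : Fin (d + 1)) :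
    ∫ z, ‖z.2‖⁻¹ * G (lift z) j * N z = -∫ z, u (lift z) * dY (bas d j) N z := by
  have hAnn : ∀ z, N z ≠ 0 → 1 / 2 < ‖z.2‖ := fun z hz => (hs (subset_tsupport _ hz)).2.1
  have hinv : ∀ z, N z ≠ 0 → |‖z.2‖⁻¹| ≤ 2 := fun z hz => by
    rw [abs_of_nonneg (by positivity)]
    exact inv_le_of_inv_le₀ (by norm_num) (by linarith [hAnn z hz])
  have i1 : Integrable (fun z => ‖z.2‖⁻¹ * G (lift z) j * N z) volume :=
    (hN.integrable_lift_mul (sol.memG_apply j) (k := fun z => ‖z.2‖⁻¹) (by fun_prop) hinv).congr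
      (Filter.Eventually.of_forall fun z => by ring)
  have i2 : Integrable (fun z => u (lift z) * dY (bas d j) N z) volume :=
    ((hN.dY (bas d j)).integrable_lift_mul sol.memu (k := fun _ => 1) (by fun_prop)
      (B := 1) (by simp)).congr (Filter.Eventually.of_forall fun z => by ring)
  have md : ∀ i, Measurable fun z : E d × E d => (dir z.2 : E d) i := fun i => by
    have h1 : Measurable fun z : E d × E d => (dir z.2 : E d) :=
      (measurable_subtype_coe.comp (measurable_dir (d := d))).comp measurable_snd
    exact (EuclideanSpace.proj i : E d →L[ℝ] ℝ).continuous.measurable.comp h1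
  have bd : ∀ i (z : E d × E d), |(dir z.2 : E d) i| ≤ 1 := fun i z =>
    (PiLp.norm_apply_le (dir z.2 : E d) i).trans (norm_sphere _).le
  have i3 : Integrable (fun z => u (lift z) * ((dir z.2 : E d) j *
      (dY (dir z.2 : E d) N z + d * ‖z.2‖⁻¹ * N z))) volume := by
    have a1 : ∀ i, Integrable (fun z => u (lift z) *
        ((dir z.2 : E d) j * (dir z.2 : E d) i * dY (bas d i) N z)) volume := fun i =>
      (hN.dY (bas d i)).integrable_lift_mul sol.memu
        (k := fun z => (dir z.2 : E d) j * (dir z.2 : E d) i) ((md j).mul (md i)) (B := 1)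
        fun z _ => by
          rw [abs_mul]
          exact mul_le_one₀ (bd j z) (abs_nonneg _) (bd i z)
    have a2 : Integrable (fun z => u (lift z) * ((d * ((dir z.2 : E d) j * ‖z.2‖⁻¹)) * N z))
        volume :=
      hN.integrable_lift_mul sol.memu (B := d * (1 * 2))
        (((md j).mul (by fun_prop)).const_mul _) fun z hz => by
          rw [abs_mul, abs_mul, abs_of_nonneg (Nat.cast_nonneg d)]
          gcongr
          · exact bd j z
          · exact hinv z hz
    refine ((integrable_finsetSum Finset.univ fun i _ => a1 i).add a2).congr
      (Filter.Eventually.of_forall fun z => ?_)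
    simp only [Pi.add_apply, dY_eq_sum (dir z.2 : E d)]
    rw [mul_add, mul_add, Finset.mul_sum, Finset.mul_sum]
    congr 1
    · exact Finset.sum_congr rfl fun i _ => by ring
    · ring
  -- Along each ray the integrand is `u` times the derivative of `r^d N`, up to a factor constant on
  -- the ray. It integrates to zero since `N` vanishes near the origin and at infinity.
  have z3 : ∫ z, u (lift z) * ((dir z.2 : E d) j * (dY (dir z.2 : E d) N z + d * ‖z.2‖⁻¹ * N z)) =
      0 := by
    rw [integral_polar' i3]
    have : ∀ p : E d × S d, ∫ r, u (lift (pol (p, r))) * ((dir (pol (p, r)).2 : E d) j *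
        (dY (dir (pol (p, r)).2 : E d) N (pol (p, r)) + d * ‖(pol (p, r)).2‖⁻¹ * N (pol (p, r))))
        ∂rad d = 0 := by
      intro p
      set φ : ℝ → ℝ := fun r => N (p.1, r • (p.2 : E d)) with hφ
      have hline : ∀ r : ℝ, HasDerivAt (fun r : ℝ => (p.1, r • (p.2 : E d))) (0, (p.2 : E d)) r := by
        intro r
        have := (hasDerivAt_id r).smul_const (p.2 : E d)
        simpa using (hasDerivAt_const r p.1).prodMk this
      have hd : ∀ r, HasDerivAt φ (dY (p.2 : E d) N (p.1, r • (p.2 : E d))) r := fun r =>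
        (hN.differentiable _).hasFDerivAt.comp_hasDerivAt r (hline r)
      have h := integral_rad_deriv (d := d) (φ := φ)
        ((hN.smooth.of_le (by simp)).comp (by fun_prop)) ?_ ?_
      · have e : ∀ r : Ioi (0 : ℝ), u (lift (pol (p, r))) * ((dir (pol (p, r)).2 : E d) j *
            (dY (dir (pol (p, r)).2 : E d) N (pol (p, r)) +
              d * ‖(pol (p, r)).2‖⁻¹ * N (pol (p, r)))) =
            u p * (p.2 : E d) j * (deriv φ r + d * (r : ℝ)⁻¹ * φ r) := by
          intro r
          have h1 : dir (pol (p, r)).2 = p.2 := dir_smul r.2 _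
          rw [lift_pol, norm_pol, h1, (hd r).deriv]
          simp only [pol, hφ]
          ring
        simp only [e]
        rw [integral_const_mul, h, mul_zero]
      · refine HasCompactSupport.intro (isCompact_closedBall (0 : ℝ) 2) fun r hr => ?_
        by_contra h0
        have := (hs (subset_tsupport _ h0)).2.2
        rw [norm_smul, norm_sphere, mul_one] at this
        simp at hr
        simp at this
        linarith
      · by_contra h0
        have := (hs (subset_tsupport _ h0)).2.1
        simp at this
        linarith
    simp only [this, integral_zero]
  have key : ∫ z, ‖z.2‖⁻¹ * G (lift z) j * N z =
      ∫ z, (u (lift z) * ((dir z.2 : E d) j * (dY (dir z.2 : E d) N z + d * ‖z.2‖⁻¹ * N z)) -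
        u (lift z) * dY (bas d j) N z) := by
    have i4 : Integrable (fun z => u (lift z) * ((dir z.2 : E d) j *
        (dY (dir z.2 : E d) N z + d * ‖z.2‖⁻¹ * N z)) - u (lift z) * dY (bas d j) N z) volume :=
      i3.sub i2
    rw [integral_polar i1, integral_polar i4]
    refine integral_congr_ae (Filter.Eventually.of_forall fun r => ?_)
    have hr : (0 : ℝ) < r := r.2
    have ht := isTest_scale hN (fun z hz => (hs hz).1) hr.ne'
    -- The field `e_j - θ_j θ` is the tangential part of `e_j` on the unit sphere.
    have hp := sol.parts (fun z => N (z.1, (r : ℝ) • z.2) • (bas d j - z.2 j • z.2))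
      ⟨ht.smooth.smul (by fun_prop), ht.compact.smul_right,
        (closure_mono (Function.support_smul_subset_left _ _)).trans ht.support⟩ (fun x θ => by
          rw [inner_smul_left, inner_sub_left, inner_smul_left, inner_sphere, real_inner_comm,
            inner_bas]
          simp)
    simp only [angDiv_smul (ht.smooth.differentiable (by simp)),
      dY_scale hN.differentiable] at hp
    have e1 : ∫ p, ‖(pol (p, r)).2‖⁻¹ * G (lift (pol (p, r))) j * N (pol (p, r)) ∂dxdθ d =
        (r : ℝ)⁻¹ * ∫ p, ⟪G p, N (p.1, (r : ℝ) • (p.2 : E d)) •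
          (bas d j - (p.2 : E d) j • (p.2 : E d))⟫ ∂dxdθ d := by
      rw [← integral_const_mul]
      refine integral_congr_ae ?_
      filter_upwards [sol.tangent] with p hp
      rw [norm_pol, lift_pol, inner_smul_right, inner_sub_right, inner_bas, inner_smul_right, hp]
      simp only [pol]
      ring
    simp only at e1 ⊢
    rw [e1, hp, ← integral_neg, ← integral_const_mul]
    refine integral_congr_ae (Filter.Eventually.of_forall fun p => ?_)
    have h1 : dir (pol (p, r)).2 = p.2 := dir_smul r.2 _
    simp only [lift_pol, norm_pol, h1]
    simp only [pol]
    field_simp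
    ring
  rw [key, integral_sub i3 i2, z3, zero_sub]

lemma integrable_σG (sol : SphereSolution d ε σ u l f G) (hN : CcSmooth N) (j : Fin (d + 1)) :
    Integrable (fun z => σ z.1 * ‖z.2‖ ^ 3 * (‖z.2‖⁻¹ * G (lift z) j) * N z) volume := by
  obtain ⟨R, hR⟩ := hN.compact.isBounded.subset_closedBall 0
  obtain ⟨B, hB⟩ := (isCompact_closedBall (0 : E d × E d) R).exists_bound_of_continuousOn
    (f := fun z => σ z.1 * ‖z.2‖ ^ 2) (by have := sol.continuous_σ; fun_prop)
  have e1 : ∀ z, σ z.1 * ‖z.2‖ ^ 3 * (‖z.2‖⁻¹ * G (lift z) j) * N z =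
      G (lift z) j * ((σ z.1 * ‖z.2‖ ^ 2) * N z) := fun z => by
    by_cases h : ‖z.2‖ = 0
    · simp [h]
    · field_simp
  simp only [e1]
  exact hN.integrable_lift_mul (sol.memG_apply j) (k := fun z => σ z.1 * ‖z.2‖ ^ 2)
    (by have := sol.continuous_σ.measurable; fun_prop)
    fun z hz => hB z (hR (subset_tsupport _ hz))

/-- At radius `r` the weak equation is tested with `N(x, r ·)` and multiplied by `r`. Rescaling
turns `r θ · ∇ₓ` into `y · ∇ₓ` and produces the coefficient `σ |y|³`. No derivative of `|y|³`
arises, because `G` is tangential. -/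
lemma lift_equation (sol : SphereSolution d ε σ u l f G) (hN : CcSmooth N) (hs : tsupport N ⊆ Ann d) :
    ε ^ 2 * (∫ z, ∑ j, σ z.1 * ‖z.2‖ ^ 3 * (‖z.2‖⁻¹ * G (lift z) j) * dY (bas d j) N z) -
      ∫ z, u (lift z) * trans N z = ∫ z, ‖z.2‖ * (f (lift z) - l (lift z)) * N z := by
  have h2 : ∀ z, N z ≠ 0 → ‖z.2‖ ≤ 2 := fun z hz => (hs (subset_tsupport _ hz)).2.2.le
  have a1 := fun j => sol.integrable_σG (hN.dY (bas d j)) j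
  have a1' : Integrable (fun z => ε ^ 2 * ∑ j, σ z.1 * ‖z.2‖ ^ 3 * (‖z.2‖⁻¹ * G (lift z) j) *
      dY (bas d j) N z) volume :=
    (integrable_finsetSum _ fun j _ => a1 j).const_mul _
  have a2 : Integrable (fun z => u (lift z) * trans N z) volume :=
    (hN.trans.integrable_lift_mul sol.memu (k := fun _ => 1) (by fun_prop)
      (B := 1) (by simp)).congr (Filter.Eventually.of_forall fun z => by ring)
  have a3 : ∀ {w : E d × FokkerPlanck.S d → ℝ}, MemLp w 2 (dxdθ d) →
      Integrable (fun z => ‖z.2‖ * w (lift z) * N z) volume := fun hw =>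
    (hN.integrable_lift_mul hw (k := fun z => ‖z.2‖) (by fun_prop)
      (B := 2) (fun z hz => by simpa using h2 z hz)).congr
        (Filter.Eventually.of_forall fun z => by ring)
  have a4 : Integrable (fun z => ε ^ 2 * (∑ j, σ z.1 * ‖z.2‖ ^ 3 * (‖z.2‖⁻¹ * G (lift z) j) *
      dY (bas d j) N z) - u (lift z) * trans N z) volume := a1'.sub a2
  have a5 : Integrable (fun z => ε ^ 2 * (∑ j, σ z.1 * ‖z.2‖ ^ 3 * (‖z.2‖⁻¹ * G (lift z) j) *
      dY (bas d j) N z) - u (lift z) * trans N z + ‖z.2‖ * l (lift z) * N z) volume :=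
    a4.add (a3 sol.meml)
  have key : ∫ z, (ε ^ 2 * (∑ j, σ z.1 * ‖z.2‖ ^ 3 * (‖z.2‖⁻¹ * G (lift z) j) *
      dY (bas d j) N z) - u (lift z) * trans N z + ‖z.2‖ * l (lift z) * N z) =
      ∫ z, ‖z.2‖ * f (lift z) * N z := by
    rw [integral_polar a5, integral_polar (a3 sol.memf)]
    refine integral_congr_ae (Filter.Eventually.of_forall fun r => ?_)
    have hr : (0 : ℝ) < r := r.2
    have ht := isTest_scale hN (fun z hz => (hs hz).1) hr.ne'
    have hp := congrArg (fun t => (r : ℝ) * t) (sol.eqn _ ht)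
    simp only [← integral_const_mul] at hp
    have eL : ∫ p, (ε ^ 2 * (∑ j, σ (pol (p, r)).1 * ‖(pol (p, r)).2‖ ^ 3 *
        (‖(pol (p, r)).2‖⁻¹ * G (lift (pol (p, r))) j) * dY (bas d j) N (pol (p, r))) -
        u (lift (pol (p, r))) * trans N (pol (p, r)) +
        ‖(pol (p, r)).2‖ * l (lift (pol (p, r))) * N (pol (p, r))) ∂dxdθ d =
        ∫ p, (r : ℝ) * (ε ^ 2 * σ p.1 *
          ⟪G p, angGrad d (fun z => N (z.1, (r : ℝ) • z.2)) p.1 p.2⟫ -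
          u p * transport d (fun z => N (z.1, (r : ℝ) • z.2)) p.1 p.2 +
          l p * N (p.1, (r : ℝ) • (p.2 : E d))) ∂dxdθ d := by
      refine integral_congr_ae ?_
      filter_upwards [sol.tangent] with p hp
      have hd := ht.smooth.differentiable (by simp)
      rw [inner_angGrad hd _ _ hp, transport_eq hd, norm_pol, lift_pol]
      simp only [trans, dX_scale hN.differentiable, dY_scale hN.differentiable]
      simp only [pol, PiLp.smul_apply, smul_eq_mul]
      rw [mul_add, mul_sub, mul_assoc (ε ^ 2), Finset.mul_sum, Finset.mul_sum, Finset.mul_sum,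
        Finset.mul_sum, Finset.mul_sum, Finset.mul_sum, Finset.mul_sum]
      congr 1
      · congr 1
        · exact Finset.sum_congr rfl fun i _ => by field_simp
        · exact Finset.sum_congr rfl fun i _ => by ring
      · ring
    simp only at eL ⊢
    rw [eL, hp]
    refine integral_congr_ae (Filter.Eventually.of_forall fun p => ?_)
    simp only [norm_pol, lift_pol]
    simp only [pol]
    ring
  rw [integral_add a4 (a3 sol.meml), integral_sub a1' a2, integral_const_mul] at key
  have e3 : ∫ z, ‖z.2‖ * (f (lift z) - l (lift z)) * N z =
      (∫ z, ‖z.2‖ * f (lift z) * N z) - ∫ z, ‖z.2‖ * l (lift z) * N z := by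
    rw [← integral_sub (a3 sol.memf) (a3 sol.meml)]
    exact integral_congr_ae (Filter.Eventually.of_forall fun z => by ring)
  rw [e3]
  linarith

end SphereSolution

end Lift

/-! ### Extension by zero of a weak solution -/

section Extend
variable {d : ℕ}

lemma convex_halfSpace : Convex ℝ (halfSpace d) :=
  (convex_Ioi (0 : ℝ)).linear_preimage (EuclideanSpace.proj (Fin.last d) : E d →L[ℝ] ℝ).toLinearMap

variable {σ₀ lam₀ M ε : ℝ} {σ lam : E d → ℝ}

lemma bas_last_mem : bas d (Fin.last d) ∈ halfSpace d := by simp [halfSpace, bas]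

lemma Coefficients.M_nonneg (h : Coefficients d σ₀ lam₀ M σ lam) : 0 ≤ M :=
  (norm_nonneg _).trans (h.σ_deriv _ bas_last_mem)

/-- On the convex half-space the gradient bound is a Lipschitz bound, and real Lipschitz functions
extend with the same constant. The extension supplies continuity on the whole space; its values
outside the half-space play no role. -/
lemma Coefficients.exists_lipschitz (h : Coefficients d σ₀ lam₀ M σ lam) :
    ∃ σ' : E d → ℝ, (∀ x y, |σ' x - σ' y| ≤ M * ‖x - y‖) ∧ EqOn σ σ' (halfSpace d) := by
  have hM := h.M_nonneg
  have hd : ∀ x ∈ halfSpace d, DifferentiableAt ℝ σ x := fun x hx =>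
    (h.σ_C1.differentiableOn (by simp)).differentiableAt (isOpen_halfSpace.mem_nhds hx)
  have hl : LipschitzOnWith ⟨M, hM⟩ σ (halfSpace d) :=
    convex_halfSpace.lipschitzOnWith_of_nnnorm_fderiv_le hd fun x hx => h.σ_deriv x hx
  obtain ⟨σ', h1, h2⟩ := hl.extend_real
  refine ⟨σ', fun x y => ?_, h2⟩
  have := h1.dist_le_mul x y
  rwa [Real.dist_eq, dist_eq_norm] at this

lemma IsTest.isBdryTest {Φ : E d × E d → ℝ} (h : IsTest d Φ) : IsBdryTest d Φ where
  smooth := h.smooth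
  compact := h.compact
  vanish x θ hx _ := image_eq_zero_of_notMem_tsupport fun hm => by
    have : 0 < x (Fin.last d) := h.support hm
    linarith

lemma IsTest.bdry_eq_zero {Φ : E d × E d → ℝ} (h : IsTest d Φ) (x' : EuclideanSpace ℝ (Fin d))
    (y : E d) : Φ (bdryPoint d x', y) = 0 :=
  image_eq_zero_of_notMem_tsupport fun hm => by
    have : 0 < (bdryPoint d x') (Fin.last d) := h.support hm
    simp [bdryPoint] at this

lemma measurableSet_Q : MeasurableSet (Q d) := isOpen_Q.measurableSet

lemma setIntegral_Q_congr {a b : E d × S d → ℝ} (h : ∀ p ∈ Q d, a p = b p) (hb : ∀ p ∉ Q d, b p = 0) :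
    ∫ p in Q d, a p ∂dxdθ d = ∫ p, b p ∂dxdθ d := by
  rw [← integral_indicator measurableSet_Q]
  refine integral_congr_ae (Filter.Eventually.of_forall fun p => ?_)
  by_cases hp : p ∈ Q d
  · simp [indicator_of_mem hp, h p hp]
  · simp [indicator_of_notMem hp, hb p hp]

lemma Coefficients.memLp_lam_mul (h : Coefficients d σ₀ lam₀ M σ lam) (hlam₀ : 0 < lam₀)
    {u : E d × S d → ℝ} (hu : MemLp u 2 ((dxdθ d).restrict (Q d))) :
    MemLp (fun p => lam p.1 * u p) 2 ((dxdθ d).restrict (Q d)) := by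
  have e : (dxdθ d).restrict (Q d) =
      ((volume : Measure (E d)).restrict (halfSpace d)).prod (volume : Measure (E d)).toSphere := by
    have : Q d = halfSpace d ×ˢ univ := by ext p; simp [Q]
    rw [this, dxdθ, ← Measure.prod_restrict, Measure.restrict_univ]
  have hm : AEStronglyMeasurable (fun p : E d × S d => lam p.1) ((dxdθ d).restrict (Q d)) := by
    rw [e]
    exact (h.lam_meas.comp_quasiMeasurePreserving
      Measure.quasiMeasurePreserving_fst).aestronglyMeasurable
  refine (hu.const_mul M).mono (hm.mul hu.1) ?_
  filter_upwards [ae_restrict_mem measurableSet_Q] with p hp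
  rw [norm_mul, norm_mul, Real.norm_of_nonneg (hlam₀.le.trans (h.lam_lower _ hp)),
    Real.norm_of_nonneg h.M_nonneg]
  gcongr
  exact h.lam_upper _ hp

/-- A weak solution, extended by zero. -/
lemma IsWeakSolution.sphereSolution (h : Coefficients d σ₀ lam₀ M σ lam) (hlam₀ : 0 < lam₀)
    {f u : E d × S d → ℝ} {g : EuclideanSpace ℝ (Fin d) × S d → ℝ} {G : E d × S d → E d}
    (hf : MemLp f 2 ((dxdθ d).restrict (Q d))) (hs : IsWeakSolution d ε σ lam f g u G)
    {σ' : E d → ℝ} (hσ' : ∀ x y, |σ' x - σ' y| ≤ M * ‖x - y‖) (he : EqOn σ σ' (halfSpace d)) :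
    SphereSolution d ε σ' ((Q d).indicator u) ((Q d).indicator fun p => lam p.1 * u p)
      ((Q d).indicator f) ((Q d).indicator G) where
  memu := (memLp_indicator_iff_restrict measurableSet_Q).2 hs.memLp
  meml := (memLp_indicator_iff_restrict measurableSet_Q).2 (h.memLp_lam_mul hlam₀ hs.memLp)
  memf := (memLp_indicator_iff_restrict measurableSet_Q).2 hf
  memG := (memLp_indicator_iff_restrict measurableSet_Q).2 hs.grad.memLp
  continuous_σ := by
    have : LipschitzWith ⟨M, h.M_nonneg⟩ σ' := LipschitzWith.of_dist_le_mul fun x y => by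
      rw [Real.dist_eq, dist_eq_norm]; exact hσ' x y
    exact this.continuous
  tangent := by
    have := hs.grad.tangent
    rw [ae_restrict_iff' measurableSet_Q] at this
    filter_upwards [this] with p hp
    by_cases hq : p ∈ Q d
    · rw [indicator_of_mem hq]; exact hp hq
    · rw [indicator_of_notMem hq, inner_zero_left]
  parts Ψ hΨ ht := by
    have := hs.grad.parts Ψ hΨ ht
    rw [setIntegral_Q_congr (b := fun p => ⟪(Q d).indicator G p, Ψ (p.1, (p.2 : E d))⟫)
      (fun p hp => by rw [indicator_of_mem hp]) (fun p hp => by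
        rw [indicator_of_notMem hp, inner_zero_left]),
      setIntegral_Q_congr (b := fun p => (Q d).indicator u p * angDiv d Ψ p.1 p.2)
      (fun p hp => by rw [indicator_of_mem hp]) (fun p hp => by
        rw [indicator_of_notMem hp, zero_mul])] at this
    exact this
  eqn Φ hΦ := by
    have := hs.eqn Φ hΦ.isBdryTest
    -- A test function supported in `Q` vanishes on the boundary, so the boundary datum disappears
    -- here.
    simp only [hΦ.bdry_eq_zero, mul_zero, integral_zero, add_zero] at this
    rw [setIntegral_Q_congr (b := fun p => ε ^ 2 * σ' p.1 *
        ⟪(Q d).indicator G p, angGrad d Φ p.1 p.2⟫ - (Q d).indicator u p * transport d Φ p.1 p.2 +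
        (Q d).indicator (fun p => lam p.1 * u p) p * Φ (p.1, (p.2 : E d)))
      (fun p hp => by simp only [indicator_of_mem hp, he hp]) (fun p hp => by
        simp only [indicator_of_notMem hp, inner_zero_left]; ring),
      setIntegral_Q_congr (b := fun p => (Q d).indicator f p * Φ (p.1, (p.2 : E d)))
      (fun p hp => by rw [indicator_of_mem hp]) (fun p hp => by
        rw [indicator_of_notMem hp, zero_mul])] at this
    exact this

end Extend

/-! ### Localization -/

section Localize
variable {d : ℕ}

lemma dY_mul {a b : E d × E d → ℝ} (ha : Differentiable ℝ a) (hb : Differentiable ℝ b) (v : E d)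
    (z : E d × E d) : dY v (fun z => a z * b z) z = a z * dY v b z + b z * dY v a z := by
  have h : HasFDerivAt (fun z => a z * b z) _ z := (ha z).hasFDerivAt.mul (hb z).hasFDerivAt
  rw [dY, h.fderiv]
  simp [dY]

lemma dX_mul {a b : E d × E d → ℝ} (ha : Differentiable ℝ a) (hb : Differentiable ℝ b) (v : E d)
    (z : E d × E d) : dX v (fun z => a z * b z) z = a z * dX v b z + b z * dX v a z := by
  have h : HasFDerivAt (fun z => a z * b z) _ z := (ha z).hasFDerivAt.mul (hb z).hasFDerivAt
  rw [dX, h.fderiv]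
  simp [dX]

lemma dY_sub {a b : E d × E d → ℝ} (ha : Differentiable ℝ a) (hb : Differentiable ℝ b) (v : E d)
    (z : E d × E d) : dY v (fun z => a z - b z) z = dY v a z - dY v b z := by
  have h : HasFDerivAt (fun z => a z - b z) _ z := (ha z).hasFDerivAt.sub (hb z).hasFDerivAt
  rw [dY, h.fderiv]
  simp [dY]

/-- The sum of the data that control a weak solution locally. -/
def weight (ε : ℝ) (O : Set (E d × S d)) (u f : E d × S d → ℝ) (G : E d × S d → E d)
    (p : E d × S d) : ℝ := O.indicator (fun p => |f p|) p + |u p| + ε ^ 2 * ‖G p‖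

/-- The right-hand side of the equation for `χ ũ`. -/
def locF (ε : ℝ) (σ : E d → ℝ) (χ : E d × E d → ℝ) (u l f : E d × S d → ℝ) (G : E d × S d → E d)
    (z : E d × E d) : ℝ :=
  ‖z.2‖ * (f (lift z) - l (lift z)) * χ z + u (lift z) * trans χ z -
    ε ^ 2 * ∑ j, σ z.1 * ‖z.2‖ ^ 3 * (‖z.2‖⁻¹ * G (lift z) j) * dY (bas d j) χ z

/-- The lower-order part of `Δ_y (χ ũ)`. -/
def locJ (χ : E d × E d → ℝ) (u : E d × S d → ℝ) (G : E d × S d → E d) (z : E d × E d) : ℝ :=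
  ∑ j, ‖z.2‖⁻¹ * G (lift z) j * dY (bas d j) χ z + u (lift z) * lapY χ z

/-- The conditions on the coefficient `σ`. -/
structure SigmaBounds (d : ℕ) (σ₀ M : ℝ) (σ : E d → ℝ) : Prop where
  lip : ∀ x y, |σ x - σ y| ≤ M * ‖x - y‖
  lower : ∀ x ∈ halfSpace d, σ₀ ≤ σ x
  upper : ∀ x ∈ halfSpace d, σ x ≤ M

/-- For `|y| < 2` the factor `|y|³` is at most `8` and has Lipschitz constant at most `12`; hence `8
M + 12 M`. -/
lemma SigmaBounds.abs_sub_le {σ₀ M : ℝ} {σ : E d → ℝ} (h : SigmaBounds d σ₀ M σ) (hσ₀ : 0 < σ₀)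
    {z t : E d × E d} (hz : z ∈ Ann d) (ht : t ∈ Ann d) :
    |σ z.1 * ‖z.2‖ ^ 3 - σ t.1 * ‖t.2‖ ^ 3| ≤ 20 * M * ‖z - t‖ := by
  have hM : 0 ≤ M := (hσ₀.le.trans (h.lower _ ht.1)).trans (h.upper _ ht.1)
  have h1 := (h.lip z.1 t.1).trans (mul_le_mul_of_nonneg_left (norm_fst_le (z - t)) hM)
  have h2 : |‖z.2‖ - ‖t.2‖| ≤ ‖z - t‖ := (abs_norm_sub_norm_le _ _).trans (norm_snd_le (z - t))
  obtain ⟨-, za, zb⟩ := hz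
  obtain ⟨t1, ta, tb⟩ := ht
  have h3 : |‖z.2‖ ^ 3 - ‖t.2‖ ^ 3| ≤ 12 * ‖z - t‖ := by
    have e : ‖z.2‖ ^ 3 - ‖t.2‖ ^ 3 =
      (‖z.2‖ ^ 2 + ‖z.2‖ * ‖t.2‖ + ‖t.2‖ ^ 2) * (‖z.2‖ - ‖t.2‖) := by ring
    rw [e, abs_mul, abs_of_nonneg (by positivity)]
    gcongr
    nlinarith [norm_nonneg z.2, norm_nonneg t.2]
  have h4 : |‖z.2‖ ^ 3| ≤ 8 := by
    rw [abs_of_nonneg (by positivity)]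
    calc ‖z.2‖ ^ 3 ≤ 2 ^ 3 := by gcongr
      _ = 8 := by norm_num
  have h5 : |σ t.1| ≤ M := by
    rw [abs_of_nonneg (hσ₀.le.trans (h.lower _ t1))]
    exact h.upper _ t1
  have e : σ z.1 * ‖z.2‖ ^ 3 - σ t.1 * ‖t.2‖ ^ 3 =
    ‖z.2‖ ^ 3 * (σ z.1 - σ t.1) + σ t.1 * (‖z.2‖ ^ 3 - ‖t.2‖ ^ 3) := by ring
  rw [e]
  refine (abs_add_le _ _).trans ?_
  rw [abs_mul, abs_mul]
  calc _ ≤ 8 * (M * ‖z - t‖) + M * (12 * ‖z - t‖) := by gcongr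
    _ = _ := by ring

lemma CcSmooth.sub {a b : E d × E d → ℝ} (ha : CcSmooth a) (hb : CcSmooth b) :
    CcSmooth fun z => a z - b z := by
  simpa [sub_eq_add_neg] using ha.add (hb.const_mul (-1))

namespace SphereSolution
variable {ε σ₀ M ε₀ : ℝ} {σ : E d → ℝ} {u l f : E d × S d → ℝ} {G : E d × S d → E d}
  {χ N : E d × E d → ℝ}

lemma integrable_u (sol : SphereSolution d ε σ u l f G) (hN : CcSmooth N) :
    Integrable (fun z => u (lift z) * N z) volume :=
  (hN.integrable_lift_mul sol.memu (k := fun _ => 1) (by fun_prop)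
    (B := 1) (by simp)).congr (Filter.Eventually.of_forall fun z => by ring)

lemma integrable_G (sol : SphereSolution d ε σ u l f G) (hN : CcSmooth N) (hs : tsupport N ⊆ Ann d)
    (j : Fin (d + 1)) : Integrable (fun z => ‖z.2‖⁻¹ * G (lift z) j * N z) volume := by
  have hinv : ∀ z, N z ≠ 0 → |‖z.2‖⁻¹| ≤ 2 := fun z hz => by
    rw [abs_of_nonneg (by positivity)]
    exact inv_le_of_inv_le₀ (by norm_num) (by linarith [(hs (subset_tsupport _ hz)).2.1])
  exact (hN.integrable_lift_mul (sol.memG_apply j) (k := fun z => ‖z.2‖⁻¹) (by fun_prop) hinv).congr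
      (Filter.Eventually.of_forall fun z => by ring)

lemma tsupport_dY_subset (v : E d) : tsupport (dY v N) ⊆ tsupport N :=
  tsupport_fderiv_apply_subset ℝ _

/-- The gradient identity is applied to `χ ∂_j N - N ∂_j χ`. The mixed terms cancel in its `j`-th
derivative, so the terms with derivatives of `χ` contain `N` undifferentiated and can be collected
in `locJ`. -/
lemma cutoff_gradient (sol : SphereSolution d ε σ u l f G) (hχ : CcSmooth χ)
    (hs : tsupport χ ⊆ Ann d) (hN : CcSmooth N) :
    ∫ z, χ z * u (lift z) * lapY N z =
      -(∫ z, ∑ j, χ z * (‖z.2‖⁻¹ * G (lift z) j) * dY (bas d j) N z) +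
        ∫ z, locJ χ u G z * N z := by
  have hsl : ∀ a : E d × E d → ℝ, tsupport (fun z => χ z * a z) ⊆ Ann d := fun a =>
    (tsupport_mul_subset_left).trans hs
  have hsr : ∀ (a : E d × E d → ℝ) j, tsupport (fun z => a z * dY (bas d j) χ z) ⊆ Ann d :=
    fun a j => (tsupport_mul_subset_right).trans ((tsupport_dY_subset _).trans hs)
  have c1 : ∀ j, CcSmooth fun z => χ z * dY (bas d j) N z := fun j =>
    hχ.mul_smooth (hN.dY _).smooth
  have c2 : ∀ j, CcSmooth fun z => N z * dY (bas d j) χ z := fun j =>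
    hN.mul_smooth (hχ.dY _).smooth
  have c3 : ∀ j, CcSmooth fun z => χ z * dY (bas d j) (dY (bas d j) N) z := fun j =>
    hχ.mul_smooth ((hN.dY _).dY _).smooth
  have c4 : ∀ j, CcSmooth fun z => N z * dY (bas d j) (dY (bas d j) χ) z := fun j =>
    hN.mul_smooth ((hχ.dY _).dY _).smooth
  have key : ∀ j, (∫ z, ‖z.2‖⁻¹ * G (lift z) j * (χ z * dY (bas d j) N z)) -
      ∫ z, ‖z.2‖⁻¹ * G (lift z) j * (N z * dY (bas d j) χ z) =
      -((∫ z, u (lift z) * (χ z * dY (bas d j) (dY (bas d j) N) z)) -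
        ∫ z, u (lift z) * (N z * dY (bas d j) (dY (bas d j) χ) z)) := by
    intro j
    have h := sol.lift_gradient ((c1 j).sub (c2 j))
      ((tsupport_sub _ _).trans (union_subset (hsl _) (hsr _ _))) j
    rw [← integral_sub (sol.integrable_G (c1 j) (hsl _) j) (sol.integrable_G (c2 j) (hsr _ _) j),
      ← integral_sub (sol.integrable_u (c3 j)) (sol.integrable_u (c4 j))]
    refine (integral_congr_ae ?_).trans (h.trans (congrArg Neg.neg (integral_congr_ae ?_)))
    · exact Filter.Eventually.of_forall fun z => by ring
    · refine Filter.Eventually.of_forall fun z => ?_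
      simp only
      rw [dY_sub (c1 j).differentiable (c2 j).differentiable,
        dY_mul hχ.differentiable (hN.dY _).differentiable,
        dY_mul hN.differentiable (hχ.dY _).differentiable]
      ring
  have e1 : ∫ z, χ z * u (lift z) * lapY N z =
      ∑ j, ∫ z, u (lift z) * (χ z * dY (bas d j) (dY (bas d j) N) z) := by
    rw [← integral_finsetSum _ fun j _ => sol.integrable_u (c3 j)]
    refine integral_congr_ae (Filter.Eventually.of_forall fun z => ?_)
    simp only [lapY, Finset.mul_sum]
    exact Finset.sum_congr rfl fun j _ => by ring
  have e2 : ∫ z, ∑ j, χ z * (‖z.2‖⁻¹ * G (lift z) j) * dY (bas d j) N z =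
      ∑ j, ∫ z, ‖z.2‖⁻¹ * G (lift z) j * (χ z * dY (bas d j) N z) := by
    rw [← integral_finsetSum _ fun j _ => sol.integrable_G (c1 j) (hsl _) j]
    refine integral_congr_ae (Filter.Eventually.of_forall fun z => ?_)
    exact Finset.sum_congr rfl fun j _ => by ring
  have e3 : ∫ z, locJ χ u G z * N z =
      (∑ j, ∫ z, ‖z.2‖⁻¹ * G (lift z) j * (N z * dY (bas d j) χ z)) +
        ∑ j, ∫ z, u (lift z) * (N z * dY (bas d j) (dY (bas d j) χ) z) := by
    rw [← integral_finsetSum _ fun j _ => sol.integrable_G (c2 j) (hsr _ _) j,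
      ← integral_finsetSum _ fun j _ => sol.integrable_u (c4 j),
      ← integral_add (integrable_finsetSum _ fun j _ => sol.integrable_G (c2 j) (hsr _ _) j)
        (integrable_finsetSum _ fun j _ => sol.integrable_u (c4 j))]
    refine integral_congr_ae (Filter.Eventually.of_forall fun z => ?_)
    simp only [locJ, lapY, add_mul, Finset.mul_sum, Finset.sum_mul]
    congr 1
    · exact Finset.sum_congr rfl fun j _ => by ring
    · exact Finset.sum_congr rfl fun j _ => by ring
  have ks := Finset.sum_congr rfl fun j (_ : j ∈ Finset.univ) => key j
  simp only [Finset.sum_neg_distrib, Finset.sum_sub_distrib] at ks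
  rw [e1, e2, e3]
  linarith

/-- The lifted equation is tested with `χ N`. All derivatives that fall on `χ` multiply `N` itself
and are moved to the right-hand side `locF`. -/
lemma cutoff_equation (sol : SphereSolution d ε σ u l f G) (hχ : CcSmooth χ)
    (hs : tsupport χ ⊆ Ann d) (hN : CcSmooth N) :
    ε ^ 2 * (∫ z, ∑ j, σ z.1 * ‖z.2‖ ^ 3 * (χ z * (‖z.2‖⁻¹ * G (lift z) j)) * dY (bas d j) N z) -
      ∫ z, χ z * u (lift z) * trans N z = ∫ z, locF ε σ χ u l f G z * N z := by
  have hsm : tsupport (fun z => χ z * N z) ⊆ Ann d := (tsupport_mul_subset_left).trans hs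
  have h := sol.lift_equation (hχ.mul_smooth hN.smooth) hsm
  have c1 : ∀ j, CcSmooth fun z => χ z * dY (bas d j) N z := fun j =>
    hχ.mul_smooth (hN.dY _).smooth
  have c2 : ∀ j, CcSmooth fun z => N z * dY (bas d j) χ z := fun j =>
    hN.mul_smooth (hχ.dY _).smooth
  have i1 := integrable_finsetSum Finset.univ fun j _ => sol.integrable_σG (c1 j) j
  have i2 := integrable_finsetSum Finset.univ fun j _ => sol.integrable_σG (c2 j) j
  have i3 := sol.integrable_u (hχ.mul_smooth hN.trans.smooth)
  have i4 := sol.integrable_u (hN.mul_smooth hχ.trans.smooth)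
  have i5 : Integrable (fun z => ‖z.2‖ * (f (lift z) - l (lift z)) * (χ z * N z)) volume := by
    have hc := hχ.mul_smooth hN.smooth
    exact (hc.integrable_lift_mul (sol.memf.sub sol.meml) (k := fun z => ‖z.2‖) (by fun_prop)
      (B := 2) (fun z hz => by simpa using (hsm (subset_tsupport _ hz)).2.2.le)).congr
        (Filter.Eventually.of_forall fun z => by simp only [Pi.sub_apply]; ring)
  have e1 : ∫ z, ∑ j, σ z.1 * ‖z.2‖ ^ 3 * (‖z.2‖⁻¹ * G (lift z) j) *
      dY (bas d j) (fun z => χ z * N z) z =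
      (∫ z, ∑ j, σ z.1 * ‖z.2‖ ^ 3 * (‖z.2‖⁻¹ * G (lift z) j) * (χ z * dY (bas d j) N z)) +
      ∫ z, ∑ j, σ z.1 * ‖z.2‖ ^ 3 * (‖z.2‖⁻¹ * G (lift z) j) * (N z * dY (bas d j) χ z) := by
    rw [← integral_add i1 i2]
    refine integral_congr_ae (Filter.Eventually.of_forall fun z => ?_)
    simp only [dY_mul hχ.differentiable hN.differentiable, mul_add, Finset.sum_add_distrib]
  have e2 : ∫ z, u (lift z) * trans (fun z => χ z * N z) z =
      (∫ z, u (lift z) * (χ z * trans N z)) + ∫ z, u (lift z) * (N z * trans χ z) := by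
    rw [← integral_add i3 i4]
    refine integral_congr_ae (Filter.Eventually.of_forall fun z => ?_)
    simp only [trans, dX_mul hχ.differentiable hN.differentiable, mul_add, Finset.sum_add_distrib,
      Finset.mul_sum]
    congr 1 <;> exact Finset.sum_congr rfl fun j _ => by ring
  have e3 : ∫ z, locF ε σ χ u l f G z * N z =
      (∫ z, ‖z.2‖ * (f (lift z) - l (lift z)) * (χ z * N z)) +
        (∫ z, u (lift z) * (N z * trans χ z)) - ε ^ 2 *
      ∫ z, ∑ j, σ z.1 * ‖z.2‖ ^ 3 * (‖z.2‖⁻¹ * G (lift z) j) * (N z * dY (bas d j) χ z) := by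
    have i6 : Integrable (fun z => ‖z.2‖ * (f (lift z) - l (lift z)) * (χ z * N z) +
        u (lift z) * (N z * trans χ z)) volume := i5.add i4
    rw [← integral_const_mul, ← integral_add i5 i4, ← integral_sub i6 (i2.const_mul _)]
    refine integral_congr_ae (Filter.Eventually.of_forall fun z => ?_)
    simp only [locF, sub_mul, add_mul, Finset.mul_sum, Finset.sum_mul]
    congr 1
    · ring
    · exact Finset.sum_congr rfl fun j _ => by ring
  have e4 : ∫ z, ∑ j, σ z.1 * ‖z.2‖ ^ 3 * (χ z * (‖z.2‖⁻¹ * G (lift z) j)) * dY (bas d j) N z =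
      ∫ z, ∑ j, σ z.1 * ‖z.2‖ ^ 3 * (‖z.2‖⁻¹ * G (lift z) j) * (χ z * dY (bas d j) N z) :=
    integral_congr_ae (Filter.Eventually.of_forall fun z =>
      Finset.sum_congr rfl fun j _ => by ring)
  have e5 : ∫ z, χ z * u (lift z) * trans N z = ∫ z, u (lift z) * (χ z * trans N z) :=
    integral_congr_ae (Filter.Eventually.of_forall fun z => by ring)
  rw [e1, e2] at h
  rw [e3, e4, e5, ← h]
  ring

/-- The dominating function `h` is a constant times the lift of `weight`, which carries `G` only as
`ε² |G|`. This matches every occurrence of `G` in the flat equation and keeps the constant uniform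
for `ε ≤ ε₀`; outside `O` the datum `f` does not enter. -/
lemma flatSolution (sol : SphereSolution d ε σ u l f G) (hσ : SigmaBounds d σ₀ M σ)
    (hσ₀ : 0 < σ₀) (hε : 0 < ε) (hεε : ε ≤ ε₀) (hl : ∀ p, |l p| ≤ M * |u p|)
    {O : Set (E d × S d)} (hO : MeasurableSet O) {z₀ : E d × E d} (hz₀ : ‖z₀.2‖ = 1) {R B : ℝ}
    (hR : 0 < R) (hR' : 320 * M * R ≤ σ₀) (hA : Metric.closedBall z₀ (2 * R) ⊆ Ann d)
    (hO' : ∀ z ∈ Metric.closedBall z₀ (2 * R), lift z ∈ O) (hχ : CcSmooth χ)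
    (hs : tsupport χ ⊆ Metric.closedBall z₀ R) (hχ1 : ∀ z, |χ z| ≤ 1)
    (hχY : ∀ j z, |dY (bas d j) χ z| ≤ B) (hχT : ∀ z, |trans χ z| ≤ B)
    (hχL : ∀ z, |lapY χ z| ≤ B) :
    ∃ h : E d × E d → ℝ, l2 h volume ≤
      (2 + 2 * M + B + 16 * M * (d + 1) * B + 2 * (d + 1) * B + ε₀ ^ 2 * B) *
        (Real.sqrt (rad d {r | (r : ℝ) ≤ 2}).toReal * l2 (weight ε O u f G) (dxdθ d)) ∧
      FlatSolution d ε (σ z₀.1) (8 * M) (20 * M) z₀ R (2 * R) (fun z => σ z.1 * ‖z.2‖ ^ 3)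
        (fun z => χ z * u (lift z)) (locF ε σ χ u l f G) (locJ χ u G) h
        fun j z => χ z * (‖z.2‖⁻¹ * G (lift z) j) := by
  have hz₀m : z₀ ∈ Ann d := hA (Metric.mem_closedBall_self (by positivity))
  have hM : 0 ≤ M := (hσ₀.le.trans (hσ.lower _ hz₀m.1)).trans (hσ.upper _ hz₀m.1)
  have hB0 : 0 ≤ B := (abs_nonneg _).trans (hχT 0)
  have hw : MemLp (weight ε O u f G) 2 (dxdθ d) :=
    ((sol.memf.norm.indicator hO).add sol.memu.norm).add (sol.memG.norm.const_mul _)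
  set w := hw.1.mk with hwd
  have hae : ∀ᵐ p ∂dxdθ d, weight ε O u f G p = w p := hw.1.ae_eq_mk
  have hwm : Measurable w := hw.1.stronglyMeasurable_mk.measurable
  have hw' : MemLp w 2 (dxdθ d) := (memLp_congr_ae hae).1 hw
  set c := 2 + 2 * M + B + 16 * M * (d + 1) * B + 2 * (d + 1) * B + ε₀ ^ 2 * B with hc
  have hc0 : 0 ≤ c := by positivity
  set h : E d × E d → ℝ := fun z => c *
    ({z : E d × E d | ‖z.2‖ ≤ 2}.indicator (fun z => w (lift z))) z with hh
  have hmem : MemLp h 2 volume := (memLp_lift hw' 2).const_mul c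
  have hhm : Measurable h := ((hwm.comp measurable_lift).indicator
    (measurableSet_le (by fun_prop) measurable_const)).const_mul c
  -- The real number `r` is quantified inside the almost-everywhere statement, so that one null set,
  -- from the measurable representative `w`, serves all the bounds that follow.
  have hbd : ∀ᵐ z, ∀ r : ℝ, (z ∉ Metric.closedBall z₀ R → r = 0) →
      (z ∈ Metric.closedBall z₀ R → |r| ≤ c * (|f (lift z)| + |u (lift z)| +
        ε ^ 2 * ‖G (lift z)‖)) → |r| ≤ h z := by
    filter_upwards [quasiMeasurePreserving_lift.ae hae] with z hz r h1 h2
    by_cases hzB : z ∈ Metric.closedBall z₀ R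
    · have hz2 := Metric.closedBall_subset_closedBall (by linarith : R ≤ 2 * R) hzB
      refine (h2 hzB).trans (le_of_eq ?_)
      have hm : z ∈ {z : E d × E d | ‖z.2‖ ≤ 2} := (hA hz2).2.2.le
      simp only [hh, indicator_of_mem hm, ← hz, weight, indicator_of_mem (hO' z hz2)]
    · rw [h1 hzB, abs_zero]
      simp only [hh]
      refine mul_nonneg hc0 ?_
      by_cases hm : z ∈ {z : E d × E d | ‖z.2‖ ≤ 2}
      · rw [indicator_of_mem hm, ← hz, weight]
        have : 0 ≤ O.indicator (fun p => |f p|) (lift z) :=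
          indicator_nonneg (fun p _ => abs_nonneg _) _
        positivity
      · rw [indicator_of_notMem hm]
  have z0 : ∀ z, z ∉ Metric.closedBall z₀ R → χ z = 0 := fun z hz =>
    image_eq_zero_of_notMem_tsupport fun hm => hz (hs hm)
  have zY : ∀ j z, z ∉ Metric.closedBall z₀ R → dY (bas d j) χ z = 0 := fun j z hz =>
    image_eq_zero_of_notMem_tsupport fun hm => hz (hs (tsupport_dY_subset _ hm))
  have zT : ∀ z, z ∉ Metric.closedBall z₀ R → trans χ z = 0 := fun z hz =>
    Finset.sum_eq_zero fun j _ => by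
      have : dX (bas d j) χ z = 0 := image_eq_zero_of_notMem_tsupport fun hm =>
        hz (hs (tsupport_fderiv_apply_subset ℝ _ hm))
      rw [this, mul_zero]
  have zL : ∀ z, z ∉ Metric.closedBall z₀ R → lapY χ z = 0 := fun z hz =>
    Finset.sum_eq_zero fun j _ => image_eq_zero_of_notMem_tsupport fun hm =>
      hz (hs (tsupport_dY_subset _ (tsupport_dY_subset _ hm)))
  have mlift : ∀ {w : E d × FokkerPlanck.S d → ℝ}, AEStronglyMeasurable w (dxdθ d) →
      AEStronglyMeasurable (fun z => w (lift z)) volume := fun hw =>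
    hw.comp_quasiMeasurePreserving quasiMeasurePreserving_lift
  have mu := mlift sol.memu.1
  have mf := mlift sol.memf.1
  have ml := mlift sol.meml.1
  have mG := fun j => mlift (sol.memG_apply j).1
  have mχ := hχ.continuous.aestronglyMeasurable (μ := (volume : Measure (E d × E d)))
  have mχY := fun j => (hχ.dY (bas d j)).continuous.aestronglyMeasurable
    (μ := (volume : Measure (E d × E d)))
  have mχT := hχ.trans.continuous.aestronglyMeasurable (μ := (volume : Measure (E d × E d)))
  have mχL := hχ.lapY.continuous.aestronglyMeasurable (μ := (volume : Measure (E d × E d)))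
  have mn : AEStronglyMeasurable (fun z : E d × E d => ‖z.2‖) volume := by fun_prop
  have mi : AEStronglyMeasurable (fun z : E d × E d => ‖z.2‖⁻¹) volume :=
    (by fun_prop : Measurable fun z : E d × E d => ‖z.2‖⁻¹).aestronglyMeasurable
  have mb : AEStronglyMeasurable (fun z : E d × E d => σ z.1 * ‖z.2‖ ^ 3) volume := by
    have := sol.continuous_σ
    exact (by fun_prop : Continuous fun z : E d × E d => σ z.1 * ‖z.2‖ ^ 3).aestronglyMeasurable
  have bi : ∀ z ∈ Metric.closedBall z₀ (2 * R), ‖z.2‖⁻¹ ≤ 2 := fun z hz =>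
    inv_le_of_inv_le₀ (by norm_num) (by linarith [(hA hz).2.1])
  have bb : ∀ z ∈ Metric.closedBall z₀ (2 * R), |σ z.1 * ‖z.2‖ ^ 3| ≤ 8 * M := fun z hz => by
    have h1 := hσ.lower _ (hA hz).1
    rw [abs_of_nonneg (mul_nonneg (hσ₀.le.trans h1) (by positivity))]
    calc σ z.1 * ‖z.2‖ ^ 3 ≤ M * 2 ^ 3 := by
          gcongr
          · exact hσ.upper _ (hA hz).1
          · exact (hA hz).2.2.le
      _ = _ := by ring
  have bG : ∀ j z, |G (lift z) j| ≤ ‖G (lift z)‖ := fun j z =>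
    PiLp.norm_apply_le (G (lift z)) j
  have bGi : ∀ j, ∀ z ∈ Metric.closedBall z₀ (2 * R),
      |‖z.2‖⁻¹ * G (lift z) j| ≤ 2 * ‖G (lift z)‖ := fun j z hz => by
    rw [abs_mul, abs_of_nonneg (by positivity : 0 ≤ ‖z.2‖⁻¹)]
    gcongr
    · exact bi z hz
    · exact bG j z
  have hRR : Metric.closedBall z₀ R ⊆ Metric.closedBall z₀ (2 * R) :=
    Metric.closedBall_subset_closedBall (by linarith)
  have t1 : 0 ≤ M * ((d : ℝ) + 1) * B := by positivity
  have t2 : 0 ≤ ((d : ℝ) + 1) * B := by positivity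
  have t3 : 0 ≤ ε₀ ^ 2 * B := by positivity
  have leV : ∀ᵐ z, |χ z * u (lift z)| ≤ h z := by
    filter_upwards [hbd] with z hz
    refine hz _ (fun hzB => by rw [z0 z hzB, zero_mul]) fun hzB => ?_
    calc |χ z * u (lift z)| ≤ 1 * |u (lift z)| := by
          rw [abs_mul]; gcongr; exact hχ1 z
      _ ≤ c * (|f (lift z)| + |u (lift z)| + ε ^ 2 * ‖G (lift z)‖) := by
          refine mul_le_mul (by linarith) ?_ (abs_nonneg _) hc0
          have : 0 ≤ ε ^ 2 * ‖G (lift z)‖ := by positivity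
          linarith [abs_nonneg (f (lift z))]
  have leH : ∀ j, ∀ᵐ z, |ε ^ 2 * (χ z * (‖z.2‖⁻¹ * G (lift z) j))| ≤ h z := fun j => by
    filter_upwards [hbd] with z hz
    refine hz _ (fun hzB => by rw [z0 z hzB]; ring) fun hzB => ?_
    calc |ε ^ 2 * (χ z * (‖z.2‖⁻¹ * G (lift z) j))| ≤ ε ^ 2 * (1 * (2 * ‖G (lift z)‖)) := by
          rw [abs_mul, abs_mul, abs_of_nonneg (sq_nonneg ε)]
          gcongr
          · exact hχ1 z
          · exact bGi j z (hRR hzB)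
      _ = 2 * (ε ^ 2 * ‖G (lift z)‖) := by ring
      _ ≤ c * (|f (lift z)| + |u (lift z)| + ε ^ 2 * ‖G (lift z)‖) := by
          refine mul_le_mul (by linarith) ?_ (by positivity) hc0
          linarith [abs_nonneg (f (lift z)), abs_nonneg (u (lift z))]
  have sum_le : ∀ {a : Fin (d + 1) → ℝ} {A : ℝ}, (∀ j, |a j| ≤ A) → |∑ j, a j| ≤ (d + 1) * A := by
    intro a A ha
    refine (Finset.abs_sum_le_sum_abs _ _).trans ((Finset.sum_le_sum fun j _ => ha j).trans ?_)
    simp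
  have leJ : ∀ᵐ z, |ε ^ 2 * locJ χ u G z| ≤ h z := by
    filter_upwards [hbd] with z hz
    refine hz _ (fun hzB => by simp [locJ, zY _ z hzB, zL z hzB]) fun hzB => ?_
    have b1 := sum_le (a := fun j => ‖z.2‖⁻¹ * G (lift z) j * dY (bas d j) χ z)
      (A := 2 * ‖G (lift z)‖ * B) fun j => by
        rw [abs_mul]
        exact mul_le_mul (bGi j z (hRR hzB)) (hχY j z) (abs_nonneg _) (by positivity)
    have b2 : |u (lift z) * lapY χ z| ≤ |u (lift z)| * B := by
      rw [abs_mul]; gcongr; exact hχL z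
    calc |ε ^ 2 * locJ χ u G z| ≤
          ε ^ 2 * ((d + 1) * (2 * ‖G (lift z)‖ * B) + |u (lift z)| * B) := by
          rw [abs_mul, abs_of_nonneg (sq_nonneg ε)]
          gcongr
          exact (abs_add_le _ _).trans (add_le_add b1 b2)
      _ = (2 * (d + 1) * B) * (ε ^ 2 * ‖G (lift z)‖) + ε ^ 2 * B * |u (lift z)| := by ring
      _ ≤ c * (ε ^ 2 * ‖G (lift z)‖) + c * |u (lift z)| := by
          have : ε ^ 2 * B ≤ ε₀ ^ 2 * B := by gcongr
          gcongr <;> linarith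
      _ ≤ c * (|f (lift z)| + |u (lift z)| + ε ^ 2 * ‖G (lift z)‖) := by
          have : 0 ≤ c * |f (lift z)| := by positivity
          linarith
  have leF : ∀ᵐ z, |locF ε σ χ u l f G z| ≤ h z := by
    filter_upwards [hbd] with z hz
    refine hz _ (fun hzB => by simp [locF, zY _ z hzB, zT z hzB, z0 z hzB]) fun hzB => ?_
    have b1 : |‖z.2‖ * (f (lift z) - l (lift z)) * χ z| ≤
        2 * (|f (lift z)| + M * |u (lift z)|) * 1 := by
      rw [abs_mul, abs_mul, abs_of_nonneg (norm_nonneg z.2)]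
      gcongr
      · exact (hA (hRR hzB)).2.2.le
      · exact (abs_sub _ _).trans (add_le_add le_rfl (hl _))
      · exact hχ1 z
    have b2 : |u (lift z) * trans χ z| ≤ |u (lift z)| * B := by
      rw [abs_mul]; gcongr; exact hχT z
    have b3 := sum_le (a := fun j => σ z.1 * ‖z.2‖ ^ 3 * (‖z.2‖⁻¹ * G (lift z) j) *
        dY (bas d j) χ z) (A := 8 * M * (2 * ‖G (lift z)‖) * B) fun j => by
        rw [abs_mul, abs_mul]
        exact mul_le_mul (mul_le_mul (bb z (hRR hzB)) (bGi j z (hRR hzB)) (abs_nonneg _)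
          (by positivity)) (hχY j z) (abs_nonneg _) (by positivity)
    have b4 := mul_le_mul_of_nonneg_left b3 (sq_nonneg ε)
    rw [← abs_of_nonneg (sq_nonneg ε), ← abs_mul, abs_of_nonneg (sq_nonneg ε)] at b4
    calc |locF ε σ χ u l f G z| ≤ 2 * (|f (lift z)| + M * |u (lift z)|) * 1 + |u (lift z)| * B +
          ε ^ 2 * ((d + 1) * (8 * M * (2 * ‖G (lift z)‖) * B)) :=
          (abs_sub _ _).trans (add_le_add ((abs_add_le _ _).trans (add_le_add b1 b2)) b4)
      _ = 2 * |f (lift z)| + (2 * M + B) * |u (lift z)| +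
          (16 * M * (d + 1) * B) * (ε ^ 2 * ‖G (lift z)‖) := by ring
      _ ≤ c * |f (lift z)| + c * |u (lift z)| + c * (ε ^ 2 * ‖G (lift z)‖) := by
          gcongr <;> linarith
      _ = _ := by ring
  have mem : ∀ {a : E d × E d → ℝ}, AEStronglyMeasurable a volume → (∀ᵐ z, |a z| ≤ h z) →
      MemLp a 2 volume := fun ha hb => hmem.mono ha (by
        filter_upwards [hb] with z hz
        exact hz.trans (le_abs_self _))
  have memε : ∀ {a : E d × E d → ℝ}, AEStronglyMeasurable a volume →
      (∀ᵐ z, |ε ^ 2 * a z| ≤ h z) → MemLp a 2 volume := fun {a} ha hb => by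
    have := (mem (ha.const_mul (ε ^ 2)) hb).const_mul (ε ^ 2)⁻¹
    refine (memLp_congr_ae (Filter.Eventually.of_forall fun z => ?_)).1 this
    field_simp
  have mH : ∀ j, AEStronglyMeasurable (fun z => χ z * (‖z.2‖⁻¹ * G (lift z) j)) volume :=
    fun j => mχ.mul (mi.mul (mG j))
  have mJ : AEStronglyMeasurable (locJ χ u G) volume := by
    unfold locJ
    exact (Finset.aestronglyMeasurable_fun_sum _ fun j _ => (mi.mul (mG j)).mul (mχY j)).add
      (mu.mul mχL)
  have mF : AEStronglyMeasurable (locF ε σ χ u l f G) volume := by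
    unfold locF
    exact (((mn.mul (mf.sub ml)).mul mχ).add (mu.mul mχT)).sub
      ((Finset.aestronglyMeasurable_fun_sum _ fun j _ =>
        (mb.mul (mi.mul (mG j))).mul (mχY j)).const_mul _)
  have memH := fun j => memε (mH j) (leH j)
  have abs_ε : ∀ a : ℝ, |ε ^ 2 * a| = ε ^ 2 * |a| := fun a => by
    rw [abs_mul, abs_of_nonneg (sq_nonneg ε)]
  simp only [abs_ε] at leH leJ
  refine ⟨h, ?_, ?_⟩
  · have e := l2_const_mul (μ := (volume : Measure (E d × E d))) c
      ({z : E d × E d | ‖z.2‖ ≤ 2}.indicator (fun z => w (lift z)))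
    simp only [smul_eq_mul] at e
    rw [hh, e, abs_of_nonneg hc0]
    have e2 : l2 (weight ε O u f G) (dxdθ d) = l2 w (dxdθ d) := by
      unfold l2
      congr 1
      refine integral_congr_ae ?_
      filter_upwards [hae] with p hp
      rw [hp]
    rw [e2]
    gcongr
    exact l2_lift_le hw' 2
  · exact {
      lt := by linarith
      b_le := bb
      -- The frozen value is `σ(z₀.1)` because `|z₀.2| = 1`. The smallness is `8 · 20 M · 2 R = 320
      -- M R ≤ σ₀`.
      b_osc := fun z hz => by
        have h1 := hσ.abs_sub_le hσ₀ (hA hz) hz₀m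
        rw [hz₀, one_pow, mul_one] at h1
        have h2 : ‖z - z₀‖ ≤ 2 * R := by rw [← dist_eq_norm]; exact hz
        have h3 := mul_le_mul_of_nonneg_left h2 (by positivity : 0 ≤ 20 * M)
        have h4 := hσ.lower _ hz₀m.1
        linarith
      b_lip := fun z hz t ht => hσ.abs_sub_le hσ₀ (hA hz) (hA ht)
      memV := mem (mχ.mul mu) leV
      memF := mem mF leF
      memJ := memε mJ (by simpa only [abs_ε] using leJ)
      memH := memH
      membH := fun j => by
        refine ((memH j).const_mul (8 * M)).mono (mb.mul (mH j)) (Filter.Eventually.of_forall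
          fun z => ?_)
        by_cases hzB : z ∈ Metric.closedBall z₀ R
        · rw [norm_mul, norm_mul (8 * M), Real.norm_of_nonneg (by positivity : 0 ≤ 8 * M)]
          gcongr
          exact bb z (hRR hzB)
        · simp [z0 z hzB]
      meas := hhm
      memh := hmem
      suppV := fun z hz => by rw [z0 z hz, zero_mul]
      suppH := fun j z hz => by rw [z0 z hz, zero_mul]
      leV := leV
      leF := leF
      leJ := leJ
      leH := leH
      gradient := fun N hN => sol.cutoff_gradient hχ
        (hs.trans (hRR.trans hA)) hN
      equation := fun N hN => sol.cutoff_equation hχ (hs.trans (hRR.trans hA)) hN }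

end SphereSolution

end Localize

/-! ### Extending a test function from the sphere -/

section Extension
variable {d : ℕ}

/-- The extension of `Φ` that is homogeneous of degree `0` in `y`, times a radial cutoff. -/
def rext (ρ : ℝ → ℝ) (Φ : E d × E d → ℝ) (z : E d × E d) : ℝ :=
  ρ (‖z.2‖ ^ 2) * Φ (z.1, ‖z.2‖⁻¹ • z.2)

/-- Smooth radial cutoff functions, with support near `1`. -/
structure RadialCutoff (ρ : ℝ → ℝ) : Prop where
  smooth : ContDiff ℝ ∞ ρ
  supp : ∀ s, ρ s ≠ 0 → |s - 1| < 3 / 4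

variable {ρ : ℝ → ℝ} {Φ : E d × E d → ℝ}

/-- The homogeneous extension is singular only at `y = 0`, and `ρ(|y|²)` vanishes near that point.
-/
lemma CcSmooth.rext (hρ : RadialCutoff ρ) (hΦ : CcSmooth Φ) :
    CcSmooth (FokkerPlanck.rext ρ Φ) where
  smooth := by
    rw [contDiff_iff_contDiffAt]
    intro z
    have hn : ContDiffAt ℝ ∞ (fun z : E d × E d => ρ (‖z.2‖ ^ 2)) z :=
      (hρ.smooth.comp (contDiff_snd.norm_sq ℝ)).contDiffAt
    by_cases hz : z.2 = 0
    · have : FokkerPlanck.rext ρ Φ =ᶠ[nhds z] fun _ => 0 := by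
        have h1 : ∀ᶠ w in nhds z, ‖w.2‖ < 1 / 2 :=
          (continuous_snd.norm.continuousAt (x := z)).eventually_lt continuousAt_const
            (by rw [hz]; norm_num)
        filter_upwards [h1] with w hw
        unfold FokkerPlanck.rext
        by_contra h
        have := hρ.supp _ (left_ne_zero_of_mul h)
        rw [abs_lt] at this
        nlinarith [norm_nonneg w.2]
      exact contDiffAt_const.congr_of_eventuallyEq this
    · have hnorm : ContDiffAt ℝ ∞ (fun z : E d × E d => ‖z.2‖) z :=
        contDiffAt_snd.norm ℝ hz
      have : ContDiffAt ℝ ∞ (fun z : E d × E d => (z.1, ‖z.2‖⁻¹ • z.2)) z :=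
        contDiffAt_fst.prodMk ((hnorm.inv (norm_ne_zero_iff.2 hz)).smul contDiffAt_snd)
      exact hn.mul (hΦ.smooth.contDiffAt.comp z this)
  compact := by
    refine HasCompactSupport.intro
      ((hΦ.compact.isCompact.image continuous_fst).prod (isCompact_closedBall (0 : E d) 2))
      fun z hz => ?_
    by_contra h
    refine hz ⟨⟨_, subset_tsupport _ (right_ne_zero_of_mul h), rfl⟩, ?_⟩
    have := hρ.supp _ (left_ne_zero_of_mul h)
    rw [abs_lt] at this
    rw [mem_closedBall_zero_iff]
    nlinarith [norm_nonneg z.2]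

lemma normalize_pol (q : (E d × S d) × Ioi (0 : ℝ)) : ‖(pol q).2‖⁻¹ • (pol q).2 = (q.1.2 : E d) := by
  have hr : (q.2 : ℝ) ≠ 0 := (show (0 : ℝ) < q.2 from q.2.2).ne'
  rw [norm_pol, pol, smul_smul, inv_mul_cancel₀ hr, one_smul]

lemma rext_pol (q : (E d × S d) × Ioi (0 : ℝ)) :
    rext ρ Φ (pol q) = ρ ((q.2 : ℝ) ^ 2) * Φ (q.1.1, (q.1.2 : E d)) := by
  rw [rext, normalize_pol, norm_pol, pol]

lemma dX_eq_fderiv (hΦ : Differentiable ℝ Φ) (v x y : E d) :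
    dX v Φ (x, y) = fderiv ℝ (fun x => Φ (x, y)) x v := by
  have h : HasFDerivAt (fun z => Φ (z, y))
      ((fderiv ℝ Φ (x, y)).comp (ContinuousLinearMap.inl ℝ (E d) (E d))) x :=
    (hΦ (x, y)).hasFDerivAt.comp x (hasFDerivAt_prodMk_left x y)
  rw [h.fderiv]
  rfl

lemma dY_eq_fderiv (hΦ : Differentiable ℝ Φ) (v x y : E d) :
    dY v Φ (x, y) = fderiv ℝ (fun y => Φ (x, y)) y v := by
  rw [(hasFDerivAt_slice hΦ x y).fderiv]
  rfl

/-- The radial cutoff is constant in `x`; the factor `r` is the length of `y` in `y · ∇ₓ`. -/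
lemma trans_rext_pol (hρ : RadialCutoff ρ) (hΦ : CcSmooth Φ) (q : (E d × S d) × Ioi (0 : ℝ)) :
    trans (rext ρ Φ) (pol q) = transport d Φ q.1.1 q.1.2 * (ρ ((q.2 : ℝ) ^ 2) * q.2) := by
  have h : ∀ v, dX v (rext ρ Φ) (pol q) = ρ ((q.2 : ℝ) ^ 2) * dX v Φ (q.1.1, (q.1.2 : E d)) := by
    intro v
    change dX v (rext ρ Φ) ((pol q).1, (pol q).2) = _
    rw [dX_eq_fderiv (hΦ.rext hρ).differentiable, dX_eq_fderiv hΦ.differentiable]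
    simp only [rext]
    rw [normalize_pol, norm_pol, fderiv_const_mul]
    · rfl
    · exact (hΦ.slice _).differentiable _
  rw [transport_eq hΦ.differentiable]
  simp only [trans, h, Finset.sum_mul]
  exact Finset.sum_congr rfl fun j _ => by simp [pol]; ring

/-- The multiplier acts in `x` alone, so a factor that depends on `|y|` passes through it. -/
lemma bes_rext_pol (q : (E d × S d) × Ioi (0 : ℝ)) :
    bes (rext ρ Φ) (pol q) =
      besselD d (2 / 3) (fun x => Φ (x, (q.1.2 : E d))) q.1.1 * ρ ((q.2 : ℝ) ^ 2) := by
  have e : bes (rext ρ Φ) (pol q) = ρ ((q.2 : ℝ) ^ 2) * bes Φ (q.1.1, (q.1.2 : E d)) := by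
    have hp : ∀ k, pF (rext ρ Φ) k (pol q).2 = (ρ ((q.2 : ℝ) ^ 2) : ℂ) * pF Φ k (q.1.2 : E d) := by
      intro k
      rw [pF_eq, pF_eq, ← integral_const_mul]
      refine integral_congr_ae (Filter.Eventually.of_forall fun x => ?_)
      simp only [rext, normalize_pol]
      simp only [norm_pol, Circle.smul_def, smul_eq_mul]
      push_cast
      ring
    rw [bes_eq_integral, bes_eq_integral]
    simp only [hp]
    rw [← Complex.re_ofReal_mul, ← integral_const_mul]
    congr 1
    refine integral_congr_ae (Filter.Eventually.of_forall fun k => ?_)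
    simp only [Circle.smul_def, smul_eq_mul, pol]
    ring
  rw [e, mul_comm]
  rfl

lemma dY_radial {g : ℝ → ℝ} (hg : Differentiable ℝ g) (v : E d) (z : E d × E d) :
    dY v (fun z => g (‖z.2‖ ^ 2)) z = 2 * deriv g (‖z.2‖ ^ 2) * ⟪z.2, v⟫ := by
  have h1 : HasFDerivAt (fun z : E d × E d => ‖z.2‖ ^ 2)
      ((2 • innerSL ℝ z.2).comp (ContinuousLinearMap.snd ℝ (E d) (E d))) z :=
    (hasStrictFDerivAt_norm_sq z.2).hasFDerivAt.comp z hasFDerivAt_snd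
  have h2 : HasFDerivAt (fun z : E d × E d => g (‖z.2‖ ^ 2)) _ z :=
    (hg (‖z.2‖ ^ 2)).hasDerivAt.comp_hasFDerivAt z h1
  rw [dY, h2.fderiv]
  simp
  ring

/-- The radial profile of `Δ (ρ(|y|²))`, as a function of `|y|²`. -/
def radLap (d : ℕ) (ρ : ℝ → ℝ) (s : ℝ) : ℝ := 4 * s * deriv (deriv ρ) s + 2 * (d + 1) * deriv ρ s

lemma lapY_eq_laplacian (hΦ : CcSmooth Φ) (x y : E d) :
    lapY Φ (x, y) = Laplacian.laplacian (fun y => Φ (x, y)) y := by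
  rw [InnerProductSpace.laplacian_eq_iteratedFDeriv_orthonormalBasis _
    (EuclideanSpace.basisFun (Fin (d + 1)) ℝ)]
  refine Finset.sum_congr rfl fun j _ => ?_
  rw [iteratedFDeriv_two_apply, dY_eq_fderiv (hΦ.dY _).differentiable]
  have hb : EuclideanSpace.basisFun (Fin (d + 1)) ℝ j = bas d j := by simp [bas]
  have e : (fun y => dY (bas d j) Φ (x, y)) = fun y => fderiv ℝ (fun y => Φ (x, y)) y (bas d j) :=
    funext fun y => dY_eq_fderiv hΦ.differentiable _ _ _
  have hs : ContDiff ℝ ∞ fun y => Φ (x, y) := hΦ.smooth.comp (by fun_prop)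
  have hd : DifferentiableAt ℝ (fderiv ℝ fun y => Φ (x, y)) y :=
    (hs.fderiv_right (m := ∞) (by simp)).differentiable (by simp) y
  rw [e, fderiv_clm_apply hd (differentiableAt_const _)]
  simp [hb]

lemma dY_const_mul (hΦ : Differentiable ℝ Φ) (c : ℝ) (v : E d) (z : E d × E d) :
    dY v (fun z => c * Φ z) z = c * dY v Φ z := by
  rw [dY, fderiv_const_mul (hΦ z)]
  rfl

lemma dY_add {a b : E d × E d → ℝ} (ha : Differentiable ℝ a) (hb : Differentiable ℝ b) (v : E d)
    (z : E d × E d) : dY v (fun z => a z + b z) z = dY v a z + dY v b z := by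
  have h : HasFDerivAt (fun z => a z + b z) _ z := (ha z).hasFDerivAt.add (hb z).hasFDerivAt
  rw [dY, h.fderiv]
  rfl

lemma lapY_scale (hΦ : CcSmooth Φ) (r : ℝ) (x y : E d) :
    lapY (fun z => Φ (z.1, r • z.2)) (x, y) = r ^ 2 * lapY Φ (x, r • y) := by
  simp only [lapY, Finset.mul_sum]
  refine Finset.sum_congr rfl fun j _ => ?_
  have e : dY (bas d j) (fun z => Φ (z.1, r • z.2)) =
      fun z => r * dY (bas d j) Φ (z.1, r • z.2) :=
    funext fun z => dY_scale hΦ.differentiable r _ z.1 z.2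
  have h2 := dY_scale (hΦ.dY (bas d j)).differentiable r (bas d j) x y
  have h3 := (hΦ.dY (bas d j)).differentiable
  have h4 : Differentiable ℝ fun z : E d × E d => dY (bas d j) Φ (z.1, r • z.2) :=
    h3.comp (by fun_prop)
  rw [e, dY_const_mul h4, h2]
  ring

lemma support_deriv {g : ℝ → ℝ} {a : ℝ} (h : ∀ s, g s ≠ 0 → |s - 1| ≤ a) {s : ℝ}
    (hs : deriv g s ≠ 0) : |s - 1| ≤ a := by
  have h1 : tsupport g ⊆ Metric.closedBall 1 a :=
    closure_minimal (fun s hs => by rw [Metric.mem_closedBall, Real.dist_eq]; exact h s hs)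
      Metric.isClosed_closedBall
  have := h1 (support_deriv_subset hs)
  rwa [Metric.mem_closedBall, Real.dist_eq] at this

lemma radLap_support (hρ' : ∀ s, ρ s ≠ 0 → |s - 1| < 1 / 4) {s : ℝ} (hs : radLap d ρ s ≠ 0) :
    |s - 1| ≤ 1 / 4 := by
  have h1 : ∀ s, deriv ρ s ≠ 0 → |s - 1| ≤ 1 / 4 := fun s =>
    support_deriv (fun s hs => (hρ' s hs).le)
  by_cases h : deriv ρ s = 0
  · by_cases h' : deriv (deriv ρ) s = 0
    · exact absurd (by simp [radLap, h, h']) hs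
    · exact support_deriv h1 h'
  · exact h1 s h

lemma RadialCutoff.radLap (hρ : RadialCutoff ρ) (hρ' : ∀ s, ρ s ≠ 0 → |s - 1| < 1 / 4) :
    RadialCutoff (radLap d ρ) where
  smooth := by
    have h1 : ContDiff ℝ ∞ (deriv ρ) := (contDiff_infty_iff_deriv.1 hρ.smooth).2
    have h2 : ContDiff ℝ ∞ (deriv (deriv ρ)) := (contDiff_infty_iff_deriv.1 h1).2
    unfold FokkerPlanck.radLap
    fun_prop
  supp s hs := (radLap_support hρ' hs).trans_lt (by norm_num)

/-- The product rule. The gradient of the cutoff is radial, so the mixed term is a radial derivative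
of `N`, which vanishes when `N` is homogeneous of degree `0`. -/
lemma lapY_radial_mul {N : E d × E d → ℝ} (hρ : ContDiff ℝ ∞ ρ) (hN : CcSmooth N)
    (z : E d × E d) : lapY (fun z => ρ (‖z.2‖ ^ 2) * N z) z =
      ρ (‖z.2‖ ^ 2) * lapY N z + 4 * deriv ρ (‖z.2‖ ^ 2) * dY z.2 N z +
        radLap d ρ (‖z.2‖ ^ 2) * N z := by
  have s1 : ContDiff ℝ ∞ (deriv ρ) := (contDiff_infty_iff_deriv.1 hρ).2
  have d0 := hρ.differentiable (by simp)
  have d1 := s1.differentiable (by simp)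
  have r0 : ∀ {g : ℝ → ℝ}, Differentiable ℝ g →
      Differentiable ℝ fun z : E d × E d => g (‖z.2‖ ^ 2) := fun hg =>
    hg.comp (differentiable_snd.norm_sq ℝ)
  have c0 : ∀ j, Differentiable ℝ fun z : E d × E d => z.2 j := fun j => by fun_prop
  have cj : ∀ j z, dY (bas d j) (fun z : E d × E d => z.2 j) z = 1 := fun j z => by
    have : HasFDerivAt (fun z : E d × E d => z.2 j) ((EuclideanSpace.proj j : E d →L[ℝ] ℝ).comp
      (ContinuousLinearMap.snd ℝ (E d) (E d))) z := ((EuclideanSpace.proj j : E d →L[ℝ] ℝ).comp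
      (ContinuousLinearMap.snd ℝ (E d) (E d))).hasFDerivAt
    rw [dY, this.fderiv]
    simp [bas]
  have e1 : ∀ j, dY (bas d j) (fun z => ρ (‖z.2‖ ^ 2) * N z) = fun z =>
      ρ (‖z.2‖ ^ 2) * dY (bas d j) N z + N z * (2 * (deriv ρ (‖z.2‖ ^ 2) * z.2 j)) := fun j =>
    funext fun z => by
      rw [dY_mul (r0 d0) hN.differentiable, dY_radial d0, inner_bas]
      ring
  have dp : ∀ j, Differentiable ℝ fun z : E d × E d => deriv ρ (‖z.2‖ ^ 2) * z.2 j :=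
    fun j => (r0 d1).mul (c0 j)
  have e2 : ∀ j, dY (bas d j) (dY (bas d j) fun z => ρ (‖z.2‖ ^ 2) * N z) z =
      ρ (‖z.2‖ ^ 2) * dY (bas d j) (dY (bas d j) N) z +
      4 * deriv ρ (‖z.2‖ ^ 2) * (z.2 j * dY (bas d j) N z) +
      (4 * deriv (deriv ρ) (‖z.2‖ ^ 2) * z.2 j ^ 2 + 2 * deriv ρ (‖z.2‖ ^ 2)) * N z := fun j => by
    have q1 : Differentiable ℝ fun z => ρ (‖z.2‖ ^ 2) * dY (bas d j) N z :=
      (r0 d0).mul (hN.dY _).differentiable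
    have q2 : Differentiable ℝ fun z => N z * (2 * (deriv ρ (‖z.2‖ ^ 2) * z.2 j)) :=
      hN.differentiable.mul ((dp j).const_mul 2)
    rw [e1, dY_add q1 q2, dY_mul (r0 d0) (hN.dY _).differentiable,
      dY_mul hN.differentiable ((dp j).const_mul 2), dY_const_mul (dp j),
      dY_mul (r0 d1) (c0 j), dY_radial d0, dY_radial d1, inner_bas, cj]
    ring
  simp only [lapY, e2, Finset.sum_add_distrib, ← Finset.mul_sum, ← Finset.sum_mul]
  rw [← dY_eq_sum, radLap, ← EuclideanSpace.real_norm_sq_eq]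
  simp only [Finset.sum_const, Finset.card_univ, Fintype.card_fin, nsmul_eq_mul]
  push_cast
  ring

/-- On a sphere of radius `r` the flat Laplacian of a function of degree `0` is `r⁻²` times the
spherical one. What remains is the Laplacian of the radial cutoff, a term of order zero in `Φ`. -/
lemma lapY_rext_pol (hρ : RadialCutoff ρ) (hρ' : ∀ s, ρ s ≠ 0 → |s - 1| < 1 / 4) (hΦ : CcSmooth Φ)
    (q : (E d × S d) × Ioi (0 : ℝ)) :
    lapY (rext ρ Φ) (pol q) =
      angLaplacian d Φ q.1.1 q.1.2 * (ρ ((q.2 : ℝ) ^ 2) * ((q.2 : ℝ) ^ 2)⁻¹) +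
        rext (radLap d ρ) Φ (pol q) := by
  obtain ⟨⟨x, θ⟩, r⟩ := q
  have hr : (0 : ℝ) < r := r.2
  -- A wider cutoff, equal to `1` near the support of `ρ`, replaces the homogeneous extension by a
  -- globally smooth `N` without changing the product with `ρ`.
  let β : ContDiffBump (1 : ℝ) := ⟨1 / 2, 3 / 4, by norm_num, by norm_num⟩
  have hβ : RadialCutoff β := ⟨β.contDiff, fun s hs => by
    by_contra h
    exact hs (β.zero_of_le_dist (by rw [Real.dist_eq]; exact not_lt.1 h))⟩
  have β1 : ∀ s, |s - 1| ≤ 1 / 2 → β s = 1 := fun s hs =>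
    β.one_of_mem_closedBall (by rw [Metric.mem_closedBall, Real.dist_eq]; exact hs)
  set N := rext β Φ with hN
  have cN : CcSmooth N := hΦ.rext hβ
  have e0 : rext ρ Φ = fun z => ρ (‖z.2‖ ^ 2) * N z := by
    funext z
    rw [hN, rext, rext]
    by_cases h : ρ (‖z.2‖ ^ 2) = 0
    · simp [h]
    · rw [β1 _ ((hρ' _ h).le.trans (by norm_num)), one_mul]
  -- Where `ρ'` is not zero, `N` is constant along the ray through the point.
  have e1 : deriv ρ (‖(pol ((x, θ), r)).2‖ ^ 2) * dY (pol ((x, θ), r)).2 N (pol ((x, θ), r)) = 0 := by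
    by_cases h : deriv ρ (‖(pol ((x, θ), r)).2‖ ^ 2) = 0
    · rw [h, zero_mul]
    · have h1 := support_deriv (fun s hs => (hρ' s hs).le) h
      set y := (pol ((x, θ), r)).2 with hy
      have hy0 : y ≠ 0 := by
        rw [← norm_ne_zero_iff, hy, norm_pol]; exact hr.ne'
      have hline : HasDerivAt (fun t : ℝ => N (x, t • y)) (dY y N (x, (1 : ℝ) • y)) 1 := by
        have : HasDerivAt (fun t : ℝ => (x, t • y)) (0, y) 1 := by
          have := (hasDerivAt_id (1 : ℝ)).smul_const y
          simpa using (hasDerivAt_const (1 : ℝ) x).prodMk this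
        exact (cN.differentiable _).hasFDerivAt.comp_hasDerivAt (1 : ℝ) this
      have hconst : (fun t : ℝ => N (x, t • y)) =ᶠ[nhds 1] fun _ => Φ (x, ‖y‖⁻¹ • y) := by
        have a1 : ∀ᶠ t : ℝ in nhds 1, |‖t • y‖ ^ 2 - 1| < 1 / 2 := by
          refine ContinuousAt.eventually_lt (by fun_prop) continuousAt_const ?_
          rw [one_smul]
          exact h1.trans_lt (by norm_num)
        filter_upwards [a1, lt_mem_nhds (zero_lt_one' ℝ)] with t ht ht0
        have : ‖t • y‖⁻¹ • t • y = ‖y‖⁻¹ • y := by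
          rw [norm_smul, Real.norm_of_nonneg ht0.le, smul_smul]
          congr 1
          field_simp
        simp only [hN, rext, this, β1 _ ht.le, one_mul]
      have := hline.unique ((hasDerivAt_const (1 : ℝ) _).congr_of_eventuallyEq hconst)
      rw [one_smul] at this
      change _ * dY y N (x, y) = 0
      rw [this, mul_zero]
  have e2 : ρ ((r : ℝ) ^ 2) * lapY N (pol ((x, θ), r)) =
      angLaplacian d Φ x θ * (ρ ((r : ℝ) ^ 2) * ((r : ℝ) ^ 2)⁻¹) := by
    by_cases h : ρ ((r : ℝ) ^ 2) = 0
    · simp [h]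
    · have h1 := hρ' _ h
      have h2 := lapY_scale cN r x (θ : E d)
      rw [lapY_eq_laplacian (cN.scale hr.ne')] at h2
      have h3 : (fun y : E d => N (x, (r : ℝ) • y)) =ᶠ[nhds (θ : E d)]
          fun y => Φ (x, ‖y‖⁻¹ • y) := by
        have a1 : ∀ᶠ y : E d in nhds (θ : E d), |‖(r : ℝ) • y‖ ^ 2 - 1| < 1 / 2 := by
          refine ContinuousAt.eventually_lt (by fun_prop) continuousAt_const ?_
          rw [norm_smul, norm_sphere, mul_one, Real.norm_of_nonneg hr.le]
          exact h1.trans (by norm_num)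
        filter_upwards [a1] with y hy
        have : ‖(r : ℝ) • y‖⁻¹ • (r : ℝ) • y = ‖y‖⁻¹ • y := by
          rw [norm_smul, Real.norm_of_nonneg hr.le, smul_smul]
          congr 1
          field_simp
        simp only [hN, rext, this, β1 _ hy.le, one_mul]
      simp only at h2
      rw [(InnerProductSpace.laplacian_congr_nhds h3).eq_of_nhds] at h2
      change _ * lapY N (x, (r : ℝ) • (θ : E d)) = _
      rw [angLaplacian, h2]
      field_simp
  have e3 : radLap d ρ ((r : ℝ) ^ 2) * N (pol ((x, θ), r)) =
      rext (radLap d ρ) Φ (pol ((x, θ), r)) := by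
    rw [hN, rext_pol, rext_pol]
    by_cases h : radLap d ρ ((r : ℝ) ^ 2) = 0
    · simp [h]
    · rw [β1 _ ((radLap_support hρ' h).trans (by norm_num)), one_mul]
  rw [e0, lapY_radial_mul hρ.smooth cN, mul_assoc 4, e1, norm_pol, e2, e3]
  ring

end Extension

/-! ### The local estimate on the sphere -/

section LocalEstimate
variable {d : ℕ}

/-- The restriction of a function on `ℝⁿ × ℝⁿ` to `ℝⁿ × 𝕊ⁿ⁻¹`. -/
def res {F : Type*} (Φ : E d × E d → F) (p : E d × S d) : F := Φ (p.1, (p.2 : E d))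

lemma continuous_inclusion : Continuous fun p : E d × S d => (p.1, (p.2 : E d)) := by fun_prop

lemma CcSmooth.hasCompactSupport_res {Φ : E d × E d → ℝ} (hΦ : CcSmooth Φ) :
    HasCompactSupport (res Φ) := by
  refine HasCompactSupport.intro
    ((hΦ.compact.isCompact.image continuous_fst).prod (isCompact_univ (X := S d))) fun p hp => ?_
  by_contra h
  exact hp ⟨⟨_, subset_tsupport _ h, rfl⟩, mem_univ _⟩

instance : IsFiniteMeasureOnCompacts (dxdθ d) := by unfold dxdθ; infer_instance

lemma CcSmooth.continuous_res {Φ : E d × E d → ℝ} (hΦ : CcSmooth Φ) : Continuous (res Φ) :=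
  hΦ.continuous.comp continuous_inclusion

lemma CcSmooth.memLp_res {Φ : E d × E d → ℝ} (hΦ : CcSmooth Φ) : MemLp (res Φ) 2 (dxdθ d) :=
  hΦ.continuous_res.memLp_of_hasCompactSupport hΦ.hasCompactSupport_res

lemma abs_integral_mul_le_l2 {α : Type*} [MeasurableSpace α] {μ : Measure α} {a b : α → ℝ}
    (ha : MemLp a 2 μ) (hb : MemLp b 2 μ) : |∫ x, a x * b x ∂μ| ≤ l2 a μ * l2 b μ := by
  have := abs_integral_inner_le hb ha
  simpa [mul_comm] using this

lemma l2_mono {α F : Type*} [MeasurableSpace α] {μ : Measure α} [NormedAddCommGroup F] {a : α → F}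
    {b : α → ℝ} (hb : MemLp b 2 μ) (h : ∀ x, ‖a x‖ ≤ b x) : l2 a μ ≤ l2 b μ := by
  refine Real.sqrt_le_sqrt (integral_mono_of_nonneg
    (Filter.Eventually.of_forall fun x => by positivity) ?_
    (Filter.Eventually.of_forall fun x => ?_))
  · exact hb.integrable_norm_pow (by norm_num)
  · have := (h x).trans (le_abs_self _)
    simp only [Real.norm_eq_abs] at this ⊢
    gcongr

/-- A radial cutoff with small support. -/
lemma exists_radialCutoff {a : ℝ} (ha : 0 < a) (ha' : a ≤ 1 / 4) :
    ∃ ρ : ℝ → ℝ, RadialCutoff ρ ∧ (∀ s, ρ s ≠ 0 → |s - 1| < a) ∧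
      (∀ w : ℝ → ℝ, ContinuousOn w (Ioi 0) → (∀ r, 0 < r → 0 < w r) →
        0 < ∫ r : Ioi (0 : ℝ), ρ ((r : ℝ) ^ 2) * w r ∂rad d) := by
  let β : ContDiffBump (1 : ℝ) := ⟨a / 2, a, by positivity, by linarith⟩
  have hs : ∀ s, β s ≠ 0 → |s - 1| < a := fun s hs => by
    by_contra h
    exact hs (β.zero_of_le_dist (by rw [Real.dist_eq]; exact not_lt.1 h))
  refine ⟨β, ⟨β.contDiff, fun s h => (hs s h).trans_le (ha'.trans (by norm_num))⟩, hs, ?_⟩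
  intro w hw hpos
  rw [integral_rad fun r => β (r ^ 2) * w r]
  have hc : ContinuousOn (fun r => r ^ d * (β (r ^ 2) * w r)) (Ioi 0) := by
    have h1 : Continuous fun r : ℝ => β (r ^ 2) := β.continuous.comp (by fun_prop)
    exact (continuousOn_id.pow d).mul (h1.continuousOn.mul hw)
  have hsub : Icc (1 / 2 : ℝ) 2 ⊆ Ioi 0 := fun r hr => (by norm_num : (0 : ℝ) < 1 / 2).trans_le hr.1
  have hz : ∀ r ∈ Ioi (0 : ℝ), r ∉ Icc (1 / 2 : ℝ) 2 → r ^ d * (β (r ^ 2) * w r) = 0 := by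
    intro r hr hn
    by_contra h
    have h1 := hs _ (left_ne_zero_of_mul (right_ne_zero_of_mul h))
    rw [abs_lt] at h1
    have hr : 0 < r := hr
    exact hn ⟨by nlinarith, by nlinarith⟩
  have hi : IntegrableOn (fun r => r ^ d * (β (r ^ 2) * w r)) (Ioi 0) := by
    have h1 : IntegrableOn (fun r => r ^ d * (β (r ^ 2) * w r)) (Icc (1 / 2) 2) :=
      (hc.mono hsub).integrableOn_compact isCompact_Icc
    exact h1.of_forall_sdiff_eq_zero measurableSet_Ioi fun r hr => hz r hr.1 hr.2
  rw [setIntegral_pos_iff_support_of_nonneg_ae]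
  · have hopen : IsOpen (Ioo (0 : ℝ) 2 ∩ {r | β (r ^ 2) ≠ 0}) := by
      have h1 : Continuous fun r : ℝ => β (r ^ 2) := β.continuous.comp (by fun_prop)
      exact isOpen_Ioo.inter (isOpen_ne_fun h1 continuous_const)
    refine (hopen.measure_pos volume ⟨1, by norm_num, ?_⟩).trans_le (measure_mono ?_)
    · have : β ((1 : ℝ) ^ 2) = 1 := β.one_of_mem_closedBall (by simp [β]; positivity)
      simp only [mem_ofPred_eq, this]; norm_num
    · intro r hr
      have hr0 : (0 : ℝ) < r := hr.1.1
      exact ⟨mul_ne_zero (pow_ne_zero _ hr0.ne') (mul_ne_zero hr.2 (hpos r hr0).ne'), hr0⟩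
  · filter_upwards [ae_restrict_mem measurableSet_Ioi] with r hr
    have hr : (0 : ℝ) < r := hr
    exact mul_nonneg (by positivity) (mul_nonneg β.nonneg (hpos r hr).le)
  · exact hi

lemma l2_rext {ρ : ℝ → ℝ} {Φ : E d × E d → ℝ} (hρ : RadialCutoff ρ) (hΦ : CcSmooth Φ) :
    l2 (rext ρ Φ) volume =
      l2 (res Φ) (dxdθ d) * Real.sqrt (∫ r : Ioi (0 : ℝ), ρ ((r : ℝ) ^ 2) ^ 2 ∂rad d) := by
  unfold l2
  rw [← Real.sqrt_mul (integral_nonneg fun p => by positivity)]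
  congr 1
  refine integral_polar_mul 
    (H := fun z => ‖rext ρ Φ z‖ ^ 2) ((hΦ.rext hρ).continuous.norm.pow 2).aestronglyMeasurable
    fun q => ?_
  rw [rext_pol, res, norm_mul, mul_pow, Real.norm_eq_abs (ρ _), sq_abs, mul_comm]

namespace SphereSolution
variable {ε : ℝ} {σ : E d → ℝ} {u l f : E d × S d → ℝ} {G : E d × S d → E d}
  {ρ : ℝ → ℝ} {Φ : E d × E d → ℝ}

lemma aestronglyMeasurable_u_lift (sol : SphereSolution d ε σ u l f G) :
    AEStronglyMeasurable (fun z => u (lift z)) volume :=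
  sol.memu.1.comp_quasiMeasurePreserving quasiMeasurePreserving_lift

lemma integral_trans_rext (sol : SphereSolution d ε σ u l f G) (hρ : RadialCutoff ρ)
    (hΦ : CcSmooth Φ) : ∫ z, u (lift z) * trans (rext ρ Φ) z =
      (∫ p, u p * transport d Φ p.1 p.2 ∂dxdθ d) * ∫ r : Ioi (0 : ℝ), ρ ((r : ℝ) ^ 2) * r ∂rad d :=
  integral_polar_mul (sol.integrable_u (hΦ.rext hρ).trans).1 fun q => by
    rw [lift_pol, trans_rext_pol hρ hΦ, mul_assoc]

lemma integral_bes_rext (sol : SphereSolution d ε σ u l f G) (hρ : RadialCutoff ρ)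
    (hΦ : CcSmooth Φ) : ∫ z, u (lift z) * bes (rext ρ Φ) z =
      (∫ p, u p * besselD d (2 / 3) (fun x => Φ (x, (p.2 : E d))) p.1 ∂dxdθ d) *
        ∫ r : Ioi (0 : ℝ), ρ ((r : ℝ) ^ 2) ∂rad d :=
  integral_polar_mul (H := fun z => u (lift z) * bes (rext ρ Φ) z)
    (sol.aestronglyMeasurable_u_lift.mul (hΦ.rext hρ).continuous_bes.aestronglyMeasurable) fun q => by
    rw [lift_pol, bes_rext_pol, mul_assoc]

/-- The Laplacian of the radial cutoff leaves a multiple of `∫ u Φ`. For the estimate it is enough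
that this is bounded by the norms of `u` and `Φ`; that the coefficient vanishes (`integral_radLap`)
matters only for the strong form. -/
lemma integral_lapY_rext (sol : SphereSolution d ε σ u l f G) (hρ : RadialCutoff ρ)
    (hρ' : ∀ s, ρ s ≠ 0 → |s - 1| < 1 / 4) (hΦ : CcSmooth Φ) :
    ∫ z, u (lift z) * lapY (rext ρ Φ) z =
      (∫ p, u p * angLaplacian d Φ p.1 p.2 ∂dxdθ d) *
        (∫ r : Ioi (0 : ℝ), ρ ((r : ℝ) ^ 2) * ((r : ℝ) ^ 2)⁻¹ ∂rad d) +
      (∫ p, u p * res Φ p ∂dxdθ d) * ∫ r : Ioi (0 : ℝ), radLap d ρ ((r : ℝ) ^ 2) ∂rad d := by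
  have i1 := sol.integrable_u (hΦ.rext hρ).lapY
  have i2 := sol.integrable_u (hΦ.rext (hρ.radLap hρ' (d := d)))
  have e2 : ∫ z, u (lift z) * rext (radLap d ρ) Φ z = (∫ p, u p * res Φ p ∂dxdθ d) *
      ∫ r : Ioi (0 : ℝ), radLap d ρ ((r : ℝ) ^ 2) ∂rad d :=
    integral_polar_mul i2.1 fun q => by rw [lift_pol, rext_pol, res]; ring
  have i3 : Integrable (fun z => u (lift z) * lapY (rext ρ Φ) z -
    u (lift z) * rext (radLap d ρ) Φ z) volume := i1.sub i2
  have e1 : ∫ z, (u (lift z) * lapY (rext ρ Φ) z - u (lift z) * rext (radLap d ρ) Φ z) =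
      (∫ p, u p * angLaplacian d Φ p.1 p.2 ∂dxdθ d) *
        ∫ r : Ioi (0 : ℝ), ρ ((r : ℝ) ^ 2) * ((r : ℝ) ^ 2)⁻¹ ∂rad d :=
    integral_polar_mul i3.1 fun q => by rw [lift_pol, lapY_rext_pol hρ hρ' hΦ]; ring
  rw [integral_sub i1 i2, e2] at e1
  linarith

end SphereSolution

lemma bes_eq_zero {W : E d × E d → ℝ} {z : E d × E d} (h : ∀ x, W (x, z.2) = 0) :
    bes W z = 0 := by
  have : ∀ k, pF W k z.2 = 0 := fun k => by
    rw [pF_eq]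
    simp [h]
  rw [bes_eq_integral]
  simp [this]

/-- The commutator bound on slices, integrated over `y` and paired with the lift of `u`. It also
gives the integrability of the tail of `D_x^{2/3} W`, which is not compactly supported in `x`. -/
lemma exists_integral_cutoff_bes_le {χ : E d → ℝ} (hχ : CcSmooth χ) :
    ∃ C : ℝ, 0 ≤ C ∧ ∀ (u : E d × S d → ℝ), MemLp u 2 (dxdθ d) → ∀ W : E d × E d → ℝ, CcSmooth W →
      (∀ z, W z ≠ 0 → χ z.1 = 1) → (∀ z, W z ≠ 0 → ‖z.2‖ ≤ 2) →
      Integrable (fun z => u (lift z) * ((1 - χ z.1) * bes W z)) volume ∧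
      |∫ z, u (lift z) * ((1 - χ z.1) * bes W z)| ≤ C * l2 u (dxdθ d) * l2 W volume := by
  obtain ⟨C, hC, h⟩ := exists_lintegral_cutoff_bes_le hχ
  refine ⟨Real.sqrt (rad d {r | (r : ℝ) ≤ 2}).toReal * Real.sqrt C.toReal,
    mul_nonneg (Real.sqrt_nonneg _) (Real.sqrt_nonneg _), fun u hu W hW h1 h2 => ?_⟩
  have hcont : Continuous fun z : E d × E d => (1 - χ z.1) * bes W z := by
    have := hW.continuous_bes
    have := hχ.continuous
    fun_prop
  have hb : ∫⁻ z : E d × E d, ‖(1 - χ z.1) * bes W z‖ₑ ^ 2 ≤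
      ENNReal.ofReal ((Real.sqrt C.toReal * l2 W volume) ^ 2) := by
    calc ∫⁻ z : E d × E d, ‖(1 - χ z.1) * bes W z‖ₑ ^ 2
        = ∫⁻ y, ∫⁻ x, ‖(1 - χ x) * bes W (x, y)‖ₑ ^ 2 :=
          lintegral_prod_symm _ (hcont.enorm.measurable.pow_const 2).aemeasurable
      _ ≤ ∫⁻ y, C * ∫⁻ x, ‖W (x, y)‖ₑ ^ 2 :=
          lintegral_mono fun y => h W hW y fun x hx => h1 (x, y) hx
      _ = C * ∫⁻ z, ‖W z‖ₑ ^ 2 := by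
          rw [lintegral_const_mul' _ _ hC]
          congr 1
          exact (lintegral_prod_symm (fun z => ‖W z‖ₑ ^ 2)
            (hW.continuous.enorm.measurable.pow_const 2).aemeasurable).symm
      _ = _ := by
          rw [lintegral_enorm_sq (hW.memLp volume), mul_pow, Real.sq_sqrt ENNReal.toReal_nonneg,
            ENNReal.ofReal_mul ENNReal.toReal_nonneg, ENNReal.ofReal_toReal hC]
  have hm : MemLp (fun z : E d × E d => (1 - χ z.1) * bes W z) 2 volume :=
    memLp_two_of_lintegral hcont.aestronglyMeasurable (hb.trans_lt ENNReal.ofReal_lt_top).ne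
  have hl : l2 (fun z : E d × E d => (1 - χ z.1) * bes W z) volume ≤
      Real.sqrt C.toReal * l2 W volume :=
    l2_le_of_lintegral (mul_nonneg (Real.sqrt_nonneg _) (l2_nonneg _)) hcont.aestronglyMeasurable hb
  have hz : ∀ z, ¬ ‖z.2‖ ≤ 2 → bes W z = 0 := fun z hz => bes_eq_zero fun x => by
    by_contra h0
    exact hz (h2 (x, z.2) h0)
  have e : (fun z => u (lift z) * ((1 - χ z.1) * bes W z)) =
      fun z => ({z : E d × E d | ‖z.2‖ ≤ 2}.indicator fun z => u (lift z)) z *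
        ((1 - χ z.1) * bes W z) := by
    funext z
    by_cases hm : z ∈ {z : E d × E d | ‖z.2‖ ≤ 2}
    · simp only [indicator_of_mem hm]
    · simp only [hz z hm, mul_zero]
  rw [e]
  refine ⟨(memLp_lift hu 2).integrable_mul hm, ?_⟩
  refine (abs_integral_mul_le_l2 (memLp_lift hu 2) hm).trans ?_
  calc _ ≤ (Real.sqrt (rad d {r | (r : ℝ) ≤ 2}).toReal * l2 u (dxdθ d)) *
        (Real.sqrt C.toReal * l2 W volume) := by
        exact mul_le_mul (l2_lift_le hu 2) hl (l2_nonneg _)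
          (mul_nonneg (Real.sqrt_nonneg _) (l2_nonneg _))
    _ = _ := by ring

end LocalEstimate

/-! ### The estimate near a point of `Q`. -/

section LocalTheorem
variable {d : ℕ}

lemma coe_sphere_ne_zero (θ : S d) : (θ : E d) ≠ 0 := by
  rw [← norm_ne_zero_iff, norm_sphere]; norm_num

lemma continuousAt_dir {y : E d} (h0 : y ≠ 0) : ContinuousAt (dir : E d → S d) y := by
  rw [Topology.IsInducing.subtypeVal.continuousAt_iff]
  have : ContinuousAt (fun y : E d => ‖y‖⁻¹ • y) y :=
    (continuousAt_id.norm.inv₀ (norm_ne_zero_iff.2 h0)).smul continuousAt_id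
  refine this.congr ?_
  filter_upwards [isOpen_ne.mem_nhds h0] with y hy
  exact (dir_coe hy).symm

lemma continuousAt_lift {z : E d × E d} (h0 : z.2 ≠ 0) : ContinuousAt lift z :=
  continuousAt_fst.prodMk (ContinuousAt.comp (g := dir) (continuousAt_dir h0) continuousAt_snd)

lemma dir_self (θ : S d) : dir (θ : E d) = θ := by
  simpa using dir_smul one_pos θ

/-- A product of cutoff functions in `x` and in `y`. -/
lemma exists_product_cutoff (z₀ : E d × E d) {R : ℝ} (hR : 0 < R) :
    ∃ χ₁ χ₂ : E d → ℝ, CcSmooth χ₁ ∧ CcSmooth (fun z : E d × E d => χ₁ z.1 * χ₂ z.2) ∧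
      tsupport (fun z : E d × E d => χ₁ z.1 * χ₂ z.2) ⊆ Metric.closedBall z₀ R ∧
      (∀ z : E d × E d, |χ₁ z.1 * χ₂ z.2| ≤ 1) ∧
      (∀ x ∈ Metric.closedBall z₀.1 (R / 2), χ₁ x = 1) ∧
      ∀ y ∈ Metric.closedBall z₀.2 (R / 2), χ₂ y = 1 := by
  let β₁ : ContDiffBump z₀.1 := ⟨R / 2, R, by positivity, by linarith⟩
  let β₂ : ContDiffBump z₀.2 := ⟨R / 2, R, by positivity, by linarith⟩
  have hs : tsupport (fun z : E d × E d => β₁ z.1 * β₂ z.2) ⊆ Metric.closedBall z₀ R := by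
    refine closure_minimal (fun z hz => ?_) Metric.isClosed_closedBall
    have h1 : z.1 ∈ Metric.ball z₀.1 R := by
      have : z.1 ∈ Function.support β₁ := left_ne_zero_of_mul hz
      rwa [β₁.support_eq] at this
    have h2 : z.2 ∈ Metric.ball z₀.2 R := by
      have : z.2 ∈ Function.support β₂ := right_ne_zero_of_mul hz
      rwa [β₂.support_eq] at this
    exact Metric.mem_closedBall.2 (max_le (Metric.mem_ball.1 h1).le (Metric.mem_ball.1 h2).le)
  refine ⟨β₁, β₂, ⟨β₁.contDiff, β₁.hasCompactSupport⟩, ⟨?_, ?_⟩, hs, fun z => ?_,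
    fun x hx => β₁.one_of_mem_closedBall hx, fun y hy => β₂.one_of_mem_closedBall hy⟩
  · exact (β₁.contDiff.comp contDiff_fst).mul (β₂.contDiff.comp contDiff_snd)
  · exact (isCompact_closedBall z₀ R).of_isClosed_subset (isClosed_tsupport _) hs
  · rw [abs_mul, abs_of_nonneg β₁.nonneg, abs_of_nonneg β₂.nonneg]
    exact mul_le_one₀ β₁.le_one β₂.nonneg β₂.le_one

/-- The radius of localization. -/
lemma exists_radius {σ₀ M : ℝ} (hσ₀ : 0 < σ₀) (hM : 0 ≤ M) {p₀ : E d × S d} {O : Set (E d × S d)}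
    (hO : IsOpen O) (hp : p₀ ∈ O) (hOQ : O ⊆ Q d) :
    ∃ R : ℝ, 0 < R ∧ R ≤ 1 ∧ 320 * M * R ≤ σ₀ ∧
      Metric.closedBall (p₀.1, (p₀.2 : E d)) (2 * R) ⊆ Ann d ∧
      ∀ z ∈ Metric.closedBall (p₀.1, (p₀.2 : E d)) (2 * R), lift z ∈ O := by
  set z₀ : E d × E d := (p₀.1, (p₀.2 : E d)) with hz₀
  have hl : ContinuousAt (lift : E d × E d → E d × S d) z₀ :=
    continuousAt_lift (coe_sphere_ne_zero p₀.2)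
  have hl0 : lift z₀ = p₀ := Prod.ext rfl (dir_self _)
  have h1 : ∀ᶠ z in nhds z₀, lift z ∈ O := hl.eventually_mem (by rw [hl0]; exact hO.mem_nhds hp)
  have h2 : ∀ᶠ z : E d × E d in nhds z₀, 1 / 2 < ‖z.2‖ ∧ ‖z.2‖ < 2 := by
    have h0 : ‖z₀.2‖ = 1 := norm_sphere _
    refine (continuousAt_const.eventually_lt (by fun_prop) (by rw [h0]; norm_num)).and
      (ContinuousAt.eventually_lt (by fun_prop) continuousAt_const (by rw [h0]; norm_num))
  obtain ⟨δ, hδ, h⟩ := Metric.eventually_nhds_iff_ball.1 (h1.and h2)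
  -- `δ / 4` puts the closed ball of radius `2 R` inside the open ball of radius `δ`; `M + 1` avoids
  -- a division by zero.
  refine ⟨min (δ / 4) (min 1 (σ₀ / (320 * (M + 1)))), by positivity,
    (min_le_right _ _).trans (min_le_left _ _), ?_, ?_, ?_⟩
  · have : min (δ / 4) (min 1 (σ₀ / (320 * (M + 1)))) ≤ σ₀ / (320 * (M + 1)) :=
      (min_le_right _ _).trans (min_le_right _ _)
    rw [le_div_iff₀ (by positivity)] at this
    have h0 : 0 ≤ min (δ / 4) (min 1 (σ₀ / (320 * (M + 1)))) := by positivity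
    nlinarith
  all_goals
    intro z hz
    have hz : z ∈ Metric.ball z₀ δ := by
      refine Metric.closedBall_subset_ball ?_ hz
      have := min_le_left (δ / 4) (min 1 (σ₀ / (320 * (M + 1))))
      linarith
    have hh := h z hz
  · exact ⟨hOQ hh.1, hh.2⟩
  · exact hh.1

/-- The distance in `y` is at most an angular part `R / 8` plus a radial part `R / 8`; in `x` it is
at most `R / 4`. The extended test function thus lives where both cutoffs equal `1`. -/
lemma mem_closedBall_of_rext_ne_zero {ρ : ℝ → ℝ} {Φ : E d × E d → ℝ} {p₀ : E d × S d} {R : ℝ}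
    (hR1 : R ≤ 1) (hρs : ∀ s, ρ s ≠ 0 → |s - 1| < R / 8)
    (hU : ∀ p, p ∉ {p : E d × S d | dist p.1 p₀.1 < R / 4 ∧ dist (p.2 : E d) (p₀.2 : E d) < R / 8} →
      res Φ p = 0) (z : E d × E d) :
    rext ρ Φ z ≠ 0 → z ∈ Metric.closedBall (p₀.1, (p₀.2 : E d)) (R / 4) := by
    intro hz
    have h1 := hρs _ (left_ne_zero_of_mul hz)
    have hn : |‖z.2‖ - 1| < R / 8 := by
      have e : |‖z.2‖ ^ 2 - 1| = |‖z.2‖ - 1| * (‖z.2‖ + 1) := by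
        rw [show ‖z.2‖ ^ 2 - 1 = (‖z.2‖ - 1) * (‖z.2‖ + 1) by ring, abs_mul,
          abs_of_nonneg (by positivity : 0 ≤ ‖z.2‖ + 1)]
      rw [e] at h1
      have h2 : |‖z.2‖ - 1| * 1 ≤ |‖z.2‖ - 1| * (‖z.2‖ + 1) :=
        mul_le_mul_of_nonneg_left (by linarith [norm_nonneg z.2]) (abs_nonneg _)
      linarith
    have hz0 : z.2 ≠ 0 := by
      intro h0
      rw [h0] at hn
      norm_num at hn
      linarith
    have hm : lift z ∈ {p : E d × S d |
        dist p.1 p₀.1 < R / 4 ∧ dist (p.2 : E d) (p₀.2 : E d) < R / 8} := by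
      by_contra hn
      refine right_ne_zero_of_mul hz ?_
      have := hU _ hn
      rwa [res, lift, dir_coe hz0] at this
    refine Metric.mem_closedBall.2 (max_le hm.1.le ?_)
    have h2 : dist (dir z.2 : E d) (p₀.2 : E d) < R / 8 := hm.2
    have h3 : dist z.2 (dir z.2 : E d) = |‖z.2‖ - 1| := by
      rw [dir_coe hz0, dist_eq_norm]
      have e : z.2 - ‖z.2‖⁻¹ • z.2 = (1 - ‖z.2‖⁻¹) • z.2 := by rw [sub_smul, one_smul]
      rw [e, norm_smul, Real.norm_eq_abs, ← abs_of_nonneg (norm_nonneg z.2), ← abs_mul,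
        abs_of_nonneg (norm_nonneg z.2), sub_mul, inv_mul_cancel₀ (norm_ne_zero_iff.2 hz0), one_mul]
    have := dist_triangle z.2 (dir z.2 : E d) (p₀.2 : E d)
    change dist z.2 (p₀.2 : E d) ≤ _
    linarith

lemma SphereSolution.l2_le_weight {ε : ℝ} {σ : E d → ℝ} {u l f : E d × S d → ℝ}
    {G : E d × S d → E d} (sol : SphereSolution d ε σ u l f G) {O : Set (E d × S d)}
    (hO : MeasurableSet O) : l2 u (dxdθ d) ≤ l2 (weight ε O u f G) (dxdθ d) := by
  have hm : MemLp (weight ε O u f G) 2 (dxdθ d) :=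
    ((sol.memf.norm.indicator hO).add sol.memu.norm).add (sol.memG.norm.const_mul _)
  refine l2_mono hm fun p => ?_
  have : 0 ≤ O.indicator (fun p => |f p|) p := indicator_nonneg (fun p _ => abs_nonneg _) _
  have h2 : 0 ≤ ε ^ 2 * ‖G p‖ := by positivity
  rw [weight, Real.norm_eq_abs]
  linarith

lemma mul_abs_le_of_mul_abs_add_le {e e₀ x y c b A w : ℝ} (hc : 0 < c) (he : 0 ≤ e) (he₀ : e ≤ e₀)
    (h : e * |x * c + y| ≤ A * w) (hy : |y| ≤ b * w) : e * |x| ≤ (A + e₀ * b) / c * w := by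
  have h1 : |x| * c ≤ |x * c + y| + |y| := by
    have := abs_sub (x * c + y) y
    rwa [add_sub_cancel_right, abs_mul, abs_of_pos hc] at this
  rw [div_mul_eq_mul_div, le_div_iff₀ hc]
  have h2 : e * |y| ≤ e₀ * (b * w) := mul_le_mul he₀ hy (abs_nonneg _) (he.trans he₀)
  calc e * |x| * c = e * (|x| * c) := by ring
    _ ≤ e * (|x * c + y| + |y|) := by gcongr
    _ ≤ _ := by linarith

/-- The flat estimate is applied to the extended test function. In polar coordinates each pairing is
the one on `Q` times a positive radial constant, up to an error bounded by the norms of `u` and `Φ`: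
the Laplacian of the radial cutoff in the first estimate, the nonlocal tail in the third. -/
theorem exists_local_estimate {σ₀ M ε₀ : ℝ} (hσ₀ : 0 < σ₀) (hM : 0 ≤ M) {p₀ : E d × S d}
    {O : Set (E d × S d)} (hO : IsOpen O) (hp : p₀ ∈ O) (hOQ : O ⊆ Q d) :
    ∃ U : Set (E d × S d), IsOpen U ∧ p₀ ∈ U ∧ U ⊆ O ∧ ∃ C : ℝ, 0 ≤ C ∧
      ∀ (ε : ℝ) (σ : E d → ℝ) (u l f : E d × S d → ℝ) (G : E d × S d → E d), 0 < ε → ε ≤ ε₀ →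
      SigmaBounds d σ₀ M σ → SphereSolution d ε σ u l f G → (∀ p, |l p| ≤ M * |u p|) →
      ∀ Φ : E d × E d → ℝ, CcSmooth Φ → (∀ p, p ∉ U → res Φ p = 0) →
      ε ^ 2 * |∫ p, u p * angLaplacian d Φ p.1 p.2 ∂dxdθ d| ≤
        C * l2 (weight ε O u f G) (dxdθ d) * l2 (res Φ) (dxdθ d) ∧
      |∫ p, u p * transport d Φ p.1 p.2 ∂dxdθ d| ≤
        C * l2 (weight ε O u f G) (dxdθ d) * l2 (res Φ) (dxdθ d) ∧
      ε ^ (2 / 3 : ℝ) *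
        |∫ p, u p * besselD d (2 / 3) (fun x => Φ (x, (p.2 : E d))) p.1 ∂dxdθ d| ≤
        C * l2 (weight ε O u f G) (dxdθ d) * l2 (res Φ) (dxdθ d) := by
  obtain ⟨R, hR, hR1, hRσ, hA, hRO⟩ := exists_radius hσ₀ hM hO hp hOQ
  set z₀ : E d × E d := (p₀.1, (p₀.2 : E d)) with hz₀
  obtain ⟨χ₁, χ₂, cχ₁, cχ, sχ, χ1, χ₁1, χ₂1⟩ := exists_product_cutoff z₀ hR
  set χ : E d × E d → ℝ := fun z => χ₁ z.1 * χ₂ z.2 with hχ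
  obtain ⟨ρ, hρ, hρs, hρpos⟩ := exists_radialCutoff (d := d) (a := R / 8) (by positivity) (by linarith)
  have hρ' : ∀ s, ρ s ≠ 0 → |s - 1| < 1 / 4 := fun s hs => (hρs s hs).trans_le (by linarith)
  obtain ⟨Cf, hCf, flat⟩ := exists_flat_estimate d (β₀ := σ₀) (β := 8 * M) (L := 20 * M) (ε₀ := ε₀)
    hσ₀ (by positivity) (by positivity)
  obtain ⟨Cb, hCb, cutb⟩ := exists_integral_cutoff_bes_le cχ₁
  obtain ⟨B, hB, hBY, hBT, hBL⟩ : ∃ B, 0 ≤ B ∧ (∀ j z, |dY (bas d j) χ z| ≤ B) ∧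
      (∀ z, |trans χ z| ≤ B) ∧ ∀ z, |lapY χ z| ≤ B := by
    choose b hb hb' using fun j => (cχ.dY (bas d j)).exists_bound
    obtain ⟨B1, hB1, h1⟩ := cχ.trans.exists_bound
    obtain ⟨B2, hB2, h2⟩ := cχ.lapY.exists_bound
    have h0 : 0 ≤ ∑ j, b j := Finset.sum_nonneg fun j _ => hb j
    refine ⟨(∑ j, b j) + B1 + B2, by positivity, fun j z => ?_, fun z => ?_, fun z => ?_⟩
    · have := Finset.single_le_sum (fun j _ => hb j) (Finset.mem_univ j)
      linarith [hb' j z]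
    · linarith [h1 z]
    · linarith [h2 z]
  set c₁ := ∫ r : Ioi (0 : ℝ), ρ ((r : ℝ) ^ 2) * ((r : ℝ) ^ 2)⁻¹ ∂rad d with hc₁
  set c₂ := ∫ r : Ioi (0 : ℝ), ρ ((r : ℝ) ^ 2) * r ∂rad d with hc₂
  set c₃ := ∫ r : Ioi (0 : ℝ), ρ ((r : ℝ) ^ 2) ∂rad d with hc₃
  set c₄ := ∫ r : Ioi (0 : ℝ), radLap d ρ ((r : ℝ) ^ 2) ∂rad d with hc₄
  set c₅ := Real.sqrt (∫ r : Ioi (0 : ℝ), ρ ((r : ℝ) ^ 2) ^ 2 ∂rad d) with hc₅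
  have pc₁ : 0 < c₁ := hρpos (fun r => (r ^ 2)⁻¹)
    (ContinuousOn.inv₀ (continuousOn_id.pow 2) fun r hr => pow_ne_zero _ (ne_of_gt hr))
    fun r hr => by positivity
  have pc₂ : 0 < c₂ := hρpos (fun r => r) continuousOn_id fun r hr => hr
  have pc₃ : 0 < c₃ := by
    have := hρpos (fun _ => 1) continuousOn_const fun r hr => one_pos
    simpa using this
  have pc₅ : 0 ≤ c₅ := Real.sqrt_nonneg _
  set K := (2 + 2 * M + B + 16 * M * (d + 1) * B + 2 * (d + 1) * B + ε₀ ^ 2 * B) *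
    Real.sqrt (rad d {r | (r : ℝ) ≤ 2}).toReal with hK
  have pK : 0 ≤ K := mul_nonneg (by positivity) (Real.sqrt_nonneg _)
  set D₁ := (Cf * K * c₅ + ε₀ ^ 2 * |c₄|) / c₁ with hD₁
  set D₂ := Cf * K * c₅ / c₂ with hD₂
  set D₃ := (Cf * K * c₅ + |ε₀| ^ (2 / 3 : ℝ) * Cb * c₅) / c₃ with hD₃
  have pD₁ : 0 ≤ D₁ := by positivity
  have pD₂ : 0 ≤ D₂ := by positivity
  have pD₃ : 0 ≤ D₃ := by positivity
  refine ⟨{p | dist p.1 p₀.1 < R / 4 ∧ dist (p.2 : E d) (p₀.2 : E d) < R / 8}, ?_, ?_, ?_,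
    D₁ + D₂ + D₃, by positivity, ?_⟩
  · have h1 : Continuous fun p : E d × FokkerPlanck.S d => dist p.1 p₀.1 := by fun_prop
    have h2 : Continuous fun p : E d × FokkerPlanck.S d => dist (p.2 : E d) (p₀.2 : E d) := by
      fun_prop
    exact (isOpen_lt h1 continuous_const).inter (isOpen_lt h2 continuous_const)
  · simp; positivity
  · intro p hp
    have h1 := hRO (p.1, (p.2 : E d)) (Metric.mem_closedBall.2
      (max_le (by linarith [hp.1]) (by linarith [hp.2])))
    have h2 : lift (p.1, (p.2 : E d)) = p := Prod.ext rfl (dir_self _)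
    rwa [h2] at h1
  intro ε σ u l f G hε hεε hσ sol hl Φ hΦ hU
  obtain ⟨h, hh, S⟩ := sol.flatSolution hσ hσ₀ hε hεε hl hO.measurableSet (z₀ := z₀)
    (norm_sphere _) hR hRσ hA hRO cχ sχ χ1 hBY hBT hBL
  have hb₀ := hσ.lower z₀.1 (hA (Metric.mem_closedBall_self (by positivity))).1
  have hb₁ := hσ.upper z₀.1 (hA (Metric.mem_closedBall_self (by positivity))).1
  set Ψ := rext ρ Φ with hΨ
  have cΨ : CcSmooth Ψ := hΦ.rext hρ
  have est := flat ε (σ z₀.1) z₀ R (2 * R) _ _ _ _ h _ hε hεε hb₀ (by linarith) S Ψ cΨ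
  set w := l2 (weight ε O u f G) (dxdθ d) with hw
  set φ := l2 (res Φ) (dxdθ d) with hφ
  have pw : 0 ≤ w := l2_nonneg _
  have pφ : 0 ≤ φ := l2_nonneg _
  have elΨ : l2 Ψ volume = φ * c₅ := l2_rext hρ hΦ
  have hlw : l2 u (dxdθ d) ≤ w := sol.l2_le_weight hO.measurableSet
  have hbase : Cf * l2 h volume * l2 Ψ volume ≤ Cf * K * c₅ * (w * φ) := by
    rw [elΨ]
    calc _ ≤ Cf * (K * w) * (φ * c₅) := by
          have : l2 h volume ≤ K * w := hh.trans (le_of_eq (by rw [hK]; ring))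
          gcongr
      _ = _ := by ring
  have hsupp : ∀ z, Ψ z ≠ 0 → z ∈ Metric.closedBall z₀ (R / 4) := mem_closedBall_of_rext_ne_zero hR1 hρs hU
  have hts : tsupport Ψ ⊆ Metric.closedBall z₀ (R / 4) :=
    closure_minimal hsupp Metric.isClosed_closedBall
  have χone : ∀ z ∈ Metric.closedBall z₀ (R / 4), χ₁ z.1 = 1 ∧ χ₂ z.2 = 1 := fun z hz => by
    have hz' := Metric.mem_closedBall.1 hz
    exact ⟨χ₁1 _ (Metric.mem_closedBall.2 ((le_max_left _ _).trans (hz'.trans (by linarith)))),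
      χ₂1 _ (Metric.mem_closedBall.2 ((le_max_right _ _).trans (hz'.trans (by linarith))))⟩
  -- For the two local operators the cutoff in front of `ũ` may be omitted, as it equals `1` on the
  -- support of the test function.
  have drop : ∀ a : E d × E d → ℝ, (∀ z, a z ≠ 0 → z ∈ Metric.closedBall z₀ (R / 4)) →
      ∫ z, χ z * u (lift z) * a z = ∫ z, u (lift z) * a z := fun a ha => by
    refine integral_congr_ae (Filter.Eventually.of_forall fun z => ?_)
    by_cases h0 : a z = 0
    · simp [h0]
    · have := χone z (ha z h0)
      simp only [hχ, this.1, this.2, one_mul]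
  have wφ : 0 ≤ w * φ := by positivity
  have fin : ∀ {x D : ℝ}, D ≤ D₁ + D₂ + D₃ → x ≤ D * (w * φ) → x ≤ (D₁ + D₂ + D₃) * w * φ :=
    fun hD hx => by
      rw [mul_assoc]
      exact hx.trans (mul_le_mul_of_nonneg_right hD wφ)
  have sY : ∀ v, tsupport (dY v Ψ) ⊆ Metric.closedBall z₀ (R / 4) := fun v =>
    (SphereSolution.tsupport_dY_subset v).trans hts
  refine ⟨fin (D := D₁) (by linarith) ?_, fin (D := D₂) (by linarith) ?_,
    fin (D := D₃) (by linarith) ?_⟩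
  · have e1 := est.1.trans hbase
    rw [drop _ fun z hz => ?_, sol.integral_lapY_rext hρ hρ' hΦ] at e1
    · refine mul_abs_le_of_mul_abs_add_le pc₁ (sq_nonneg ε) (by gcongr) e1 ?_
      rw [abs_mul, mul_comm]
      gcongr
      exact (abs_integral_mul_le_l2 sol.memu hΦ.memLp_res).trans (by gcongr)
    · obtain ⟨j, -, hj⟩ := Finset.exists_ne_zero_of_sum_ne_zero hz
      exact sY _ (SphereSolution.tsupport_dY_subset _ (subset_tsupport _ hj))
  · have e1 := est.2.1.trans hbase
    rw [drop _ fun z hz => ?_, sol.integral_trans_rext hρ hΦ, ← one_mul |_|] at e1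
    · have := mul_abs_le_of_mul_abs_add_le (y := 0) (b := 0) pc₂ zero_le_one le_rfl
        (h := (congrArg (fun t => 1 * |t|) (add_zero _)).trans_le e1) (by simp)
      simpa using this
    · obtain ⟨j, -, hj⟩ := Finset.exists_ne_zero_of_sum_ne_zero hz
      exact hts (tsupport_fderiv_apply_subset ℝ _ (subset_tsupport _ (right_ne_zero_of_mul hj)))
  · have e1 := est.2.2.trans hbase
    have hW1 : ∀ z, Ψ z ≠ 0 → χ₁ z.1 = 1 := fun z hz => (χone z (hsupp z hz)).1
    have hW2 : ∀ z, Ψ z ≠ 0 → ‖z.2‖ ≤ 2 := fun z hz => by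
      have h1 : dist z.2 z₀.2 ≤ R / 4 := (le_max_right _ _).trans (Metric.mem_closedBall.1 (hsupp z hz))
      have h2 := norm_le_norm_add_norm_sub' z.2 z₀.2
      rw [dist_eq_norm] at h1
      have h3 : ‖z₀.2‖ = 1 := norm_sphere _
      linarith
    obtain ⟨i2, h2⟩ := cutb u sol.memu Ψ cΨ hW1 hW2
    -- The multiplier is local in `y`, so the second cutoff is invisible and only the one in `x`
    -- needs a commutator.
    have bes2 : ∀ z, χ₂ z.2 * bes Ψ z = bes Ψ z := fun z => by
      by_cases h0 : ∃ x, Ψ (x, z.2) ≠ 0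
      · obtain ⟨x, hx⟩ := h0
        rw [(χone _ (hsupp _ hx)).2, one_mul]
      · push Not at h0
        rw [bes_eq_zero h0, mul_zero]
    obtain ⟨Bb, hBb⟩ := cΨ.exists_bound_bes
    have i1 : Integrable (fun z => u (lift z) * (χ z * bes Ψ z)) volume :=
      integrable_lift_mul sol.memu (z₀ := z₀) (R := R) (B := Bb)
        (cχ.continuous.mul cΨ.continuous_bes).aestronglyMeasurable
        (fun z => by
          rw [abs_mul, ← one_mul Bb]
          exact mul_le_mul (χ1 z) (hBb z) (abs_nonneg _) zero_le_one)
        fun z hz => by rw [image_eq_zero_of_notMem_tsupport fun h => hz (sχ h), zero_mul]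
    have e3 : ∫ z, χ z * u (lift z) * bes Ψ z = (∫ p, u p *
        besselD d (2 / 3) (fun x => Φ (x, (p.2 : E d))) p.1 ∂dxdθ d) * c₃ +
        -∫ z, u (lift z) * ((1 - χ₁ z.1) * bes Ψ z) := by
      rw [← sol.integral_bes_rext hρ hΦ, ← sub_eq_add_neg, eq_sub_iff_add_eq]
      have e4 : ∫ z, χ z * u (lift z) * bes Ψ z = ∫ z, u (lift z) * (χ z * bes Ψ z) :=
        integral_congr_ae (Filter.Eventually.of_forall fun z => by ring)
      rw [e4, ← integral_add i1 i2]
      refine integral_congr_ae (Filter.Eventually.of_forall fun z => ?_)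
      have e5 : χ z * bes Ψ z = χ₁ z.1 * bes Ψ z := by rw [mul_assoc, bes2]
      simp only [e5]
      ring
    rw [e3] at e1
    have := mul_abs_le_of_mul_abs_add_le (e₀ := |ε₀| ^ (2 / 3 : ℝ)) (b := Cb * c₅) pc₃ (by positivity)
      (Real.rpow_le_rpow hε.le (hεε.trans (le_abs_self _)) (by norm_num)) e1 (by
        rw [abs_neg]
        refine h2.trans ?_
        rw [elΨ]
        calc Cb * l2 u (dxdθ d) * (φ * c₅) ≤ Cb * w * (φ * c₅) := by gcongr
          _ = _ := by ring)
    refine this.trans (le_of_eq ?_)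
    rw [hD₃]
    ring

end LocalTheorem

/-! ### Representing distributions by functions -/

section Riesz

/-- A functional that is bounded with respect to the Hilbert seminorm `‖J v‖` is an inner product
with an element of the Hilbert space. -/
lemma exists_inner_eq {V H : Type*} [AddCommGroup V] [Module ℝ V] [NormedAddCommGroup H]
    [InnerProductSpace ℝ H] [CompleteSpace H] (J : V →ₗ[ℝ] H) (Λ : V →ₗ[ℝ] ℝ) {C : ℝ}
    (hC : 0 ≤ C) (h : ∀ v, |Λ v| ≤ C * ‖J v‖) :
    ∃ m : H, ‖m‖ ≤ C ∧ ∀ v, Λ v = ⟪m, J v⟫ := by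
  have hker : LinearMap.ker J.rangeRestrict ≤ LinearMap.ker Λ := fun v hv => by
    have h0 : J v = 0 := congrArg Subtype.val (LinearMap.mem_ker.1 hv)
    have := h v
    rw [h0, norm_zero, mul_zero] at this
    exact LinearMap.mem_ker.2 (abs_nonpos_iff.1 this)
  let e := J.rangeRestrict.quotKerEquivOfSurjective (LinearMap.surjective_rangeRestrict J)
  let g : LinearMap.range J →ₗ[ℝ] ℝ := (LinearMap.ker J.rangeRestrict).liftQ Λ hker ∘ₗ e.symm.toLinearMap
  have hg : ∀ v, g (J.rangeRestrict v) = Λ v := fun v => by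
    have : e.symm (J.rangeRestrict v) = (LinearMap.ker J.rangeRestrict).mkQ v := by
      rw [LinearEquiv.symm_apply_eq]; rfl
    change (LinearMap.ker J.rangeRestrict).liftQ Λ hker (e.symm (J.rangeRestrict v)) = _
    rw [this]
    rfl
  have hb : ∀ x, ‖g x‖ ≤ C * ‖x‖ := fun x => by
    obtain ⟨v, rfl⟩ := LinearMap.surjective_rangeRestrict J x
    rw [hg]
    exact h v
  -- The Hahn–Banach extension makes it unnecessary to close the range of `J` before the Riesz
  -- theorem is applied.
  obtain ⟨F, hF, hFn⟩ := _root_.exists_extension_norm_eq _ (g.mkContinuous C hb)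
  refine ⟨(InnerProductSpace.toDual ℝ H).symm F, ?_, fun v => ?_⟩
  · rw [LinearIsometryEquiv.norm_map, hFn]
    exact g.mkContinuous_norm_le hC hb
  · rw [InnerProductSpace.toDual_symm_apply, ← hg v]
    exact (hF (J.rangeRestrict v)).symm

variable {d : ℕ}

/-- Linear functionals of the restriction of a test function to `ℝⁿ × 𝕊ⁿ⁻¹`. -/
structure SphereFunctional (Λ : (E d × E d → ℝ) → ℝ) : Prop where
  add : ∀ Φ Ψ, CcSmooth Φ → CcSmooth Ψ → Λ (fun z => Φ z + Ψ z) = Λ Φ + Λ Ψ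
  const_mul : ∀ (c : ℝ) Φ, CcSmooth Φ → Λ (fun z => c * Φ z) = c * Λ Φ
  congr : ∀ Φ Ψ, CcSmooth Φ → CcSmooth Ψ → res Φ = res Ψ → Λ Φ = Λ Ψ

lemma ccSmooth_zero : CcSmooth fun _ : E d × E d => (0 : ℝ) := ⟨contDiff_const, .zero⟩

lemma SphereFunctional.zero {Λ : (E d × E d → ℝ) → ℝ} (hΛ : SphereFunctional Λ) :
    Λ (fun _ => 0) = 0 := by
  simpa using hΛ.const_mul 0 (fun _ => 0) ccSmooth_zero

lemma SphereFunctional.sum {Λ : (E d × E d → ℝ) → ℝ} (hΛ : SphereFunctional Λ) {ι : Type*}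
    (s : Finset ι) {Φ : ι → E d × E d → ℝ} (hΦ : ∀ i, CcSmooth (Φ i)) :
    Λ (fun z => ∑ i ∈ s, Φ i z) = ∑ i ∈ s, Λ (Φ i) := by
  classical
  induction s using Finset.induction_on with
  | empty => simpa using hΛ.zero
  | insert a s ha ih =>
    simp only [Finset.sum_insert ha]
    rw [hΛ.add _ _ (hΦ a) (CcSmooth.sum s hΦ), ih]

/-- The test functions whose restriction to `ℝⁿ × 𝕊ⁿ⁻¹` vanishes outside `U`. -/
def testSpace (U : Set (E d × S d)) : Submodule ℝ (E d × E d → ℝ) where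
  carrier := {Φ | CcSmooth Φ ∧ ∀ p ∉ U, res Φ p = 0}
  add_mem' h h' := ⟨h.1.add h'.1, fun p hp => by
    have := h.2 p hp
    have := h'.2 p hp
    simp_all [res]⟩
  zero_mem' := ⟨ccSmooth_zero, fun _ _ => rfl⟩
  smul_mem' c Φ h := ⟨h.1.const_mul c, fun p hp => by
    have := h.2 p hp
    simp_all [res]⟩

/-- The Riesz theorem in `L²`, with the restriction of a test function to the sphere as its element
of the Hilbert space. The norm of the representative is the constant in the bound. -/
lemma SphereFunctional.exists_representative {Λ : (E d × E d → ℝ) → ℝ} (hΛ : SphereFunctional Λ)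
    {U : Set (E d × S d)} {C : ℝ} (hC : 0 ≤ C)
    (h : ∀ Φ, CcSmooth Φ → (∀ p ∉ U, res Φ p = 0) → |Λ Φ| ≤ C * l2 (res Φ) (dxdθ d)) :
    ∃ m : E d × S d → ℝ, MemLp m 2 (dxdθ d) ∧ eLpNorm m 2 (dxdθ d) ≤ ENNReal.ofReal C ∧
      ∀ Φ, CcSmooth Φ → (∀ p ∉ U, res Φ p = 0) → Λ Φ = ∫ p, m p * res Φ p ∂dxdθ d := by
  let J : testSpace U →ₗ[ℝ] Lp ℝ 2 (dxdθ d) :=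
    { toFun := fun Φ => Φ.2.1.memLp_res.toLp _
      map_add' := fun Φ Ψ => MemLp.toLp_add Φ.2.1.memLp_res Ψ.2.1.memLp_res
      map_smul' := fun c Φ => MemLp.toLp_const_smul c Φ.2.1.memLp_res }
  let L : testSpace U →ₗ[ℝ] ℝ :=
    { toFun := fun Φ => Λ Φ
      map_add' := fun Φ Ψ => hΛ.add _ _ Φ.2.1 Ψ.2.1
      map_smul' := fun c Φ => hΛ.const_mul c _ Φ.2.1 }
  obtain ⟨m, hm, hmL⟩ := exists_inner_eq J L hC fun Φ => by
    refine (h Φ Φ.2.1 Φ.2.2).trans_eq ?_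
    rw [l2_eq_toReal Φ.2.1.memLp_res.1]
    exact congrArg (C * ·) (Lp.norm_toLp _ Φ.2.1.memLp_res).symm
  refine ⟨m, Lp.memLp m, ?_, fun Φ hΦ hU => ?_⟩
  · rw [← Lp.enorm_def, ← ofReal_norm]
    exact ENNReal.ofReal_le_ofReal hm
  · have := hmL ⟨Φ, hΦ, hU⟩
    refine this.trans ?_
    rw [L2.inner_def]
    refine integral_congr_ae ?_
    filter_upwards [hΦ.memLp_res.coeFn_toLp] with p hp
    change ⟪m p, (hΦ.memLp_res.toLp _ : Lp ℝ 2 (dxdθ d)) p⟫ = _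
    rw [hp]
    simp [mul_comm]

end Riesz

/-! ### Test functions determine a function almost everywhere. -/

section Uniqueness
variable {d : ℕ}

instance : (ae (rad d)).NeBot := by
  rw [ae_neBot]
  intro h
  have h1 : rad d (Iio ⟨1, mem_Ioi.2 one_pos⟩) = 0 := by rw [h]; rfl
  rw [rad, Measure.volumeIoiPow_apply_Iio] at h1
  simp at h1
  linarith

lemma continuousOn_lift : ContinuousOn (lift : E d × E d → E d × S d) {z | z.2 ≠ 0} :=
  fun _ hz => (continuousAt_lift hz).continuousWithinAt

lemma isOpen_lift_preimage {U : Set (E d × S d)} (hU : IsOpen U) :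
    IsOpen {z : E d × E d | z.2 ≠ 0 ∧ lift z ∈ U} :=
  continuousOn_lift.isOpen_inter_preimage (isOpen_ne_fun continuous_snd continuous_const) hU

/-- A function that is orthogonal to all test functions vanishes. -/
lemma ae_eq_zero_of_integral_res {U : Set (E d × S d)} (hU : IsOpen U) (hUQ : U ⊆ Q d)
    {k : E d × S d → ℝ}
    (hk : ∀ K, IsCompact K → K ⊆ U → MemLp k 2 ((dxdθ d).restrict K))
    (h : ∀ Φ, IsTest d Φ → (∀ p ∉ U, res Φ p = 0) → ∫ p, k p * res Φ p ∂dxdθ d = 0) :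
    ∀ᵐ p ∂dxdθ d, p ∈ U → k p = 0 := by
  have hV := isOpen_lift_preimage hU
  set V := {z : E d × E d | z.2 ≠ 0 ∧ lift z ∈ U}
  have hc : ContinuousOn lift V := continuousOn_lift.mono fun z hz => hz.1
  have hcut : ∀ K, IsCompact K → K ⊆ V → MemLp ((lift '' K).indicator k) 2 (dxdθ d) := by
    intro K hK hKV
    have hK' : IsCompact (lift '' K) := hK.image_of_continuousOn (hc.mono hKV)
    rw [memLp_indicator_iff_restrict hK'.measurableSet]
    exact hk _ hK' (image_subset_iff.2 fun z hz => (hKV hz).2)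
  have hflat : ∀ᵐ z : E d × E d, z ∈ V → k (lift z) = 0 := by
    refine hV.ae_eq_zero_of_integral_contDiff_smul_eq_zero ?_ fun g hg hgc hgV => ?_
    · rw [locallyIntegrableOn_iff hV.isLocallyClosed]
      intro K hKV hK
      obtain ⟨R, hR⟩ := hK.isBounded.subset_closedBall 0
      have : IsFiniteMeasure (volume.restrict K : Measure (E d × E d)) :=
        isFiniteMeasure_restrict.2 hK.measure_lt_top.ne
      have h1 := ((memLp_lift (hcut K hK hKV) R).restrict K).integrable one_le_two
      refine h1.congr ?_
      filter_upwards [ae_restrict_mem hK.measurableSet] with z hz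
      have hzR : z ∈ {z : E d × E d | ‖z.2‖ ≤ R} :=
        (le_max_right _ _).trans (mem_closedBall_zero_iff.1 (hR hz))
      rw [indicator_of_mem hzR, indicator_of_mem (mem_image_of_mem _ hz)]
    · have cg : CcSmooth g := ⟨hg, hgc⟩
      set k' := (lift '' tsupport g).indicator k with hk'
      have hi : Integrable (fun z => k' (lift z) * g z) volume :=
        (cg.integrable_lift_mul (hcut _ hgc.isCompact hgV) (k := fun _ => 1) measurable_const
          (B := 1) (by simp)).congr (Filter.Eventually.of_forall fun z => by ring)
      have e1 : ∫ z, g z • k (lift z) = ∫ z, k' (lift z) * g z := by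
        refine integral_congr_ae (Filter.Eventually.of_forall fun z => ?_)
        by_cases hz : z ∈ tsupport g
        · simp only [hk', indicator_of_mem (mem_image_of_mem lift hz), smul_eq_mul, mul_comm]
        · simp [image_eq_zero_of_notMem_tsupport hz]
      rw [e1, integral_polar hi]
      refine (integral_congr_ae (Filter.Eventually.of_forall fun r => ?_)).trans
        (integral_zero _ _)
      have hr : (0 : ℝ) < r := r.2
      have hmem : ∀ p : E d × S d, g (pol (p, r)) ≠ 0 → pol (p, r) ∈ tsupport g := fun p hp =>
        subset_tsupport _ hp
      -- For each radius the slice of a flat test function is a test function on the sphere, so the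
      -- pairing vanishes already before integration over `r`.
      have hz := h _ (isTest_scale cg (fun z hz => hUQ (hgV hz).2) hr.ne') fun p hp => by
        by_contra hn
        have := (hgV (hmem p hn)).2
        rw [lift_pol] at this
        exact hp this
      refine Eq.trans (integral_congr_ae (Filter.Eventually.of_forall fun p => ?_)) hz
      by_cases hn : g (pol (p, r)) = 0
      · have : res (fun z : E d × E d => g (z.1, (r : ℝ) • z.2)) p = 0 := hn
        simp only [hn, this, mul_zero]
      · have : p ∈ lift '' tsupport g := ⟨_, hmem p hn, lift_pol _⟩
        simp only [lift_pol, hk', indicator_of_mem this]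
        rfl
  have h1 := measurePreserving_pol.quasiMeasurePreserving.ae hflat
  -- The lift is constant on rays, so a single good radius suffices.
  filter_upwards [Measure.ae_ae_of_ae_prod h1] with p hp hpU
  obtain ⟨r, hr⟩ := hp.exists
  have hr0 : (0 : ℝ) < r := r.2
  rw [lift_pol] at hr
  refine hr ⟨?_, by rwa [lift_pol]⟩
  exact smul_ne_zero hr0.ne' (coe_sphere_ne_zero _)

end Uniqueness

/-! ### Estimates near a compact set -/

section Patching
variable {d : ℕ}

/-- Smooth functions `ψ i`, `i ∈ t`, with support in `U i` and sum `1` on `V`. -/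
structure Patching (t : Finset (E d × S d)) (U : E d × S d → Set (E d × S d)) (V : Set (E d × S d))
    (ψ : E d × S d → E d × E d → ℝ) : Prop where
  smooth : ∀ i, ContDiff ℝ ∞ (ψ i)
  bound : ∀ i z, |ψ i z| ≤ 1
  supp : ∀ i p, res (ψ i) p ≠ 0 → i ∈ t ∧ p ∈ U i
  sum : ∀ p ∈ V, ∑ i ∈ t, res (ψ i) p = 1

lemma lift_inclusion (p : E d × S d) : lift (p.1, (p.2 : E d)) = p := Prod.ext rfl (dir_self _)

/-- A smooth partition of unity in flat space, subordinate to the cones over a finite subfamily of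
the `U i`. An intermediate compact set leaves room for an open neighbourhood of `K` on which the sum
is `1`. -/
lemma exists_patching {K O : Set (E d × S d)} (hK : IsCompact K) (hO : IsOpen O) (hKO : K ⊆ O)
    {U : E d × S d → Set (E d × S d)} (hU : ∀ p ∈ O, IsOpen (U p) ∧ p ∈ U p) :
    ∃ V, IsOpen V ∧ K ⊆ V ∧ V ⊆ O ∧ ∃ t ψ, (∀ i ∈ t, i ∈ O) ∧ Patching t U V ψ := by
  obtain ⟨K', hK', hKK', hKO'⟩ := exists_compact_between hK hO hKO
  obtain ⟨t, ht, htU⟩ := hK'.elim_nhds_subcover U fun p hp =>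
    (hU p (hKO' hp)).1.mem_nhds (hU p (hKO' hp)).2
  have hs : IsClosed ((fun p : E d × S d => (p.1, (p.2 : E d))) '' K') :=
    (hK'.image continuous_inclusion).isClosed
  -- The condition `i ∈ t` makes the open sets empty for all other indices, so the partition is in
  -- effect finite.
  have hopen : ∀ i, IsOpen {z : E d × E d | i ∈ t ∧ z.2 ≠ 0 ∧ lift z ∈ U i} := fun i => by
    by_cases hi : i ∈ t
    · simp only [hi, true_and]
      exact isOpen_lift_preimage (hU i (hKO' (ht i hi))).1
    · simp [hi]
  obtain ⟨f, hf⟩ := SmoothPartitionOfUnity.exists_isSubordinate (modelWithCornersSelf ℝ (E d × E d))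
    hs _ hopen (by
      rintro _ ⟨p, hp, rfl⟩
      obtain ⟨i, hi, hpi⟩ := mem_iUnion₂.1 (htU hp)
      exact mem_iUnion.2 ⟨i, hi, coe_sphere_ne_zero _, by rwa [lift_inclusion]⟩)
  have hsupp : ∀ i p, res (f i) p ≠ 0 → i ∈ t ∧ p ∈ U i := fun i p hp => by
    have := hf i (subset_tsupport _ hp)
    exact ⟨this.1, by simpa only [lift_inclusion] using this.2.2⟩
  refine ⟨interior K', isOpen_interior, hKK', interior_subset.trans hKO', t, fun i => f i,
    fun i hi => hKO' (ht i hi), fun i => (f i).contMDiff.contDiff, fun i z => ?_, hsupp,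
    fun p hp => ?_⟩
  · rw [abs_of_nonneg (f.nonneg i z)]
    exact f.le_one i z
  · have h1 : ∑ᶠ i, res (f i) p = 1 := f.sum_eq_one (mem_image_of_mem _ (interior_subset hp))
    rwa [finsum_eq_sum_of_support_subset _ (s := t) fun i hi => (hsupp i p hi).1] at h1

/-- The bounds contain the test function only through its `L²` norm, and multiplication by `ψ i`
does not increase that norm. So the constants simply add, and nonlocality of the functional does no
harm. -/
lemma SphereFunctional.mul_abs_le_of_patching {Λ : (E d × E d → ℝ) → ℝ} (hΛ : SphereFunctional Λ)
    {t : Finset (E d × S d)} {U : E d × S d → Set (E d × S d)} {V : Set (E d × S d)}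
    {ψ : E d × S d → E d × E d → ℝ} (hψ : Patching t U V ψ) {e w : ℝ} {C : E d × S d → ℝ}
    (he : 0 ≤ e) (hw : 0 ≤ w) (hC : ∀ i ∈ t, 0 ≤ C i)
    (h : ∀ i ∈ t, ∀ Φ, CcSmooth Φ → (∀ p, p ∉ U i → res Φ p = 0) →
      e * |Λ Φ| ≤ C i * w * l2 (res Φ) (dxdθ d))
    {Φ : E d × E d → ℝ} (hΦ : CcSmooth Φ) (hV : ∀ p, p ∉ V → res Φ p = 0) :
    e * |Λ Φ| ≤ (∑ i ∈ t, C i) * w * l2 (res Φ) (dxdθ d) := by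
  have hc : ∀ i, CcSmooth fun z => ψ i z * Φ z := fun i => CcSmooth.smooth_mul (hψ.smooth i) hΦ
  have hres : res Φ = res fun z => ∑ i ∈ t, ψ i z * Φ z := funext fun p => by
    have e1 : (res fun z => ∑ i ∈ t, ψ i z * Φ z) p = (∑ i ∈ t, res (ψ i) p) * res Φ p := by
      rw [Finset.sum_mul]; rfl
    rw [e1]
    by_cases hp : p ∈ V
    · rw [hψ.sum p hp, one_mul]
    · rw [hV p hp, mul_zero]
  rw [hΛ.congr _ _ hΦ (CcSmooth.sum t hc) hres, hΛ.sum t hc]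
  calc e * |∑ i ∈ t, Λ fun z => ψ i z * Φ z| ≤ e * ∑ i ∈ t, |Λ fun z => ψ i z * Φ z| := by
        gcongr
        exact Finset.abs_sum_le_sum_abs _ _
    _ = ∑ i ∈ t, e * |Λ fun z => ψ i z * Φ z| := Finset.mul_sum _ _ _
    _ ≤ ∑ i ∈ t, C i * w * l2 (res Φ) (dxdθ d) := by
        refine Finset.sum_le_sum fun i hi => (h i hi _ (hc i) fun p hp => ?_).trans ?_
        · by_contra h0
          exact hp (hψ.supp i p (left_ne_zero_of_mul h0)).2
        · have h1 := hC i hi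
          gcongr
          refine (l2_mono (b := fun p => ‖res Φ p‖) hΦ.memLp_res.norm fun p => ?_).trans_eq
            (by simp [l2])
          have : res (fun z => ψ i z * Φ z) p = ψ i (p.1, (p.2 : E d)) * res Φ p := rfl
          rw [this, norm_mul]
          exact mul_le_of_le_one_left (norm_nonneg _) (hψ.bound i _)
    _ = _ := by rw [Finset.sum_mul, Finset.sum_mul]

end Patching

/-! ### Linearity of the three functionals. -/

section Functionals
variable {d : ℕ} {ρ : ℝ → ℝ} {Φ Ψ : E d × E d → ℝ}

lemma rext_add : rext ρ (fun z => Φ z + Ψ z) = fun z => rext ρ Φ z + rext ρ Ψ z := by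
  funext z; simp only [rext]; ring

lemma rext_const_mul (c : ℝ) : rext ρ (fun z => c * Φ z) = fun z => c * rext ρ Φ z := by
  funext z; simp only [rext]; ring

/-- The extension uses `Φ` only at unit vectors, and at `y = 0` the cutoff vanishes. -/
lemma rext_congr (hρ : RadialCutoff ρ) (h : res Φ = res Ψ) : rext ρ Φ = rext ρ Ψ := by
  funext z
  by_cases hz : z.2 = 0
  · have : ρ (‖z.2‖ ^ 2) = 0 := by
      by_contra h0
      have := hρ.supp _ h0
      rw [hz] at this
      norm_num at this
    simp [rext, this]
  · have := congrFun h (lift z)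
    simp only [res, lift, dir_coe hz] at this
    rw [rext, rext, this]

/-- A functional that becomes linear after lifting to `ℝⁿ × ℝⁿ` is linear. -/
lemma sphereFunctional_of_lift {Λ : (E d × E d → ℝ) → ℝ} {A : (E d × E d → ℝ) → E d × E d → ℝ}
    {u : E d × S d → ℝ} {b c : ℝ} (hu : MemLp u 2 (dxdθ d)) (hρ : RadialCutoff ρ) (hc : c ≠ 0)
    (hint : ∀ Φ, CcSmooth Φ → Integrable (fun z => u (lift z) * A (rext ρ Φ) z) volume)
    (hadd : ∀ V W, CcSmooth V → CcSmooth W → ∀ z, A (fun z => V z + W z) z = A V z + A W z)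
    (hmul : ∀ (a : ℝ) V, CcSmooth V → ∀ z, A (fun z => a * V z) z = a * A V z)
    (h : ∀ Φ, CcSmooth Φ → ∫ z, u (lift z) * A (rext ρ Φ) z =
      Λ Φ * c + (∫ p, u p * res Φ p ∂dxdθ d) * b) : SphereFunctional Λ := by
  refine ⟨fun Φ Ψ hΦ hΨ => ?_, fun a Φ hΦ => ?_, fun Φ Ψ hΦ hΨ hr => ?_⟩ <;>
    refine mul_right_cancel₀ hc ?_
  · have e1 : ∫ z, u (lift z) * A (rext ρ fun z => Φ z + Ψ z) z =
        (∫ z, u (lift z) * A (rext ρ Φ) z) + ∫ z, u (lift z) * A (rext ρ Ψ) z := by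
      rw [← integral_add (hint Φ hΦ) (hint Ψ hΨ), rext_add]
      exact integral_congr_ae (Filter.Eventually.of_forall fun z => by
        simp only [hadd _ _ (hΦ.rext hρ) (hΨ.rext hρ)]; ring)
    have e2 : ∫ p, u p * res (fun z => Φ z + Ψ z) p ∂dxdθ d =
        (∫ p, u p * res Φ p ∂dxdθ d) + ∫ p, u p * res Ψ p ∂dxdθ d := by
      have i1 : Integrable (fun p => u p * res Φ p) (dxdθ d) := hu.integrable_mul hΦ.memLp_res
      have i2 : Integrable (fun p => u p * res Ψ p) (dxdθ d) := hu.integrable_mul hΨ.memLp_res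
      rw [← integral_add i1 i2]
      exact integral_congr_ae (Filter.Eventually.of_forall fun p => by simp only [res]; ring)
    rw [h _ (hΦ.add hΨ), h Φ hΦ, h Ψ hΨ, e2] at e1
    linarith
  · have e1 : ∫ z, u (lift z) * A (rext ρ fun z => a * Φ z) z =
        a * ∫ z, u (lift z) * A (rext ρ Φ) z := by
      rw [← integral_const_mul, rext_const_mul]
      exact integral_congr_ae (Filter.Eventually.of_forall fun z => by
        simp only [hmul _ _ (hΦ.rext hρ)]; ring)
    have e2 : ∫ p, u p * res (fun z => a * Φ z) p ∂dxdθ d = a * ∫ p, u p * res Φ p ∂dxdθ d := by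
      rw [← integral_const_mul]
      exact integral_congr_ae (Filter.Eventually.of_forall fun p => by simp only [res]; ring)
    rw [h _ (hΦ.const_mul a), h Φ hΦ, e2] at e1
    linarith
  · have e1 := h Φ hΦ
    rw [rext_congr hρ hr, hr, h Ψ hΨ] at e1
    linarith

lemma dX_add (hΦ : Differentiable ℝ Φ) (hΨ : Differentiable ℝ Ψ) (v : E d) (z : E d × E d) :
    dX v (fun z => Φ z + Ψ z) z = dX v Φ z + dX v Ψ z := by
  have h : HasFDerivAt (fun z => Φ z + Ψ z) _ z := (hΦ z).hasFDerivAt.add (hΨ z).hasFDerivAt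
  rw [dX, h.fderiv]
  rfl

lemma dX_const_mul (hΦ : Differentiable ℝ Φ) (c : ℝ) (v : E d) (z : E d × E d) :
    dX v (fun z => c * Φ z) z = c * dX v Φ z := by
  rw [dX, fderiv_const_mul (hΦ z)]
  rfl

lemma trans_add (hΦ : CcSmooth Φ) (hΨ : CcSmooth Ψ) (z : E d × E d) :
    trans (fun z => Φ z + Ψ z) z = trans Φ z + trans Ψ z := by
  simp only [trans, dX_add hΦ.differentiable hΨ.differentiable, mul_add, Finset.sum_add_distrib]

lemma trans_const_mul (hΦ : CcSmooth Φ) (c : ℝ) (z : E d × E d) :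
    trans (fun z => c * Φ z) z = c * trans Φ z := by
  simp only [trans, dX_const_mul hΦ.differentiable, Finset.mul_sum]
  exact Finset.sum_congr rfl fun j _ => by ring

lemma lapY_add (hΦ : CcSmooth Φ) (hΨ : CcSmooth Ψ) (z : E d × E d) :
    lapY (fun z => Φ z + Ψ z) z = lapY Φ z + lapY Ψ z := by
  have h : ∀ v, dY v (fun z => Φ z + Ψ z) = fun z => dY v Φ z + dY v Ψ z := fun v =>
    funext fun z => dY_add hΦ.differentiable hΨ.differentiable v z
  simp only [lapY, h, dY_add (hΦ.dY _).differentiable (hΨ.dY _).differentiable,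
    Finset.sum_add_distrib]

lemma lapY_const_mul (hΦ : CcSmooth Φ) (c : ℝ) (z : E d × E d) :
    lapY (fun z => c * Φ z) z = c * lapY Φ z := by
  have h : ∀ v, dY v (fun z => c * Φ z) = fun z => c * dY v Φ z := fun v =>
    funext fun z => dY_const_mul hΦ.differentiable c v z
  simp only [lapY, h, dY_const_mul (hΦ.dY _).differentiable, Finset.mul_sum]

lemma CcSmooth.integrable_bes_integrand (hΦ : CcSmooth Φ) (z : E d × E d) :
    Integrable (fun k => Real.fourierChar ⟪k, z.1⟫ • (sym k * pF Φ k z.2)) volume := by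
  obtain ⟨b, hb, -, hWb⟩ := hΦ.exists_sym_dominating
  refine hb.mono' (Continuous.aestronglyMeasurable ?_)
    (Filter.Eventually.of_forall fun k => by rw [Circle.norm_smul]; exact hWb k z.2)
  have hs := continuous_sym (d := d)
  have : Continuous fun k => pF Φ k z.2 := by
    have h : Continuous fun k : E d => (k, z.2) := by fun_prop
    simpa only [Function.comp_def] using Continuous.comp hΦ.continuous_pF h
  simp only [Circle.smul_def]
  fun_prop

lemma bes_add (hΦ : CcSmooth Φ) (hΨ : CcSmooth Ψ) (z : E d × E d) :
    bes (fun z => Φ z + Ψ z) z = bes Φ z + bes Ψ z := by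
  have h : ∀ k, pF (fun z => Φ z + Ψ z) k z.2 = pF Φ k z.2 + pF Ψ k z.2 := fun k => by
    rw [pF_eq, pF_eq, pF_eq, ← integral_add (hΦ.integrable_slice k z.2) (hΨ.integrable_slice k z.2)]
    refine integral_congr_ae (Filter.Eventually.of_forall fun x => ?_)
    simp only [← smul_add]
    push_cast
    rfl
  rw [bes_eq_integral, bes_eq_integral, bes_eq_integral, ← Complex.add_re,
    ← integral_add (hΦ.integrable_bes_integrand z) (hΨ.integrable_bes_integrand z)]
  simp only [h, mul_add, smul_add]

lemma bes_const_mul (c : ℝ) (z : E d × E d) : bes (fun z => c * Φ z) z = c * bes Φ z := by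
  have h : ∀ k, pF (fun z => c * Φ z) k z.2 = (c : ℂ) * pF Φ k z.2 := fun k => by
    rw [pF_eq, pF_eq, ← integral_const_mul]
    refine integral_congr_ae (Filter.Eventually.of_forall fun x => ?_)
    simp only [Circle.smul_def, smul_eq_mul]
    push_cast
    ring
  rw [bes_eq_integral, bes_eq_integral, ← Complex.re_ofReal_mul, ← integral_const_mul]
  congr 2
  funext k
  simp only [h, Circle.smul_def, smul_eq_mul]
  ring

namespace SphereSolution
variable {ε : ℝ} {σ : E d → ℝ} {u l f : E d × S d → ℝ} {G : E d × S d → E d}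

/-- The tail in `x` is not compact. Near the support a cutoff makes the product bounded with compact
support; far away the commutator bound puts it in `L²`. -/
lemma integrable_bes_rext (sol : SphereSolution d ε σ u l f G) (hρ : RadialCutoff ρ)
    (hΦ : CcSmooth Φ) : Integrable (fun z => u (lift z) * bes (rext ρ Φ) z) volume := by
  have cΨ := hΦ.rext hρ
  obtain ⟨R, hR⟩ := (hΦ.compact.isCompact.image continuous_fst).isBounded.subset_closedBall 0
  let β : ContDiffBump (0 : E d) := ⟨max R 1, max R 1 + 1, by positivity, by linarith⟩
  have cβ : CcSmooth β := ⟨β.contDiff, β.hasCompactSupport⟩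
  have h2 : ∀ z, rext ρ Φ z ≠ 0 → ‖z.2‖ ≤ 2 := fun z hz => by
    have := hρ.supp _ (left_ne_zero_of_mul hz)
    rw [abs_lt] at this
    nlinarith [norm_nonneg z.2]
  obtain ⟨C, -, h⟩ := exists_integral_cutoff_bes_le cβ
  have i2 := (h u sol.memu _ cΨ (fun z hz => β.one_of_mem_closedBall
    (Metric.closedBall_subset_closedBall (le_max_left _ _)
      (hR ⟨_, subset_tsupport _ (right_ne_zero_of_mul hz), rfl⟩))) h2).1
  obtain ⟨B, hB⟩ := cΨ.exists_bound_bes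
  have i1 : Integrable (fun z => u (lift z) * (β z.1 * bes (rext ρ Φ) z)) volume := by
    refine integrable_lift_mul sol.memu (z₀ := 0) (R := max (max R 1 + 1) 2) (B := B)
      ((β.continuous.comp continuous_fst).mul cΨ.continuous_bes).aestronglyMeasurable
      (fun z => ?_) fun z hz => ?_
    · rw [abs_mul, ← one_mul B, abs_of_nonneg β.nonneg]
      exact mul_le_mul β.le_one (hB z) (abs_nonneg _) zero_le_one
    · by_contra h0
      refine hz (mem_closedBall_zero_iff.2 (max_le_max ?_ ?_))
      · have : z.1 ∈ Function.support β := left_ne_zero_of_mul h0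
        rw [β.support_eq] at this
        exact (mem_ball_zero_iff.1 this).le
      · by_contra h3
        exact right_ne_zero_of_mul h0 (bes_eq_zero fun x => by
          by_contra h4
          exact h3 (h2 (x, z.2) h4))
  refine (i1.add i2).congr (Filter.Eventually.of_forall fun z => ?_)
  simp only [Pi.add_apply]
  ring

/-- The flat pairing is linear and sees only the restriction to the sphere. Both properties descend,
because the radial constant is positive; the same argument serves the transport operator and
`D_x^{2/3}`. -/
lemma sphereFunctional_angLaplacian (sol : SphereSolution d ε σ u l f G) :
    SphereFunctional fun Φ => ∫ p, u p * angLaplacian d Φ p.1 p.2 ∂dxdθ d := by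
  obtain ⟨ρ, hρ, hρs, hρpos⟩ := exists_radialCutoff (d := d) (a := 1 / 4) (by norm_num) le_rfl
  exact sphereFunctional_of_lift sol.memu hρ
    (hρpos (fun r => (r ^ 2)⁻¹)
      (ContinuousOn.inv₀ (continuousOn_id.pow 2) fun r hr => pow_ne_zero _ (ne_of_gt hr))
      fun r hr => by positivity).ne'
    (fun Φ hΦ => sol.integrable_u (hΦ.rext hρ).lapY)
    (fun V W hV hW => lapY_add hV hW) (fun a V hV => lapY_const_mul hV a)
    fun Φ hΦ => sol.integral_lapY_rext hρ hρs hΦ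

lemma sphereFunctional_transport (sol : SphereSolution d ε σ u l f G) :
    SphereFunctional fun Φ => ∫ p, u p * transport d Φ p.1 p.2 ∂dxdθ d := by
  obtain ⟨ρ, hρ, hρs, hρpos⟩ := exists_radialCutoff (d := d) (a := 1 / 4) (by norm_num) le_rfl
  exact sphereFunctional_of_lift (b := 0) sol.memu hρ
    (hρpos (fun r => r) continuousOn_id fun r hr => hr).ne'
    (fun Φ hΦ => sol.integrable_u (hΦ.rext hρ).trans)
    (fun V W hV hW => trans_add hV hW) (fun a V hV => trans_const_mul hV a)
    fun Φ hΦ => by rw [mul_zero, add_zero, sol.integral_trans_rext hρ hΦ]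

lemma sphereFunctional_besselD (sol : SphereSolution d ε σ u l f G) :
    SphereFunctional fun Φ =>
      ∫ p, u p * besselD d (2 / 3) (fun x => Φ (x, (p.2 : E d))) p.1 ∂dxdθ d := by
  obtain ⟨ρ, hρ, hρs, hρpos⟩ := exists_radialCutoff (d := d) (a := 1 / 4) (by norm_num) le_rfl
  exact sphereFunctional_of_lift (b := 0) sol.memu hρ
    (hρpos (fun _ => 1) continuousOn_const fun r hr => one_pos).ne'
    (fun Φ hΦ => sol.integrable_bes_rext hρ hΦ)
    (fun V W hV hW => bes_add hV hW) (fun a V _ => bes_const_mul a)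
    fun Φ hΦ => by rw [mul_zero, add_zero, sol.integral_bes_rext hρ hΦ]; simp

end SphereSolution

end Functionals

/-! ### The estimate near a compact subset of `Q`. -/

section CompactEstimate
variable {d : ℕ}

/-- The neighbourhoods and constants of the local estimate are fixed before `ε`, the coefficients
and the solution are chosen, so patching preserves the uniformity. -/
theorem exists_compact_estimate {σ₀ M : ℝ} (ε₀ : ℝ) (hσ₀ : 0 < σ₀) (hM : 0 ≤ M)
    {K O : Set (E d × S d)} (hK : IsCompact K) (hO : IsOpen O) (hKO : K ⊆ O) (hOQ : O ⊆ Q d) :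
    ∃ V : Set (E d × S d), IsOpen V ∧ K ⊆ V ∧ V ⊆ O ∧ ∃ C : ℝ, 0 ≤ C ∧
      ∀ (ε : ℝ) (σ : E d → ℝ) (u l f : E d × S d → ℝ) (G : E d × S d → E d), 0 < ε → ε ≤ ε₀ →
      SigmaBounds d σ₀ M σ → SphereSolution d ε σ u l f G → (∀ p, |l p| ≤ M * |u p|) →
      ∀ Φ : E d × E d → ℝ, CcSmooth Φ → (∀ p, p ∉ V → res Φ p = 0) →
      ε ^ 2 * |∫ p, u p * angLaplacian d Φ p.1 p.2 ∂dxdθ d| ≤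
        C * l2 (weight ε O u f G) (dxdθ d) * l2 (res Φ) (dxdθ d) ∧
      |∫ p, u p * transport d Φ p.1 p.2 ∂dxdθ d| ≤
        C * l2 (weight ε O u f G) (dxdθ d) * l2 (res Φ) (dxdθ d) ∧
      ε ^ (2 / 3 : ℝ) *
        |∫ p, u p * besselD d (2 / 3) (fun x => Φ (x, (p.2 : E d))) p.1 ∂dxdθ d| ≤
        C * l2 (weight ε O u f G) (dxdθ d) * l2 (res Φ) (dxdθ d) := by
  have key := fun p (hp : p ∈ O) =>
    exists_local_estimate (ε₀ := ε₀) hσ₀ hM hO hp hOQ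
  choose! U hUo hUm hUO C hC est using key
  obtain ⟨V, hV, hKV, hVO, t, ψ, ht, hψ⟩ := exists_patching hK hO hKO fun p hp =>
    ⟨hUo p hp, hUm p hp⟩
  refine ⟨V, hV, hKV, hVO, ∑ i ∈ t, C i, Finset.sum_nonneg fun i hi => hC i (ht i hi), ?_⟩
  intro ε σ u l f G hε hεε hσ sol hl Φ hΦ hΦV
  have h := fun i (hi : i ∈ t) => est i (ht i hi) ε σ u l f G hε hεε hσ sol hl
  have hC' := fun i (hi : i ∈ t) => hC i (ht i hi)
  refine ⟨?_, ?_, ?_⟩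
  · exact sol.sphereFunctional_angLaplacian.mul_abs_le_of_patching hψ (sq_nonneg ε) (l2_nonneg _) hC'
      (fun i hi Φ hΦ hU => (h i hi Φ hΦ hU).1) hΦ hΦV
  · have := sol.sphereFunctional_transport.mul_abs_le_of_patching hψ zero_le_one (l2_nonneg _) hC'
      (fun i hi Φ hΦ hU => (one_mul _).trans_le (h i hi Φ hΦ hU).2.1) hΦ hΦV
    rwa [one_mul] at this
  · exact sol.sphereFunctional_besselD.mul_abs_le_of_patching hψ (by positivity) (l2_nonneg _) hC'
      (fun i hi Φ hΦ hU => (h i hi Φ hΦ hU).2.2) hΦ hΦV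

end CompactEstimate

/-! ### Distributions in `L²_loc` -/

section LocalRepresentation
variable {d : ℕ}

lemma IsTest.ccSmooth {Φ : E d × E d → ℝ} (hΦ : IsTest d Φ) : CcSmooth Φ := ⟨hΦ.smooth, hΦ.compact⟩

lemma IsTest.tsupport_res_subset {Φ : E d × E d → ℝ} (hΦ : IsTest d Φ) :
    tsupport (res Φ) ⊆ Q d := fun _ hp =>
  hΦ.support (tsupport_comp_subset_preimage Φ continuous_inclusion hp)

lemma IsTest.res_eq_zero {Φ : E d × E d → ℝ} (hΦ : IsTest d Φ) {p : E d × S d} (hp : p ∉ Q d) :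
    res Φ p = 0 :=
  image_eq_zero_of_notMem_tsupport fun h => hp (hΦ.tsupport_res_subset h)

lemma MemLp.l2loc {k : E d × S d → ℝ} (hk : MemLp k 2 (dxdθ d)) : L2loc d k :=
  fun K _ _ => MeasureTheory.MemLp.restrict K hk

lemma L2loc.sub {k k' : E d × S d → ℝ} (hk : L2loc d k) (hk' : L2loc d k') :
    L2loc d fun p => k p - k' p :=
  fun K hK hKQ => MeasureTheory.MemLp.sub (hk K hK hKQ) (hk' K hK hKQ)

lemma L2loc.add {k k' : E d × S d → ℝ} (hk : L2loc d k) (hk' : L2loc d k') :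
    L2loc d fun p => k p + k' p :=
  fun K hK hKQ => MeasureTheory.MemLp.add (hk K hK hKQ) (hk' K hK hKQ)

lemma L2loc.integrable_mul_res {k : E d × S d → ℝ} (hk : L2loc d k) {Φ : E d × E d → ℝ}
    (hΦ : IsTest d Φ) : Integrable (fun p => k p * res Φ p) (dxdθ d) := by
  have hK : IsCompact (tsupport (res Φ)) := hΦ.ccSmooth.hasCompactSupport_res
  have h1 := (memLp_indicator_iff_restrict hK.measurableSet).2 (hk _ hK hΦ.tsupport_res_subset)
  refine (h1.integrable_mul hΦ.ccSmooth.memLp_res).congr (Filter.Eventually.of_forall fun p => ?_)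
  by_cases hp : p ∈ tsupport (res Φ)
  · simp only [Pi.mul_apply, indicator_of_mem hp]
  · simp [image_eq_zero_of_notMem_tsupport hp]

lemma ae_eq_of_integral_res {U : Set (E d × S d)} (hU : IsOpen U) (hUQ : U ⊆ Q d)
    {k k' : E d × S d → ℝ} (hk : L2loc d k) (hk' : L2loc d k')
    (h : ∀ Φ, IsTest d Φ → (∀ p ∉ U, res Φ p = 0) →
      ∫ p, k p * res Φ p ∂dxdθ d = ∫ p, k' p * res Φ p ∂dxdθ d) :
    ∀ᵐ p ∂dxdθ d, p ∈ U → k p = k' p := by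
  have := ae_eq_zero_of_integral_res hU hUQ
    (fun K hK hKU => (hk.sub hk') K hK (hKU.trans hUQ)) fun Φ hΦ hΦU => by
      simp only [sub_mul]
      rw [integral_sub (hk.integrable_mul_res hΦ) (hk'.integrable_mul_res hΦ), h Φ hΦ hΦU, sub_self]
  filter_upwards [this] with p hp hpU
  exact sub_eq_zero.1 (hp hpU)

lemma setIntegral_mul_res {k : E d × S d → ℝ} {Φ : E d × E d → ℝ} (hΦ : IsTest d Φ) :
    ∫ p in Q d, k p * Φ (p.1, (p.2 : E d)) ∂dxdθ d = ∫ p, k p * res Φ p ∂dxdθ d :=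
  setIntegral_Q_congr (fun _ _ => rfl) fun p hp => by rw [hΦ.res_eq_zero hp, mul_zero]

/-- A compact exhaustion of `Q`. -/
def exhaust (d n : ℕ) : Set (E d × S d) := {p | (n + 1 : ℝ)⁻¹ ≤ p.1 (Fin.last d) ∧ ‖p.1‖ ≤ n}

lemma exhaust_subset (n : ℕ) : exhaust d n ⊆ Q d := fun p hp =>
  (by positivity : (0 : ℝ) < (n + 1 : ℝ)⁻¹).trans_le hp.1

lemma isCompact_exhaust (n : ℕ) : IsCompact (exhaust d n) := by
  have h1 : Continuous fun p : E d × S d => p.1 (Fin.last d) := by fun_prop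
  have h2 : Continuous fun p : E d × S d => ‖p.1‖ := by fun_prop
  refine ((isCompact_closedBall (0 : E d) n).prod (isCompact_univ (X := S d))).of_isClosed_subset
    ((isClosed_le continuous_const h1).inter (isClosed_le h2 continuous_const)) fun p hp =>
      ⟨mem_closedBall_zero_iff.2 hp.2, mem_univ _⟩

lemma exists_subset_exhaust {K : Set (E d × S d)} (hK : IsCompact K) (hKQ : K ⊆ Q d) :
    ∃ n, K ⊆ exhaust d n := by
  have h1 : Continuous fun p : E d × S d => p.1 (Fin.last d) := by fun_prop
  have h2 : Continuous fun p : E d × S d => ‖p.1‖ := by fun_prop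
  obtain ⟨n, hn⟩ := hK.elim_directed_cover
    (fun n : ℕ => {p : E d × S d | (n + 1 : ℝ)⁻¹ < p.1 (Fin.last d) ∧ ‖p.1‖ < n})
    (fun n => (isOpen_lt continuous_const h1).inter (isOpen_lt h2 continuous_const))
    (fun p hp => by
      obtain ⟨a, ha⟩ := exists_nat_one_div_lt (show 0 < p.1 (Fin.last d) from hKQ hp)
      obtain ⟨b, hb⟩ := exists_nat_gt ‖p.1‖
      refine mem_iUnion.2 ⟨max a b, ?_, hb.trans_le (by exact_mod_cast le_max_right a b)⟩
      refine lt_of_le_of_lt ?_ ha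
      rw [one_div]
      gcongr
      exact le_max_left a b)
    (Monotone.directed_le fun m n hmn p hp =>
      ⟨lt_of_le_of_lt (by gcongr) hp.1, hp.2.trans_le (by exact_mod_cast hmn)⟩)
  exact ⟨n, fun p hp => ⟨(hn hp).1.le, (hn hp).2.le⟩⟩

/-- A functional that is locally bounded in `L²` is represented by a function in `L²_loc`. -/
theorem SphereFunctional.exists_l2loc {Λ : (E d × E d → ℝ) → ℝ} (hΛ : SphereFunctional Λ)
    (h : ∀ K, IsCompact K → K ⊆ Q d → ∃ V, IsOpen V ∧ K ⊆ V ∧ V ⊆ Q d ∧ ∃ C : ℝ, 0 ≤ C ∧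
      ∀ Φ, CcSmooth Φ → (∀ p ∉ V, res Φ p = 0) → |Λ Φ| ≤ C * l2 (res Φ) (dxdθ d)) :
    ∃ k, L2loc d k ∧ ∀ Φ, IsTest d Φ → ∫ p in Q d, k p * Φ (p.1, (p.2 : E d)) ∂dxdθ d = Λ Φ := by
  classical
  choose V hV hKV hVQ C hC hb using fun n => h _ (isCompact_exhaust (d := d) n) (exhaust_subset n)
  choose m hm _ hrep using fun n => hΛ.exists_representative (hC n) (hb n)
  -- The representatives on different members of the exhaustion agree on overlaps, since they
  -- represent the same functional there.
  have hcomp : ∀ᵐ p ∂dxdθ d, ∀ i j, p ∈ V i ∩ V j → m i p = m j p := by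
    simp only [ae_all_iff]
    intro i j
    refine ae_eq_of_integral_res ((hV i).inter (hV j)) (inter_subset_left.trans (hVQ i))
      (MemLp.l2loc (hm i)) (MemLp.l2loc (hm j)) fun Φ hΦ h0 => ?_
    rw [← hrep i Φ hΦ.ccSmooth fun p hp => h0 p fun h => hp h.1,
      ← hrep j Φ hΦ.ccSmooth fun p hp => h0 p fun h => hp h.2]
  -- The gluing takes the first index whose compact set contains the point; by compatibility the
  -- choice does not matter.
  set k : E d × S d → ℝ := fun p => if h : ∃ n, p ∈ exhaust d n then m (Nat.find h) p else 0 with hk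
  have hkm : ∀ n, ∀ᵐ p ∂dxdθ d, p ∈ exhaust d n → k p = m n p := fun n => by
    filter_upwards [hcomp] with p hp hpn
    have hex : ∃ n, p ∈ exhaust d n := ⟨n, hpn⟩
    simp only [hk, dif_pos hex]
    exact hp _ _ ⟨hKV _ (Nat.find_spec hex), hKV _ hpn⟩
  refine ⟨k, fun K hK hKQ => ?_, fun Φ hΦ => ?_⟩
  · obtain ⟨n, hn⟩ := exists_subset_exhaust hK hKQ
    refine (memLp_congr_ae ?_).1 ((hm n).restrict K)
    filter_upwards [ae_restrict_of_ae (hkm n), ae_restrict_mem hK.measurableSet] with p hp hpK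
    exact (hp (hn hpK)).symm
  · obtain ⟨n, hn⟩ := exists_subset_exhaust hΦ.ccSmooth.hasCompactSupport_res hΦ.tsupport_res_subset
    have h0 : ∀ p, p ∉ exhaust d n → res Φ p = 0 := fun p hp =>
      image_eq_zero_of_notMem_tsupport fun h => hp (hn h)
    rw [setIntegral_mul_res hΦ, hrep n Φ hΦ.ccSmooth fun p hp => h0 p fun h => hp (hKV n h)]
    refine integral_congr_ae ?_
    filter_upwards [hkm n] with p hp
    by_cases hpn : p ∈ exhaust d n
    · simp only [hp hpn]
    · simp only [h0 p hpn, mul_zero]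

/-- A function that represents a functional obeys the bounds of the functional. -/
lemma SphereFunctional.mul_eLpNorm_le {Λ : (E d × E d → ℝ) → ℝ} (hΛ : SphereFunctional Λ)
    {K V : Set (E d × S d)} (hV : IsOpen V) (hKV : K ⊆ V) (hVQ : V ⊆ Q d) {e B : ℝ} (he : 0 < e)
    (hB : 0 ≤ B)
    (h : ∀ Φ, CcSmooth Φ → (∀ p ∉ V, res Φ p = 0) → e * |Λ Φ| ≤ B * l2 (res Φ) (dxdθ d))
    {k : E d × S d → ℝ} (hk : L2loc d k)
    (hrep : ∀ Φ, IsTest d Φ → ∫ p in Q d, k p * Φ (p.1, (p.2 : E d)) ∂dxdθ d = Λ Φ) :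
    ENNReal.ofReal e * eLpNorm k 2 ((dxdθ d).restrict K) ≤ ENNReal.ofReal B := by
  obtain ⟨m, hm, hmB, hmrep⟩ := hΛ.exists_representative (U := V) (C := B / e) (by positivity)
    fun Φ hΦ h0 => by
      rw [div_mul_eq_mul_div, le_div_iff₀ he, mul_comm]
      exact h Φ hΦ h0
  have hae := ae_eq_of_integral_res hV hVQ hk (MemLp.l2loc hm) fun Φ hΦ h0 => by
    rw [← hmrep Φ hΦ.ccSmooth h0, ← setIntegral_mul_res hΦ, hrep Φ hΦ]
  have h1 : eLpNorm k 2 ((dxdθ d).restrict K) ≤ ENNReal.ofReal (B / e) := by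
    calc eLpNorm k 2 ((dxdθ d).restrict K) ≤ eLpNorm k 2 ((dxdθ d).restrict V) :=
          eLpNorm_mono_measure _ (Measure.restrict_mono hKV le_rfl)
      _ = eLpNorm m 2 ((dxdθ d).restrict V) := by
          refine eLpNorm_congr_ae ?_
          filter_upwards [ae_restrict_of_ae hae, ae_restrict_mem hV.measurableSet] with p hp hpV
          exact hp hpV
      _ ≤ eLpNorm m 2 (dxdθ d) := eLpNorm_mono_measure _ Measure.restrict_le_self
      _ ≤ _ := hmB
  calc _ ≤ ENNReal.ofReal e * ENNReal.ofReal (B / e) := by gcongr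
    _ = ENNReal.ofReal B := by rw [← ENNReal.ofReal_mul he.le, mul_div_cancel₀ _ he.ne']

end LocalRepresentation

/-! ### The strong form of the equation -/

section StrongForm
variable {d : ℕ} {ε : ℝ} {σ : E d → ℝ} {u l f : E d × S d → ℝ} {G : E d × S d → E d}
  {ρ : ℝ → ℝ} {Φ : E d × E d → ℝ}

/-- The radial part of the Laplacian is a divergence. -/
lemma integral_radLap (hρ : RadialCutoff ρ) :
    ∫ r : Ioi (0 : ℝ), radLap d ρ ((r : ℝ) ^ 2) ∂rad d = 0 := by
  have s1 : ContDiff ℝ ∞ (deriv ρ) := (contDiff_infty_iff_deriv.1 hρ.smooth).2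
  have hφ : ContDiff ℝ ∞ fun r : ℝ => 2 * r * deriv ρ (r ^ 2) := by
    have : ContDiff ℝ ∞ fun r : ℝ => deriv ρ (r ^ 2) := s1.comp (contDiff_id.pow 2)
    exact (contDiff_const.mul contDiff_id).mul this
  have hc : HasCompactSupport fun r : ℝ => 2 * r * deriv ρ (r ^ 2) := by
    refine HasCompactSupport.intro (isCompact_Icc (a := -2) (b := (2 : ℝ))) fun r hr => ?_
    have : deriv ρ (r ^ 2) = 0 := by
      by_contra h0
      have := support_deriv (fun s hs => (hρ.supp s hs).le) h0
      rw [abs_le] at this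
      exact hr ⟨by nlinarith, by nlinarith⟩
    rw [this, mul_zero]
  have h := integral_rad_deriv (d := d) (hφ.of_le (by simp)) hc (by simp)
  refine Eq.trans (integral_congr_ae (Filter.Eventually.of_forall fun r => ?_)) h
  have hr : (0 : ℝ) < r := r.2
  have hd : HasDerivAt (fun r : ℝ => 2 * r * deriv ρ (r ^ 2))
      (2 * deriv ρ ((r : ℝ) ^ 2) + 2 * r * (deriv (deriv ρ) ((r : ℝ) ^ 2) * (2 * r))) r := by
    have h1 : HasDerivAt (fun r : ℝ => 2 * r) 2 r := by simpa using (hasDerivAt_id (r : ℝ)).const_mul 2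
    have h2 : HasDerivAt (fun r : ℝ => r ^ 2) (2 * (r : ℝ)) r := by simpa using hasDerivAt_pow 2 (r : ℝ)
    have h3 : HasDerivAt (fun r : ℝ => deriv ρ (r ^ 2))
        (deriv (deriv ρ) ((r : ℝ) ^ 2) * (2 * r)) r :=
      HasDerivAt.comp (h₂ := deriv ρ) (r : ℝ)
        (s1.differentiable (by simp) ((r : ℝ) ^ 2)).hasDerivAt h2
    exact h1.mul h3
  simp only [hd.deriv, radLap]
  field_simp
  ring

lemma IsTest.tsupport_rext_subset (hρ : ∀ s, ρ s ≠ 0 → |s - 1| < 1 / 4) (hΦ : IsTest d Φ) :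
    tsupport (rext ρ Φ) ⊆ Ann d := by
  have hc : IsClosed ((Prod.fst '' tsupport Φ) ×ˢ {y : E d | |‖y‖ ^ 2 - 1| ≤ 1 / 4}) :=
    (hΦ.compact.isCompact.image continuous_fst).isClosed.prod
      (isClosed_le (by fun_prop) continuous_const)
  refine (closure_minimal (fun z hz => ?_) hc).trans ?_
  · exact ⟨⟨_, subset_tsupport _ (right_ne_zero_of_mul hz), rfl⟩, (hρ _ (left_ne_zero_of_mul hz)).le⟩
  · rintro ⟨x, y⟩ ⟨⟨w, hw, rfl⟩, hy⟩
    have hy : |‖y‖ ^ 2 - 1| ≤ 1 / 4 := hy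
    rw [abs_le] at hy
    exact ⟨hΦ.support (a := w) hw, by
      change 1 / 2 < ‖y‖
      nlinarith [norm_nonneg y], by
      change ‖y‖ < 2
      nlinarith [norm_nonneg y]⟩

/-- For tangential `w` the radial cutoff is not differentiated. One factor `r⁻¹` is explicit and the
other comes from rescaling the derivative to radius `r`. -/
lemma sum_mul_dY_rext_pol (hρ : RadialCutoff ρ) (hΦ : CcSmooth Φ) (q : (E d × S d) × Ioi (0 : ℝ))
    {w : E d} (hw : ⟪w, (q.1.2 : E d)⟫ = (0 : ℝ)) :
    ∑ j, ‖(pol q).2‖⁻¹ * w j * dY (bas d j) (rext ρ Φ) (pol q) =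
      (∑ j, w j * res (dY (bas d j) Φ) q.1) * (ρ ((q.2 : ℝ) ^ 2) * ((q.2 : ℝ) ^ 2)⁻¹) := by
  have hr : (0 : ℝ) < q.2 := q.2.2
  have cW := hΦ.rext hρ
  have e1 := inner_angGrad (cW.scale hr.ne').differentiable q.1.1 q.1.2 hw
  have e2 := inner_angGrad hΦ.differentiable q.1.1 q.1.2 hw
  have e3 : angGrad d (fun z => rext ρ Φ (z.1, (q.2 : ℝ) • z.2)) q.1.1 q.1.2 =
      ρ ((q.2 : ℝ) ^ 2) • angGrad d Φ q.1.1 q.1.2 := by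
    have : (fun y : E d => rext ρ Φ (q.1.1, (q.2 : ℝ) • ‖y‖⁻¹ • y)) =ᶠ[nhds (q.1.2 : E d)]
        fun y => ρ ((q.2 : ℝ) ^ 2) • Φ (q.1.1, ‖y‖⁻¹ • y) := by
      filter_upwards [isOpen_ne.mem_nhds (coe_sphere_ne_zero q.1.2)] with y hy
      have h1 : ‖(q.2 : ℝ) • ‖y‖⁻¹ • y‖ = q.2 := by
        rw [norm_smul, norm_smul, norm_inv, norm_norm, inv_mul_cancel₀ (norm_ne_zero_iff.2 hy),
          mul_one, Real.norm_of_nonneg hr.le]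
      rw [rext]
      simp only [h1]
      rw [smul_smul _ (q.2 : ℝ), inv_mul_cancel₀ hr.ne', one_smul, smul_eq_mul]
    rw [angGrad, angGrad, gradient, gradient, this.fderiv_eq]
    have h2 := congrFun (fderiv_const_smul_field (𝕜 := ℝ)
      (f := fun y : E d => Φ (q.1.1, ‖y‖⁻¹ • y)) (ρ ((q.2 : ℝ) ^ 2))) (q.1.2 : E d)
    rw [← map_smul]
    exact congrArg _ h2
  simp only [dY_scale cW.differentiable] at e1
  rw [e3, inner_smul_right, e2] at e1
  have e4 : pol q = (q.1.1, (q.2 : ℝ) • (q.1.2 : E d)) := rfl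
  have e5 : ∑ j, ‖(pol q).2‖⁻¹ * w j * dY (bas d j) (rext ρ Φ) (pol q) = ((q.2 : ℝ) ^ 2)⁻¹ *
      ∑ j, w j * ((q.2 : ℝ) * dY (bas d j) (rext ρ Φ) (q.1.1, (q.2 : ℝ) • (q.1.2 : E d))) := by
    rw [Finset.mul_sum, norm_pol]
    refine Finset.sum_congr rfl fun j _ => ?_
    rw [e4]
    field_simp
  rw [e5, ← e1]
  simp only [res]
  ring

namespace SphereSolution

lemma integrable_gradient_res (sol : SphereSolution d ε σ u l f G) (hΦ : CcSmooth Φ) :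
    Integrable (fun p => ∑ j, G p j * res (dY (bas d j) Φ) p) (dxdθ d) :=
  integrable_finsetSum _ fun j _ => (sol.memG_apply j).integrable_mul (hΦ.dY (bas d j)).memLp_res

lemma inner_angGrad_ae (sol : SphereSolution d ε σ u l f G) (hΦ : CcSmooth Φ) :
    ∀ᵐ p ∂dxdθ d, ⟪G p, angGrad d Φ p.1 p.2⟫ = ∑ j, G p j * res (dY (bas d j) Φ) p := by
  filter_upwards [sol.tangent] with p hp
  exact inner_angGrad hΦ.differentiable p.1 p.2 hp

/-- Integration by parts on the sphere. -/
lemma integral_gradient_res (sol : SphereSolution d ε σ u l f G) (hΦ : IsTest d Φ) :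
    ∫ p, ∑ j, G p j * res (dY (bas d j) Φ) p ∂dxdθ d =
      -∫ p, u p * angLaplacian d Φ p.1 p.2 ∂dxdθ d := by
  obtain ⟨ρ, hρ, hρs, hρpos⟩ := exists_radialCutoff (d := d) (a := 1 / 4) (by norm_num) le_rfl
  have pc := hρpos (fun r => (r ^ 2)⁻¹)
    (ContinuousOn.inv₀ (continuousOn_id.pow 2) fun r hr => pow_ne_zero _ (ne_of_gt hr))
    fun r hr => by positivity
  have cW := hΦ.ccSmooth.rext hρ
  have hs := hΦ.tsupport_rext_subset hρs
  have hsj := fun j => (tsupport_dY_subset (N := rext ρ Φ) (bas d j)).trans hs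
  have i1 := fun j => sol.integrable_G (cW.dY (bas d j)) (hsj j) j
  have i2 := fun j => sol.integrable_u ((cW.dY (bas d j)).dY (bas d j))
  have e1 : ∫ z, ∑ j, ‖z.2‖⁻¹ * G (lift z) j * dY (bas d j) (rext ρ Φ) z =
      -∫ z, u (lift z) * lapY (rext ρ Φ) z := by
    simp only [lapY, Finset.mul_sum]
    rw [integral_finsetSum _ fun j _ => i1 j, integral_finsetSum _ fun j _ => i2 j,
      ← Finset.sum_neg_distrib]
    exact Finset.sum_congr rfl fun j _ => sol.lift_gradient (cW.dY (bas d j)) (hsj j) j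
  -- The lower-order term drops out exactly, because the radial profile is a divergence with respect
  -- to `r^d dr`.
  rw [sol.integral_lapY_rext hρ hρs hΦ.ccSmooth, integral_radLap hρ, mul_zero, add_zero] at e1
  have e2 : ∫ z, ∑ j, ‖z.2‖⁻¹ * G (lift z) j * dY (bas d j) (rext ρ Φ) z =
      (∫ p, ∑ j, G p j * res (dY (bas d j) Φ) p ∂dxdθ d) *
        ∫ r : Ioi (0 : ℝ), ρ ((r : ℝ) ^ 2) * ((r : ℝ) ^ 2)⁻¹ ∂rad d := by
    refine integral_polar_mul_ae (integrable_finsetSum _ fun j _ => i1 j).1 ?_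
    filter_upwards [Measure.quasiMeasurePreserving_fst.ae sol.tangent] with q hq
    rw [lift_pol]
    exact sum_mul_dY_rext_pol hρ hΦ.ccSmooth q hq
  rw [e2, ← neg_mul] at e1
  exact mul_right_cancel₀ pc.ne' e1

/-- The coefficient `σ(x)` commutes with `∇_θ`. -/
lemma integral_σ_gradient_res (sol : SphereSolution d ε σ u l f G) {k : E d × S d → ℝ}
    (hk : L2loc d k) (hkσ : L2loc d fun p => σ p.1 * k p)
    (hrep : ∀ Φ, IsTest d Φ → ∫ p, k p * res Φ p ∂dxdθ d =
      ∫ p, u p * angLaplacian d Φ p.1 p.2 ∂dxdθ d) (hΦ : IsTest d Φ)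
    (hi : Integrable (fun p => σ p.1 * ∑ j, G p j * res (dY (bas d j) Φ) p) (dxdθ d)) :
    ∫ p, σ p.1 * ∑ j, G p j * res (dY (bas d j) Φ) p ∂dxdθ d =
      -∫ p, σ p.1 * k p * res Φ p ∂dxdθ d := by
  have ia : Integrable (fun p => (∑ j, G p j * res (dY (bas d j) Φ) p) + k p * res Φ p) (dxdθ d) :=
    (sol.integrable_gradient_res hΦ.ccSmooth).add (hk.integrable_mul_res hΦ)
  set a : E d × S d → ℝ := fun p => (∑ j, G p j * res (dY (bas d j) Φ) p) + k p * res Φ p with ha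
  -- The product `σ Φ` is not a smooth test function. Testing with `η(x) Φ` for arbitrary `η` shows
  -- instead that the integral over `θ` vanishes for almost every `x`, after which any factor in `x`
  -- may be inserted.
  have hA : ∀ᵐ x : E d, ∫ θ, a (x, θ) ∂(volume : Measure (E d)).toSphere = 0 := by
    refine ae_eq_zero_of_integral_contDiff_smul_eq_zero ia.integral_prod_left.locallyIntegrable
      fun η hη hηc => ?_
    have hηΦ : IsTest d fun z => η z.1 * Φ z :=
      ⟨(hη.comp contDiff_fst).mul hΦ.smooth, hΦ.compact.mul_left,
        tsupport_mul_subset_right.trans hΦ.support⟩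
    have e1 := sol.integral_gradient_res hηΦ
    rw [← hrep _ hηΦ] at e1
    have hdY : ∀ v, dY v (fun z => η z.1 * Φ z) = fun z => η z.1 * dY v Φ z := fun v =>
      funext fun z => by
        change dY v (fun z => η z.1 * Φ z) (z.1, z.2) = η z.1 * dY v Φ (z.1, z.2)
        rw [dY_eq_fderiv hηΦ.ccSmooth.differentiable, dY_eq_fderiv hΦ.ccSmooth.differentiable]
        exact congrArg (· v) (fderiv_const_mul
          (hasFDerivAt_slice hΦ.ccSmooth.differentiable z.1 z.2).differentiableAt (η z.1))
    have i1 := sol.integrable_gradient_res hηΦ.ccSmooth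
    have i2 := hk.integrable_mul_res hηΦ
    have e2 : ∫ p, η p.1 * a p ∂dxdθ d = 0 := by
      have e3 : ∫ p, ((∑ j, G p j * res (dY (bas d j) fun z => η z.1 * Φ z) p) +
          k p * res (fun z => η z.1 * Φ z) p) ∂dxdθ d = 0 := by
        rw [integral_add i1 i2, e1]; ring
      rw [← e3]
      refine integral_congr_ae (Filter.Eventually.of_forall fun p => ?_)
      simp only [ha, hdY, res, mul_add, Finset.mul_sum]
      congr 1
      · exact Finset.sum_congr rfl fun j _ => by ring
      · ring
    have i3 : Integrable (fun p : E d × S d => η p.1 * a p) (dxdθ d) := by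
      refine (i1.add i2).congr (Filter.Eventually.of_forall fun p => ?_)
      simp only [ha, hdY, res, mul_add, Finset.mul_sum, Pi.add_apply]
      congr 1
      · exact Finset.sum_congr rfl fun j _ => by ring
      · ring
    have e4 := integral_prod _ i3
    rw [← e2]
    refine Eq.trans ?_ e4.symm
    refine integral_congr_ae (Filter.Eventually.of_forall fun x => ?_)
    simp only [smul_eq_mul, integral_const_mul]
  have i4 : Integrable (fun p => σ p.1 * k p * res Φ p) (dxdθ d) := hkσ.integrable_mul_res hΦ
  have i5 : Integrable (fun p => σ p.1 * a p) (dxdθ d) :=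
    (hi.add i4).congr (Filter.Eventually.of_forall fun p => by simp only [ha, Pi.add_apply]; ring)
  have e5 : ∫ p, σ p.1 * a p ∂dxdθ d = 0 := by
    have e6 := integral_prod _ i5
    refine Eq.trans e6 ((integral_congr_ae ?_).trans (integral_zero _ _))
    filter_upwards [hA] with x hx
    simp only [integral_const_mul, hx, mul_zero]
  rw [← add_eq_zero_iff_eq_neg, ← integral_add hi i4, ← e5]
  exact integral_congr_ae (Filter.Eventually.of_forall fun p => by simp only [ha]; ring)

/-- With the Laplacian and the transport term represented by functions, both sides of the weak
equation are pairings of `L²_loc` functions with test functions, and uniqueness gives the pointwise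
identity. -/
theorem strong_form (sol : SphereSolution d ε σ u l f G) {σ₀ M : ℝ} (hσ₀ : 0 < σ₀)
    (hσ : SigmaBounds d σ₀ M σ) {k h : E d × S d → ℝ}
    (hk : L2loc d k) (hh : L2loc d h)
    (hrep : ∀ Φ, IsTest d Φ → ∫ p, k p * res Φ p ∂dxdθ d =
      ∫ p, u p * angLaplacian d Φ p.1 p.2 ∂dxdθ d)
    (hreph : ∀ Φ, IsTest d Φ → ∫ p, h p * res Φ p ∂dxdθ d =
      -∫ p, u p * transport d Φ p.1 p.2 ∂dxdθ d) :
    ∀ᵐ p ∂dxdθ d, p ∈ Q d → -(ε ^ 2 * (σ p.1 * k p)) + h p + l p = f p := by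
  have hσb : ∀ x ∈ halfSpace d, |σ x| ≤ M := fun x hx => by
    rw [abs_of_nonneg (hσ₀.le.trans (hσ.lower x hx))]
    exact hσ.upper x hx
  have hkσ : L2loc d fun p => σ p.1 * k p := fun K hK hKQ => by
    have hm : AEStronglyMeasurable (fun p : E d × FokkerPlanck.S d => σ p.1) ((dxdθ d).restrict K) :=
      (sol.continuous_σ.comp continuous_fst).aestronglyMeasurable
    refine MemLp.of_le_mul (c := M) (hk K hK hKQ) (hm.mul (hk K hK hKQ).1) ?_
    filter_upwards [ae_restrict_mem hK.measurableSet] with p hp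
    rw [norm_mul]
    exact mul_le_mul_of_nonneg_right (hσb _ (hKQ hp)) (norm_nonneg _)
  have hsum : L2loc d fun p => -(ε ^ 2 * (σ p.1 * k p)) + h p + l p := by
    refine L2loc.add (L2loc.add (fun K hK hKQ => ?_) hh) (MemLp.l2loc sol.meml)
    exact MemLp.neg (MemLp.const_mul (hkσ K hK hKQ) _)
  refine ae_eq_of_integral_res isOpen_Q subset_rfl hsum (MemLp.l2loc sol.memf) fun Φ hΦ _ => ?_
  have iG := sol.integrable_gradient_res hΦ.ccSmooth
  have hdz : ∀ p ∉ Q d, ∀ j, res (dY (bas d j) Φ) p = 0 := fun p hp j =>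
    image_eq_zero_of_notMem_tsupport (f := dY (bas d j) Φ) fun hm => hp (hΦ.support (a := (p.1, (p.2 : E d)))
      (tsupport_dY_subset _ hm))
  have iσ : Integrable (fun p => σ p.1 * ∑ j, G p j * res (dY (bas d j) Φ) p) (dxdθ d) := by
    have hm : AEStronglyMeasurable (fun p : E d × FokkerPlanck.S d => σ p.1) (dxdθ d) :=
      (sol.continuous_σ.comp continuous_fst).aestronglyMeasurable
    refine Integrable.mono' (iG.norm.const_mul M) (hm.mul iG.1)
      (Filter.Eventually.of_forall fun p => ?_)
    by_cases hp : p ∈ Q d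
    · rw [norm_mul]
      exact mul_le_mul_of_nonneg_right (hσb _ hp) (norm_nonneg _)
    · simp [hdz p hp]
  have e1 := sol.integral_σ_gradient_res hk hkσ hrep hΦ iσ
  have e2 := sol.eqn Φ hΦ
  have i1 : Integrable (fun p => ε ^ 2 * (σ p.1 * ∑ j, G p j * res (dY (bas d j) Φ) p)) (dxdθ d) :=
    iσ.const_mul _
  have i2 : Integrable (fun p => u p * transport d Φ p.1 p.2) (dxdθ d) := by
    refine (sol.memu.integrable_mul hΦ.ccSmooth.trans.memLp_res).congr
      (Filter.Eventually.of_forall fun p => ?_)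
    simp only [Pi.mul_apply, transport_eq hΦ.ccSmooth.differentiable, res]
  have i3 : Integrable (fun p => l p * res Φ p) (dxdθ d) :=
    sol.meml.integrable_mul hΦ.ccSmooth.memLp_res
  have i12 : Integrable (fun p => ε ^ 2 * (σ p.1 * ∑ j, G p j * res (dY (bas d j) Φ) p) -
      u p * transport d Φ p.1 p.2) (dxdθ d) := i1.sub i2
  have e3 : ∫ p, (ε ^ 2 * σ p.1 * ⟪G p, angGrad d Φ p.1 p.2⟫ - u p * transport d Φ p.1 p.2 +
      l p * Φ (p.1, (p.2 : E d))) ∂dxdθ d =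
      ∫ p, ((ε ^ 2 * (σ p.1 * ∑ j, G p j * res (dY (bas d j) Φ) p) -
        u p * transport d Φ p.1 p.2) + l p * res Φ p) ∂dxdθ d := by
    refine integral_congr_ae ?_
    filter_upwards [sol.inner_angGrad_ae hΦ.ccSmooth] with p hp
    rw [hp, mul_assoc]
    rfl
  rw [e3, integral_add i12 i3, integral_sub i1 i2, integral_const_mul, e1] at e2
  have i4 : Integrable (fun p => ε ^ 2 * (σ p.1 * k p * res Φ p)) (dxdθ d) :=
    (hkσ.integrable_mul_res hΦ).const_mul _
  have i5 := hh.integrable_mul_res hΦ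
  have i45 : Integrable (fun p => -(ε ^ 2 * (σ p.1 * k p * res Φ p)) + h p * res Φ p) (dxdθ d) :=
    i4.neg.add i5
  have e4 : ∫ p, (-(ε ^ 2 * (σ p.1 * k p)) + h p + l p) * res Φ p ∂dxdθ d =
      ∫ p, ((-(ε ^ 2 * (σ p.1 * k p * res Φ p)) + h p * res Φ p) + l p * res Φ p) ∂dxdθ d :=
    integral_congr_ae (Filter.Eventually.of_forall fun p => by ring)
  have i4' : Integrable (fun p => -(ε ^ 2 * (σ p.1 * k p * res Φ p))) (dxdθ d) := i4.neg
  rw [e4, integral_add i45 i3, integral_add i4' i5, integral_neg, integral_const_mul, hreph Φ hΦ]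
  have e5 : ∫ p, f p * res Φ p ∂dxdθ d = ∫ p, f p * Φ (p.1, (p.2 : E d)) ∂dxdθ d := rfl
  rw [e5, ← e2]
  ring

end SphereSolution

end StrongForm

/-! ### Weak solutions are strong solutions -/

section Conclusion
variable {d : ℕ} {σ₀ lam₀ M ε : ℝ} {σ lam : E d → ℝ} {f u : E d × S d → ℝ}
  {g : EuclideanSpace ℝ (Fin d) × S d → ℝ} {G : E d × S d → E d}

lemma Coefficients.exists_extension (h : Coefficients d σ₀ lam₀ M σ lam) :
    ∃ σ', SigmaBounds d σ₀ M σ' ∧ EqOn σ σ' (halfSpace d) := by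
  obtain ⟨σ', hl, he⟩ := h.exists_lipschitz
  exact ⟨σ', ⟨hl, fun x hx => he hx ▸ h.σ_lower x hx, fun x hx => he hx ▸ h.σ_upper x hx⟩, he⟩

lemma Coefficients.abs_indicator_lam_mul_le (h : Coefficients d σ₀ lam₀ M σ lam) (hlam₀ : 0 < lam₀)
    (p : E d × S d) :
    |(Q d).indicator (fun p => lam p.1 * u p) p| ≤ M * |(Q d).indicator u p| := by
  by_cases hp : p ∈ Q d
  · rw [indicator_of_mem hp, indicator_of_mem hp, abs_mul,
      abs_of_nonneg (hlam₀.le.trans (h.lam_lower _ hp))]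
    exact mul_le_mul_of_nonneg_right (h.lam_upper _ hp) (abs_nonneg _)
  · simp [indicator_of_notMem hp]

lemma setIntegral_Q_mul (u b : E d × S d → ℝ) :
    ∫ p in Q d, u p * b p ∂dxdθ d = ∫ p, (Q d).indicator u p * b p ∂dxdθ d :=
  setIntegral_Q_congr (fun p hp => by rw [indicator_of_mem hp])
    fun p hp => by rw [indicator_of_notMem hp, zero_mul]

lemma ofReal_l2_weight_le {O : Set (E d × S d)} (hO : IsOpen O) (hOQ : O ⊆ Q d)
    (hf : MemLp f 2 ((dxdθ d).restrict (Q d))) (hu : MemLp u 2 ((dxdθ d).restrict (Q d)))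
    (hG : MemLp G 2 ((dxdθ d).restrict (Q d))) :
    ENNReal.ofReal (l2 (weight ε O ((Q d).indicator u) ((Q d).indicator f) ((Q d).indicator G))
      (dxdθ d)) ≤ eLpNorm f 2 ((dxdθ d).restrict O) +
        ENNReal.ofReal (ε ^ 2) * eLpNorm G 2 ((dxdθ d).restrict (Q d)) +
        eLpNorm u 2 ((dxdθ d).restrict (Q d)) := by
  have hu' := (memLp_indicator_iff_restrict measurableSet_Q).2 hu
  have hf' := (memLp_indicator_iff_restrict measurableSet_Q).2 hf
  have hG' := (memLp_indicator_iff_restrict measurableSet_Q).2 hG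
  have m1 : MemLp (O.indicator fun p => |(Q d).indicator f p|) 2 (dxdθ d) :=
    hf'.norm.indicator hO.measurableSet
  have m2 : MemLp (fun p => |(Q d).indicator u p|) 2 (dxdθ d) := hu'.norm
  have m3 : MemLp (fun p => ε ^ 2 * ‖(Q d).indicator G p‖) 2 (dxdθ d) := hG'.norm.const_mul _
  have e1 : eLpNorm (O.indicator fun p => |(Q d).indicator f p|) 2 (dxdθ d) =
      eLpNorm f 2 ((dxdθ d).restrict O) := by
    rw [eLpNorm_indicator_eq_eLpNorm_restrict hO.measurableSet]
    refine (eLpNorm_norm ((Q d).indicator f)).trans (eLpNorm_congr_ae ?_)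
    filter_upwards [ae_restrict_mem hO.measurableSet] with p hp
    rw [indicator_of_mem (hOQ hp)]
  have e2 : eLpNorm (fun p => |(Q d).indicator u p|) 2 (dxdθ d) =
      eLpNorm u 2 ((dxdθ d).restrict (Q d)) :=
    (eLpNorm_norm ((Q d).indicator u)).trans
      (eLpNorm_indicator_eq_eLpNorm_restrict measurableSet_Q)
  have e3 : eLpNorm (fun p => ε ^ 2 * ‖(Q d).indicator G p‖) 2 (dxdθ d) =
      ENNReal.ofReal (ε ^ 2) * eLpNorm G 2 ((dxdθ d).restrict (Q d)) := by
    refine (eLpNorm_const_smul (ε ^ 2) (fun p => ‖(Q d).indicator G p‖) 2 (dxdθ d)).trans ?_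
    rw [eLpNorm_norm, eLpNorm_indicator_eq_eLpNorm_restrict measurableSet_Q,
      Real.enorm_of_nonneg (sq_nonneg ε)]
  have hw : weight ε O ((Q d).indicator u) ((Q d).indicator f) ((Q d).indicator G) =
      ((O.indicator fun p => |(Q d).indicator f p|) + fun p => |(Q d).indicator u p|) +
        fun p => ε ^ 2 * ‖(Q d).indicator G p‖ := rfl
  rw [hw, l2_eq_toReal ((m1.add m2).add m3).1]
  refine ENNReal.ofReal_toReal_le.trans ((eLpNorm_add_le (m1.add m2).1 m3.1 one_le_two).trans ?_)
  rw [e3]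
  refine (add_le_add_left (eLpNorm_add_le m1.1 m2.1 one_le_two) _).trans ?_
  rw [e1, e2, add_right_comm]

/-- For fixed `ε` the compact estimate is used with `O = Q` and `ε₀ = ε`. Division by the power of
`ε` is harmless here, since only local boundedness of the functionals is needed. -/
theorem IsWeakSolution.exists_strong (hσ₀ : 0 < σ₀) (hlam₀ : 0 < lam₀)
    (h : Coefficients d σ₀ lam₀ M σ lam) (hε : 0 < ε)
    (hf : MemLp f 2 ((dxdθ d).restrict (Q d))) (hs : IsWeakSolution d ε σ lam f g u G) :
    ∃ k h w : E d × S d → ℝ, HasWeakAngLaplacian d u k ∧ HasWeakTransport d u h ∧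
      HasWeakBesselD d (2 / 3) u w ∧ ∀ᵐ p ∂(dxdθ d).restrict (Q d),
        -(ε ^ 2 * σ p.1 * k p) + h p + lam p.1 * u p = f p := by
  obtain ⟨σ', hσ', he⟩ := h.exists_extension
  have sol := hs.sphereSolution h hlam₀ hf hσ'.lip he
  have key : ∀ K, IsCompact K → K ⊆ Q d → _ := fun K hK hKQ =>
    exists_compact_estimate ε hσ₀ h.M_nonneg hK isOpen_Q hKQ subset_rfl
  have hl := h.abs_indicator_lam_mul_le hlam₀ (u := u)
  set w := l2 (weight ε (Q d) ((Q d).indicator u) ((Q d).indicator f) ((Q d).indicator G)) (dxdθ d)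
  have pw : 0 ≤ w := l2_nonneg _
  obtain ⟨k, hk, hkrep⟩ := sol.sphereFunctional_angLaplacian.exists_l2loc fun K hK hKQ => by
    obtain ⟨V, hV, hKV, hVQ, C, hC, est⟩ := key K hK hKQ
    refine ⟨V, hV, hKV, hVQ, C * w / ε ^ 2, by positivity, fun Φ hΦ h0 => ?_⟩
    have := (est ε σ' _ _ _ _ hε le_rfl hσ' sol hl Φ hΦ h0).1
    rw [div_mul_eq_mul_div, le_div_iff₀ (by positivity), mul_comm]
    exact this
  obtain ⟨t, ht, htrep⟩ := sol.sphereFunctional_transport.exists_l2loc fun K hK hKQ => by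
    obtain ⟨V, hV, hKV, hVQ, C, hC, est⟩ := key K hK hKQ
    exact ⟨V, hV, hKV, hVQ, C * w, by positivity, fun Φ hΦ h0 =>
      (est ε σ' _ _ _ _ hε le_rfl hσ' sol hl Φ hΦ h0).2.1⟩
  obtain ⟨b, hb, hbrep⟩ := sol.sphereFunctional_besselD.exists_l2loc fun K hK hKQ => by
    obtain ⟨V, hV, hKV, hVQ, C, hC, est⟩ := key K hK hKQ
    refine ⟨V, hV, hKV, hVQ, C * w / ε ^ (2 / 3 : ℝ), by positivity, fun Φ hΦ h0 => ?_⟩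
    have := (est ε σ' _ _ _ _ hε le_rfl hσ' sol hl Φ hΦ h0).2.2
    rw [div_mul_eq_mul_div, le_div_iff₀ (by positivity), mul_comm]
    exact this
  -- The functional is `∫ u θ · ∇ₓ Φ`, so its representative is minus the weak transport derivative.
  have htn : L2loc d fun p => -t p := fun K hK hKQ => (ht K hK hKQ).neg
  have htn' : ∀ Φ, IsTest d Φ → ∫ p in Q d, -t p * Φ (p.1, (p.2 : E d)) ∂dxdθ d =
      -∫ p, (Q d).indicator u p * transport d Φ p.1 p.2 ∂dxdθ d := fun Φ hΦ => by
    simp only [neg_mul, integral_neg]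
    rw [htrep Φ hΦ]
  refine ⟨k, fun p => -t p, b, ⟨hk, fun Φ hΦ => ?_⟩, ⟨htn, fun Φ hΦ => ?_⟩, ⟨hb, fun Φ hΦ => ?_⟩, ?_⟩
  · rw [hkrep Φ hΦ, setIntegral_Q_mul u fun p => angLaplacian d Φ p.1 p.2]
  · rw [htn' Φ hΦ, setIntegral_Q_mul u fun p => transport d Φ p.1 p.2]
  · rw [hbrep Φ hΦ,
      setIntegral_Q_mul u fun p => besselD d (2 / 3) (fun z => Φ (z, (p.2 : E d))) p.1]
  · have := sol.strong_form hσ₀ hσ' hk htn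
      (fun Φ hΦ => by rw [← setIntegral_mul_res hΦ, hkrep Φ hΦ])
      fun Φ hΦ => by rw [← setIntegral_mul_res hΦ, htn' Φ hΦ]
    filter_upwards [ae_restrict_of_ae this, ae_restrict_mem measurableSet_Q] with p hp hpQ
    have h1 := hp hpQ
    simp only [indicator_of_mem hpQ] at h1
    rw [he hpQ, ← h1]
    ring

/-- The functions `k`, `h`, `w` are arbitrary weak derivatives; each represents a functional that
obeys the compact estimate, up to a sign for `h`, and inherits the bound by uniqueness. -/
theorem exists_subelliptic_estimate (hσ₀ : 0 < σ₀) (hlam₀ : 0 < lam₀) (M : ℝ)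
    {K O : Set (E d × S d)} (hK : IsCompact K) (hO : IsOpen O) (hKO : K ⊆ O) (hOQ : O ⊆ Q d)
    (ε₀ : ℝ) :
    ∃ C : ℝ, 0 < C ∧ ∀ σ lam : E d → ℝ, Coefficients d σ₀ lam₀ M σ lam →
      ∀ ε : ℝ, 0 < ε → ε ≤ ε₀ →
      ∀ (f : E d × S d → ℝ) (g : EuclideanSpace ℝ (Fin d) × S d → ℝ) (u : E d × S d → ℝ)
        (G : E d × S d → E d), MemLp f 2 ((dxdθ d).restrict (Q d)) →
      IsWeakSolution d ε σ lam f g u G →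
      ∀ k h w : E d × S d → ℝ, HasWeakAngLaplacian d u k → HasWeakTransport d u h →
        HasWeakBesselD d (2 / 3) u w →
        ENNReal.ofReal (ε ^ 2) * eLpNorm k 2 ((dxdθ d).restrict K) +
          ENNReal.ofReal (ε ^ (2 / 3 : ℝ)) * eLpNorm w 2 ((dxdθ d).restrict K) +
          eLpNorm h 2 ((dxdθ d).restrict K) ≤
        ENNReal.ofReal C * (eLpNorm f 2 ((dxdθ d).restrict O) +
          ENNReal.ofReal (ε ^ 2) * eLpNorm G 2 ((dxdθ d).restrict (Q d)) +
          eLpNorm u 2 ((dxdθ d).restrict (Q d))) := by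
  -- For `M < 0` there are no admissible coefficients, since `M` bounds a norm.
  rcases lt_or_ge M 0 with hM | hM
  · exact ⟨1, one_pos, fun σ lam h => absurd h.M_nonneg (not_le.2 hM)⟩
  obtain ⟨V, hV, hKV, hVO, C, hC, est⟩ := exists_compact_estimate ε₀ hσ₀ hM hK hO hKO hOQ
  -- One `C` for each of the three terms; the `1` makes the constant positive.
  refine ⟨3 * C + 1, by positivity, ?_⟩
  intro σ lam hcoef ε hε hεε f g u G hf hs k h w hk hh hw
  obtain ⟨σ', hσ', he⟩ := hcoef.exists_extension
  have sol := hs.sphereSolution hcoef hlam₀ hf hσ'.lip he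
  have est := est ε σ' _ _ _ _ hε hεε hσ' sol (hcoef.abs_indicator_lam_mul_le hlam₀ (u := u))
  have hW := ofReal_l2_weight_le (ε := ε) hO hOQ hf hs.memLp hs.grad.memLp
  set W := l2 (weight ε O ((Q d).indicator u) ((Q d).indicator f) ((Q d).indicator G)) (dxdθ d)
  have pW : 0 ≤ W := l2_nonneg _
  have hVQ := hVO.trans hOQ
  have b1 := sol.sphereFunctional_angLaplacian.mul_eLpNorm_le hV hKV hVQ (e := ε ^ 2) (B := C * W)
    (by positivity) (by positivity) (fun Φ hΦ h0 => (est Φ hΦ h0).1) hk.loc fun Φ hΦ => by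
      rw [hk.parts Φ hΦ, setIntegral_Q_mul u fun p => angLaplacian d Φ p.1 p.2]
  have b2 := sol.sphereFunctional_besselD.mul_eLpNorm_le hV hKV hVQ (e := ε ^ (2 / 3 : ℝ))
    (B := C * W) (by positivity) (by positivity) (fun Φ hΦ h0 => (est Φ hΦ h0).2.2) hw.loc
    fun Φ hΦ => by
      rw [hw.parts Φ hΦ,
        setIntegral_Q_mul u fun p => besselD d (2 / 3) (fun z => Φ (z, (p.2 : E d))) p.1]
  have b3 := sol.sphereFunctional_transport.mul_eLpNorm_le hV hKV hVQ (e := 1) (B := C * W)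
    (k := fun p => -h p) one_pos (by positivity)
    (fun Φ hΦ h0 => (one_mul _).trans_le (est Φ hΦ h0).2.1)
    (fun K hK hKQ => (hh.loc K hK hKQ).neg) fun Φ hΦ => by
      simp only [neg_mul, integral_neg]
      rw [hh.parts Φ hΦ, setIntegral_Q_mul u fun p => transport d Φ p.1 p.2, neg_neg]
  have e3 : eLpNorm (fun p => -h p) 2 ((dxdθ d).restrict K) = eLpNorm h 2 ((dxdθ d).restrict K) :=
    eLpNorm_neg h 2 _
  rw [ENNReal.ofReal_one, one_mul, e3] at b3
  calc _ ≤ ENNReal.ofReal (C * W) + ENNReal.ofReal (C * W) + ENNReal.ofReal (C * W) :=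
        add_le_add (add_le_add b1 b2) b3
    _ = ENNReal.ofReal (3 * C * W) := by
        rw [← ENNReal.ofReal_add (by positivity) (by positivity),
          ← ENNReal.ofReal_add (by positivity) (by positivity)]
        congr 1
        ring
    _ ≤ ENNReal.ofReal ((3 * C + 1) * W) := ENNReal.ofReal_le_ofReal (by nlinarith)
    _ = ENNReal.ofReal (3 * C + 1) * ENNReal.ofReal W := ENNReal.ofReal_mul (by positivity)
    _ ≤ _ := by gcongr

end Conclusion

end FokkerPlanck

end

theorem theorem2p5 (d : ℕ) (hd : 1 ≤ d) (σ₀ lam₀ M : ℝ) (hσ₀ : 0 < σ₀) (hlam₀ : 0 < lam₀) :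
    -- Regularity: every weak solution is a strong solution.
    (∀ σ lam : FokkerPlanck.E d → ℝ, FokkerPlanck.Coefficients d σ₀ lam₀ M σ lam →
      ∀ ε : ℝ, 0 < ε →
      ∀ (f : FokkerPlanck.E d × FokkerPlanck.S d → ℝ)
        (g : EuclideanSpace ℝ (Fin d) × FokkerPlanck.S d → ℝ)
        (u : FokkerPlanck.E d × FokkerPlanck.S d → ℝ)
        (G : FokkerPlanck.E d × FokkerPlanck.S d → FokkerPlanck.E d),
      MemLp f 2 ((FokkerPlanck.dxdθ d).restrict (FokkerPlanck.Q d)) →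
      MemLp g 2 (FokkerPlanck.inflowMeasure d) →
      FokkerPlanck.IsWeakSolution d ε σ lam f g u G →
      ∃ k h w : FokkerPlanck.E d × FokkerPlanck.S d → ℝ,
        FokkerPlanck.HasWeakAngLaplacian d u k ∧
        FokkerPlanck.HasWeakTransport d u h ∧
        FokkerPlanck.HasWeakBesselD d (2 / 3) u w ∧
        ∀ᵐ p ∂(FokkerPlanck.dxdθ d).restrict (FokkerPlanck.Q d),
          -(ε ^ 2 * σ p.1 * k p) + h p + lam p.1 * u p = f p) ∧
    -- The local subelliptic estimate, with a constant that does not depend on `ε ∈ (0, ε₀]`.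
    (∀ K O : Set (FokkerPlanck.E d × FokkerPlanck.S d), IsCompact K → IsOpen O → K ⊆ O →
      O ⊆ FokkerPlanck.Q d → ∀ ε₀ : ℝ, 0 < ε₀ →
      ∃ C : ℝ, 0 < C ∧
      ∀ σ lam : FokkerPlanck.E d → ℝ, FokkerPlanck.Coefficients d σ₀ lam₀ M σ lam →
      ∀ ε : ℝ, 0 < ε → ε ≤ ε₀ →
      ∀ (f : FokkerPlanck.E d × FokkerPlanck.S d → ℝ)
        (g : EuclideanSpace ℝ (Fin d) × FokkerPlanck.S d → ℝ)
        (u : FokkerPlanck.E d × FokkerPlanck.S d → ℝ)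
        (G : FokkerPlanck.E d × FokkerPlanck.S d → FokkerPlanck.E d),
      MemLp f 2 ((FokkerPlanck.dxdθ d).restrict (FokkerPlanck.Q d)) →
      MemLp g 2 (FokkerPlanck.inflowMeasure d) →
      FokkerPlanck.IsWeakSolution d ε σ lam f g u G →
      ∀ k h w : FokkerPlanck.E d × FokkerPlanck.S d → ℝ,
        FokkerPlanck.HasWeakAngLaplacian d u k →
        FokkerPlanck.HasWeakTransport d u h →
        FokkerPlanck.HasWeakBesselD d (2 / 3) u w →
        ENNReal.ofReal (ε ^ 2) * eLpNorm k 2 ((FokkerPlanck.dxdθ d).restrict K) +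
          ENNReal.ofReal (ε ^ (2 / 3 : ℝ)) * eLpNorm w 2 ((FokkerPlanck.dxdθ d).restrict K) +
          eLpNorm h 2 ((FokkerPlanck.dxdθ d).restrict K) ≤
        ENNReal.ofReal C *
          (eLpNorm f 2 ((FokkerPlanck.dxdθ d).restrict O) +
            ENNReal.ofReal (ε ^ 2) *
              eLpNorm G 2 ((FokkerPlanck.dxdθ d).restrict (FokkerPlanck.Q d)) +
            eLpNorm u 2 ((FokkerPlanck.dxdθ d).restrict (FokkerPlanck.Q d)))) := by
  refine ⟨fun σ lam h ε hε f g u G hf _ hs => hs.exists_strong hσ₀ hlam₀ h hε hf,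
    fun K O hK hO hKO hOQ ε₀ _ => ?_⟩
  obtain ⟨C, hC, est⟩ :=
    FokkerPlanck.exists_subelliptic_estimate (lam₀ := lam₀) hσ₀ hlam₀ M hK hO hKO hOQ ε₀
  exact ⟨C, hC, fun σ lam h ε hε hεε f g u G hf _ hs => est σ lam h ε hε hεε f g u G hf hs⟩
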